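/- Let $0<q<1$, $a\in\mathbb R$, $[x]=\frac{q^x-q^{-x}}{q-q^{-1}}$, $[\![x]\!]=q^x-q^{-x}$, $t=[\![a]\!]$. **Algebras.** Let $\mathcal A=\mathcal O_q(SU(2))$ be the Hopf $*$-algebra generated by $\alpha,\gamma$ such that $u=\begin{pmatrix}\alpha&-q\gamma^*\\ \gamma&\alpha^*\end{pmatrix}$ is unitary, i.e. $\alpha^*\alpha+\gamma^*\gamma=1$, $\alpha\alpha^*+q^2\gamma\gamma^*=1$, $\gamma^*\gamma=\gamma\gamma^*$, $\alpha\gamma=q\gamma\alpha$, $\alpha\gamma^*=q\gamma^*\alpha$, with $\Delta(u_{ij})=\sum_k u_{ik}\otimes u_{kj}$, counit $\epsilon$ and antipode $S$. Let $\mathcal U=\operatorname{Hom}(\mathcal A,\mathbb C)$ with the convolution product and $\omega^*(x)=\overline{\omega(S(x)^*)}$. View $U_q(\mathfrak{su}(2))$, generated by $k^{\pm1},e,f$ with $\Delta(k)=k\otimes k$, $\Delta(e)=e\otimes1+k\otimes e$, $\Delta(f)=1\otimes f+f\otimes k^{-1}$, inside $\mathcal U$ through the pairing with $(u,k)=\operatorname{diag}(q,q^{-1})$,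 $(u,e)=\begin{pmatrix}0&q^{1/2}\\0&0\end{pmatrix}$, $(u,f)=\begin{pmatrix}0&0\\q^{-1/2}&0\end{pmatrix}$. Put $B_t=-q^{1/2}k^{-1}e+q^{1/2}f-\sqrt{-1}(q-q^{-1})^{-1}t\,k^{-1}$, $I=\mathbb C[B_t]$, and $$\mathcal O_q(S_t^2)=\{x\in\mathcal A\mid x_{(1)}h(x_{(2)})=h(1)x\ \text{for all } h\in I\}.$$ The Drinfeld double $\mathcal A\bowtie\mathcal U$ is the algebra generated by $\mathcal A$ and $\mathcal U$ with the relations $\omega x=x_{(2)}\,\omega\big(x_{(3)}\,\cdot\,S^{-1}(x_{(1)})\big)$ for $x\in\mathcal A$, $\omega\in\mathcal U$. Let $\mathcal O_q(S_t^2)_+=\mathcal O_q(S_t^2)\cap\ker\epsilon$. The stabilizer dual $\mathcal I_c\subset\mathcal U$ is the direct sum over $m\in\mathbb Z$ of the blocks $\{\omega\in\mathcal U\mid \omega(\mathcal O_q(S_t^2)_+\mathcal A)=0,\ \sqrt{-1}B_t\,\omega=[a+m]\omega\}$. Inside $\mathcal A\bowtie\mathcal U$ let $U_q(\mathfrak{sl}(2,\mathbb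 R)_t)$ be the subalgebra generated by $\mathcal O_q(S_t^2)$ and $I$, and let $\mathcal O_q(S_t^2)\bowtie\mathcal I_c$ be the subalgebra generated by $\mathcal O_q(S_t^2)$ and $\mathcal I_c$. **Modules.** Let $H_1\subset\mathbb C^2\otimes\mathbb C^2$ have the orthonormal basis $\xi_1=v_+\otimes v_+$, $\xi_0=-(1+q^2)^{-1/2}(q\,v_+\otimes v_-+v_-\otimes v_+)$, $\xi_{-1}=v_-\otimes v_-$. Let $u_{\xi,\eta}$ be the matrix coefficients of the tensor square of $u$ (conjugate linear in $\xi$). Let $\eta=q^{1/2}\xi_1-\frac{\sqrt{-1}\,t}{\sqrt{q+q^{-1}}}\xi_0+q^{-1/2}\xi_{-1}$. For $c\in\mathbb R$ define the following elements of $\mathcal O_q(S_t^2)$: - $T_c^+=u_{\xi,\eta}$ with $\xi=q^{c-1/2}\xi_1+\sqrt{-1}\sqrt{q+q^{-1}}\,\xi_0-q^{-c+1/2}\xi_{-1}$; - $T_c^-=u_{\xi,\eta}$ with $\xi=-q^{-c-1/2}\xi_1+\sqrt{-1}\sqrt{q+q^{-1}}\,\xi_0+q^{c+1/2}\xi_{-1}$;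 - $A_c=u_{\xi,\eta}-(q^{-1}+q)^{-1}[\![c]\!]\,t$ with $\xi=q^{-3/2}\xi_1-\frac{\sqrt{-1}\,[\![c]\!]}{\sqrt{q+q^{-1}}}\xi_0+q^{3/2}\xi_{-1}$. For $\lambda,b\in\mathbb R$ let $\mathcal M_{\lambda,b}$ be the universal $U_q(\mathfrak{sl}(2,\mathbb R)_t)$-module generated by a vector $e_b$ with $\sqrt{-1}B_te_b=[b]e_b$ and $A_be_b=\lambda e_b$. Let $\mathcal L_{\lambda,b}$ be its quotient by the kernel of its $*$-invariant sesquilinear form (unique once normalized by $\langle e_b,e_b\rangle=1$). In both modules put $e_{b+2n}=T^+_{b+2n-2}\cdots T^+_be_b$ and $e_{b-2n}=T^-_{b-2n+2}\cdots T^-_be_b$ for $n\ge1$. Put $\mathcal D_2^{\pm}=\mathcal L_{q+q^{-1},a\pm2}$ and $\mathbb 1=\mathcal L_{q+q^{-1},a}$. These modules and $\mathcal M_{q+q^{-1},a}$ are regarded as non-degenerate representations of $\mathcal O_q(S_t^2)\bowtie\mathcal I_c$: the elements of $\mathcal O_q(S_t^2)$ act as before, and the projection of $\mathcal I_c$ onto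 its $m$-th block acts as the projection onto the eigenspace of $\sqrt{-1}B_t$ for $[a+m]$. **Lemma.** These four representations exist, and $\mathbb 1$ is the one-dimensional trivial representation $\epsilon$ (where $\epsilon(\omega)=\omega(1)$ for $\omega\in\mathcal I_c$). There is an exact sequence $$0\to\mathcal D_2^+\oplus\mathcal D_2^-\xrightarrow{\ \phi\ }\mathcal M_{q+q^{-1},a}\xrightarrow{\ p\ }\mathbb 1\to0$$ of representations of $\mathcal O_q(S_t^2)\bowtie\mathcal I_c$, where $\phi$ maps $e_{a+2n}$ to $e_{a+2n}$ for all $n\in\mathbb Z\setminus\{0\}$ (with $e_{a+2n}\in\mathcal D_2^+$ for $n>0$ and $e_{a+2n}\in\mathcal D_2^-$ for $n<0$) and $p$ is the canonical projection. The sequence splits as a sequence of $\mathcal I_c$-representations, but it does not split as a sequence of representations of $\mathcal O_q(S_t^2)\bowtie\mathcal I_c$. -/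

import Mathlib

open scoped TensorProduct ComplexConjugate

noncomputable section

namespace QSL

/-- The deformation parameter `0 < q < 1`. -/
abbrev Param : Type := Set.Ioo (0 : ℝ) 1

/-- `q` as a complex number. -/
def qC (q : Param) : ℂ := ((q : ℝ) : ℂ)

theorem qC_ne_zero (q : Param) : qC q ≠ 0 :=
  Complex.ofReal_ne_zero.mpr q.2.1.ne'

/-- Names of the generators `α, α*, γ, γ*`. -/
inductive Gen : Type
  | α | αs | γ | γs

open FreeAlgebra in
/-- The relations of `O_q(SU(2))` between `α, α*, γ, γ*` (the last two are the adjoints of the two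
before them). -/
inductive SURel (q : Param) : FreeAlgebra ℂ Gen → FreeAlgebra ℂ Gen → Prop
  | unit₁ : SURel q (ι ℂ Gen.αs * ι ℂ Gen.α + ι ℂ Gen.γs * ι ℂ Gen.γ) 1
  | unit₂ : SURel q (ι ℂ Gen.α * ι ℂ Gen.αs + (qC q ^ 2) • (ι ℂ Gen.γ * ι ℂ Gen.γs)) 1
  | normal : SURel q (ι ℂ Gen.γs * ι ℂ Gen.γ) (ι ℂ Gen.γ * ι ℂ Gen.γs)
  | comm₁ : SURel q (ι ℂ Gen.α * ι ℂ Gen.γ) (qC q • (ι ℂ Gen.γ * ι ℂ Gen.α))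
  | comm₂ : SURel q (ι ℂ Gen.α * ι ℂ Gen.γs) (qC q • (ι ℂ Gen.γs * ι ℂ Gen.α))
  | comm₁s : SURel q (ι ℂ Gen.γs * ι ℂ Gen.αs) (qC q • (ι ℂ Gen.αs * ι ℂ Gen.γs))
  | comm₂s : SURel q (ι ℂ Gen.γ * ι ℂ Gen.αs) (qC q • (ι ℂ Gen.αs * ι ℂ Gen.γ))

/-- The algebra `O_q(SU(2))`. -/
def OSU (q : Param) : Type := RingQuot (SURel q)

instance (q : Param) : Ring (OSU q) := inferInstanceAs (Ring (RingQuot (SURel q)))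

instance (q : Param) : Algebra ℂ (OSU q) := inferInstanceAs (Algebra ℂ (RingQuot (SURel q)))

namespace OSU

/-- The quotient map from the free algebra. -/
def mk (q : Param) : FreeAlgebra ℂ Gen →ₐ[ℂ] OSU q := RingQuot.mkAlgHom ℂ (SURel q)

theorem mk_rel {q : Param} {x y : FreeAlgebra ℂ Gen} (h : SURel q x y) : mk q x = mk q y :=
  RingQuot.mkAlgHom_rel ℂ h

/-- The generators of `O_q(SU(2))`. -/
def gen (q : Param) (g : Gen) : OSU q := mk q (FreeAlgebra.ι ℂ g)

abbrev α (q : Param) : OSU q := gen q Gen.α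
abbrev αs (q : Param) : OSU q := gen q Gen.αs
abbrev γ (q : Param) : OSU q := gen q Gen.γ
abbrev γs (q : Param) : OSU q := gen q Gen.γs

/-- Four elements of an algebra satisfying the defining relations. -/
structure Quad (q : Param) (R : Type*) [Ring R] [Algebra ℂ R] (a as c cs : R) : Prop where
  unit₁ : as * a + cs * c = 1
  unit₂ : a * as + (qC q ^ 2) • (c * cs) = 1
  normal : cs * c = c * cs
  comm₁ : a * c = qC q • (c * a)
  comm₂ : a * cs = qC q • (cs * a)
  comm₁s : cs * as = qC q • (as * cs)
  comm₂s : c * as = qC q • (as * c)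

/-- The map on generators with the given values. -/
def assign {R : Type*} (a as c cs : R) : Gen → R
  | .α => a
  | .αs => as
  | .γ => c
  | .γs => cs

theorem Quad.rel {q : Param} {R : Type*} [Ring R] [Algebra ℂ R] {a as c cs : R}
    (h : Quad q R a as c cs) ⦃x y : FreeAlgebra ℂ Gen⦄ (hxy : SURel q x y) :
    FreeAlgebra.lift ℂ (assign a as c cs) x = FreeAlgebra.lift ℂ (assign a as c cs) y := by
  cases hxy <;> simp only [map_add, map_mul, map_smul, map_one, FreeAlgebra.lift_ι_apply, assign]
  exacts [h.unit₁, h.unit₂, h.normal, h.comm₁, h.comm₂, h.comm₁s, h.comm₂s]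

/-- The homomorphism out of `O_q(SU(2))` with given values `a, as, c, cs` on `α, α*, γ, γ*`. -/
def lift {q : Param} {R : Type*} [Ring R] [Algebra ℂ R] {a as c cs : R}
    (h : Quad q R a as c cs) : OSU q →ₐ[ℂ] R :=
  RingQuot.liftAlgHom ℂ ⟨FreeAlgebra.lift ℂ (assign a as c cs), h.rel⟩

@[simp] theorem lift_gen {q : Param} {R : Type*} [Ring R] [Algebra ℂ R] {a as c cs : R}
    (h : Quad q R a as c cs) (g : Gen) : lift h (gen q g) = assign a as c cs g :=
  (RingQuot.liftAlgHom_mkAlgHom_apply ℂ (FreeAlgebra.lift ℂ (assign a as c cs)) h.rel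
    (FreeAlgebra.ι ℂ g)).trans (FreeAlgebra.lift_ι_apply ..)

theorem hom_ext {q : Param} {R : Type*} [Semiring R] [Algebra ℂ R] {f g : OSU q →ₐ[ℂ] R}
    (h : ∀ x, f (gen q x) = g (gen q x)) : f = g :=
  RingQuot.ringQuot_ext' ℂ f g (FreeAlgebra.hom_ext (funext h))

theorem quad (q : Param) : Quad q (OSU q) (α q) (αs q) (γ q) (γs q) where
  unit₁ := by simpa only [α, αs, γ, γs, gen, map_add, map_mul, map_smul, map_one] using mk_rel (SURel.unit₁ (q := q))
  unit₂ := by simpa only [α, αs, γ, γs, gen, map_add, map_mul, map_smul, map_one] using mk_rel (SURel.unit₂ (q := q))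
  normal := by simpa only [α, αs, γ, γs, gen, map_add, map_mul, map_smul, map_one] using mk_rel (SURel.normal (q := q))
  comm₁ := by simpa only [α, αs, γ, γs, gen, map_add, map_mul, map_smul, map_one] using mk_rel (SURel.comm₁ (q := q))
  comm₂ := by simpa only [α, αs, γ, γs, gen, map_add, map_mul, map_smul, map_one] using mk_rel (SURel.comm₂ (q := q))
  comm₁s := by
    simpa only [α, αs, γ, γs, gen, map_add, map_mul, map_smul, map_one] using mk_rel (SURel.comm₁s (q := q))
  comm₂s := by
    simpa only [α, αs, γ, γs, gen, map_add, map_mul, map_smul, map_one] using mk_rel (SURel.comm₂s (q := q))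

theorem antipode_quad (q : Param) {z : ℂ} (hz : z ≠ 0) : Quad q (OSU q)ᵐᵒᵖ (.op (αs q)) (.op (α q))
    (.op (-z • γ q)) (.op (-z⁻¹ • γs q)) := by
  have h := quad q
  constructor <;> apply MulOpposite.unop_injective <;>
    simp only [MulOpposite.unop_add, MulOpposite.unop_mul, MulOpposite.unop_op,
      MulOpposite.unop_one, MulOpposite.unop_smul, smul_mul_assoc, mul_smul_comm, smul_smul,
      h.comm₁, h.comm₂, h.comm₁s, h.comm₂s, h.normal]
  · rw [← h.unit₁, h.normal]; congr 1; convert one_smul ℂ _ using 2; field_simp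
  · rw [← h.unit₂]; congr 2; field_simp
  all_goals congr 1; ring

theorem star_quad (q : Param) : Quad q (OSU q)ᵐᵒᵖ (.op (αs q)) (.op (α q))
    (.op (γs q)) (.op (γ q)) := by
  have h := quad q
  constructor <;> apply MulOpposite.unop_injective <;>
    simp only [MulOpposite.unop_add, MulOpposite.unop_mul, MulOpposite.unop_op,
      MulOpposite.unop_one, MulOpposite.unop_smul,
      h.comm₁, h.comm₂, h.comm₁s, h.comm₂s, h.normal]
  · rw [← h.unit₁, h.normal]
  · rw [← h.unit₂]

theorem comul_quad (q : Param) : Quad q (OSU q ⊗[ℂ] OSU q)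
    (α q ⊗ₜ α q - qC q • (γs q ⊗ₜ γ q)) (αs q ⊗ₜ αs q - qC q • (γ q ⊗ₜ γs q))
    (γ q ⊗ₜ α q + αs q ⊗ₜ γ q) (γs q ⊗ₜ αs q + α q ⊗ₜ γs q) := by
  have h := quad q
  have h1 : αs q * α q = 1 - γ q * γs q := by rw [← h.unit₁, h.normal]; abel
  have h2 : α q * αs q = 1 - qC q ^ 2 • (γ q * γs q) := by rw [← h.unit₂]; abel
  constructor <;>
    simp only [mul_add, add_mul, mul_sub, sub_mul, smul_mul_assoc, mul_smul_comm,
      Algebra.TensorProduct.tmul_mul_tmul, h1, h2, h.comm₁, h.comm₂, h.comm₁s, h.comm₂s, h.normal,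
      TensorProduct.tmul_sub, TensorProduct.sub_tmul, TensorProduct.tmul_smul,
      TensorProduct.smul_tmul', Algebra.TensorProduct.one_def] <;> 
    simp only [← TensorProduct.smul_tmul'] <;> module

theorem counit_quad (q : Param) : Quad q ℂ 1 1 0 0 := by constructor <;> simp


/-- The coproduct `Δ(u i j) = ∑ k, u i k ⊗ u k j`, where `u` is the matrix
`(α, -q γ*; γ, α*)`. -/
def comulHom (q : Param) : OSU q →ₐ[ℂ] OSU q ⊗[ℂ] OSU q := lift (comul_quad q)

/-- The counit: `ε(α) = ε(α*) = 1`, `ε(γ) = ε(γ*) = 0`. -/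
def counitHom (q : Param) : OSU q →ₐ[ℂ] ℂ := lift (counit_quad q)

instance (q : Param) : Bialgebra ℂ (OSU q) :=
  Bialgebra.ofAlgHom (comulHom q) (counitHom q)
    (by
      apply hom_ext
      rintro (_ | _ | _ | _) <;>
        simp [comulHom, assign, TensorProduct.tmul_add, TensorProduct.add_tmul,
          TensorProduct.tmul_sub, TensorProduct.sub_tmul, ← TensorProduct.smul_tmul',
          TensorProduct.tmul_smul] <;> module)
    (by apply hom_ext; rintro (_ | _ | _ | _) <;> simp [comulHom, counitHom, assign])
    (by apply hom_ext; rintro (_ | _ | _ | _) <;> simp [comulHom, counitHom, assign])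

/-- The antipode, the anti-homomorphism with `α ↦ α*`, `α* ↦ α`, `γ ↦ -q γ`, `γ* ↦ -q⁻¹ γ*`. -/
def S (q : Param) (x : OSU q) : OSU q :=
  (lift (antipode_quad q (qC_ne_zero q)) x).unop

/-- The inverse of the antipode: `α ↦ α*`, `α* ↦ α`, `γ ↦ -q⁻¹ γ`, `γ* ↦ -q γ*`. -/
def SInv (q : Param) (x : OSU q) : OSU q :=
  (lift (antipode_quad q (inv_ne_zero (qC_ne_zero q))) x).unop

/-- The opposite algebra with the conjugate scalar action; the involution of `O_q(SU(2))` is a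
homomorphism into it. -/
def ConjOp (q : Param) : Type := (OSU q)ᵐᵒᵖ

instance (q : Param) : Ring (ConjOp q) := inferInstanceAs (Ring (OSU q)ᵐᵒᵖ)

instance (q : Param) : Algebra ℂ (ConjOp q) :=
  ((algebraMap ℂ (OSU q)ᵐᵒᵖ).comp (starRingEnd ℂ)).toAlgebra'
    fun z x => Algebra.commutes (A := (OSU q)ᵐᵒᵖ) (conj z) x

theorem conjOp_smul (q : Param) (z : ℂ) (x : OSU q) :
    z • (show ConjOp q from .op x) = (MulOpposite.op (conj z • x) : (OSU q)ᵐᵒᵖ) := by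
  rw [MulOpposite.op_smul, Algebra.smul_def (A := (OSU q)ᵐᵒᵖ)]
  exact Algebra.smul_def (A := ConjOp q) z _

theorem conj_qC (q : Param) : conj (qC q) = qC q := Complex.conj_ofReal _

theorem star_quad' (q : Param) : Quad q (ConjOp q) (.op (αs q)) (.op (α q))
    (.op (γs q)) (.op (γ q)) := by
  have h := star_quad q
  have key (n : ℕ) (x : OSU q) : (qC q ^ n • (show ConjOp q from .op x)) =
      (qC q ^ n • MulOpposite.op x : (OSU q)ᵐᵒᵖ) := by
    rw [conjOp_smul, map_pow, conj_qC, MulOpposite.op_smul]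
  have key1 (x : OSU q) : (qC q • (show ConjOp q from .op x)) =
      (qC q • MulOpposite.op x : (OSU q)ᵐᵒᵖ) := by
    simpa only [pow_one] using key 1 x
  exact
    { unit₁ := h.unit₁
      unit₂ := (congrArg (fun t : (OSU q)ᵐᵒᵖ => .op (αs q) * .op (α q) + t)
        (key 2 (γ q * γs q))).trans h.unit₂
      normal := h.normal
      comm₁ := h.comm₁.trans (key1 (αs q * γs q)).symm
      comm₂ := h.comm₂.trans (key1 (αs q * γ q)).symm
      comm₁s := h.comm₁s.trans (key1 (γ q * α q)).symm
      comm₂s := h.comm₂s.trans (key1 (γs q * α q)).symm }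

/-- The involution as a homomorphism into the conjugate opposite algebra. -/
def starHom (q : Param) : OSU q →ₐ[ℂ] ConjOp q := lift (star_quad' q)

/-- The involution `x ↦ x*` of `O_q(SU(2))`, exchanging `α, α*` and `γ, γ*`. -/
def adj (q : Param) (x : OSU q) : OSU q := MulOpposite.unop (starHom q x)

theorem adj_smul (q : Param) (z : ℂ) (x : OSU q) : adj q (z • x) = conj z • adj q x := by
  have h := map_smul (starHom q) z x
  exact congrArg MulOpposite.unop (h.trans (conjOp_smul q z (adj q x)))

theorem adj_mul (q : Param) (x y : OSU q) : adj q (x * y) = adj q y * adj q x :=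
  congrArg MulOpposite.unop (map_mul (starHom q) x y)

theorem adj_add (q : Param) (x y : OSU q) : adj q (x + y) = adj q x + adj q y :=
  congrArg MulOpposite.unop (map_add (starHom q) x y)

theorem adj_one (q : Param) : adj q 1 = 1 := congrArg MulOpposite.unop (map_one (starHom q))

theorem adj_gen (q : Param) (g : Gen) :
    adj q (gen q g) = assign (αs q) (α q) (γs q) (γ q) g := by
  have h := congrArg MulOpposite.unop (lift_gen (star_quad' q) g)
  refine h.trans ?_
  cases g <;> rfl

theorem adj_adj (q : Param) (x : OSU q) : adj q (adj q x) = x := by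
  obtain ⟨y, rfl⟩ := RingQuot.mkAlgHom_surjective ℂ (SURel q) x
  change adj q (adj q (mk q y)) = mk q y
  induction y using FreeAlgebra.induction with
  | grade0 r =>
    rw [AlgHom.commutes, Algebra.algebraMap_eq_smul_one, adj_smul, adj_one, adj_smul, adj_one,
      Complex.conj_conj]
  | grade1 g =>
    change adj q (adj q (gen q g)) = gen q g
    rw [adj_gen]
    cases g <;> exact adj_gen q _
  | mul a b ha hb => rw [map_mul, adj_mul, adj_mul, ha, hb]
  | add a b ha hb => rw [map_add, adj_add, adj_add, ha, hb]

instance (q : Param) : StarRing (OSU q) where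
  star := adj q
  star_involutive := adj_adj q
  star_mul := adj_mul q
  star_add := adj_add q

instance (q : Param) : StarModule ℂ (OSU q) where
  star_smul := adj_smul q

end OSU

/-- `U = Hom(O_q(SU(2)), ℂ)` with the convolution product `(ω ν)(x) = ω(x₁) ν(x₂)`. The Hopf
algebra `U_q(su(2))` is viewed inside `U` through its pairing with `O_q(SU(2))`. -/
abbrev U (q : Param) : Type := WithConv (OSU q →ₗ[ℂ] ℂ)

namespace U
open OSU

theorem k_quad (q : Param) : Quad q ℂ (qC q) (qC q)⁻¹ 0 0 := by
  have := qC_ne_zero q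
  constructor <;> simp [this]

theorem kInv_quad (q : Param) : Quad q ℂ (qC q)⁻¹ (qC q) 0 0 := by
  have := qC_ne_zero q
  constructor <;> simp [this]

/-- `q^{1/2}`. -/
def sqrtq (q : Param) : ℂ := ((Real.sqrt q : ℝ) : ℂ)

theorem e_quad (q : Param) : Quad q (Matrix (Fin 2) (Fin 2) ℂ)
    !![qC q, 0; 0, 1] !![(qC q)⁻¹, 0; 0, 1] 0 !![0, -(sqrtq q)⁻¹; 0, 0] := by
  have := qC_ne_zero q
  constructor <;> ext i j <;> fin_cases i <;> fin_cases j <;> simp [this]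

theorem f_quad (q : Param) : Quad q (Matrix (Fin 2) (Fin 2) ℂ)
    !![1, 0; 0, (qC q)⁻¹] !![1, 0; 0, qC q] !![0, (sqrtq q)⁻¹; 0, 0] 0 := by
  have := qC_ne_zero q
  constructor <;> ext i j <;> fin_cases i <;> fin_cases j <;> simp [this]
  all_goals field_simp

/-- `k`, the character with `(u, k) = diag(q, q⁻¹)`. -/
def k (q : Param) : U q := .toConv (lift (k_quad q)).toLinearMap

/-- `k⁻¹`. -/
def kInv (q : Param) : U q := .toConv (lift (kInv_quad q)).toLinearMap

/-- `e`, with `(x y, e) = (x, e) ε(y) + (x, k) (y, e)` and `(u, e) = (0, q^{1/2}; 0, 0)`: the upper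
right entry of the homomorphism `x ↦ ((x, k), (x, e); 0, ε(x))`. -/
def e (q : Param) : U q :=
  .toConv (Matrix.entryLinearMap ℂ ℂ 0 1 ∘ₗ (lift (e_quad q)).toLinearMap)

/-- `f`, with `(x y, f) = ε(x) (y, f) + (x, f) (y, k⁻¹)` and `(u, f) = (0, 0; q^{-1/2}, 0)`: the upper
right entry of the homomorphism `x ↦ (ε(x), (x, f); 0, (x, k⁻¹))`. -/
def f (q : Param) : U q :=
  .toConv (Matrix.entryLinearMap ℂ ℂ 0 1 ∘ₗ (lift (f_quad q)).toLinearMap)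

/-- The involution of `U`: `ω*(x)` is the conjugate of `ω(S(x)*)`. -/
def dualStar (q : Param) (ω : U q) : U q :=
  .toConv
    { toFun := fun x => conj (ω.ofConv (star (S q x)))
      map_add' := by intro x y; simp [S]
      map_smul' := by intro z x; simp [S] }

/-- The left action `ω ▷ x = x₁ ω(x₂)` of `U` on `O_q(SU(2))`. -/
def lact {q : Param} (ω : U q) (x : OSU q) : OSU q :=
  TensorProduct.rid ℂ (OSU q) (LinearMap.lTensor (OSU q) ω.ofConv (Coalgebra.comul x))

theorem lact_add {q : Param} (ω ν : U q) (x : OSU q) :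
    lact (ω + ν) x = lact ω x + lact ν x := by
  simp [lact, LinearMap.lTensor_add]

theorem lact_smul {q : Param} (z : ℂ) (ω : U q) (x : OSU q) :
    lact (z • ω) x = z • lact ω x := by
  simp [lact, LinearMap.lTensor_smul]

theorem lact_one {q : Param} (x : OSU q) : lact 1 x = x := by
  have : (1 : U q).ofConv = Coalgebra.counit := by ext y; simp [LinearMap.convOne_def]
  simp [lact, this]

theorem lact_add_right {q : Param} (ω : U q) (x y : OSU q) :
    lact ω (x + y) = lact ω x + lact ω y := by
  simp [lact]

theorem lact_smul_right {q : Param} (z : ℂ) (ω : U q) (x : OSU q) :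
    lact ω (z • x) = z • lact ω x := by
  simp [lact]

theorem lact_mul {q : Param} (ω ν : U q) (x : OSU q) :
    lact (ω * ν) x = lact ω (lact ν x) := by
  have hmul : (ω * ν).ofConv = LinearMap.mul' ℂ ℂ ∘ₗ TensorProduct.map ω.ofConv ν.ofConv ∘ₗ
    Coalgebra.comul := rfl
  have aux (y : OSU q ⊗[ℂ] OSU q) :
      TensorProduct.rid ℂ (OSU q) (LinearMap.lTensor (OSU q)
        (LinearMap.mul' ℂ ℂ ∘ₗ TensorProduct.map ω.ofConv ν.ofConv)
        (TensorProduct.assoc ℂ _ _ _ (LinearMap.rTensor (OSU q) Coalgebra.comul y))) =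
      lact ω (TensorProduct.rid ℂ (OSU q) (LinearMap.lTensor (OSU q) ν.ofConv y)) := by
    induction y using TensorProduct.induction_on with
    | zero => simp [lact]
    | add a b ha hb => simp only [map_add, ha, hb, lact_add_right]
    | tmul u v =>
      simp only [LinearMap.rTensor_tmul, LinearMap.lTensor_tmul, TensorProduct.rid_tmul,
        lact_smul_right]
      rw [lact]
      induction (Coalgebra.comul u : OSU q ⊗[ℂ] OSU q) using TensorProduct.induction_on with
      | zero => simp
      | add a b ha hb => simp only [map_add, TensorProduct.add_tmul, ha, hb, smul_add]
      | tmul a b => simp [smul_smul, mul_comm]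
  rw [lact, hmul, ← LinearMap.comp_assoc, LinearMap.lTensor_comp, LinearMap.comp_apply,
    ← Coalgebra.coassoc_apply, aux]
  rfl

end U

/-- `[x] = (q^x - q^{-x}) / (q - q⁻¹)`. -/
def bracket (q : Param) (x : ℝ) : ℝ :=
  ((q : ℝ) ^ x - (q : ℝ) ^ (-x)) / ((q : ℝ) - (q : ℝ)⁻¹)

/-- `⟦x⟧ = q^x - q^{-x}`. -/
def dbracket (q : Param) (x : ℝ) : ℝ := (q : ℝ) ^ x - (q : ℝ) ^ (-x)

open U

/-- `B_t = -q^{1/2} k⁻¹ e + q^{1/2} f - √-1 (q - q⁻¹)⁻¹ t k⁻¹`, where `t = ⟦a⟧`. -/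
def Bt (q : Param) (a : ℝ) : U q :=
  -(sqrtq q • (kInv q * e q)) + sqrtq q • f q
    - (Complex.I * (qC q - (qC q)⁻¹)⁻¹ * (dbracket q a : ℂ)) • kInv q

/-- `I = ℂ[B_t]`. -/
def coideal (q : Param) (a : ℝ) : Subalgebra ℂ (U q) := Algebra.adjoin ℂ {Bt q a}

/-- The Podleś sphere `O_q(S_t²) = {x | h ▷ x = ε(h) x for all h ∈ I}`; recall `ε(h) = h(1)`. -/
def sphere (q : Param) (a : ℝ) : Submodule ℂ (OSU q) where
  carrier := {x | ∀ h ∈ coideal q a, lact h x = h.ofConv 1 • x}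
  zero_mem' := by intro h _; simp [lact]
  add_mem' := by intro x y hx hy h hh; rw [lact_add_right, hx h hh, hy h hh, smul_add]
  smul_mem' := by intro z x hx h hh; rw [lact_smul_right, hx h hh, smul_comm]

theorem mem_sphere_of_Bt {q : Param} {a : ℝ} {x : OSU q}
    (hx : lact (Bt q a) x = (Bt q a).ofConv 1 • x) : x ∈ sphere q a := by
  intro h hh
  have h1 (ω ν : U q) : (ω * ν).ofConv 1 = ω.ofConv 1 * ν.ofConv 1 := by
    simp [LinearMap.convMul_def, Algebra.TensorProduct.one_def]
  induction hh using Algebra.adjoin_induction with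
  | mem h hh => rw [Set.mem_singleton_iff.mp hh, hx]
  | algebraMap z =>
    rw [Algebra.algebraMap_eq_smul_one, lact_smul, lact_one]
    simp [LinearMap.convOne_def]
  | add h h' _ _ ih ih' => rw [lact_add, ih, ih']; simp [add_smul]
  | mul h h' _ _ ih ih' => rw [lact_mul, ih', lact_smul_right, ih, h1, smul_smul, mul_comm]

open OSU in
/-- The fundamental corepresentation. -/
def mat (q : Param) : Matrix (Fin 2) (Fin 2) (OSU q) :=
  !![α q, -(qC q • γs q); γ q, αs q]

/-- The matrix coefficient `u_{ξ,η}` of the tensor square of the fundamental corepresentation, for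
`ξ, η ∈ ℂ² ⊗ ℂ²`; it is conjugate linear in `ξ` and linear in `η`. -/
def coeff (q : Param) (ξ η : Matrix (Fin 2) (Fin 2) ℂ) : OSU q :=
  ∑ i, ∑ j, ∑ k, ∑ l, (conj (ξ i j) * η k l) • (mat q i k * mat q j l)

/-- The vector `x ξ₁ + y ξ₀ + z ξ₋₁` of the spin-one subspace of `ℂ² ⊗ ℂ²`, where
`ξ₁ = v₊ ⊗ v₊`, `ξ₀ = -(1 + q²)^{-1/2} (q v₊ ⊗ v₋ + v₋ ⊗ v₊)`, `ξ₋₁ = v₋ ⊗ v₋` is an orthonormal basis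
of weight vectors. -/
def spinOne (q : Param) (x y z : ℂ) : Matrix (Fin 2) (Fin 2) ℂ :=
  !![x, -(qC q / (Real.sqrt (1 + (q : ℝ) ^ 2) : ℝ) * y);
    -(1 / (Real.sqrt (1 + (q : ℝ) ^ 2) : ℝ) * y), z]

/-- `√(q + q⁻¹)`. -/
def rt (q : Param) : ℂ := ((Real.sqrt ((q : ℝ) + (q : ℝ)⁻¹) : ℝ) : ℂ)

/-- `q^x` as a complex number. -/
def qpow (q : Param) (x : ℝ) : ℂ := (((q : ℝ) ^ x : ℝ) : ℂ)

/-- The vector `q^{1/2} ξ₁ - (√-1 t / √(q + q⁻¹)) ξ₀ + q^{-1/2} ξ₋₁`, `t = ⟦a⟧`, on which `√-1 B_t`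
acts by `[a]`. -/
def ηt (q : Param) (a : ℝ) : Matrix (Fin 2) (Fin 2) ℂ :=
  spinOne q (qpow q (1 / 2)) (-(Complex.I * (dbracket q a : ℂ) / rt q)) (qpow q (-1 / 2))

theorem comul_mat (q : Param) (i j : Fin 2) :
    Coalgebra.comul (R := ℂ) (mat q i j) = ∑ k, mat q i k ⊗ₜ[ℂ] mat q k j := by
  change OSU.comulHom q _ = _
  fin_cases i <;> fin_cases j <;>
    simp [mat, OSU.comulHom, OSU.assign, TensorProduct.tmul_neg, TensorProduct.neg_tmul,
      ← TensorProduct.smul_tmul', TensorProduct.tmul_smul] <;> module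

theorem comul_mat_mul (q : Param) (i j k l : Fin 2) :
    Coalgebra.comul (R := ℂ) (mat q i k * mat q j l) =
      ∑ m, ∑ n, (mat q i m * mat q j n) ⊗ₜ[ℂ] (mat q m k * mat q n l) := by
  simp only [Bialgebra.comul_mul, comul_mat, Finset.sum_mul_sum,
    Algebra.TensorProduct.tmul_mul_tmul]

theorem lact_mat_mul (q : Param) (ω : U q) (i j k l : Fin 2) :
    lact ω (mat q i k * mat q j l) =
      ∑ m, ∑ n, ω.ofConv (mat q m k * mat q n l) • (mat q i m * mat q j n) := by
  simp only [lact, comul_mat_mul, map_sum, LinearMap.lTensor_tmul, TensorProduct.rid_tmul]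

theorem kInv_mat_mul (q : Param) (m n k l : Fin 2) :
    (kInv q).ofConv (mat q m k * mat q n l) =
      (!![(qC q)⁻¹, 0; 0, qC q] m k) * (!![(qC q)⁻¹, 0; 0, qC q] n l) := by
  change OSU.lift (kInv_quad q) _ = _
  rw [map_mul]
  congr 1
  · fin_cases m <;> fin_cases k <;> simp [mat, OSU.assign]
  · fin_cases n <;> fin_cases l <;> simp [mat, OSU.assign]

theorem sqrtq_sq (q : Param) : sqrtq q ^ 2 = qC q := by
  rw [sqrtq, qC, ← Complex.ofReal_pow, Real.sq_sqrt q.2.1.le]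

theorem sqrtq_ne_zero (q : Param) : sqrtq q ≠ 0 := by
  intro h
  exact qC_ne_zero q (by rw [← sqrtq_sq, h]; simp)

theorem e_mat_mul (q : Param) (m n k l : Fin 2) :
    (e q).ofConv (mat q m k * mat q n l) =
      (!![0, sqrtq q; 0, 0] m k) * (!![1, 0; 0, 1] n l)
        + (!![qC q, 0; 0, (qC q)⁻¹] m k) * (!![0, sqrtq q; 0, 0] n l) := by
  change OSU.lift (e_quad q) _ 0 1 = _
  have hs := sqrtq_ne_zero q
  have h : qC q * (sqrtq q)⁻¹ = sqrtq q := by rw [← sqrtq_sq]; field_simp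
  rw [map_mul, Matrix.mul_apply, Fin.sum_univ_two, add_comm]
  congr 2
  all_goals first
    | (fin_cases m <;> fin_cases k <;> simp [mat, OSU.assign, h]; done)
    | (fin_cases n <;> fin_cases l <;> simp [mat, OSU.assign, h]; done)

theorem f_mat_mul (q : Param) (m n k l : Fin 2) :
    (f q).ofConv (mat q m k * mat q n l) =
      (!![1, 0; 0, 1] m k) * (!![0, 0; (sqrtq q)⁻¹, 0] n l)
        + (!![0, 0; (sqrtq q)⁻¹, 0] m k) * (!![(qC q)⁻¹, 0; 0, qC q] n l) := by
  change OSU.lift (f_quad q) _ 0 1 = _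
  rw [map_mul, Matrix.mul_apply, Fin.sum_univ_two]
  congr 2
  all_goals first
    | (fin_cases m <;> fin_cases k <;> simp [mat, OSU.assign]; done)
    | (fin_cases n <;> fin_cases l <;> simp [mat, OSU.assign]; done)

theorem conv_mat_mul (q : Param) (ω ν : U q) (i j k l : Fin 2) :
    (ω * ν).ofConv (mat q i k * mat q j l) =
      ∑ m, ∑ n, ω.ofConv (mat q i m * mat q j n) * ν.ofConv (mat q m k * mat q n l) := by
  rw [LinearMap.convMul_def]
  simp only [WithConv.ofConv_toConv, LinearMap.comp_apply, comul_mat_mul, map_sum,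
    TensorProduct.map_tmul, LinearMap.mul'_apply]

theorem Bt_one (q : Param) (a : ℝ) : (Bt q a).ofConv 1 =
    -(Complex.I * (qC q - (qC q)⁻¹)⁻¹ * (dbracket q a : ℂ)) := by
  have h1 : (kInv q).ofConv 1 = 1 := map_one (OSU.lift (kInv_quad q))
  have h2 : (e q).ofConv 1 = 0 := by
    change OSU.lift (e_quad q) 1 0 1 = 0
    simp
  have h3 : (f q).ofConv 1 = 0 := by
    change OSU.lift (f_quad q) 1 0 1 = 0
    simp
  have h4 : (kInv q * e q).ofConv 1 = 0 := by
    rw [LinearMap.convMul_def]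
    simp [Algebra.TensorProduct.one_def, h2]
  simp [Bt, h1, h3, h4]

theorem Bt_eigen (q : Param) (a : ℝ) (m n : Fin 2) :
    ∑ k, ∑ l, (Bt q a).ofConv (mat q m k * mat q n l) * ηt q a k l =
      (Bt q a).ofConv 1 * ηt q a m n := by
  have hs := sqrtq_ne_zero q
  have hq := sqrtq_sq q
  have hq0 : (0 : ℝ) < q := q.2.1
  have hq1 : (q : ℝ) < 1 := q.2.2
  have h1 : qpow q (1 / 2) = sqrtq q := by rw [qpow, sqrtq, Real.sqrt_eq_rpow]
  have h2 : qpow q (-1 / 2) = (sqrtq q)⁻¹ := by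
    rw [qpow, sqrtq, Real.sqrt_eq_rpow, ← Complex.ofReal_inv, ← Real.rpow_neg hq0.le, neg_div]
  have h3 : ((Real.sqrt (1 + (q : ℝ) ^ 2) : ℝ) : ℂ) = rt q * sqrtq q := by
    rw [rt, sqrtq, ← Complex.ofReal_mul, ← Real.sqrt_mul (by positivity)]
    congr 2
    field_simp
    ring
  have h4 : rt q ^ 2 = qC q + (qC q)⁻¹ := by
    rw [rt, qC, ← Complex.ofReal_pow, Real.sq_sqrt (by positivity)]
    simp
  have h5 : rt q ≠ 0 := by
    rw [rt, Complex.ofReal_ne_zero]; positivity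
  have h6 : qC q - (qC q)⁻¹ ≠ 0 := by
    have : (q : ℝ) < (q : ℝ)⁻¹ := hq1.trans ((one_lt_inv₀ hq0).mpr hq1)
    rw [qC, ← Complex.ofReal_inv, ← Complex.ofReal_sub, Complex.ofReal_ne_zero]
    exact (sub_neg.mpr this).ne
  rw [Bt_one]
  simp only [Bt, WithConv.ofConv_add, WithConv.ofConv_sub, WithConv.ofConv_neg,
    WithConv.ofConv_smul, LinearMap.add_apply,
    LinearMap.sub_apply, LinearMap.neg_apply, LinearMap.smul_apply, conv_mat_mul, kInv_mat_mul,
    e_mat_mul, f_mat_mul, Fin.sum_univ_two, ηt, h1, h2, spinOne, h3]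
  generalize (dbracket q a : ℂ) = t
  generalize rt q = r at *
  rw [← hq] at *
  generalize sqrtq q = s at *
  have h7 : s ^ 4 - 1 ≠ 0 := by
    intro h
    apply h6
    field_simp
    linear_combination h
  have hd : (s ^ 2 - (s ^ 2)⁻¹)⁻¹ = s ^ 2 / (s ^ 4 - 1) := by
    rw [inv_eq_iff_eq_inv, inv_div]
    field_simp
  have h8 : r ^ 2 * s ^ 2 = s ^ 4 + 1 := by
    rw [h4]
    field_simp
  rw [hd]
  fin_cases m <;> fin_cases n <;> simp <;> field_simp
  · linear_combination (t * (s ^ 4 - 1)) * h8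
  · ring
  · ring
  · linear_combination (-(t * (s ^ 4 - 1))) * h8

theorem lact_coeff (q : Param) (a : ℝ) (ξ : Matrix (Fin 2) (Fin 2) ℂ) :
    lact (Bt q a) (coeff q ξ (ηt q a)) = (Bt q a).ofConv 1 • coeff q ξ (ηt q a) := by
  have hsum {ι : Type} (s : Finset ι) (g : ι → OSU q) :
      lact (Bt q a) (∑ i ∈ s, g i) = ∑ i ∈ s, lact (Bt q a) (g i) := by
    simp [lact]
  have key := Bt_eigen q a
  simp only [coeff, hsum, lact_smul_right, lact_mat_mul]
  simp only [Finset.smul_sum, smul_smul]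
  refine Finset.sum_congr rfl fun i _ => Finset.sum_congr rfl fun j _ => ?_
  calc _ = ∑ m, ∑ n, (conj (ξ i j) * ∑ k, ∑ l, (Bt q a).ofConv (mat q m k * mat q n l) * ηt q a k l) •
        (mat q i m * mat q j n) := by
        simp only [Fin.sum_univ_two]
        module
    _ = _ := by
        simp only [key]
        refine Finset.sum_congr rfl fun i _ => Finset.sum_congr rfl fun j _ => ?_
        congr 1
        ring


theorem coeff_mem (q : Param) (a : ℝ) (ξ : Matrix (Fin 2) (Fin 2) ℂ) :
    coeff q ξ (ηt q a) ∈ sphere q a :=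
  mem_sphere_of_Bt (lact_coeff q a ξ)

theorem one_mem_sphere (q : Param) (a : ℝ) : (1 : OSU q) ∈ sphere q a :=
  mem_sphere_of_Bt (by simp [lact, Algebra.TensorProduct.one_def])

/-- `T_c⁺ ∈ O_q(S_t²)`, which raises weights `[c]` to `[c + 2]`: the coefficient `u_{ξ,ηt}` with
`ξ = q^{c-1/2} ξ₁ + √-1 √(q + q⁻¹) ξ₀ - q^{-c+1/2} ξ₋₁`. -/
def TPlus (q : Param) (a c : ℝ) : sphere q a :=
  ⟨coeff q (spinOne q (qpow q (c - 1 / 2)) (Complex.I * rt q) (-qpow q (-c + 1 / 2))) (ηt q a),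
    coeff_mem q a _⟩

/-- `T_c⁻ ∈ O_q(S_t²)`, which lowers weights `[c]` to `[c - 2]`: the coefficient `u_{ξ,ηt}` with
`ξ = -q^{-c-1/2} ξ₁ + √-1 √(q + q⁻¹) ξ₀ + q^{c+1/2} ξ₋₁`. -/
def TMinus (q : Param) (a c : ℝ) : sphere q a :=
  ⟨coeff q (spinOne q (-qpow q (-c - 1 / 2)) (Complex.I * rt q) (qpow q (c + 1 / 2))) (ηt q a),
    coeff_mem q a _⟩

/-- `A_c ∈ O_q(S_t²)`, which preserves weights `[c]`: it is `u_{ξ,ηt} - (q⁻¹ + q)⁻¹ ⟦c⟧ t` with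
`ξ = q^{-3/2} ξ₁ - (√-1 ⟦c⟧ / √(q + q⁻¹)) ξ₀ + q^{3/2} ξ₋₁`. -/
def AElt (q : Param) (a c : ℝ) : sphere q a :=
  ⟨coeff q (spinOne q (qpow q (-3 / 2)) (-(Complex.I * (dbracket q c : ℂ) / rt q))
      (qpow q (3 / 2))) (ηt q a), coeff_mem q a _⟩
    - (((((q : ℝ)⁻¹ + (q : ℝ))⁻¹ * dbracket q c * dbracket q a : ℝ)) : ℂ) • ⟨1, one_mem_sphere q a⟩

/-- The functional `z ↦ ω(x z y)`. -/
def twist {q : Param} (x y : OSU q) (ω : U q) : U q :=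
  .toConv (ω.ofConv ∘ₗ LinearMap.mulLeft ℂ x ∘ₗ LinearMap.mulRight ℂ y)

open FreeAlgebra in
/-- The relations of the Drinfeld double: those of `O_q(SU(2))`, those of `U`, and
`ω x = x₂ (S⁻¹(x₁) ▷ ω ◁ x₃)`, where `S⁻¹(x₁) ▷ ω ◁ x₃` is the functional `z ↦ ω(x₃ z S⁻¹(x₁))`. -/
inductive DoubleRel (q : Param) :
    FreeAlgebra ℂ (OSU q ⊕ U q) → FreeAlgebra ℂ (OSU q ⊕ U q) → Prop
  | fun_add (x y : OSU q) :
      DoubleRel q (ι ℂ (.inl (x + y))) (ι ℂ (.inl x) + ι ℂ (.inl y))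
  | fun_smul (z : ℂ) (x : OSU q) : DoubleRel q (ι ℂ (.inl (z • x))) (z • ι ℂ (.inl x))
  | fun_mul (x y : OSU q) :
      DoubleRel q (ι ℂ (.inl (x * y))) (ι ℂ (.inl x) * ι ℂ (.inl y))
  | fun_one : DoubleRel q (ι ℂ (.inl 1)) 1
  | dual_add (ω ν : U q) :
      DoubleRel q (ι ℂ (.inr (ω + ν))) (ι ℂ (.inr ω) + ι ℂ (.inr ν))
  | dual_smul (z : ℂ) (ω : U q) : DoubleRel q (ι ℂ (.inr (z • ω))) (z • ι ℂ (.inr ω))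
  | dual_mul (ω ν : U q) :
      DoubleRel q (ι ℂ (.inr (ω * ν))) (ι ℂ (.inr ω) * ι ℂ (.inr ν))
  | dual_one : DoubleRel q (ι ℂ (.inr 1)) 1
  | cross (ω : U q) (x : OSU q) (n : ℕ) (x₁ x₂ x₃ : Fin n → OSU q)
      (h : LinearMap.lTensor (OSU q) Coalgebra.comul (Coalgebra.comul (R := ℂ) x) =
        ∑ i, x₁ i ⊗ₜ[ℂ] (x₂ i ⊗ₜ[ℂ] x₃ i)) :
      DoubleRel q (ι ℂ (.inr ω) * ι ℂ (.inl x))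
        (∑ i, ι ℂ (.inl (x₂ i)) * ι ℂ (.inr (twist (x₃ i) (OSU.SInv q (x₁ i)) ω)))

/-- The Drinfeld double `O_q(SU(2)) ⋈ U`. -/
def Double (q : Param) : Type := RingQuot (DoubleRel q)

instance (q : Param) : Ring (Double q) := inferInstanceAs (Ring (RingQuot (DoubleRel q)))

instance (q : Param) : Algebra ℂ (Double q) :=
  inferInstanceAs (Algebra ℂ (RingQuot (DoubleRel q)))

/-- The quotient map from the free algebra. -/
def Double.mk (q : Param) : FreeAlgebra ℂ (OSU q ⊕ U q) →ₐ[ℂ] Double q :=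
  RingQuot.mkAlgHom ℂ (DoubleRel q)

/-- The map `O_q(SU(2)) → O_q(SU(2)) ⋈ U`. -/
def Double.ofFun (q : Param) (x : OSU q) : Double q := Double.mk q (FreeAlgebra.ι ℂ (.inl x))

/-- The map `U → O_q(SU(2)) ⋈ U`. -/
def Double.ofDual (q : Param) (ω : U q) : Double q := Double.mk q (FreeAlgebra.ι ℂ (.inr ω))

/-- `U_q(sl(2,ℝ)_t) = O_q(S_t²) ⋈ I`, the subalgebra of the Drinfeld double generated by
`O_q(S_t²)` and `I`. -/
def UqSL (q : Param) (a : ℝ) : Subalgebra ℂ (Double q) :=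
  Algebra.adjoin ℂ (Double.ofFun q '' (sphere q a) ∪ Double.ofDual q '' (coideal q a))

namespace UqSL

/-- Elements of `O_q(S_t²)` as elements of `U_q(sl(2,ℝ)_t)`. -/
def ofFun {q : Param} {a : ℝ} (x : sphere q a) : UqSL q a :=
  ⟨Double.ofFun q x, Algebra.subset_adjoin (.inl ⟨x, x.2, rfl⟩)⟩

/-- Elements of `I` as elements of `U_q(sl(2,ℝ)_t)`. -/
def ofDual {q : Param} {a : ℝ} (ω : coideal q a) : UqSL q a :=
  ⟨Double.ofDual q ω, Algebra.subset_adjoin (.inr ⟨ω, ω.2, rfl⟩)⟩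

/-- `B_t` as an element of `U_q(sl(2,ℝ)_t)`. -/
def B (q : Param) (a : ℝ) : UqSL q a :=
  ofDual ⟨Bt q a, Algebra.subset_adjoin (Set.mem_singleton _)⟩

end UqSL

/-- The left ideal generated by `√-1 B_t - [b]` and `A_b - λ`. -/
def basicIdeal (q : Param) (a lam b : ℝ) : Submodule (UqSL q a) (UqSL q a) :=
  Submodule.span (UqSL q a)
    {Complex.I • UqSL.B q a - algebraMap ℂ (UqSL q a) (bracket q b : ℂ),
      UqSL.ofFun (AElt q a b) - algebraMap ℂ (UqSL q a) (lam : ℂ)}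

/-- The universal `(λ, b)`-basic module `M_{λ,b}`: it is generated by a vector `e_b` with
`√-1 B_t e_b = [b] e_b` and `A_b e_b = λ e_b`, and maps onto every module with such a cyclic vector. -/
abbrev M (q : Param) (a lam b : ℝ) : Type := UqSL q a ⧸ basicIdeal q a lam b

/-- The cyclic vector `e_b` of `M_{λ,b}`. -/
def M.e (q : Param) (a lam b : ℝ) : M q a lam b := (basicIdeal q a lam b).mkQ 1

/-- `*`-invariant sesquilinear forms, conjugate linear in the first variable: `⟨v, x w⟩ = ⟨x* v, w⟩`
for `x` in `O_q(S_t²)` and in `I`, which generate `U_q(sl(2,ℝ)_t)`. -/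
structure IsInvariantForm (q : Param) (a : ℝ) {V : Type} [AddCommGroup V] [Module (UqSL q a) V]
    [Module ℂ V] (F : V →ₗ⋆[ℂ] V →ₗ[ℂ] ℂ) : Prop where
  invariant_fun : ∀ x y : sphere q a, (y : OSU q) = star (x : OSU q) →
    ∀ v w : V, F v (UqSL.ofFun x • w) = F (UqSL.ofFun y • v) w
  invariant_dual : ∀ x y : coideal q a, (y : U q) = U.dualStar q (x : U q) →
    ∀ v w : V, F v (UqSL.ofDual x • w) = F (UqSL.ofDual y • v) w

/-- The kernel `N_{λ,b}` of the invariant sesquilinear form of `M_{λ,b}`, which is unique up to a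
scalar. (Invariance makes the kernel a submodule, so that quantifying over `x` changes nothing; the
zero form imposes no condition.) -/
def N (q : Param) (a lam b : ℝ) : Submodule (UqSL q a) (M q a lam b) where
  carrier := {v | ∀ F : M q a lam b →ₗ⋆[ℂ] M q a lam b →ₗ[ℂ] ℂ, IsInvariantForm q a F →
    ∀ (x : UqSL q a) (w : M q a lam b), F (x • v) w = 0}
  zero_mem' := by intro F _ x w; simp
  add_mem' := by
    intro v v' hv hv' F hF x w
    rw [smul_add, map_add, LinearMap.add_apply, hv F hF, hv' F hF, add_zero]
  smul_mem' := by
    intro y v hv F hF x w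
    rw [smul_smul]
    exact hv F hF (x * y) w

/-- `L_{λ,b} = M_{λ,b} / N_{λ,b}`. -/
abbrev L (q : Param) (a lam b : ℝ) : Type := M q a lam b ⧸ N q a lam b

/-- The cyclic vector of `L_{λ,b}`. -/
def L.e (q : Param) (a lam b : ℝ) : L q a lam b := (N q a lam b).mkQ (M.e q a lam b)

/-- The canonical projection `M_{λ,b} → L_{λ,b}`. -/
def L.proj (q : Param) (a lam b : ℝ) : M q a lam b →ₗ[ℂ] L q a lam b :=
  (N q a lam b).mkQ.restrictScalars ℂ

/-- The vectors `e_{b+2n} = T⁺_{b+2n-2} ⋯ T⁺_b e_b`, `n ≥ 0`, built from `e_b = v`. -/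
def up (q : Param) (a : ℝ) {V : Type} [AddCommGroup V] [Module (UqSL q a) V] (b : ℝ) (v : V) :
    ℕ → V
  | 0 => v
  | n + 1 => UqSL.ofFun (TPlus q a (b + 2 * n)) • up q a b v n

/-- The vectors `e_{b-2n} = T⁻_{b-2n+2} ⋯ T⁻_b e_b`, `n ≥ 0`, built from `e_b = v`. -/
def down (q : Param) (a : ℝ) {V : Type} [AddCommGroup V] [Module (UqSL q a) V] (b : ℝ) (v : V) :
    ℕ → V
  | 0 => v
  | n + 1 => UqSL.ofFun (TMinus q a (b - 2 * n)) • down q a b v n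

/-- `D₂⁺ = L_{q+q⁻¹,a+2}`. -/
abbrev DPlus (q : Param) (a : ℝ) : Type := L q a ((q : ℝ) + (q : ℝ)⁻¹) (a + 2)

/-- `D₂⁻ = L_{q+q⁻¹,a-2}`. -/
abbrev DMinus (q : Param) (a : ℝ) : Type := L q a ((q : ℝ) + (q : ℝ)⁻¹) (a - 2)

/-- `M_{q+q⁻¹,a}`. -/
abbrev MCrit (q : Param) (a : ℝ) : Type := M q a ((q : ℝ) + (q : ℝ)⁻¹) a

/-- `𝟙 = L_{q+q⁻¹,a}`. -/
abbrev Triv (q : Param) (a : ℝ) : Type := L q a ((q : ℝ) + (q : ℝ)⁻¹) a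

/-- The dual of `O_q(SU(2)) / B₊ O_q(SU(2))`, where `B = O_q(S_t²)` and `B₊ = B ∩ ker ε`, as a subspace
of `U`. It is the product of one-dimensional blocks, on which `√-1 B_t` acts by `[a + m]`, `m ∈ ℤ`. -/
def stabilizerDual (q : Param) (a : ℝ) : Submodule ℂ (U q) where
  carrier := {ω | ∀ b ∈ sphere q a, Coalgebra.counit (R := ℂ) b = 0 →
    ∀ x : OSU q, ω.ofConv (b * x) = 0}
  zero_mem' := by intro b _ _ x; simp
  add_mem' := by intro ω ν hω hν b hb h x; simp [hω b hb h x, hν b hb h x]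
  smul_mem' := by intro z ω hω b hb h x; simp [hω b hb h x]

/-- The block on which `√-1 B_t` acts by `[a + m]`. -/
def weightSpace (q : Param) (a : ℝ) (m : ℤ) : Submodule ℂ (U q) :=
  stabilizerDual q a ⊓ LinearMap.ker
    (LinearMap.mulLeft ℂ (Complex.I • Bt q a - algebraMap ℂ (U q) (bracket q (a + m) : ℂ)))

/-- The stabilizer dual `I_c`, the direct sum of the blocks. -/
def Ic (q : Param) (a : ℝ) : Submodule ℂ (U q) := ⨆ m : ℤ, weightSpace q a m

/-- `O_q(S_t²) ⋈ I_c`, the subalgebra of the Drinfeld double generated by `O_q(S_t²)` and `I_c`. -/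
def DIc (q : Param) (a : ℝ) : Subalgebra ℂ (Double q) :=
  Algebra.adjoin ℂ (Double.ofFun q '' (sphere q a) ∪ Double.ofDual q '' (Ic q a))

namespace DIc

/-- Elements of `O_q(S_t²)` as elements of `O_q(S_t²) ⋈ I_c`. -/
def ofFun {q : Param} {a : ℝ} (x : sphere q a) : DIc q a :=
  ⟨Double.ofFun q x, Algebra.subset_adjoin (.inl ⟨x, x.2, rfl⟩)⟩

/-- Elements of `I_c` as elements of `O_q(S_t²) ⋈ I_c`. -/
def ofDual {q : Param} {a : ℝ} (ω : Ic q a) : DIc q a :=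
  ⟨Double.ofDual q ω, Algebra.subset_adjoin (.inr ⟨ω, ω.2, rfl⟩)⟩

end DIc

/-- `Φ` is the projection of `I_c` onto the block on which `√-1 B_t` acts by `[a + m]`. -/
structure IsWeightProj (q : Param) (a : ℝ) (m : ℤ) (Φ : Ic q a) : Prop where
  mem : (Φ : U q) ∈ weightSpace q a m
  ne_zero : Φ ≠ 0
  idem : (Φ : U q) * Φ = Φ

/-- `ρ` is the non-degenerate representation of `O_q(S_t²) ⋈ I_c` corresponding to the
`U_q(sl(2,ℝ)_t)`-module `V`: elements of `O_q(S_t²)` act as they do on `V`, and the projections of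
`I_c` act as the projections onto the weight spaces of `√-1 B_t`. -/
structure IsAssociatedRep (q : Param) (a : ℝ) (V : Type) [AddCommGroup V] [Module (UqSL q a) V]
    [Module ℂ V] [IsScalarTower ℂ (UqSL q a) V] (ρ : DIc q a →ₐ[ℂ] Module.End ℂ V) : Prop where
  fun_apply : ∀ (x : sphere q a) (v : V), ρ (DIc.ofFun x) v = UqSL.ofFun x • v
  proj_apply : ∀ (m : ℤ) (Φ : Ic q a), IsWeightProj q a m Φ → ∀ (n : ℤ) (v : V),
    Complex.I • (UqSL.B q a • v) = (bracket q (a + n) : ℂ) • v →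
      ρ (DIc.ofDual Φ) v = if n = m then v else 0
  nondegenerate : Submodule.span ℂ {w : V | ∃ (ω : Ic q a) (v : V), ρ (DIc.ofDual ω) v = w} = ⊤

end QSL

end

/-!
Everything is made explicit. Write `E(b, c) ⊆ O_q(SU(2))` (`eig`) for the space on which `√-1 B_t`
with `t = ⟦b⟧` acts by `[c]`. Then `E(b, c) E(c, d) ⊆ E(b, d)`, the sphere is `E(a, a)`, and
multiplication by the two "arrows of length one" shows that `O_q(SU(2)) = ⨁ₘ E(a, a + m)` and that
three elements `X`, `Y`, `N` generate the sphere. In particular `1 ∈ E(a + m, a) E(a, a + m)`, so a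
functional in the stabilizer dual is a multiple of `ε` on every `E(a, a + m)`. Hence the `m`-th block
of `I_c` is a line, spanned by the projection `blockUnit` (`eq_smul_blockUnit`).

*Ladders.* The relations of the Drinfeld double give the commutation rules of `B_t` with `X`, `Y`,
`N`, and these show that `T_c^±` maps weight vectors for `[c]` to weight vectors for `[c ± 2]`
(`IsWt.TPlus`, `IsWt.TMinus`). The quadratic relations of the sphere express
`T^∓_{c ± 2} T^±_c` by the numbers `q^x + q^{-x}` and `A_c`; so on the ladder `e_{b+2n}`
generated by an eigenvector of `A_b` every generator acts by explicit coefficients, and the ladder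
spans the module it generates. The coefficient of `T⁻_{c+2} T⁺_c` on `e_c` is `step`.

*Representations.* The double acts on `O_q(SU(2))` (functions by multiplication, functionals by a
twisted adjoint action), and the sphere is a submodule which is generated by `1` and which maps onto
`M_{λ,a}`, because `B_t` can be moved to the right of any element of the sphere and then acts on the
generator by a scalar. There `I_c` acts through the weight projections. So `M_{λ,a}` carries the
representation asked for (`exists_isWeightRep_M`), and submodules and quotients inherit it.

*The ladder of `M_{λ,a}` for `λ = q + q⁻¹` has no zeros.* If `e_{a+2}` were zero, comparing weights in
the sphere would give `T_a⁺ = T_a⁺ p(A_a) (A_a - λ)` for a polynomial `p`. Multiplied by `T⁻_{a+2}` this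
is an algebraic equation for `A_a`; but `A_a` is transcendental (`aeval_AElt_ne_zero`), as is seen in
the representation of `O_q(SU(2))` by weighted shifts. The same holds for `e_{a-2}`, and the other
vectors are reached from these two with nonvanishing coefficients.

*The invariant form.* A module with a ladder basis has the invariant form which is diagonal in the
ladder with entries the products `stepProd` of the coefficients `step`; hence the kernel of the form of
`M_{λ,b}` is spanned by the `e_{b+2n}` with `stepProd n = 0` (`mem_N_iff`). For `λ = q + q⁻¹` and
`b = a` the coefficients vanish exactly at the two steps starting or ending at `e_a`, so the kernel is
the span of all `e_{a+2n}` with `n ≠ 0` and `𝟙` is a line. For `b = a ± 2` the kernel is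
spanned by `e_a` and the vectors beyond it, and the rest of the ladder is identified with the
corresponding half of the ladder of `M_{q+q⁻¹,a}` (`exists_DPlus_hom`, `exists_DMinus_hom`). This gives
the exact sequence.

*Splitting.* Mapping the generator of `𝟙` to `e_a` is a section over `I_c`. A section over the whole
algebra would send it to a weight vector for `[a]`, that is, to a multiple of `e_a`; but `T_a⁺`
annihilates `𝟙` and not `e_a`.
-/

noncomputable section

namespace QSL

open OSU U

/-! ### Powers of the deformation parameter -/

theorem q_pos (q : Param) : (0 : ℝ) < q := q.2.1

theorem qpow_add (q : Param) (x y : ℝ) : qpow q (x + y) = qpow q x * qpow q y := by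
  simp [qpow, Real.rpow_add (q_pos q)]

theorem qpow_one (q : Param) : qpow q 1 = qC q := by simp [qpow, qC]

theorem qpow_ne_zero (q : Param) (x : ℝ) : qpow q x ≠ 0 := by
  simpa [qpow] using (Real.rpow_pos_of_pos (q_pos q) x).ne'

theorem qpow_neg (q : Param) (x : ℝ) : qpow q (-x) = (qpow q x)⁻¹ := by
  simp [qpow, Real.rpow_neg (q_pos q).le]

theorem qpow_sub (q : Param) (x y : ℝ) : qpow q (x - y) = qpow q x * (qpow q y)⁻¹ := by
  rw [sub_eq_add_neg, qpow_add, qpow_neg]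

theorem qC_sub_inv_lt (q : Param) : (q : ℝ) - (q : ℝ)⁻¹ < 0 :=
  sub_neg.mpr (q.2.2.trans ((one_lt_inv₀ (q_pos q)).mpr q.2.2))

theorem qC_sub_inv_ne_zero (q : Param) : qC q - (qC q)⁻¹ ≠ 0 := by
  rw [qC, ← Complex.ofReal_inv, ← Complex.ofReal_sub, Complex.ofReal_ne_zero]
  exact (qC_sub_inv_lt q).ne

theorem dbracket_eq (q : Param) (x : ℝ) : (dbracket q x : ℂ) = qpow q x - (qpow q x)⁻¹ := by
  simp [dbracket, qpow, Real.rpow_neg (q_pos q).le]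

theorem bracket_eq (q : Param) (x : ℝ) :
    (bracket q x : ℂ) = (qpow q x - (qpow q x)⁻¹) / (qC q - (qC q)⁻¹) := by
  simp [bracket, qpow, qC, Real.rpow_neg (q_pos q).le]

theorem bracket_strictMono (q : Param) : StrictMono (bracket q) := by
  intro x y hxy
  have h1 : (q : ℝ) ^ y < (q : ℝ) ^ x := Real.rpow_lt_rpow_of_exponent_gt (q_pos q) q.2.2 hxy
  have h2 : (q : ℝ) ^ (-x) < (q : ℝ) ^ (-y) :=
    Real.rpow_lt_rpow_of_exponent_gt (q_pos q) q.2.2 (neg_lt_neg hxy)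
  rw [bracket, bracket, div_lt_div_right_of_neg (qC_sub_inv_lt q)]
  linarith

theorem bracket_inj {q : Param} {x y : ℝ} : (bracket q x : ℂ) = bracket q y ↔ x = y := by
  rw [Complex.ofReal_inj, (bracket_strictMono q).injective.eq_iff]

/-- `[b + 1] - q⁻¹ [b] = q^b`. -/
theorem bracket_add_one (q : Param) (b : ℝ) :
    (bracket q (b + 1) : ℂ) = (qC q)⁻¹ * bracket q b + qpow q b := by
  have h := qC_sub_inv_ne_zero q
  have hq := qC_ne_zero q
  have hb := qpow_ne_zero q b
  have h' : qC q ^ 2 - 1 ≠ 0 := by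
    intro h0; apply h; field_simp; linear_combination h0
  rw [bracket_eq, bracket_eq, qpow_add, qpow_one]
  field_simp
  ring

/-- `[b - 1] - q⁻¹ [b] = -q^{-b}`. -/
theorem bracket_sub_one (q : Param) (b : ℝ) :
    (bracket q (b - 1) : ℂ) = (qC q)⁻¹ * bracket q b - (qpow q b)⁻¹ := by
  have h := qC_sub_inv_ne_zero q
  have hq := qC_ne_zero q
  have hb := qpow_ne_zero q b
  have h' : qC q ^ 2 - 1 ≠ 0 := by
    intro h0; apply h; field_simp; linear_combination h0
  rw [bracket_eq, bracket_eq, qpow_sub, qpow_one]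
  field_simp
  ring

/-- `q^x + q^{-x}`. -/
def qcosh (q : Param) (x : ℝ) : ℝ := (q : ℝ) ^ x + (q : ℝ) ^ (-x)

theorem qcosh_pos (q : Param) (x : ℝ) : 0 < qcosh q x :=
  add_pos (Real.rpow_pos_of_pos (q_pos q) _) (Real.rpow_pos_of_pos (q_pos q) _)

theorem qcosh_eq (q : Param) (x : ℝ) : (qcosh q x : ℂ) = qpow q x + (qpow q x)⁻¹ := by
  simp [qcosh, qpow, Real.rpow_neg (q_pos q).le]

theorem qpow_add_inv_ne_zero (q : Param) (x : ℝ) : qpow q x + (qpow q x)⁻¹ ≠ 0 := by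
  rw [← qcosh_eq, Complex.ofReal_ne_zero]
  exact (qcosh_pos q x).ne'

/-! ### Induction on `O_q(SU(2))` -/

theorem OSU.induction {q : Param} {P : OSU q → Prop} (hc : ∀ z : ℂ, P (algebraMap ℂ _ z))
    (hg : ∀ g, P (gen q g)) (hm : ∀ x y, P x → P y → P (x * y))
    (ha : ∀ x y, P x → P y → P (x + y)) (x : OSU q) : P x := by
  obtain ⟨y, rfl⟩ := RingQuot.mkAlgHom_surjective ℂ (SURel q) x
  change P (mk q y)
  induction y using FreeAlgebra.induction with
  | grade0 z => simpa using hc z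
  | grade1 g => exact hg g
  | mul a b ha' hb => rw [map_mul]; exact hm _ _ ha' hb
  | add a b ha' hb => rw [map_add]; exact ha _ _ ha' hb

theorem gen_mem_mat (q : Param) (g : Gen) : ∃ (z : ℂ) (i j : Fin 2), gen q g = z • mat q i j := by
  have hq := qC_ne_zero q
  cases g with
  | α => exact ⟨1, 0, 0, by simp [mat]⟩
  | αs => exact ⟨1, 1, 1, by simp [mat]⟩
  | γ => exact ⟨1, 1, 0, by simp [mat]⟩
  | γs => exact ⟨-(qC q)⁻¹, 0, 1, by simp [mat, smul_smul, hq]⟩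

/-- A subspace of `O_q(SU(2))` containing `1` and stable under right multiplication by the entries
of `u` is everything. -/
theorem OSU.eq_top_of_mul_mat {q : Param} (W : Submodule ℂ (OSU q)) (h1 : 1 ∈ W)
    (hm : ∀ x ∈ W, ∀ i j, x * mat q i j ∈ W) : W = ⊤ := by
  have key : ∀ x : OSU q, ∀ y ∈ W, y * x ∈ W := by
    intro x
    induction x using OSU.induction with
    | hc z =>
      intro y hy
      rw [Algebra.algebraMap_eq_smul_one, mul_smul_comm, mul_one]
      exact W.smul_mem z hy
    | hg g =>
      intro y hy
      obtain ⟨z, i, j, h⟩ := gen_mem_mat q g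
      rw [h, mul_smul_comm]
      exact W.smul_mem _ (hm y hy i j)
    | hm x y hx hy =>
      intro w hw
      rw [← mul_assoc]
      exact hy _ (hx _ hw)
    | ha x y hx hy =>
      intro w hw
      rw [mul_add]
      exact W.add_mem (hx _ hw) (hy _ hw)
  rw [eq_top_iff]
  intro x _
  simpa using key x 1 h1

/-! ### The left action of `U` -/

theorem counit_lact {q : Param} (ω : U q) (x : OSU q) :
    Coalgebra.counit (R := ℂ) (lact ω x) = ω.ofConv x := by
  have aux (y : OSU q ⊗[ℂ] OSU q) : Coalgebra.counit (R := ℂ)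
      (TensorProduct.rid ℂ (OSU q) (LinearMap.lTensor (OSU q) ω.ofConv y)) =
      ω.ofConv (TensorProduct.lid ℂ (OSU q) (LinearMap.rTensor (OSU q) Coalgebra.counit y)) := by
    induction y using TensorProduct.induction_on with
    | zero => simp
    | add a b ha hb => simp only [map_add, ha, hb]
    | tmul u v => simp [mul_comm]
  rw [lact, aux, Coalgebra.rTensor_counit_comul]
  simp

theorem counit_mul {q : Param} (x y : OSU q) : Coalgebra.counit (R := ℂ) (x * y) =
    Coalgebra.counit (R := ℂ) x * Coalgebra.counit (R := ℂ) y := Bialgebra.counit_mul ..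

/-- A coproduct formula for `ω` turns into a Leibniz rule for its action. -/
theorem lact_mul_right {q : Param} {ω ω₁ ω₂ ω₃ ω₄ : U q}
    (h : ∀ x y, ω.ofConv (x * y) =
      ω₁.ofConv x * ω₂.ofConv y + ω₃.ofConv x * ω₄.ofConv y) (x y : OSU q) :
    lact ω (x * y) = lact ω₁ x * lact ω₂ y + lact ω₃ x * lact ω₄ y := by
  have aux (s t : OSU q ⊗[ℂ] OSU q) :
      TensorProduct.rid ℂ (OSU q) (LinearMap.lTensor (OSU q) ω.ofConv (s * t)) =
      TensorProduct.rid ℂ (OSU q) (LinearMap.lTensor (OSU q) ω₁.ofConv s) *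
        TensorProduct.rid ℂ (OSU q) (LinearMap.lTensor (OSU q) ω₂.ofConv t) +
      TensorProduct.rid ℂ (OSU q) (LinearMap.lTensor (OSU q) ω₃.ofConv s) *
        TensorProduct.rid ℂ (OSU q) (LinearMap.lTensor (OSU q) ω₄.ofConv t) := by
    induction s using TensorProduct.induction_on with
    | zero => simp
    | add a b ha hb => simp only [map_add, add_mul, ha, hb]; abel
    | tmul s s' =>
      induction t using TensorProduct.induction_on with
      | zero => simp
      | add a b ha hb => simp only [map_add, mul_add, ha, hb]; abel
      | tmul t t' =>
        simp only [Algebra.TensorProduct.tmul_mul_tmul, LinearMap.lTensor_tmul,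
          TensorProduct.rid_tmul, h, smul_mul_assoc, mul_smul_comm, smul_smul]
        module
  rw [lact, Bialgebra.comul_mul, aux]
  rfl

theorem lact_mat (q : Param) (ω : U q) (i j : Fin 2) :
    lact ω (mat q i j) = ∑ k, ω.ofConv (mat q k j) • mat q i k := by
  simp only [lact, comul_mat, map_sum, LinearMap.lTensor_tmul, TensorProduct.rid_tmul]

theorem lact_neg {q : Param} (ω : U q) (x : OSU q) : lact (-ω) x = -lact ω x := by
  have := lact_smul (-1 : ℂ) ω x
  simpa using this

/-- `lact ω` as a linear endomorphism. -/
def lactEnd {q : Param} (ω : U q) : Module.End ℂ (OSU q) where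
  toFun := lact ω
  map_add' := lact_add_right ω
  map_smul' z x := lact_smul_right z ω x

@[simp] theorem lactEnd_apply {q : Param} (ω : U q) (x : OSU q) : lactEnd ω x = lact ω x := rfl

theorem lact_injective {q : Param} {ω ν : U q} (h : ∀ x, lact ω x = lact ν x) : ω = ν := by
  refine WithConv.ofConv_injective (LinearMap.ext fun x => ?_)
  exact (counit_lact ω x).symm.trans ((congrArg _ (h x)).trans (counit_lact ν x))

/-! ### The skew-primitive part of `B_t` -/

theorem kInv_mul (q : Param) (x y : OSU q) :
    (kInv q).ofConv (x * y) = (kInv q).ofConv x * (kInv q).ofConv y :=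
  map_mul (OSU.lift (kInv_quad q)) x y

theorem k_mul (q : Param) (x y : OSU q) :
    (k q).ofConv (x * y) = (k q).ofConv x * (k q).ofConv y :=
  map_mul (OSU.lift (k_quad q)) x y

theorem e_quad_diag (q : Param) (x : OSU q) : OSU.lift (e_quad q) x 1 0 = 0 ∧
    OSU.lift (e_quad q) x 0 0 = (k q).ofConv x ∧
    OSU.lift (e_quad q) x 1 1 = Coalgebra.counit (R := ℂ) x := by
  change _ ∧ _ = OSU.lift (k_quad q) x ∧ _ = OSU.counitHom q x
  unfold OSU.counitHom
  induction x using OSU.induction with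
  | hc z => simp [Matrix.algebraMap_matrix_apply]
  | hg g => cases g <;> simp [OSU.assign]
  | hm x y hx hy =>
    simp [Matrix.mul_apply, Fin.sum_univ_two, hx.1, hx.2.1, hx.2.2, hy.1, hy.2.1, hy.2.2]
  | ha x y hx hy => simp [hx.1, hx.2.1, hx.2.2, hy.1, hy.2.1, hy.2.2]

theorem f_quad_diag (q : Param) (x : OSU q) : OSU.lift (f_quad q) x 1 0 = 0 ∧
    OSU.lift (f_quad q) x 0 0 = Coalgebra.counit (R := ℂ) x ∧
    OSU.lift (f_quad q) x 1 1 = (kInv q).ofConv x := by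
  change _ ∧ _ = OSU.counitHom q x ∧ _ = OSU.lift (kInv_quad q) x
  unfold OSU.counitHom
  induction x using OSU.induction with
  | hc z => simp [Matrix.algebraMap_matrix_apply]
  | hg g => cases g <;> simp [OSU.assign]
  | hm x y hx hy =>
    simp [Matrix.mul_apply, Fin.sum_univ_two, hx.1, hx.2.1, hx.2.2, hy.1, hy.2.1, hy.2.2]
  | ha x y hx hy => simp [hx.1, hx.2.1, hx.2.2, hy.1, hy.2.1, hy.2.2]

theorem e_mul (q : Param) (x y : OSU q) : (e q).ofConv (x * y) =
    (e q).ofConv x * Coalgebra.counit (R := ℂ) y + (k q).ofConv x * (e q).ofConv y := by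
  change OSU.lift (e_quad q) _ 0 1 = OSU.lift (e_quad q) _ 0 1 * _ + _ * OSU.lift (e_quad q) _ 0 1
  rw [← (e_quad_diag q x).2.1, ← (e_quad_diag q y).2.2, map_mul, Matrix.mul_apply,
    Fin.sum_univ_two, add_comm]

theorem f_mul (q : Param) (x y : OSU q) : (f q).ofConv (x * y) =
    Coalgebra.counit (R := ℂ) x * (f q).ofConv y + (f q).ofConv x * (kInv q).ofConv y := by
  change OSU.lift (f_quad q) _ 0 1 = _ * OSU.lift (f_quad q) _ 0 1 + OSU.lift (f_quad q) _ 0 1 * _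
  rw [← (f_quad_diag q x).2.1, ← (f_quad_diag q y).2.2, map_mul, Matrix.mul_apply,
    Fin.sum_univ_two]

theorem one_ofConv {q : Param} : (1 : U q).ofConv = Coalgebra.counit := by
  ext y; simp [LinearMap.convOne_def]

theorem lact_kInv_mul (q : Param) (x y : OSU q) :
    lact (kInv q) (x * y) = lact (kInv q) x * lact (kInv q) y := by
  have := lact_mul_right (ω := kInv q) (ω₁ := kInv q) (ω₂ := kInv q) (ω₃ := 0) (ω₄ := 0)
    (by intro x y; simp [kInv_mul]) x y
  simpa [lact] using this

theorem lact_k_mul (q : Param) (x y : OSU q) :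
    lact (k q) (x * y) = lact (k q) x * lact (k q) y := by
  have := lact_mul_right (ω := k q) (ω₁ := k q) (ω₂ := k q) (ω₃ := 0) (ω₄ := 0)
    (by intro x y; simp [k_mul]) x y
  simpa [lact] using this

theorem k_mat (q : Param) (i j : Fin 2) :
    (k q).ofConv (mat q i j) = !![qC q, 0; 0, (qC q)⁻¹] i j := by
  change OSU.lift (k_quad q) _ = _
  fin_cases i <;> fin_cases j <;> simp [mat, OSU.assign]

theorem kInv_mat (q : Param) (i j : Fin 2) :
    (kInv q).ofConv (mat q i j) = !![(qC q)⁻¹, 0; 0, qC q] i j := by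
  change OSU.lift (kInv_quad q) _ = _
  fin_cases i <;> fin_cases j <;> simp [mat, OSU.assign]

theorem lact_of_one {q : Param} (ω : U q) : lact ω 1 = ω.ofConv 1 • 1 := by
  simp [lact, Algebra.TensorProduct.one_def]

theorem lact_algebraMap {q : Param} (ω : U q) (z : ℂ) :
    lact ω (algebraMap ℂ _ z) = ω.ofConv 1 • algebraMap ℂ _ z := by
  rw [Algebra.algebraMap_eq_smul_one, lact_smul_right, lact_of_one, smul_comm]

theorem kInv_one (q : Param) : (kInv q).ofConv 1 = 1 := map_one (OSU.lift (kInv_quad q))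
theorem k_one (q : Param) : (k q).ofConv 1 = 1 := map_one (OSU.lift (k_quad q))

theorem kInv_mul_k (q : Param) : kInv q * k q = 1 := by
  have hq := qC_ne_zero q
  apply lact_injective
  intro x
  rw [lact_mul, lact_one]
  induction x using OSU.induction with
  | hc z => simp [lact_algebraMap, kInv_one, k_one]
  | hg g =>
    obtain ⟨z, i, j, h⟩ := gen_mem_mat q g
    rw [h, lact_smul_right, lact_smul_right]
    congr 1
    simp only [lact_mat, Fin.sum_univ_two, lact_add_right, lact_smul_right, k_mat, kInv_mat]
    fin_cases i <;> fin_cases j <;> simp [smul_smul, hq]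
  | hm x y hx hy => rw [lact_k_mul, lact_kInv_mul, hx, hy]
  | ha x y hx hy => rw [lact_add_right, lact_add_right, hx, hy]

/-- `D = -q^{1/2} k⁻¹ e + q^{1/2} f`, the part of `B_t` that does not depend on `t`. -/
def skewD (q : Param) : U q := -(sqrtq q • (kInv q * e q)) + sqrtq q • f q

theorem I_smul_Bt (q : Param) (b : ℝ) :
    Complex.I • Bt q b = Complex.I • skewD q + (bracket q b : ℂ) • kInv q := by
  have h : (bracket q b : ℂ) = -(Complex.I * (Complex.I * (qC q - (qC q)⁻¹)⁻¹ * dbracket q b)) := by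
    rw [bracket_eq, dbracket_eq, ← mul_assoc, ← mul_assoc, Complex.I_mul_I]
    ring
  rw [Bt, smul_sub, smul_smul, h, neg_smul, skewD, sub_eq_add_neg]

theorem lact_kInv_mul_e (q : Param) (x y : OSU q) :
    lact (kInv q * e q) (x * y) =
      lact (kInv q * e q) x * lact (kInv q) y + x * lact (kInv q * e q) y := by
  have he := lact_mul_right (ω := e q) (ω₁ := e q) (ω₂ := 1) (ω₃ := k q) (ω₄ := e q)
    (by intro x y; rw [e_mul, one_ofConv]) x y
  rw [lact_mul, he, lact_one, lact_add_right, lact_kInv_mul, lact_kInv_mul, ← lact_mul,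
    ← lact_mul, ← lact_mul, kInv_mul_k, lact_one]

theorem lact_skewD_mul (q : Param) (x y : OSU q) :
    lact (skewD q) (x * y) = lact (skewD q) x * lact (kInv q) y + x * lact (skewD q) y := by
  have hf := lact_mul_right (ω := f q) (ω₁ := 1) (ω₂ := f q) (ω₃ := f q) (ω₄ := kInv q)
    (by intro x y; rw [f_mul, one_ofConv]) x y
  rw [lact_one] at hf
  simp only [skewD, lact_add, lact_neg, lact_smul, lact_kInv_mul_e, hf, smul_add, neg_mul,
    add_mul, mul_add, mul_neg, smul_mul_assoc, mul_smul_comm]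
  abel

theorem skewD_mul (q : Param) (x y : OSU q) : (skewD q).ofConv (x * y) =
    (skewD q).ofConv x * (kInv q).ofConv y + Coalgebra.counit (R := ℂ) x * (skewD q).ofConv y := by
  rw [← counit_lact, lact_skewD_mul, map_add, counit_mul, counit_mul, counit_lact, counit_lact,
    counit_lact]

theorem skewD_mat (q : Param) (i j : Fin 2) :
    (skewD q).ofConv (mat q i j) = !![0, -1; 1, 0] i j := by
  have hs := sqrtq_ne_zero q
  have h1 : ∀ i j, (e q).ofConv (mat q i j) = !![0, sqrtq q; 0, 0] i j := by
    intro i j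
    have h : qC q * (sqrtq q)⁻¹ = sqrtq q := by rw [← sqrtq_sq]; field_simp
    change OSU.lift (e_quad q) _ 0 1 = _
    fin_cases i <;> fin_cases j <;> simp [mat, OSU.assign, h]
  have h2 : ∀ i j, (f q).ofConv (mat q i j) = !![0, 0; (sqrtq q)⁻¹, 0] i j := by
    intro i j
    change OSU.lift (f_quad q) _ 0 1 = _
    fin_cases i <;> fin_cases j <;> simp [mat, OSU.assign]
  have h3 : (kInv q * e q).ofConv (mat q i j) =
      ∑ k, (kInv q).ofConv (mat q i k) * (e q).ofConv (mat q k j) := by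
    rw [LinearMap.convMul_def]
    simp only [LinearMap.comp_apply, comul_mat, map_sum,
      TensorProduct.map_tmul, LinearMap.mul'_apply]
  have hq : qC q = sqrtq q ^ 2 := (sqrtq_sq q).symm
  simp only [skewD, WithConv.ofConv_add, WithConv.ofConv_neg, WithConv.ofConv_smul,
    LinearMap.add_apply, LinearMap.neg_apply, LinearMap.smul_apply, h3, h2, h1, kInv_mat,
    Fin.sum_univ_two]
  fin_cases i <;> fin_cases j <;> simp [hs, hq]
  field_simp

theorem lact_kInv_mat (q : Param) (i : Fin 2) :
    lact (kInv q) (mat q i 0) = (qC q)⁻¹ • mat q i 0 ∧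
    lact (kInv q) (mat q i 1) = qC q • mat q i 1 := by
  simp [lact_mat, kInv_mat, Fin.sum_univ_two]

theorem lact_skewD_mat (q : Param) (i : Fin 2) :
    lact (skewD q) (mat q i 0) = mat q i 1 ∧ lact (skewD q) (mat q i 1) = -mat q i 0 := by
  simp [lact_mat, skewD_mat, Fin.sum_univ_two]

/-! ### Eigenspaces of `√-1 B_t` for varying `t` -/

/-- `E(b, c)`: the elements of `O_q(SU(2))` on which `√-1 B_t` with `t = ⟦b⟧` acts by `[c]` under the
left action. These subspaces compose like the arrows of a groupoid, `E(b, c) E(c, d) ⊆ E(b, d)`, and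
`E(a, a)` is the sphere. -/
def eig (q : Param) (b c : ℝ) : Submodule ℂ (OSU q) :=
  Module.End.eigenspace (lactEnd (Complex.I • Bt q b)) (bracket q c : ℂ)

theorem mem_eig {q : Param} {b c : ℝ} {x : OSU q} :
    x ∈ eig q b c ↔ Complex.I • lact (skewD q) x + (bracket q b : ℂ) • lact (kInv q) x =
      (bracket q c : ℂ) • x := by
  rw [eig, Module.End.mem_eigenspace_iff, lactEnd_apply, I_smul_Bt, lact_add, lact_smul, lact_smul]

theorem mul_mem_eig {q : Param} {b c d : ℝ} {x y : OSU q} (hx : x ∈ eig q b c)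
    (hy : y ∈ eig q c d) : x * y ∈ eig q b d := by
  rw [mem_eig] at *
  calc Complex.I • lact (skewD q) (x * y) + (bracket q b : ℂ) • lact (kInv q) (x * y)
      = (Complex.I • lact (skewD q) x + (bracket q b : ℂ) • lact (kInv q) x) * lact (kInv q) y +
        x * (Complex.I • lact (skewD q) y) := by
        rw [lact_skewD_mul, lact_kInv_mul]
        simp only [smul_add, add_mul, smul_mul_assoc, mul_smul_comm]
        abel
    _ = x * (Complex.I • lact (skewD q) y + (bracket q c : ℂ) • lact (kInv q) y) := by
        rw [hx, mul_add, smul_mul_assoc, mul_smul_comm _ x (lact (kInv q) y), add_comm]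
    _ = _ := by rw [hy, mul_smul_comm]

theorem skewD_one (q : Param) : (skewD q).ofConv 1 = 0 := by
  have h := skewD_mul q 1 1
  rw [mul_one, kInv_one, mul_one, Bialgebra.counit_one, one_mul] at h
  simpa using h

theorem one_mem_eig (q : Param) (b : ℝ) : (1 : OSU q) ∈ eig q b b := by
  rw [mem_eig, lact_of_one, lact_of_one, skewD_one, kInv_one]
  simp

theorem mem_sphere_iff {q : Param} {a : ℝ} {x : OSU q} : x ∈ sphere q a ↔ x ∈ eig q a a := by
  have h1 : Complex.I • lact (Bt q a) (1 : OSU q) = (bracket q a : ℂ) • 1 := by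
    have := mem_eig.mp (one_mem_eig q a)
    rwa [← lact_smul, ← lact_smul, ← lact_add, ← I_smul_Bt, lact_smul] at this
  have h2 : Complex.I * (Bt q a).ofConv 1 = bracket q a := by
    have := congrArg (Coalgebra.counit (R := ℂ)) h1
    simpa [counit_lact] using this
  have h3 : x ∈ eig q a a ↔ lact (Bt q a) x = (Bt q a).ofConv 1 • x := by
    rw [eig, Module.End.mem_eigenspace_iff, lactEnd_apply, lact_smul, ← h2, ← smul_smul]
    exact (smul_right_injective _ Complex.I_ne_zero).eq_iff
  rw [h3]
  exact ⟨fun h => h _ (Algebra.subset_adjoin rfl), mem_sphere_of_Bt⟩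

theorem sphere_eq_eig (q : Param) (a : ℝ) : sphere q a = eig q a a :=
  Submodule.ext fun _ => mem_sphere_iff

theorem mul_mem_sphere {q : Param} {a : ℝ} {x y : OSU q} (hx : x ∈ sphere q a)
    (hy : y ∈ sphere q a) : x * y ∈ sphere q a := by
  rw [mem_sphere_iff] at *
  exact mul_mem_eig hx hy

/-! ### Arrows of length one and two -/

/-- The combination `u i 0 + √-1 z u i 1` of the entries of the `i`-th row of `u`. -/
def rowVec (q : Param) (z : ℂ) (i : Fin 2) : OSU q := mat q i 0 + (Complex.I * z) • mat q i 1

theorem rowVec_mem_eig {q : Param} {b c : ℝ} {z : ℂ}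
    (h : (bracket q c : ℂ) = (qC q)⁻¹ * bracket q b + z)
    (h' : (1 : ℂ) + bracket q b * qC q * z = bracket q c * z) (i : Fin 2) :
    rowVec q z i ∈ eig q b c := by
  have hI : Complex.I * Complex.I = -1 := Complex.I_mul_I
  rw [mem_eig, rowVec]
  simp only [lact_add_right, lact_smul_right, lact_kInv_mat, lact_skewD_mat]
  match_scalars
  · linear_combination Complex.I * h'
  · linear_combination (-z) * hI - h

theorem rowVec_up_mem (q : Param) (b : ℝ) (i : Fin 2) :
    rowVec q (qpow q b) i ∈ eig q b (b + 1) := by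
  refine rowVec_mem_eig (bracket_add_one q b) ?_ i
  have h := qC_sub_inv_ne_zero q
  have hq := qC_ne_zero q
  have hb := qpow_ne_zero q b
  have h' : qC q ^ 2 - 1 ≠ 0 := by
    intro h0; apply h; field_simp; linear_combination h0
  rw [bracket_eq, bracket_eq, qpow_add, qpow_one]
  field_simp
  ring

theorem rowVec_down_mem (q : Param) (b : ℝ) (i : Fin 2) :
    rowVec q (-(qpow q b)⁻¹) i ∈ eig q b (b - 1) := by
  refine rowVec_mem_eig (by rw [bracket_sub_one]; ring) ?_ i
  have h := qC_sub_inv_ne_zero q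
  have hq := qC_ne_zero q
  have hb := qpow_ne_zero q b
  have h' : qC q ^ 2 - 1 ≠ 0 := by
    intro h0; apply h; field_simp; linear_combination h0
  rw [bracket_eq, bracket_eq, qpow_sub, qpow_one]
  field_simp
  ring

/-- The span of the two `rowVec q z i`. -/
def rowSpan (q : Param) (z : ℂ) : Submodule ℂ (OSU q) := Submodule.span ℂ (Set.range (rowVec q z))

theorem rowSpan_up_le (q : Param) (b : ℝ) : rowSpan q (qpow q b) ≤ eig q b (b + 1) :=
  Submodule.span_le.mpr (Set.range_subset_iff.mpr (rowVec_up_mem q b))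

theorem rowSpan_down_le (q : Param) (b : ℝ) : rowSpan q (-(qpow q b)⁻¹) ≤ eig q b (b - 1) :=
  Submodule.span_le.mpr (Set.range_subset_iff.mpr (rowVec_down_mem q b))

theorem mat_mem_rowSpan {q : Param} {y z : ℂ} (h : y ≠ z) (i j : Fin 2) :
    mat q i j ∈ rowSpan q y ⊔ rowSpan q z := by
  have hy : rowVec q y i ∈ rowSpan q y ⊔ rowSpan q z :=
    Submodule.mem_sup_left (Submodule.subset_span ⟨i, rfl⟩)
  have hz : rowVec q z i ∈ rowSpan q y ⊔ rowSpan q z :=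
    Submodule.mem_sup_right (Submodule.subset_span ⟨i, rfl⟩)
  have hyz : y - z ≠ 0 := sub_ne_zero.mpr h
  have hI := Complex.I_ne_zero
  have h1 : mat q i 1 ∈ rowSpan q y ⊔ rowSpan q z := by
    have := Submodule.smul_mem _ (Complex.I * (y - z))⁻¹ (Submodule.sub_mem _ hy hz)
    convert this using 1
    rw [rowVec, rowVec, add_sub_add_left_eq_sub, ← sub_smul, ← mul_sub, smul_smul,
      inv_mul_cancel₀ (mul_ne_zero hI hyz), one_smul]
  have h0 : mat q i 0 ∈ rowSpan q y ⊔ rowSpan q z := by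
    have := Submodule.sub_mem _ hy (Submodule.smul_mem _ (Complex.I * y) h1)
    convert this using 1
    rw [rowVec, add_sub_cancel_right]
  fin_cases j
  exacts [h0, h1]

/-- The `q`-symplectic form `u i k u j l - q u j k u i l`. -/
def qEps (q : Param) : Matrix (Fin 2) (Fin 2) ℂ := !![0, 1; -qC q, 0]

/-- The entries of each row satisfy `x y' - q y x' = const`. -/
theorem mat_row_rel (q : Param) (i j : Fin 2) :
    mat q i 0 * mat q j 1 = qC q • (mat q i 1 * mat q j 0) + algebraMap ℂ _ (qEps q i j) := by
  have h := quad q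
  have h2 : α q * αs q = 1 - qC q ^ 2 • (γ q * γs q) := by rw [← h.unit₂]; abel
  have h1 : αs q * α q = 1 - γ q * γs q := by rw [← h.unit₁, h.normal]; abel
  fin_cases i <;> fin_cases j <;>
    simp [mat, qEps, Algebra.algebraMap_eq_smul_one, h.comm₂, h.comm₂s, h1, h2, h.normal] <;> module

theorem mat_col_rel (q : Param) (k l : Fin 2) :
    mat q 0 k * mat q 1 l = qC q • (mat q 1 k * mat q 0 l) + algebraMap ℂ _ (qEps q k l) := by
  have h := quad q
  have h2 : α q * αs q = 1 - qC q ^ 2 • (γ q * γs q) := by rw [← h.unit₂]; abel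
  have h1 : αs q * α q = 1 - γ q * γs q := by rw [← h.unit₁, h.normal]; abel
  fin_cases k <;> fin_cases l <;>
    simp [mat, qEps, Algebra.algebraMap_eq_smul_one, h.comm₁, h.comm₁s, h1, h2, h.normal] <;> module

/-- A closed path of length two, `E(b, b ± 1) E(b ± 1, b)`, where `z = ± q^{± b}`. -/
def loop (q : Param) (z : ℂ) (i j : Fin 2) : OSU q := rowVec q z i * rowVec q (-(qC q * z)⁻¹) j

theorem loop_eq {q : Param} {z : ℂ} (hz : z ≠ 0) (i j : Fin 2) :
    loop q z i j = mat q i 0 * mat q j 0 + (qC q)⁻¹ • (mat q i 1 * mat q j 1) +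
      (Complex.I * (z - z⁻¹)) • (mat q i 1 * mat q j 0) -
      (Complex.I * (qC q * z)⁻¹ * qEps q i j) • 1 := by
  have hI : Complex.I * Complex.I = -1 := Complex.I_mul_I
  have hq := qC_ne_zero q
  simp only [loop, rowVec, add_mul, mul_add, smul_mul_assoc, mul_smul_comm, mat_row_rel,
    Algebra.algebraMap_eq_smul_one]
  match_scalars
  · ring
  · field_simp; ring
  · ring
  · field_simp; linear_combination -hI

theorem one_mem_span_loop {q : Param} {z : ℂ}
    (h : qC q * z + (qC q * z)⁻¹ ≠ 0) : (1 : OSU q) ∈ Submodule.span ℂ (Set.range (loop q z).uncurry) := by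
  have hI : Complex.I * Complex.I = -1 := Complex.I_mul_I
  have key : loop q z 0 1 - qC q • loop q z 1 0 =
      (-Complex.I * (qC q * z + (qC q * z)⁻¹)) • 1 := by
    simp only [loop, rowVec, add_mul, mul_add, smul_mul_assoc, mul_smul_comm, mat_col_rel,
      Algebra.algebraMap_eq_smul_one, qEps]
    simp only [Matrix.of_apply, Matrix.cons_val', Matrix.cons_val_zero, Matrix.cons_val_one,
      Matrix.cons_val_fin_one]
    module
  have hm : loop q z 0 1 - qC q • loop q z 1 0 ∈ Submodule.span ℂ (Set.range (loop q z).uncurry) :=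
    Submodule.sub_mem _ (Submodule.subset_span ⟨(0, 1), rfl⟩)
      (Submodule.smul_mem _ _ (Submodule.subset_span ⟨(1, 0), rfl⟩))
  rw [key] at hm
  have := Submodule.smul_mem _ (-Complex.I * (qC q * z + (qC q * z)⁻¹))⁻¹ hm
  rwa [smul_smul, inv_mul_cancel₀ (mul_ne_zero (neg_ne_zero.mpr Complex.I_ne_zero) h),
    one_smul] at this

theorem rowSpan_mul_rowSpan (q : Param) (z : ℂ) :
    rowSpan q z * rowSpan q (-(qC q * z)⁻¹) = Submodule.span ℂ (Set.range (loop q z).uncurry) := by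
  rw [rowSpan, rowSpan, Submodule.span_mul_span]
  congr 1
  ext x
  simp [Set.mem_mul, loop, Function.uncurry]

/-- Both kinds of closed paths of length two span the same space, because `z - z⁻¹` does not
change under `z ↦ -z⁻¹`, and the constants lie in the span. -/
theorem span_loop_le {q : Param} {z : ℂ} (hz : z ≠ 0) (h : qC q * z + (qC q * z)⁻¹ ≠ 0) :
    Submodule.span ℂ (Set.range (loop q (-z⁻¹)).uncurry) ≤
      Submodule.span ℂ (Set.range (loop q z).uncurry) := by
  rw [Submodule.span_le]
  rintro _ ⟨⟨i, j⟩, rfl⟩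
  have hq := qC_ne_zero q
  have h1 : loop q (-z⁻¹) i j = loop q z i j +
      (Complex.I * (qC q)⁻¹ * (z + z⁻¹) * qEps q i j) • 1 := by
    rw [loop_eq hz, loop_eq (neg_ne_zero.mpr (inv_ne_zero hz))]
    match_scalars
    · ring
    · ring
    · field_simp; ring
    · field_simp; ring
  change loop q (-z⁻¹) i j ∈ _
  rw [h1]
  exact Submodule.add_mem _ (Submodule.subset_span ⟨(i, j), rfl⟩)
    (Submodule.smul_mem _ _ (one_mem_span_loop h))

theorem qC_mul_qpow (q : Param) (b : ℝ) : qC q * qpow q b = qpow q (b + 1) := by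
  rw [qpow_add, qpow_one, mul_comm]

theorem qC_mul_inv_qpow (q : Param) (b : ℝ) : qC q * (qpow q b)⁻¹ = (qpow q (b - 1))⁻¹ := by
  rw [qpow_sub, qpow_one, mul_inv, inv_inv, mul_comm]

theorem loop_up_ne_zero (q : Param) (b : ℝ) :
    qC q * qpow q b + (qC q * qpow q b)⁻¹ ≠ 0 := by
  rw [qC_mul_qpow]
  exact qpow_add_inv_ne_zero q _

theorem loop_down_ne_zero (q : Param) (b : ℝ) :
    qC q * -(qpow q b)⁻¹ + (qC q * -(qpow q b)⁻¹)⁻¹ ≠ 0 := by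
  rw [mul_neg, qC_mul_inv_qpow, inv_neg, inv_inv, ← neg_add, add_comm]
  exact neg_ne_zero.mpr (qpow_add_inv_ne_zero q _)

/-- The span of the closed paths of length two at `b`. -/
def loopSpan (q : Param) (b : ℝ) : Submodule ℂ (OSU q) :=
  Submodule.span ℂ (Set.range (loop q (qpow q b)).uncurry)

theorem up_mul_down (q : Param) (b : ℝ) :
    rowSpan q (qpow q b) * rowSpan q (-(qpow q (b + 1))⁻¹) = loopSpan q b := by
  rw [loopSpan, ← rowSpan_mul_rowSpan, qC_mul_qpow]

theorem down_mul_up (q : Param) (b : ℝ) :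
    rowSpan q (-(qpow q b)⁻¹) * rowSpan q (qpow q (b - 1)) = loopSpan q b := by
  have h1 : rowSpan q (-(qpow q b)⁻¹) * rowSpan q (qpow q (b - 1)) =
      Submodule.span ℂ (Set.range (loop q (-(qpow q b)⁻¹)).uncurry) := by
    rw [← rowSpan_mul_rowSpan, mul_neg, qC_mul_inv_qpow, inv_neg, neg_neg, inv_inv]
  rw [h1, loopSpan]
  apply le_antisymm
  · exact span_loop_le (qpow_ne_zero q b) (loop_up_ne_zero q b)
  · have := span_loop_le (z := -(qpow q b)⁻¹) (neg_ne_zero.mpr (inv_ne_zero (qpow_ne_zero q b)))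
      (loop_down_ne_zero q b)
    rwa [inv_neg, neg_neg, inv_inv] at this

theorem one_mem_loopSpan (q : Param) (b : ℝ) : (1 : OSU q) ∈ loopSpan q b :=
  one_mem_span_loop (loop_up_ne_zero q b)

/-! ### Decomposition of `O_q(SU(2))` and generators of the sphere -/

/-- The subalgebra generated by the closed paths of length two at `a`. -/
def loopAlg (q : Param) (a : ℝ) : Subalgebra ℂ (OSU q) := Algebra.adjoin ℂ (loopSpan q a)

/-- Paths at `a` that go up `n` times after loops. -/
def pathUp (q : Param) (a : ℝ) : ℕ → Submodule ℂ (OSU q)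
  | 0 => Subalgebra.toSubmodule (loopAlg q a)
  | n + 1 => pathUp q a n * rowSpan q (qpow q (a + n))

/-- Paths at `a` that go down `n` times after loops. -/
def pathDown (q : Param) (a : ℝ) : ℕ → Submodule ℂ (OSU q)
  | 0 => Subalgebra.toSubmodule (loopAlg q a)
  | n + 1 => pathDown q a n * rowSpan q (-(qpow q (a - n))⁻¹)

theorem loopAlg_mul_loopSpan (q : Param) (a : ℝ) :
    Subalgebra.toSubmodule (loopAlg q a) * loopSpan q a ≤ Subalgebra.toSubmodule (loopAlg q a) :=
  Submodule.mul_le.mpr fun _ hx _ hy =>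
    (loopAlg q a).mul_mem hx (Algebra.subset_adjoin hy)

/-- A step down after steps up stays among such paths: the last turn is replaced by the opposite one,
which moves the step down to the left until it is part of a loop at `a`. -/
theorem pathUp_mul_down (q : Param) (a : ℝ) (n : ℕ) :
    pathUp q a (n + 1) * rowSpan q (-(qpow q (a + n + 1))⁻¹) ≤ pathUp q a n := by
  induction n with
  | zero =>
    change Subalgebra.toSubmodule (loopAlg q a) * _ * _ ≤ Subalgebra.toSubmodule (loopAlg q a)
    rw [mul_assoc, up_mul_down, Nat.cast_zero, add_zero]
    exact loopAlg_mul_loopSpan q a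
  | succ n ih =>
    rw [pathUp, mul_assoc, up_mul_down, ← down_mul_up, ← mul_assoc]
    have h1 : a + ((n + 1 : ℕ) : ℝ) = a + n + 1 := by push_cast; ring
    rw [h1, add_sub_cancel_right]
    exact mul_le_mul_left ih _

theorem pathDown_mul_up (q : Param) (a : ℝ) (n : ℕ) :
    pathDown q a (n + 1) * rowSpan q (qpow q (a - n - 1)) ≤ pathDown q a n := by
  induction n with
  | zero =>
    change Subalgebra.toSubmodule (loopAlg q a) * _ * _ ≤ Subalgebra.toSubmodule (loopAlg q a)
    rw [mul_assoc, down_mul_up, Nat.cast_zero, sub_zero]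
    exact loopAlg_mul_loopSpan q a
  | succ n ih =>
    rw [pathDown, mul_assoc, down_mul_up, ← up_mul_down, ← mul_assoc]
    have h1 : a - ((n + 1 : ℕ) : ℝ) = a - n - 1 := by push_cast; ring
    rw [h1, sub_add_cancel]
    exact mul_le_mul_left ih _

/-- Paths from `a` to `a + m`. -/
def path (q : Param) (a : ℝ) : ℤ → Submodule ℂ (OSU q)
  | Int.ofNat n => pathUp q a n
  | Int.negSucc n => pathDown q a (n + 1)

theorem path_mul_up (q : Param) (a : ℝ) (m : ℤ) :
    path q a m * rowSpan q (qpow q (a + m)) ≤ path q a (m + 1) := by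
  match m with
  | Int.ofNat n => exact le_of_eq (by simp [path]; rfl)
  | Int.negSucc 0 =>
    have := pathDown_mul_up q a 0
    simpa [path, Int.negSucc_eq, pathUp, pathDown, ← sub_eq_add_neg] using this
  | Int.negSucc (n + 1) =>
    have := pathDown_mul_up q a (n + 1)
    have h1 : a + ((Int.negSucc (n + 1) : ℤ) : ℝ) = a - ((n + 1 : ℕ) : ℝ) - 1 := by
      rw [Int.negSucc_eq]; push_cast; ring
    have h2 : Int.negSucc (n + 1) + 1 = Int.negSucc n := by omega
    rw [h1, h2]
    exact this

theorem path_mul_down (q : Param) (a : ℝ) (m : ℤ) :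
    path q a m * rowSpan q (-(qpow q (a + m))⁻¹) ≤ path q a (m - 1) := by
  match m with
  | Int.ofNat 0 =>
    change Subalgebra.toSubmodule (loopAlg q a) * _ ≤
      Subalgebra.toSubmodule (loopAlg q a) * rowSpan q (-(qpow q (a - (0 : ℕ)))⁻¹)
    simp
  | Int.ofNat (n + 1) =>
    have := pathUp_mul_down q a n
    have h1 : a + ((Int.ofNat (n + 1) : ℤ) : ℝ) = a + n + 1 := by
      simp; ring
    have h2 : Int.ofNat (n + 1) - 1 = Int.ofNat n := by simp
    rw [h1, h2]
    exact this
  | Int.negSucc n =>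
    have h1 : a + ((Int.negSucc n : ℤ) : ℝ) = a - ((n + 1 : ℕ) : ℝ) := by
      rw [Int.negSucc_eq]; push_cast; ring
    have h2 : Int.negSucc n - 1 = Int.negSucc (n + 1) := by omega
    rw [h1, h2]
    exact le_rfl

theorem iSup_path (q : Param) (a : ℝ) : ⨆ m, path q a m = ⊤ := by
  apply OSU.eq_top_of_mul_mat
  · exact Submodule.mem_iSup_of_mem 0 (one_mem (loopAlg q a))
  · intro x hx i j
    induction hx using Submodule.iSup_induction' with
    | zero => rw [zero_mul]; exact Submodule.zero_mem _
    | add x y _ _ hx hy => rw [add_mul]; exact Submodule.add_mem _ hx hy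
    | mem m x hx =>
      have hne : qpow q (a + m) ≠ -(qpow q (a + m))⁻¹ := by
        intro h
        exact qpow_add_inv_ne_zero q (a + m) (by
          nth_rewrite 1 [h]
          exact neg_add_cancel _)
      obtain ⟨y, hy, z, hz, h⟩ := Submodule.mem_sup.mp (mat_mem_rowSpan (q := q) hne i j)
      rw [← h, mul_add]
      exact Submodule.add_mem _
        (Submodule.mem_iSup_of_mem _ (path_mul_up q a m (Submodule.mul_mem_mul hx hy)))
        (Submodule.mem_iSup_of_mem _ (path_mul_down q a m (Submodule.mul_mem_mul hx hz)))

theorem loopSpan_le (q : Param) (a : ℝ) : loopSpan q a ≤ eig q a a := by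
  rw [← up_mul_down]
  refine Submodule.mul_le.mpr fun x hx y hy => mul_mem_eig (rowSpan_up_le q a hx) ?_
  simpa using rowSpan_down_le q _ hy

theorem loopAlg_le (q : Param) (a : ℝ) : Subalgebra.toSubmodule (loopAlg q a) ≤ eig q a a := by
  intro x hx
  replace hx : x ∈ loopAlg q a := hx
  rw [loopAlg] at hx
  induction hx using Algebra.adjoin_induction with
  | mem x hx => exact loopSpan_le q a hx
  | algebraMap z =>
    rw [Algebra.algebraMap_eq_smul_one]
    exact Submodule.smul_mem _ _ (one_mem_eig q a)
  | add x y hx' hy' hx hy => exact Submodule.add_mem _ hx hy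
  | mul x y hx' hy' hx hy => exact mul_mem_eig hx hy

theorem path_le (q : Param) (a : ℝ) (m : ℤ) : path q a m ≤ eig q a (a + m) := by
  have hu : ∀ n : ℕ, pathUp q a n ≤ eig q a (a + n) := by
    intro n
    induction n with
    | zero => simpa [pathUp] using loopAlg_le q a
    | succ n ih =>
      refine Submodule.mul_le.mpr fun x hx y hy => mul_mem_eig (ih hx) ?_
      have := rowSpan_up_le q _ hy
      rwa [add_assoc, ← Nat.cast_succ] at this
  have hd : ∀ n : ℕ, pathDown q a n ≤ eig q a (a - n) := by
    intro n
    induction n with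
    | zero => simpa [pathDown] using loopAlg_le q a
    | succ n ih =>
      refine Submodule.mul_le.mpr fun x hx y hy => mul_mem_eig (ih hx) ?_
      have := rowSpan_down_le q _ hy
      rwa [sub_sub, ← Nat.cast_succ] at this
  match m with
  | Int.ofNat n => exact hu n
  | Int.negSucc n =>
    have := hd (n + 1)
    rw [Int.negSucc_eq]
    push_cast at *
    rwa [← sub_eq_add_neg]

theorem eig_iSupIndep (q : Param) (a : ℝ) : iSupIndep fun m : ℤ => eig q a (a + m) :=
  (Module.End.eigenspaces_iSupIndep (lactEnd (Complex.I • Bt q a))).comp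
    (f := fun m : ℤ => (bracket q (a + m) : ℂ)) fun m n h => by
      have := bracket_inj.mp h
      simpa using this

theorem iSup_eig (q : Param) (a : ℝ) : ⨆ m : ℤ, eig q a (a + m) = ⊤ :=
  top_le_iff.mp ((iSup_path q a).symm.le.trans (iSup_mono (path_le q a)))

theorem path_eq_eig (q : Param) (a : ℝ) (m : ℤ) : path q a m = eig q a (a + m) := by
  refine le_antisymm (path_le q a m) fun x hx => ?_
  have hx' : x ∈ path q a m ⊔ ⨆ n ≠ m, path q a n := by
    have : path q a m ⊔ ⨆ n ≠ m, path q a n = ⊤ := by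
      rw [← iSup_path q a]
      apply le_antisymm
      · exact sup_le (le_iSup _ _) (iSup₂_le fun n _ => le_iSup _ n)
      · refine iSup_le fun n => ?_
        by_cases h : n = m
        · rw [h]; exact le_sup_left
        · exact le_sup_of_le_right (le_iSup₂_of_le n h le_rfl)
    rw [this]; trivial
  obtain ⟨y, hy, z, hz, rfl⟩ := Submodule.mem_sup.mp hx'
  have hz1 : z ∈ eig q a (a + m) := by
    simpa using Submodule.sub_mem _ hx (path_le q a m hy)
  have hz2 : z ∈ ⨆ n ≠ m, eig q a (a + n) := iSup₂_mono (fun n _ => path_le q a n) hz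
  have := (Submodule.disjoint_def.mp (eig_iSupIndep q a m)) z hz1 hz2
  rw [this, add_zero]
  exact hy

/-- The sphere is generated by the closed paths of length two. -/
theorem sphere_eq_loopAlg (q : Param) (a : ℝ) :
    sphere q a = Subalgebra.toSubmodule (loopAlg q a) := by
  rw [sphere_eq_eig]
  have := path_eq_eig q a 0
  simpa [path, pathUp] using this.symm

/-- `1 ∈ E(c, b) E(b, c)` whenever `b` and `c` differ by an integer. -/
theorem one_mem_eig_mul_eig (q : Param) (b : ℝ) (m : ℤ) :
    (1 : OSU q) ∈ eig q (b + m) b * eig q b (b + m) := by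
  have htrans : ∀ {b c d : ℝ}, (1 : OSU q) ∈ eig q c b * eig q b c →
      (1 : OSU q) ∈ eig q d c * eig q c d → (1 : OSU q) ∈ eig q d b * eig q b d := by
    intro b c d h h'
    have h1 : eig q d c * (eig q c b * eig q b c) * eig q c d ≤ eig q d b * eig q b d := by
      rw [← mul_assoc, mul_assoc]
      exact mul_le_mul' (Submodule.mul_le.mpr fun x hx y hy => mul_mem_eig hx hy)
        (Submodule.mul_le.mpr fun x hx y hy => mul_mem_eig hx hy)
    have h2 : eig q d c * 1 * eig q c d ≤ eig q d c * (eig q c b * eig q b c) * eig q c d :=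
      mul_le_mul_left (mul_le_mul_right (Submodule.one_le.mpr h) _) _
    rw [mul_one] at h2
    exact h1 (h2 h')
  have hup : ∀ b : ℝ, (1 : OSU q) ∈ eig q (b + 1) b * eig q b (b + 1) := by
    intro b
    have h := one_mem_loopSpan q (b + 1)
    rw [← down_mul_up] at h
    refine mul_le_mul' (rowSpan_down_le q _ |>.trans ?_) (?_) h
    · rw [add_sub_cancel_right]
    · rw [add_sub_cancel_right]; exact rowSpan_up_le q b
  have hdn : ∀ b : ℝ, (1 : OSU q) ∈ eig q (b - 1) b * eig q b (b - 1) := by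
    intro b
    have h := one_mem_loopSpan q (b - 1)
    rw [← up_mul_down] at h
    refine mul_le_mul' (rowSpan_up_le q _ |>.trans ?_) (?_) h
    · rw [sub_add_cancel]
    · rw [sub_add_cancel]; exact rowSpan_down_le q b
  induction m using Int.induction_on with
  | zero =>
    have := Submodule.mul_mem_mul (one_mem_eig q b) (one_mem_eig q b)
    simpa using this
  | succ n ih =>
    have := htrans ih (hup _)
    push_cast at *
    rwa [add_assoc] at this
  | pred n ih =>
    have := htrans ih (hdn _)
    push_cast at *
    rwa [add_sub_assoc] at this

/-! ### The minimal projections of the stabilizer dual -/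

theorem isCompl_eig (q : Param) (a : ℝ) (m : ℤ) :
    IsCompl (eig q a (a + m)) (⨆ n ≠ m, eig q a (a + n)) where
  disjoint := eig_iSupIndep q a m
  codisjoint := by
    rw [codisjoint_iff_le_sup, ← iSup_eig q a]
    refine iSup_le fun n => ?_
    by_cases h : n = m
    · rw [h]; exact le_sup_left
    · exact le_sup_of_le_right (le_iSup₂_of_le n h le_rfl)

/-- The projection of `O_q(SU(2))` onto the eigenspace of `√-1 B_t` for `[a + m]`. -/
def eigProj (q : Param) (a : ℝ) (m : ℤ) : OSU q →ₗ[ℂ] OSU q :=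
  Submodule.projection _ _ (isCompl_eig q a m)

theorem eigProj_apply_mem (q : Param) (a : ℝ) (m : ℤ) (x : OSU q) :
    eigProj q a m x ∈ eig q a (a + m) :=
  Submodule.projection_apply_mem _ x

theorem eigProj_of_mem {q : Param} {a : ℝ} {n : ℤ} {x : OSU q} (hx : x ∈ eig q a (a + n)) (m : ℤ) :
    eigProj q a m x = if n = m then x else 0 := by
  split_ifs with h
  · subst h
    exact Submodule.projection_apply_of_mem_left _ hx
  · exact (Submodule.projection_apply_eq_zero_iff _).mpr
      ((le_iSup₂_of_le n h le_rfl : eig q a (a + n) ≤ ⨆ n ≠ m, eig q a (a + n)) hx)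

theorem eig_induction {q : Param} (a : ℝ) {P : OSU q → Prop}
    (h : ∀ n : ℤ, ∀ x ∈ eig q a (a + n), P x) (hadd : ∀ x y, P x → P y → P (x + y)) (x : OSU q) :
    P x := by
  have hx : x ∈ ⨆ m : ℤ, eig q a (a + m) := by rw [iSup_eig]; trivial
  induction hx using Submodule.iSup_induction' with
  | mem n x hx => exact h n x hx
  | zero => exact h 0 0 (Submodule.zero_mem _)
  | add x y _ _ hx hy => exact hadd x y hx hy

theorem exists_sum_eigProj {q : Param} (a : ℝ) (x : OSU q) :
    ∃ s : Finset ℤ, ∀ s', s ⊆ s' → ∑ m ∈ s', eigProj q a m x = x := by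
  classical
  induction x using eig_induction a with
  | h n x hx =>
    refine ⟨{n}, fun s' hs => ?_⟩
    simp [eigProj_of_mem hx, Finset.singleton_subset_iff.mp hs]
  | hadd x y hx hy =>
    obtain ⟨s, hs⟩ := hx
    obtain ⟨t, ht⟩ := hy
    refine ⟨s ∪ t, fun s' h => ?_⟩
    simp only [map_add, Finset.sum_add_distrib]
    rw [hs s' (Finset.union_subset_left h), ht s' (Finset.union_subset_right h)]

theorem exists_sum_lTensor_eigProj {q : Param} (a : ℝ) (x : OSU q ⊗[ℂ] OSU q) :
    ∃ s : Finset ℤ, ∀ s', s ⊆ s' → ∑ m ∈ s', (eigProj q a m).lTensor (OSU q) x = x := by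
  classical
  induction x using TensorProduct.induction_on with
  | zero => exact ⟨∅, by simp⟩
  | add x y hx hy =>
    obtain ⟨s, hs⟩ := hx
    obtain ⟨t, ht⟩ := hy
    refine ⟨s ∪ t, fun s' h => ?_⟩
    simp only [map_add, Finset.sum_add_distrib]
    rw [hs s' (Finset.union_subset_left h), ht s' (Finset.union_subset_right h)]
  | tmul x y =>
    obtain ⟨s, hs⟩ := exists_sum_eigProj a y
    refine ⟨s, fun s' h => ?_⟩
    simp only [LinearMap.lTensor_tmul, ← TensorProduct.tmul_sum]
    rw [hs s' h]

/-- The left action of `U` commutes with the left coaction. -/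
theorem comul_lact {q : Param} (ω : U q) (x : OSU q) : Coalgebra.comul (R := ℂ) (lact ω x) =
    (lactEnd ω).lTensor (OSU q) (Coalgebra.comul x) := by
  have aux (y : OSU q ⊗[ℂ] OSU q) : Coalgebra.comul (R := ℂ)
      (TensorProduct.rid ℂ (OSU q) (LinearMap.lTensor (OSU q) ω.ofConv y)) =
      LinearMap.lTensor (OSU q) ((TensorProduct.rid ℂ (OSU q)).toLinearMap ∘ₗ
        LinearMap.lTensor (OSU q) ω.ofConv)
        (TensorProduct.assoc ℂ _ _ _ (LinearMap.rTensor (OSU q) Coalgebra.comul y)) := by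
    induction y using TensorProduct.induction_on with
    | zero => simp
    | add a b ha hb => simp only [map_add, ha, hb]
    | tmul u v =>
      simp only [LinearMap.rTensor_tmul, LinearMap.lTensor_tmul, TensorProduct.rid_tmul, map_smul]
      induction (Coalgebra.comul u : OSU q ⊗[ℂ] OSU q) using TensorProduct.induction_on with
      | zero => simp
      | add a b ha hb => simp only [map_add, TensorProduct.add_tmul, ← ha, ← hb, smul_add]
      | tmul a b => simp
  rw [lact, aux, Coalgebra.coassoc_apply, ← LinearMap.comp_apply, ← LinearMap.lTensor_comp]
  rfl

theorem eigProj_lact {q : Param} (a : ℝ) (m : ℤ) (x : OSU q) :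
    eigProj q a m (lact (Complex.I • Bt q a) x) = (bracket q (a + m) : ℂ) • eigProj q a m x := by
  induction x using eig_induction a with
  | h n x hx =>
    have := Module.End.mem_eigenspace_iff.mp hx
    rw [lactEnd_apply] at this
    rw [this, map_smul, eigProj_of_mem hx]
    split_ifs with h
    · rw [h]
    · simp
  | hadd x y hx hy => rw [lact_add_right, map_add, map_add, hx, hy, smul_add]

/-- The eigenspaces of `√-1 B_t` are left coideals. -/
theorem lTensor_eigProj_comul {q : Param} {a : ℝ} {n : ℤ} {x : OSU q}
    (hx : x ∈ eig q a (a + n)) (m : ℤ) :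
    (eigProj q a m).lTensor (OSU q) (Coalgebra.comul x) =
      if n = m then Coalgebra.comul (R := ℂ) x else 0 := by
  have h0 (k : ℤ) (hk : n ≠ k) :
      (eigProj q a k).lTensor (OSU q) (Coalgebra.comul (R := ℂ) x) = 0 := by
    have h1 : (lactEnd (Complex.I • Bt q a)).lTensor (OSU q) (Coalgebra.comul x) =
        (bracket q (a + n) : ℂ) • Coalgebra.comul (R := ℂ) x := by
      rw [← comul_lact, ← lactEnd_apply, Module.End.mem_eigenspace_iff.mp hx, map_smul]
    have h2 := congrArg ((eigProj q a k).lTensor (OSU q)) h1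
    have h3 : eigProj q a k ∘ₗ lactEnd (Complex.I • Bt q a) =
        (bracket q (a + k) : ℂ) • eigProj q a k := LinearMap.ext (eigProj_lact a k)
    rw [← LinearMap.comp_apply, ← LinearMap.lTensor_comp, h3, LinearMap.lTensor_smul, map_smul,
      LinearMap.smul_apply, ← sub_eq_zero, ← sub_smul, smul_eq_zero] at h2
    refine h2.resolve_left (sub_ne_zero.mpr fun h => hk ?_)
    have := bracket_inj.mp h
    simp only [add_right_inj, Int.cast_inj] at this
    exact this.symm
  split_ifs with h
  · subst h
    obtain ⟨s, hs⟩ := exists_sum_lTensor_eigProj a (Coalgebra.comul (R := ℂ) x)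
    have := hs (insert n s) (Finset.subset_insert _ _)
    rw [Finset.sum_eq_single n] at this
    · exact this
    · intro k _ hk
      exact h0 k hk.symm
    · intro h
      exact absurd (Finset.mem_insert_self _ _) h
  · exact h0 m h

/-- The functional `ε ∘ P_m`, where `P_m` projects onto the eigenspace of `√-1 B_t` for `[a + m]`. It
spans the `m`-th block of the stabilizer dual and is its unit. -/
def blockUnit (q : Param) (a : ℝ) (m : ℤ) : U q := .toConv (Coalgebra.counit ∘ₗ eigProj q a m)

/-- A functional that is a multiple of `ε` on an eigenspace acts there by a scalar. -/
theorem lact_of_eq_counit {q : Param} {a : ℝ} {n : ℤ} {ω : U q} {c : ℂ}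
    (hω : ∀ y ∈ eig q a (a + n), ω.ofConv y = c * Coalgebra.counit (R := ℂ) y) {x : OSU q}
    (hx : x ∈ eig q a (a + n)) : lact ω x = c • x := by
  have h1 := lTensor_eigProj_comul hx n
  rw [if_pos rfl] at h1
  have h2 : ω.ofConv ∘ₗ eigProj q a n = (c • Coalgebra.counit (R := ℂ)) ∘ₗ eigProj q a n :=
    LinearMap.ext fun y => hω _ (eigProj_apply_mem q a n y)
  rw [lact, ← h1, ← LinearMap.comp_apply (LinearMap.lTensor _ _), ← LinearMap.lTensor_comp, h2,
    LinearMap.lTensor_comp, LinearMap.comp_apply, h1, LinearMap.lTensor_smul, LinearMap.smul_apply,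
    Coalgebra.lTensor_counit_comul]
  simp

theorem lact_blockUnit {q : Param} (a : ℝ) (m : ℤ) (x : OSU q) :
    lact (blockUnit q a m) x = eigProj q a m x := by
  induction x using eig_induction a with
  | h n x hx =>
    rw [eigProj_of_mem hx]
    rw [lact_of_eq_counit (c := if n = m then 1 else 0) _ hx]
    · split_ifs <;> simp
    · intro y hy
      change Coalgebra.counit (R := ℂ) (eigProj q a m y) = _
      rw [eigProj_of_mem hy]
      split_ifs <;> simp
  | hadd x y hx hy => rw [lact_add_right, map_add, hx, hy]

theorem blockUnit_mul_self (q : Param) (a : ℝ) (m : ℤ) :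
    blockUnit q a m * blockUnit q a m = blockUnit q a m := by
  refine lact_injective fun x => ?_
  rw [lact_mul, lact_blockUnit, lact_blockUnit, eigProj_of_mem (eigProj_apply_mem q a m x),
    if_pos rfl]

theorem Bt_mul_blockUnit (q : Param) (a : ℝ) (m : ℤ) :
    (Complex.I • Bt q a) * blockUnit q a m = (bracket q (a + m) : ℂ) • blockUnit q a m := by
  refine lact_injective fun x => ?_
  rw [lact_mul, lact_smul _ (blockUnit q a m), lact_blockUnit]
  exact Module.End.mem_eigenspace_iff.mp (eigProj_apply_mem q a m x)

theorem blockUnit_mul_Bt (q : Param) (a : ℝ) (m : ℤ) :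
    blockUnit q a m * (Complex.I • Bt q a) = (bracket q (a + m) : ℂ) • blockUnit q a m := by
  refine lact_injective fun x => ?_
  rw [lact_mul, lact_smul _ (blockUnit q a m), lact_blockUnit, lact_blockUnit, eigProj_lact]

theorem eigProj_mul {q : Param} {a : ℝ} {b : OSU q} (hb : b ∈ sphere q a) (m : ℤ) (x : OSU q) :
    eigProj q a m (b * x) = b * eigProj q a m x := by
  induction x using eig_induction a with
  | h n x hx =>
    rw [eigProj_of_mem hx, eigProj_of_mem (mul_mem_eig (mem_sphere_iff.mp hb) hx), mul_ite, mul_zero]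
  | hadd x y hx hy => rw [mul_add, map_add, map_add, hx, hy, mul_add]

theorem mem_weightSpace_iff {q : Param} {a : ℝ} {m : ℤ} {ω : U q} : ω ∈ weightSpace q a m ↔
    ω ∈ stabilizerDual q a ∧ (Complex.I • Bt q a) * ω = (bracket q (a + m) : ℂ) • ω := by
  rw [weightSpace, Submodule.mem_inf, LinearMap.mem_ker, LinearMap.mulLeft_apply, sub_mul,
    sub_eq_zero, Algebra.smul_def (bracket q (a + m) : ℂ) ω]

theorem blockUnit_mem (q : Param) (a : ℝ) (m : ℤ) : blockUnit q a m ∈ weightSpace q a m := by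
  refine mem_weightSpace_iff.mpr ⟨fun b hb h x => ?_, Bt_mul_blockUnit q a m⟩
  change Coalgebra.counit (R := ℂ) (eigProj q a m (b * x)) = 0
  rw [eigProj_mul hb, counit_mul, h, zero_mul]

theorem one_mem_sphere' (q : Param) (a : ℝ) : (1 : OSU q) ∈ sphere q a :=
  mem_sphere_iff.mpr (one_mem_eig q a)

theorem stabilizerDual_mul {q : Param} {a : ℝ} {ω : U q} (hω : ω ∈ stabilizerDual q a) {b : OSU q}
    (hb : b ∈ sphere q a) (x : OSU q) :
    ω.ofConv (b * x) = Coalgebra.counit (R := ℂ) b * ω.ofConv x := by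
  have h := hω (b - Coalgebra.counit (R := ℂ) b • 1)
    (Submodule.sub_mem _ hb (Submodule.smul_mem _ _ (one_mem_sphere' q a))) (by simp) x
  rw [sub_mul, smul_mul_assoc, one_mul, map_sub, map_smul, sub_eq_zero] at h
  simpa using h

/-- The fibre of each eigenspace at `ε` is a line: since `1 ∈ E(a + n, a) E(a, a + n)`, every
`x ∈ E(a, a + n)` is a combination `∑ (x v) z` with `x v` in the sphere. -/
theorem stabilizerDual_eq_counit {q : Param} {a : ℝ} {ω : U q} (hω : ω ∈ stabilizerDual q a)
    (n : ℤ) : ∃ c : ℂ, ∀ x ∈ eig q a (a + n), ω.ofConv x = c * Coalgebra.counit (R := ℂ) x := by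
  have key : ∀ y ∈ eig q (a + n) a * eig q a (a + n), ∃ c : ℂ, ∀ x ∈ eig q a (a + n),
      ω.ofConv (x * y) = c * Coalgebra.counit (R := ℂ) x := by
    intro y hy
    induction hy using Submodule.mul_induction_on' with
    | mem_mul_mem v hv z _ =>
      refine ⟨Coalgebra.counit (R := ℂ) v * ω.ofConv z, fun x hx => ?_⟩
      rw [← mul_assoc, stabilizerDual_mul hω (mem_sphere_iff.mpr (mul_mem_eig hx hv)), counit_mul]
      ring
    | add y _ y' _ hy hy' =>
      obtain ⟨c, hc⟩ := hy
      obtain ⟨c', hc'⟩ := hy'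
      refine ⟨c + c', fun x hx => ?_⟩
      rw [mul_add, map_add, hc x hx, hc' x hx, add_mul]
  obtain ⟨c, hc⟩ := key 1 (one_mem_eig_mul_eig q a n)
  exact ⟨c, fun x hx => by simpa using hc x hx⟩

theorem eq_smul_blockUnit {q : Param} {a : ℝ} {m : ℤ} {ω : U q} (hω : ω ∈ weightSpace q a m) :
    ∃ c : ℂ, ω = c • blockUnit q a m := by
  obtain ⟨h1, h2⟩ := mem_weightSpace_iff.mp hω
  obtain ⟨c, hc⟩ := stabilizerDual_eq_counit h1 m
  refine ⟨c, WithConv.ofConv_injective (LinearMap.ext fun x => ?_)⟩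
  change ω.ofConv x = c * Coalgebra.counit (R := ℂ) (eigProj q a m x)
  induction x using eig_induction a with
  | h n x hx =>
    rw [eigProj_of_mem hx]
    split_ifs with h
    · subst h; exact hc x hx
    · obtain ⟨d, hd⟩ := stabilizerDual_eq_counit h1 n
      have h3 : ((Complex.I • Bt q a) * ω).ofConv x = (bracket q (a + n) : ℂ) * ω.ofConv x := by
        rw [← counit_lact, lact_mul, lact_of_eq_counit hd hx, lact_smul_right, map_smul, hd x hx]
        have := Module.End.mem_eigenspace_iff.mp hx
        rw [lactEnd_apply] at this
        rw [this, map_smul, smul_eq_mul, smul_eq_mul]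
        ring
      rw [h2] at h3
      have h4 : (bracket q (a + m) : ℂ) * ω.ofConv x = bracket q (a + n) * ω.ofConv x := h3
      rcases mul_eq_mul_right_iff.mp h4 with h5 | h5
      · have := bracket_inj.mp h5
        simp only [add_right_inj, Int.cast_inj] at this
        exact absurd this.symm h
      · simpa using h5
  | hadd x y hx hy => simp only [map_add, hx, hy, mul_add]

theorem IsWeightProj.eq_blockUnit {q : Param} {a : ℝ} {m : ℤ} {Φ : Ic q a}
    (h : IsWeightProj q a m Φ) : (Φ : U q) = blockUnit q a m := by
  obtain ⟨c, hc⟩ := eq_smul_blockUnit h.mem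
  have h0 : (Φ : U q) ≠ 0 := fun h' => h.ne_zero (Subtype.ext h')
  have h1 := h.idem
  rw [hc, smul_mul_smul_comm, blockUnit_mul_self] at h1
  have h2 : blockUnit q a m ≠ 0 := by
    rintro h'
    rw [h', smul_zero] at hc
    exact h0 hc
  have h3 : c ≠ 0 := by
    rintro rfl
    exact h0 (by rw [hc, zero_smul])
  have h4 := smul_left_injective ℂ h2 h1
  rw [hc, mul_right_cancel₀ h3 (h4.trans (one_mul c).symm), one_smul]

theorem blockUnit_mem_Ic (q : Param) (a : ℝ) (m : ℤ) : blockUnit q a m ∈ Ic q a :=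
  Submodule.mem_iSup_of_mem m (blockUnit_mem q a m)

theorem Ic_induction {q : Param} {a : ℝ} {P : U q → Prop}
    (h : ∀ m, P (blockUnit q a m)) (h0 : P 0) (hadd : ∀ x y, P x → P y → P (x + y))
    (hsmul : ∀ (z : ℂ) x, P x → P (z • x)) {ω : U q} (hω : ω ∈ Ic q a) : P ω := by
  rw [Ic] at hω
  induction hω using Submodule.iSup_induction' with
  | mem m x hx =>
    obtain ⟨c, rfl⟩ := eq_smul_blockUnit hx
    exact hsmul c _ (h m)
  | zero => exact h0
  | add x y _ _ hx hy => exact hadd x y hx hy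

/-! ### The inverse of the antipode -/

theorem SInv_mul (q : Param) (x y : OSU q) : SInv q (x * y) = SInv q y * SInv q x :=
  congrArg MulOpposite.unop (map_mul (OSU.lift (antipode_quad q (inv_ne_zero (qC_ne_zero q)))) x y)

theorem SInv_add (q : Param) (x y : OSU q) : SInv q (x + y) = SInv q x + SInv q y :=
  congrArg MulOpposite.unop (map_add (OSU.lift (antipode_quad q (inv_ne_zero (qC_ne_zero q)))) x y)

theorem SInv_smul (q : Param) (z : ℂ) (x : OSU q) : SInv q (z • x) = z • SInv q x :=
  congrArg MulOpposite.unop (map_smul (OSU.lift (antipode_quad q (inv_ne_zero (qC_ne_zero q)))) z x)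

theorem SInv_one (q : Param) : SInv q 1 = 1 :=
  congrArg MulOpposite.unop (map_one (OSU.lift (antipode_quad q (inv_ne_zero (qC_ne_zero q)))))

theorem SInv_mat (q : Param) (i j : Fin 2) : SInv q (mat q i j) =
    !![mat q 1 1, -(qC q • mat q 0 1); -((qC q)⁻¹ • mat q 1 0), mat q 0 0] i j := by
  have h : ∀ g, SInv q (gen q g) = (assign (R := (OSU q)ᵐᵒᵖ) (.op (αs q)) (.op (α q))
      (.op (-(qC q)⁻¹ • γ q)) (.op (-(qC q)⁻¹⁻¹ • γs q)) g).unop := fun g =>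
    congrArg MulOpposite.unop (lift_gen (antipode_quad q (inv_ne_zero (qC_ne_zero q))) g)
  fin_cases i <;> fin_cases j
  · exact h Gen.α
  · change SInv q (-(qC q • γs q)) = _
    rw [← neg_smul, SInv_smul, h]
    simp [assign, mat, smul_smul]
  · exact (h Gen.γ).trans (by simp [assign, mat])
  · exact h Gen.αs

/-- `SInv` as a linear map. -/
def SInvL (q : Param) : OSU q →ₗ[ℂ] OSU q where
  toFun := SInv q
  map_add' := SInv_add q
  map_smul' := SInv_smul q

@[simp] theorem SInvL_apply (q : Param) (x : OSU q) : SInvL q x = SInv q x := rfl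

/-! ### The representation of the Drinfeld double on `O_q(SU(2))` -/

/-- The iterated coproduct `x ↦ x₁ ⊗ (x₂ ⊗ x₃)`. -/
def comul₂ (q : Param) : OSU q →ₐ[ℂ] OSU q ⊗[ℂ] (OSU q ⊗[ℂ] OSU q) :=
  (Algebra.TensorProduct.map (AlgHom.id ℂ _) (Bialgebra.comulAlgHom ℂ (OSU q))).comp
    (Bialgebra.comulAlgHom ℂ (OSU q))

theorem comul₂_apply (q : Param) (x : OSU q) :
    comul₂ q x = LinearMap.lTensor (OSU q) Coalgebra.comul (Coalgebra.comul (R := ℂ) x) := rfl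

/-- The linear map `x₁ ⊗ (x₂ ⊗ x₃) ↦ x₂ ω(x₃ S⁻¹(x₁))`. -/
def adjForm {q : Param} (ω : U q) : OSU q ⊗[ℂ] (OSU q ⊗[ℂ] OSU q) →ₗ[ℂ] OSU q :=
  TensorProduct.lift
    { toFun := fun x => (TensorProduct.rid ℂ (OSU q)).toLinearMap ∘ₗ
        LinearMap.lTensor (OSU q) (ω.ofConv ∘ₗ LinearMap.mulRight ℂ (SInv q x))
      map_add' := by
        intro x y
        rw [SInv_add, ← LinearMap.comp_add, ← LinearMap.lTensor_add, ← LinearMap.comp_add]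
        congr 3
        ext z; simp [mul_add]
      map_smul' := by
        intro z x
        rw [SInv_smul, RingHom.id_apply, ← LinearMap.comp_smul, ← LinearMap.lTensor_smul]
        congr 2
        ext z; simp }

theorem adjForm_tmul {q : Param} (ω : U q) (x y z : OSU q) :
    adjForm ω (x ⊗ₜ (y ⊗ₜ z)) = ω.ofConv (z * SInv q x) • y := by
  simp [adjForm]

theorem adjForm_twist {q : Param} (ω : U q) (x₁ x₂ x₃ : OSU q)
    (y : OSU q ⊗[ℂ] (OSU q ⊗[ℂ] OSU q)) :
    adjForm ω ((x₁ ⊗ₜ (x₂ ⊗ₜ x₃)) * y) = x₂ * adjForm (twist x₃ (SInv q x₁) ω) y := by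
  induction y using TensorProduct.induction_on with
  | zero => simp
  | add a b ha hb => simp only [mul_add, map_add, ha, hb]
  | tmul y₁ y' =>
    induction y' using TensorProduct.induction_on with
    | zero => simp
    | add a b ha hb => simp only [TensorProduct.tmul_add, mul_add, map_add, ha, hb]
    | tmul y₂ y₃ =>
      simp only [Algebra.TensorProduct.tmul_mul_tmul, adjForm_tmul, SInv_mul, mul_smul_comm, twist,
        LinearMap.comp_apply, LinearMap.mulLeft_apply, LinearMap.mulRight_apply, mul_assoc]

theorem adjForm_add {q : Param} (ω ν : U q) : adjForm (ω + ν) = adjForm ω + adjForm ν := by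
  apply TensorProduct.ext'
  intro x y
  induction y using TensorProduct.induction_on with
  | zero => simp
  | add a b ha hb => rw [TensorProduct.tmul_add, map_add, map_add, ha, hb]
  | tmul y z => simp [adjForm_tmul, add_smul]

theorem adjForm_smul {q : Param} (z : ℂ) (ω : U q) : adjForm (z • ω) = z • adjForm ω := by
  apply TensorProduct.ext'
  intro x y
  induction y using TensorProduct.induction_on with
  | zero => simp
  | add a b ha hb => rw [TensorProduct.tmul_add, map_add, map_add, ha, hb]
  | tmul y z => simp [adjForm_tmul, smul_smul]

/-- The action `ω · x = x₂ ω(x₃ S⁻¹(x₁))` of `U` on `O_q(SU(2))`. -/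
def adjAct {q : Param} (ω : U q) : Module.End ℂ (OSU q) := adjForm ω ∘ₗ (comul₂ q).toLinearMap

theorem adjAct_apply {q : Param} (ω : U q) (x : OSU q) : adjAct ω x = adjForm ω (comul₂ q x) := rfl

theorem adjAct_mul_right {q : Param} (ω : U q) {x : OSU q} {n : ℕ} {x₁ x₂ x₃ : Fin n → OSU q}
    (h : comul₂ q x = ∑ i, x₁ i ⊗ₜ[ℂ] (x₂ i ⊗ₜ[ℂ] x₃ i)) (y : OSU q) :
    adjAct ω (x * y) = ∑ i, x₂ i * adjAct (twist (x₃ i) (SInv q (x₁ i)) ω) y := by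
  rw [adjAct_apply, map_mul, h, Finset.sum_mul, map_sum]
  exact Finset.sum_congr rfl fun i _ => adjForm_twist ..

/-- `Δ(S⁻¹(x)) = S⁻¹(x₂) ⊗ S⁻¹(x₁)`. -/
theorem comul_SInv (q : Param) (x : OSU q) : Coalgebra.comul (R := ℂ) (SInv q x) =
    TensorProduct.map (SInvL q) (SInvL q) (TensorProduct.comm ℂ _ _ (Coalgebra.comul x)) := by
  have hmul : ∀ s t : OSU q ⊗[ℂ] OSU q,
      TensorProduct.map (SInvL q) (SInvL q) (TensorProduct.comm ℂ _ _ (s * t)) =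
      TensorProduct.map (SInvL q) (SInvL q) (TensorProduct.comm ℂ _ _ t) *
      TensorProduct.map (SInvL q) (SInvL q) (TensorProduct.comm ℂ _ _ s) := by
    intro s t
    induction s using TensorProduct.induction_on with
    | zero => simp
    | add a b ha hb => simp only [add_mul, mul_add, map_add, ha, hb]
    | tmul s s' =>
      induction t using TensorProduct.induction_on with
      | zero => simp
      | add a b ha hb => simp only [add_mul, mul_add, map_add, ha, hb]
      | tmul t t' => simp [SInv_mul]
  induction x using OSU.induction with
  | hc z =>
    simp [Algebra.algebraMap_eq_smul_one, Algebra.TensorProduct.one_def, SInv_one, SInv_smul]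
  | hg g =>
    obtain ⟨z, i, j, h⟩ := gen_mem_mat q g
    have hq := qC_ne_zero q
    rw [h, SInv_smul, map_smul, map_smul, map_smul, map_smul]
    congr 1
    rw [comul_mat]
    simp only [Fin.sum_univ_two, map_add, TensorProduct.comm_tmul, TensorProduct.map_tmul,
      SInvL_apply, SInv_mat]
    fin_cases i <;> fin_cases j <;>
      simp [comul_mat, Fin.sum_univ_two, TensorProduct.tmul_neg, TensorProduct.neg_tmul,
        TensorProduct.tmul_smul, ← TensorProduct.smul_tmul', smul_smul, hq] <;> abel
  | hm x y hx hy => rw [SInv_mul, Bialgebra.comul_mul, Bialgebra.comul_mul, hmul, hx, hy]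
  | ha x y hx hy => simp only [SInv_add, map_add, hx, hy]

theorem counit_SInv (q : Param) (x : OSU q) :
    Coalgebra.counit (R := ℂ) (SInv q x) = Coalgebra.counit (R := ℂ) x := by
  induction x using OSU.induction with
  | hc z => simp [Algebra.algebraMap_eq_smul_one, SInv_one, SInv_smul]
  | hg g =>
    obtain ⟨z, i, j, h⟩ := gen_mem_mat q g
    have hc : ∀ i j, Coalgebra.counit (R := ℂ) (mat q i j) = if i = j then 1 else 0 := by
      intro i j
      change counitHom q _ = _
      unfold counitHom
      fin_cases i <;> fin_cases j <;> simp [mat, assign]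
    rw [h, SInv_smul, map_smul, map_smul, SInv_mat]
    fin_cases i <;> fin_cases j <;> simp [hc]
  | hm x y hx hy => rw [SInv_mul, counit_mul, counit_mul, hx, hy, mul_comm]
  | ha x y hx hy => rw [SInv_add, map_add, map_add, hx, hy]

theorem adjAct_one (q : Param) : adjAct (1 : U q) = 1 := by
  refine LinearMap.ext fun x => ?_
  have h1 : adjForm (1 : U q) = (TensorProduct.lid ℂ (OSU q)).toLinearMap ∘ₗ
      TensorProduct.map Coalgebra.counit
        ((TensorProduct.rid ℂ (OSU q)).toLinearMap ∘ₗ LinearMap.lTensor _ Coalgebra.counit) := by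
    apply TensorProduct.ext'
    intro x y
    induction y using TensorProduct.induction_on with
    | zero => simp
    | add a b ha hb => rw [TensorProduct.tmul_add, map_add, map_add, ha, hb]
    | tmul y z => simp [adjForm_tmul, one_ofConv, counit_SInv, smul_smul, mul_comm]
  have h2 : ((TensorProduct.rid ℂ (OSU q)).toLinearMap ∘ₗ
      LinearMap.lTensor (OSU q) Coalgebra.counit) ∘ₗ Coalgebra.comul (R := ℂ) = LinearMap.id := by
    ext y
    simp
  rw [adjAct_apply, comul₂_apply, h1, LinearMap.comp_apply, ← LinearMap.comp_apply
    (TensorProduct.map _ _), LinearMap.map_comp_lTensor, h2]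
  have := Coalgebra.rTensor_counit_comul (R := ℂ) x
  rw [LinearMap.rTensor] at this
  rw [this]
  simp

theorem comul₂_mat (q : Param) (i j : Fin 2) : comul₂ q (mat q i j) =
    ∑ k, ∑ l, mat q i k ⊗ₜ[ℂ] (mat q k l ⊗ₜ[ℂ] mat q l j) := by
  rw [comul₂_apply, comul_mat]
  simp only [map_sum, LinearMap.lTensor_tmul, comul_mat, TensorProduct.tmul_sum]

theorem adjAct_mat_mul {q : Param} (ω : U q) (i j : Fin 2) (y : OSU q) :
    adjAct ω (mat q i j * y) =
      ∑ k, ∑ l, mat q k l * adjAct (twist (mat q l j) (SInv q (mat q i k)) ω) y := by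
  rw [adjAct_apply, map_mul, comul₂_mat, Finset.sum_mul, map_sum]
  refine Finset.sum_congr rfl fun k _ => ?_
  rw [Finset.sum_mul, map_sum]
  exact Finset.sum_congr rfl fun l _ => adjForm_twist ..

theorem adjAct_add {q : Param} (ω ν : U q) : adjAct (ω + ν) = adjAct ω + adjAct ν := by
  rw [adjAct, adjForm_add, LinearMap.add_comp]; rfl

theorem adjAct_smul {q : Param} (z : ℂ) (ω : U q) : adjAct (z • ω) = z • adjAct ω := by
  rw [adjAct, adjForm_smul, LinearMap.smul_comp]; rfl

/-- `ω ↦ adjAct ω` as a linear map. -/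
def adjActL (q : Param) : U q →ₗ[ℂ] Module.End ℂ (OSU q) where
  toFun := adjAct
  map_add' := adjAct_add
  map_smul' := adjAct_smul

theorem adjAct_sum {q : Param} {ι : Type*} (s : Finset ι) (ω : ι → U q) :
    adjAct (∑ i ∈ s, ω i) = ∑ i ∈ s, adjAct (ω i) :=
  map_sum (adjActL q) ω s

theorem adjAct_apply_one {q : Param} (ω : U q) : adjAct ω 1 = ω.ofConv 1 • 1 := by
  rw [adjAct_apply, map_one, Algebra.TensorProduct.one_def, Algebra.TensorProduct.one_def,
    adjForm_tmul, SInv_one, mul_one]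

theorem twist_mul {q : Param} (ω ν : U q) (i j k l : Fin 2) :
    twist (mat q l j) (SInv q (mat q i k)) (ω * ν) =
      ∑ p, ∑ r, twist (mat q l p) (SInv q (mat q r k)) ω *
        twist (mat q p j) (SInv q (mat q i r)) ν := by
  refine WithConv.ofConv_injective (LinearMap.ext fun z => ?_)
  have aux (t : OSU q ⊗[ℂ] OSU q) : LinearMap.mul' ℂ ℂ (TensorProduct.map ω.ofConv ν.ofConv
      ((∑ p, mat q l p ⊗ₜ[ℂ] mat q p j) * (t * ∑ r, SInv q (mat q r k) ⊗ₜ[ℂ] SInv q (mat q i r)))) =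
      ∑ p, ∑ r, LinearMap.mul' ℂ ℂ (TensorProduct.map
        (twist (mat q l p) (SInv q (mat q r k)) ω).ofConv
        (twist (mat q p j) (SInv q (mat q i r)) ν).ofConv t) := by
    induction t using TensorProduct.induction_on with
    | zero => simp
    | add a b ha hb => simp only [add_mul, mul_add, map_add, ha, hb, Finset.sum_add_distrib]
    | tmul a b =>
      simp only [Finset.mul_sum, Finset.sum_mul, map_sum, Algebra.TensorProduct.tmul_mul_tmul,
        TensorProduct.map_tmul, LinearMap.mul'_apply, twist, LinearMap.comp_apply,
        LinearMap.mulLeft_apply, LinearMap.mulRight_apply]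
      exact Finset.sum_comm
  have h1 : Coalgebra.comul (R := ℂ) (mat q l j * (z * SInv q (mat q i k))) =
      (∑ p, mat q l p ⊗ₜ[ℂ] mat q p j) * (Coalgebra.comul (R := ℂ) z *
        ∑ r, SInv q (mat q r k) ⊗ₜ[ℂ] SInv q (mat q i r)) := by
    rw [Bialgebra.comul_mul, Bialgebra.comul_mul, comul_SInv, comul_mat, comul_mat]
    simp only [map_sum, TensorProduct.comm_tmul, TensorProduct.map_tmul, SInvL_apply]
  have h2 : (twist (mat q l j) (SInv q (mat q i k)) (ω * ν)).ofConv z =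
      LinearMap.mul' ℂ ℂ (TensorProduct.map ω.ofConv ν.ofConv
        (Coalgebra.comul (R := ℂ) (mat q l j * (z * SInv q (mat q i k))))) := rfl
  rw [h2, h1, aux]
  simp only [WithConv.ofConv_sum, LinearMap.sum_apply]
  rfl

theorem adjAct_mul {q : Param} (ω ν : U q) : adjAct (ω * ν) = adjAct ω * adjAct ν := by
  have key : ∀ x y : OSU q, (∀ ω ν : U q, adjAct (ω * ν) y = adjAct ω (adjAct ν y)) →
      ∀ ω ν : U q, adjAct (ω * ν) (x * y) = adjAct ω (adjAct ν (x * y)) := by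
    intro x
    induction x using OSU.induction with
    | hc z =>
      intro y h ω ν
      simp only [Algebra.algebraMap_eq_smul_one, smul_mul_assoc, one_mul, map_smul, h]
    | hg g =>
      obtain ⟨z, i, j, hg⟩ := gen_mem_mat q g
      intro y h ω ν
      simp only [hg, smul_mul_assoc, map_smul]
      congr 1
      simp only [adjAct_mat_mul, map_sum, twist_mul, adjAct_sum, LinearMap.sum_apply, h,
        Finset.mul_sum]
      simp only [Fin.sum_univ_two]
      abel
    | hm x x' hx hx' =>
      intro y h
      simp only [mul_assoc]
      exact hx _ (hx' _ h)
    | ha x x' hx hx' =>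
      intro y h ω ν
      simp only [add_mul, map_add, hx y h, hx' y h]
  refine LinearMap.ext fun x => ?_
  have := key x 1 (fun ω ν => by
    have h1 : (ω * ν).ofConv 1 = ω.ofConv 1 * ν.ofConv 1 := by
      simp [LinearMap.convMul_def, Algebra.TensorProduct.one_def]
    simp only [adjAct_apply_one, map_smul, smul_smul, h1, mul_comm]) ω ν
  simpa using this

theorem doubleRel_adjAct {q : Param} ⦃x y : FreeAlgebra ℂ (OSU q ⊕ U q)⦄ (h : DoubleRel q x y) :
    FreeAlgebra.lift ℂ (Sum.elim (LinearMap.mulLeft ℂ) adjAct : _ → Module.End ℂ (OSU q)) x =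
      FreeAlgebra.lift ℂ (Sum.elim (LinearMap.mulLeft ℂ) adjAct : _ → Module.End ℂ (OSU q)) y := by
  cases h with
  | fun_add x y => ext; simp [add_mul]
  | fun_smul z x => ext; simp
  | fun_mul x y => ext; simp
  | fun_one => ext; simp
  | dual_add ω ν => simp [adjAct_add]
  | dual_smul z ω => simp [adjAct_smul]
  | dual_mul ω ν => simp [adjAct_mul]
  | dual_one => simp [adjAct_one]
  | cross ω x n x₁ x₂ x₃ h =>
    ext y
    simp [adjAct_mul_right ω h y]

/-- The representation of the Drinfeld double on `O_q(SU(2))` induced from the trivial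
representation of `U`: functions act by multiplication, functionals by `ω · x = x₂ ω(x₃ S⁻¹(x₁))`. -/
def indRep (q : Param) : Double q →ₐ[ℂ] Module.End ℂ (OSU q) :=
  RingQuot.liftAlgHom ℂ ⟨FreeAlgebra.lift ℂ (Sum.elim (LinearMap.mulLeft ℂ) adjAct),
    doubleRel_adjAct⟩

theorem indRep_ofFun {q : Param} (x y : OSU q) : indRep q (Double.ofFun q x) y = x * y := by
  have : indRep q (Double.ofFun q x) = LinearMap.mulLeft ℂ x :=
    (RingQuot.liftAlgHom_mkAlgHom_apply ..).trans (FreeAlgebra.lift_ι_apply ..)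
  rw [this]; rfl

theorem indRep_ofDual {q : Param} (ω : U q) : indRep q (Double.ofDual q ω) = adjAct ω :=
  (RingQuot.liftAlgHom_mkAlgHom_apply ..).trans (FreeAlgebra.lift_ι_apply ..)

/-! ### Relations in the Drinfeld double -/

namespace Double

theorem mk_eq {q : Param} {x y} (h : DoubleRel q x y) : Double.mk q x = Double.mk q y :=
  RingQuot.mkAlgHom_rel ℂ h

theorem ofFun_add {q : Param} (x y : OSU q) : ofFun q (x + y) = ofFun q x + ofFun q y :=
  (mk_eq (.fun_add x y)).trans (map_add ..)
theorem ofFun_smul {q : Param} (z : ℂ) (x : OSU q) : ofFun q (z • x) = z • ofFun q x :=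
  (mk_eq (.fun_smul z x)).trans (map_smul ..)
theorem ofFun_mul {q : Param} (x y : OSU q) : ofFun q (x * y) = ofFun q x * ofFun q y :=
  (mk_eq (.fun_mul x y)).trans (map_mul ..)
theorem ofFun_one {q : Param} : ofFun q 1 = 1 := (mk_eq .fun_one).trans (map_one _)
theorem ofDual_add {q : Param} (x y : U q) : ofDual q (x + y) = ofDual q x + ofDual q y :=
  (mk_eq (.dual_add x y)).trans (map_add ..)
theorem ofDual_smul {q : Param} (z : ℂ) (x : U q) : ofDual q (z • x) = z • ofDual q x :=
  (mk_eq (.dual_smul z x)).trans (map_smul ..)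
theorem ofDual_mul {q : Param} (x y : U q) : ofDual q (x * y) = ofDual q x * ofDual q y :=
  (mk_eq (.dual_mul x y)).trans (map_mul ..)
theorem ofDual_one {q : Param} : ofDual q 1 = 1 := (mk_eq .dual_one).trans (map_one _)

/-- The embedding of `O_q(SU(2))` as an algebra homomorphism. -/
def funHom (q : Param) : OSU q →ₐ[ℂ] Double q :=
  AlgHom.ofLinearMap { toFun := ofFun q, map_add' := ofFun_add, map_smul' := ofFun_smul }
    ofFun_one ofFun_mul

/-- The embedding of `U` as an algebra homomorphism. -/
def dualHom (q : Param) : U q →ₐ[ℂ] Double q :=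
  AlgHom.ofLinearMap { toFun := ofDual q, map_add' := ofDual_add, map_smul' := ofDual_smul }
    ofDual_one ofDual_mul

theorem funHom_apply {q : Param} (x : OSU q) : funHom q x = ofFun q x := rfl

theorem cross {q : Param} (ω : U q) {x : OSU q} {n : ℕ} {x₁ x₂ x₃ : Fin n → OSU q}
    (h : comul₂ q x = ∑ i, x₁ i ⊗ₜ[ℂ] (x₂ i ⊗ₜ[ℂ] x₃ i)) :
    ofDual q ω * ofFun q x = ∑ i, ofFun q (x₂ i) * ofDual q (twist (x₃ i) (SInv q (x₁ i)) ω) := by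
  have := mk_eq (.cross ω x n x₁ x₂ x₃ h)
  simp only [map_mul, map_sum] at this
  exact this

end Double

/-! ### Generators of the sphere and their relations -/

theorem alpha_gamma (q : Param) : α q * γ q = qC q • (γ q * α q) := (quad q).comm₁
theorem alpha_gammaS (q : Param) : α q * γs q = qC q • (γs q * α q) := (quad q).comm₂
theorem alphaS_gamma (q : Param) : αs q * γ q = (qC q)⁻¹ • (γ q * αs q) := by
  rw [(quad q).comm₂s, smul_smul, inv_mul_cancel₀ (qC_ne_zero q), one_smul]
theorem alphaS_gammaS (q : Param) : αs q * γs q = (qC q)⁻¹ • (γs q * αs q) := by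
  rw [(quad q).comm₁s, smul_smul, inv_mul_cancel₀ (qC_ne_zero q), one_smul]
theorem alphaS_alpha (q : Param) : αs q * α q = 1 - γ q * γs q := by
  rw [← (quad q).unit₁, (quad q).normal]; abel
theorem alpha_alphaS (q : Param) : α q * αs q = 1 - qC q ^ 2 • (γ q * γs q) := by
  rw [← (quad q).unit₂]; abel

section Reassociated
variable (q : Param) (x : OSU q)

theorem alpha_gamma_mul : α q * (γ q * x) = qC q • (γ q * (α q * x)) := by
  rw [← mul_assoc, alpha_gamma, smul_mul_assoc, mul_assoc]
theorem alpha_gammaS_mul : α q * (γs q * x) = qC q • (γs q * (α q * x)) := by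
  rw [← mul_assoc, alpha_gammaS, smul_mul_assoc, mul_assoc]
theorem alphaS_gamma_mul : αs q * (γ q * x) = (qC q)⁻¹ • (γ q * (αs q * x)) := by
  rw [← mul_assoc, alphaS_gamma, smul_mul_assoc, mul_assoc]
theorem alphaS_gammaS_mul : αs q * (γs q * x) = (qC q)⁻¹ • (γs q * (αs q * x)) := by
  rw [← mul_assoc, alphaS_gammaS, smul_mul_assoc, mul_assoc]
theorem gammaS_gamma_mul : γs q * (γ q * x) = γ q * (γs q * x) := by
  rw [← mul_assoc, (quad q).normal, mul_assoc]
theorem alphaS_alpha_mul : αs q * (α q * x) = x - γ q * (γs q * x) := by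
  rw [← mul_assoc, alphaS_alpha, sub_mul, one_mul, mul_assoc]
theorem alpha_alphaS_mul : α q * (αs q * x) = x - qC q ^ 2 • (γ q * (γs q * x)) := by
  rw [← mul_assoc, alpha_alphaS, sub_mul, one_mul, smul_mul_assoc, mul_assoc]

end Reassociated

/-- The combination `u i 0 u j 0 + q⁻¹ u i 1 u j 1 + √-1 t u i 1 u j 0`, which differs from
`loop q (q^a) i j` by a constant. -/
def sphH (q : Param) (a : ℝ) (i j : Fin 2) : OSU q :=
  mat q i 0 * mat q j 0 + (qC q)⁻¹ • (mat q i 1 * mat q j 1) +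
    (Complex.I * dbracket q a) • (mat q i 1 * mat q j 0)

/-- The generator `X` of the sphere. -/
def sphX (q : Param) (a : ℝ) : OSU q :=
  α q * α q + qC q • (γs q * γs q) - (Complex.I * dbracket q a * qC q) • (γs q * α q)

/-- The generator `Y = q⁻¹ X*` of the sphere. -/
def sphY (q : Param) (a : ℝ) : OSU q :=
  γ q * γ q + (qC q)⁻¹ • (αs q * αs q) + (Complex.I * dbracket q a) • (αs q * γ q)

/-- The anti-selfadjoint element `Z = γ α - α* γ* - √-1 t γ γ*` of the sphere. -/
def sphZ (q : Param) (a : ℝ) : OSU q :=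
  γ q * α q - αs q * γs q - (Complex.I * dbracket q a) • (γ q * γs q)

/-- The selfadjoint generator `N = √-1 Z` of the sphere. -/
def sphN (q : Param) (a : ℝ) : OSU q := Complex.I • sphZ q a

theorem sphH_zero_zero (q : Param) (a : ℝ) : sphH q a 0 0 = sphX q a := by
  have hq := qC_ne_zero q
  simp only [sphH, sphX, mat, Matrix.of_apply, Matrix.cons_val', Matrix.cons_val_zero,
    Matrix.cons_val_one, Matrix.cons_val_fin_one, neg_mul, mul_neg, smul_mul_assoc, mul_smul_comm]
  match_scalars <;> field_simp

theorem sphH_one_one (q : Param) (a : ℝ) : sphH q a 1 1 = sphY q a := by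
  simp [sphH, sphY, mat]

theorem sphH_one_zero (q : Param) (a : ℝ) :
    sphH q a 1 0 = sphZ q a + (Complex.I * dbracket q a) • 1 := by
  have hq := qC_ne_zero q
  simp only [sphH, sphZ, mat, Matrix.of_apply, Matrix.cons_val', Matrix.cons_val_zero,
    Matrix.cons_val_one, Matrix.cons_val_fin_one, mul_neg, mul_smul_comm,
    alphaS_alpha]
  match_scalars <;> field_simp

theorem sphH_zero_one (q : Param) (a : ℝ) : sphH q a 0 1 = qC q • sphZ q a := by
  have hq := qC_ne_zero q
  simp only [sphH, sphZ, mat, Matrix.of_apply, Matrix.cons_val', Matrix.cons_val_zero,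
    Matrix.cons_val_one, Matrix.cons_val_fin_one, neg_mul, smul_mul_assoc,
    alpha_gamma, alphaS_gammaS, (quad q).normal]
  match_scalars <;> field_simp

theorem loop_eq_sphH (q : Param) (a : ℝ) (i j : Fin 2) : loop q (qpow q a) i j =
    sphH q a i j - (Complex.I * (qC q * qpow q a)⁻¹ * qEps q i j) • 1 := by
  rw [loop_eq (qpow_ne_zero q a), sphH, dbracket_eq]

theorem sphH_mem_loopSpan (q : Param) (a : ℝ) (i j : Fin 2) : sphH q a i j ∈ loopSpan q a := by
  rw [← sub_add_cancel (sphH q a i j) ((Complex.I * (qC q * qpow q a)⁻¹ * qEps q i j) • 1),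
    ← loop_eq_sphH]
  exact Submodule.add_mem _ (Submodule.subset_span ⟨(i, j), rfl⟩)
    (Submodule.smul_mem _ _ (one_mem_loopSpan q a))

theorem mem_sphere_of_loopSpan {q : Param} {a : ℝ} {x : OSU q} (hx : x ∈ loopSpan q a) :
    x ∈ sphere q a := mem_sphere_iff.mpr (loopSpan_le q a hx)

theorem sphH_mem (q : Param) (a : ℝ) (i j : Fin 2) : sphH q a i j ∈ sphere q a :=
  mem_sphere_of_loopSpan (sphH_mem_loopSpan q a i j)

theorem sphX_mem (q : Param) (a : ℝ) : sphX q a ∈ sphere q a := by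
  rw [← sphH_zero_zero]; exact sphH_mem q a 0 0

theorem sphY_mem (q : Param) (a : ℝ) : sphY q a ∈ sphere q a := by
  rw [← sphH_one_one]; exact sphH_mem q a 1 1

theorem sphZ_mem (q : Param) (a : ℝ) : sphZ q a ∈ sphere q a := by
  rw [← add_sub_cancel_right (sphZ q a) ((Complex.I * dbracket q a) • 1), ← sphH_one_zero]
  exact Submodule.sub_mem _ (sphH_mem q a 1 0) (Submodule.smul_mem _ _ (one_mem_sphere' q a))

theorem sphN_mem (q : Param) (a : ℝ) : sphN q a ∈ sphere q a :=
  Submodule.smul_mem _ _ (sphZ_mem q a)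

theorem sphZ_eq (q : Param) (a : ℝ) : sphZ q a = -Complex.I • sphN q a := by
  rw [sphN, smul_smul, neg_mul, Complex.I_mul_I, neg_neg, one_smul]

/-- The sphere is generated by `X`, `Y` and `N`. -/
theorem sphere_le_adjoin (q : Param) (a : ℝ) : sphere q a ≤
    Subalgebra.toSubmodule (Algebra.adjoin ℂ {sphX q a, sphY q a, sphN q a}) := by
  have hX : sphX q a ∈ Algebra.adjoin ℂ {sphX q a, sphY q a, sphN q a} :=
    Algebra.subset_adjoin (by simp)
  have hY : sphY q a ∈ Algebra.adjoin ℂ {sphX q a, sphY q a, sphN q a} :=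
    Algebra.subset_adjoin (by simp)
  have hZ : sphZ q a ∈ Algebra.adjoin ℂ {sphX q a, sphY q a, sphN q a} := by
    rw [sphZ_eq]
    exact Subalgebra.smul_mem _ (Algebra.subset_adjoin (by simp)) _
  have hH : ∀ i j, sphH q a i j ∈ Algebra.adjoin ℂ {sphX q a, sphY q a, sphN q a} := by
    intro i j
    fin_cases i <;> fin_cases j
    · exact (sphH_zero_zero q a).symm ▸ hX
    · exact (sphH_zero_one q a).symm ▸ Subalgebra.smul_mem _ hZ _
    · exact (sphH_one_zero q a).symm ▸
        add_mem hZ (Subalgebra.smul_mem _ (one_mem _) _)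
    · exact (sphH_one_one q a).symm ▸ hY
  rw [sphere_eq_loopAlg, loopAlg]
  have : loopSpan q a ≤
      Subalgebra.toSubmodule (Algebra.adjoin ℂ {sphX q a, sphY q a, sphN q a}) := by
    refine Submodule.span_le.mpr ?_
    rintro _ ⟨⟨i, j⟩, rfl⟩
    change loop q (qpow q a) i j ∈ _
    rw [loop_eq_sphH]
    exact sub_mem (hH i j) (Subalgebra.smul_mem _ (one_mem _) _)
  exact Algebra.adjoin_le this

theorem sphere_induction {q : Param} {a : ℝ} {P : OSU q → Prop}
    (hX : P (sphX q a)) (hY : P (sphY q a)) (hN : P (sphN q a))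
    (hc : ∀ z : ℂ, P (algebraMap ℂ _ z))
    (hm : ∀ x ∈ sphere q a, ∀ y ∈ sphere q a, P x → P y → P (x * y))
    (ha : ∀ x ∈ sphere q a, ∀ y ∈ sphere q a, P x → P y → P (x + y)) {x : OSU q}
    (hx : x ∈ sphere q a) : P x := by
  have h : x ∈ sphere q a ∧ P x := by
    replace hx : x ∈ Algebra.adjoin ℂ {sphX q a, sphY q a, sphN q a} := sphere_le_adjoin q a hx
    induction hx using Algebra.adjoin_induction with
    | mem x hx =>
      rcases hx with rfl | rfl | rfl
      exacts [⟨sphX_mem q a, hX⟩, ⟨sphY_mem q a, hY⟩, ⟨sphN_mem q a, hN⟩]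
    | algebraMap z =>
      refine ⟨?_, hc z⟩
      rw [Algebra.algebraMap_eq_smul_one]
      exact Submodule.smul_mem _ _ (one_mem_sphere' q a)
    | add x y _ _ hx hy => exact ⟨add_mem hx.1 hy.1, ha x hx.1 y hy.1 hx.2 hy.2⟩
    | mul x y _ _ hx hy => exact ⟨mul_mem_sphere hx.1 hy.1, hm x hx.1 y hy.1 hx.2 hy.2⟩
  exact h.2

set_option maxHeartbeats 1000000 in
theorem sphX_mul_sphZ (q : Param) (a : ℝ) :
    sphX q a * sphZ q a = qC q ^ 2 • (sphZ q a * sphX q a) := by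
  have hq := qC_ne_zero q
  simp only [sphX, sphZ]
  generalize Complex.I * (dbracket q a : ℂ) = s
  simp only [add_mul, sub_mul, mul_add, mul_sub, smul_mul_assoc, mul_smul_comm, mul_assoc,
    alpha_gammaS, alphaS_gammaS, alphaS_alpha, alpha_alphaS,
    alpha_gamma_mul, alpha_gammaS_mul, alphaS_gammaS_mul,
    gammaS_gamma_mul, alphaS_alpha_mul, mul_one]
  match_scalars <;> field_simp <;> ring

set_option maxHeartbeats 1000000 in
theorem sphZ_mul_sphY (q : Param) (a : ℝ) :
    sphZ q a * sphY q a = qC q ^ 2 • (sphY q a * sphZ q a) := by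
  have hq := qC_ne_zero q
  simp only [sphY, sphZ]
  generalize Complex.I * (dbracket q a : ℂ) = s
  simp only [add_mul, sub_mul, mul_add, mul_sub, smul_mul_assoc, mul_smul_comm, mul_assoc,
    alpha_gamma, alphaS_gamma, alphaS_gammaS, alphaS_alpha, alpha_alphaS,
    (quad q).normal, alpha_gamma_mul, alphaS_gamma_mul, alphaS_gammaS_mul,
    gammaS_gamma_mul, alpha_alphaS_mul, mul_one]
  match_scalars <;> field_simp <;> ring

set_option maxHeartbeats 1000000 in
theorem sphX_mul_sphY (q : Param) (a : ℝ) : sphX q a * sphY q a =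
    (qC q)⁻¹ • (1 + (qC q ^ 2 * (Complex.I * dbracket q a)) • sphZ q a +
      qC q ^ 4 • (sphZ q a * sphZ q a)) := by
  have hq := qC_ne_zero q
  simp only [sphX, sphY, sphZ]
  generalize Complex.I * (dbracket q a : ℂ) = s
  simp only [add_mul, sub_mul, mul_add, mul_sub, smul_mul_assoc, mul_smul_comm, mul_assoc,
    alpha_gamma, alpha_gammaS, alphaS_gamma, alphaS_gammaS, alphaS_alpha, alpha_alphaS,
    (quad q).normal, alpha_gamma_mul, alpha_gammaS_mul, alphaS_gamma_mul, alphaS_gammaS_mul,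
    gammaS_gamma_mul, alpha_alphaS_mul, mul_one]
  match_scalars <;> field_simp <;> ring

set_option maxHeartbeats 1000000 in
theorem sphY_mul_sphX (q : Param) (a : ℝ) : sphY q a * sphX q a =
    (qC q)⁻¹ • (1 + (Complex.I * dbracket q a) • sphZ q a + sphZ q a * sphZ q a) := by
  have hq := qC_ne_zero q
  simp only [sphX, sphY, sphZ]
  generalize Complex.I * (dbracket q a : ℂ) = s
  simp only [add_mul, sub_mul, mul_add, mul_sub, smul_mul_assoc, mul_smul_comm, mul_assoc,
    alpha_gammaS, alphaS_gamma, alphaS_gammaS, alphaS_alpha, alpha_alphaS,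
    (quad q).normal, alpha_gamma_mul, alpha_gammaS_mul, alphaS_gamma_mul, alphaS_gammaS_mul,
    gammaS_gamma_mul, alphaS_alpha_mul, mul_one]
  match_scalars <;> field_simp <;> ring

theorem star_gen (q : Param) : star (α q) = αs q ∧ star (αs q) = α q ∧ star (γ q) = γs q ∧
    star (γs q) = γ q :=
  ⟨adj_gen q _, adj_gen q _, adj_gen q _, adj_gen q _⟩

theorem star_sphX (q : Param) (a : ℝ) : star (sphX q a) = qC q • sphY q a := by
  have hq := qC_ne_zero q
  have hc : (starRingEnd ℂ) (qC q) = qC q := conj_qC q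
  obtain ⟨h1, h2, h3, h4⟩ := star_gen q
  simp only [sphX, sphY, star_sub, star_add, star_smul, star_mul, h1, h4,
    RCLike.star_def, hc, Complex.conj_I, Complex.conj_ofReal]
  match_scalars <;> field_simp

theorem star_sphY (q : Param) (a : ℝ) : star (sphY q a) = (qC q)⁻¹ • sphX q a := by
  have hq := qC_ne_zero q
  have h := congrArg star (star_sphX q a)
  have hc : (starRingEnd ℂ) (qC q) = qC q := conj_qC q
  rw [star_star, star_smul, RCLike.star_def, hc] at h
  rw [h, smul_smul, inv_mul_cancel₀ hq, one_smul]

theorem star_sphN (q : Param) (a : ℝ) : star (sphN q a) = sphN q a := by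
  obtain ⟨h1, h2, h3, h4⟩ := star_gen q
  simp only [sphN, sphZ, star_sub, star_smul, star_mul, h1, h2, h3, h4,
    RCLike.star_def, Complex.conj_I, Complex.conj_ofReal]
  module

theorem star_mem_sphere {q : Param} {a : ℝ} {x : OSU q} (hx : x ∈ sphere q a) :
    star x ∈ sphere q a := by
  refine sphere_induction (P := fun x => star x ∈ sphere q a) ?_ ?_ ?_ (fun z => ?_)
    (fun x _ y _ hx hy => ?_) (fun x _ y _ hx hy => ?_) hx
  · rw [star_sphX]; exact Submodule.smul_mem _ _ (sphY_mem q a)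
  · rw [star_sphY]; exact Submodule.smul_mem _ _ (sphX_mem q a)
  · rw [star_sphN]; exact sphN_mem q a
  · rw [Algebra.algebraMap_eq_smul_one, star_smul, star_one]
    exact Submodule.smul_mem _ _ (one_mem_sphere' q a)
  · rw [star_mul]; exact mul_mem_sphere hy hx
  · rw [star_add]; exact add_mem hx hy

/-! ### The elements `T_c^±` and `A_c` -/

theorem qpow_half (q : Param) : qpow q (1 / 2) = sqrtq q := by
  rw [qpow, sqrtq, Real.sqrt_eq_rpow]

theorem rt_sq (q : Param) : rt q ^ 2 = qC q + (qC q)⁻¹ := by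
  have := q_pos q
  rw [rt, qC, ← Complex.ofReal_pow, Real.sq_sqrt (by positivity)]
  simp

theorem rt_ne_zero (q : Param) : rt q ≠ 0 := by
  have := q_pos q
  rw [rt, Complex.ofReal_ne_zero]; positivity

theorem sqrt_one_add (q : Param) : ((Real.sqrt (1 + (q : ℝ) ^ 2) : ℝ) : ℂ) = rt q * sqrtq q := by
  have := q_pos q
  rw [rt, sqrtq, ← Complex.ofReal_mul, ← Real.sqrt_mul (by positivity)]
  congr 2
  field_simp
  ring

theorem one_add_sq_ne_zero (q : Param) : 1 + qC q ^ 2 ≠ 0 := by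
  have h : (0 : ℝ) < 1 + (q : ℝ) ^ 2 := by positivity
  have := Complex.ofReal_ne_zero.mpr h.ne'
  simpa [qC] using this

theorem one_add_pow_four_ne_zero {q : Param} {s : ℂ} (hs : s ^ 2 = qC q) : 1 + s ^ 4 ≠ 0 := by
  intro h4
  apply one_add_sq_ne_zero q
  rw [← hs]
  linear_combination h4

/-- The coefficients `u_{ξ,η}` in terms of the generators of the sphere. -/
theorem coeff_eq (q : Param) (a : ℝ) (ξ : Matrix (Fin 2) (Fin 2) ℂ) : coeff q ξ (ηt q a) =
    sqrtq q • ∑ i, ∑ j, conj (ξ i j) • (sphH q a i j +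
      (Complex.I * dbracket q a * qC q / (1 + qC q ^ 2) * qEps q i j) • 1) := by
  have hs := sqrtq_ne_zero q
  have hsq := sqrtq_sq q
  have hr := rt_ne_zero q
  have hr2 : rt q ^ 2 * qC q = 1 + qC q ^ 2 := by
    rw [rt_sq, add_mul, inv_mul_cancel₀ (qC_ne_zero q)]; ring
  have hq1 := one_add_sq_ne_zero q
  have hq := qC_ne_zero q
  have hq4 : ∀ s : ℂ, s ^ 2 = qC q → 1 + s ^ 4 ≠ 0 := fun _ => one_add_pow_four_ne_zero
  have key : ∀ i j, ∑ k, ∑ l, ηt q a k l • (mat q i k * mat q j l) = sqrtq q • (sphH q a i j +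
      (Complex.I * dbracket q a * qC q / (1 + qC q ^ 2) * qEps q i j) • 1) := by
    intro i j
    simp only [Fin.sum_univ_two, ηt, spinOne, sphH, sqrt_one_add, qpow_half, Matrix.of_apply,
      Matrix.cons_val', Matrix.cons_val_zero, Matrix.cons_val_one, Matrix.cons_val_fin_one,
      mat_row_rel, Algebra.algebraMap_eq_smul_one, neg_div, qpow_neg]
    generalize (dbracket q a : ℂ) = t
    generalize rt q = r at *
    rw [← hsq] at *
    generalize sqrtq q = s at *
    have hq5 := hq4 s hsq
    match_scalars <;> field_simp
    · linear_combination (-t) * hr2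
    · linear_combination (-t * qEps q i j) * hr2
  rw [coeff, Finset.smul_sum]
  refine Finset.sum_congr rfl fun i _ => ?_
  rw [Finset.smul_sum]
  refine Finset.sum_congr rfl fun j _ => ?_
  rw [smul_comm, ← key]
  simp only [mul_smul, Finset.smul_sum]

section
variable (q : Param)
theorem conj_qpow (x : ℝ) : conj (qpow q x) = qpow q x := Complex.conj_ofReal _
theorem conj_rt : conj (rt q) = rt q := Complex.conj_ofReal _
theorem conj_sqrtq : conj (sqrtq q) = sqrtq q := Complex.conj_ofReal _
theorem conj_qC' : conj (qC q) = qC q := Complex.conj_ofReal _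
end

theorem TPlus_coe (q : Param) (a c : ℝ) : (TPlus q a c : OSU q) =
    qpow q c • sphX q a + (1 + qC q ^ 2) • sphN q a - (dbracket q a : ℂ) • 1 -
      (qC q * (qpow q c)⁻¹) • sphY q a := by
  have hI : Complex.I * Complex.I = -1 := Complex.I_mul_I
  have hs := sqrtq_ne_zero q
  have hsq := sqrtq_sq q
  have hr := rt_ne_zero q
  have hq1 := one_add_sq_ne_zero q
  have hq := qC_ne_zero q
  have hq4 : ∀ s : ℂ, s ^ 2 = qC q → 1 + s ^ 4 ≠ 0 := fun _ => one_add_pow_four_ne_zero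
  have hc := qpow_ne_zero q c
  change coeff q _ _ = _
  rw [coeff_eq]
  simp only [Fin.sum_univ_two, spinOne, sqrt_one_add, Matrix.of_apply, Matrix.cons_val',
    Matrix.cons_val_zero, Matrix.cons_val_one, Matrix.cons_val_fin_one, qEps, sphH_zero_zero,
    sphH_zero_one, sphH_one_zero, sphH_one_one, map_neg, map_mul, map_div₀, Complex.conj_I,
    conj_qpow, conj_rt, conj_sqrtq, conj_qC', qpow_add, qpow_sub, qpow_neg, qpow_half, sphN,
    map_one, map_inv₀]
  generalize (dbracket q a : ℂ) = t
  generalize rt q = r at *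
  rw [← hsq] at *
  generalize sqrtq q = s at *
  have hq5 := hq4 s hsq
  match_scalars <;> field_simp
  · linear_combination (qpow q c * t * (1 + s ^ 4)) * hI
  · ring

theorem TMinus_coe (q : Param) (a c : ℝ) : (TMinus q a c : OSU q) =
    -(qpow q c)⁻¹ • sphX q a + (1 + qC q ^ 2) • sphN q a - (dbracket q a : ℂ) • 1 +
      (qC q * qpow q c) • sphY q a := by
  have hI : Complex.I * Complex.I = -1 := Complex.I_mul_I
  have hs := sqrtq_ne_zero q
  have hsq := sqrtq_sq q
  have hr := rt_ne_zero q
  have hq1 := one_add_sq_ne_zero q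
  have hq := qC_ne_zero q
  have hq4 : ∀ s : ℂ, s ^ 2 = qC q → 1 + s ^ 4 ≠ 0 := fun _ => one_add_pow_four_ne_zero
  have hc := qpow_ne_zero q c
  change coeff q _ _ = _
  rw [coeff_eq]
  simp only [Fin.sum_univ_two, spinOne, sqrt_one_add, Matrix.of_apply, Matrix.cons_val',
    Matrix.cons_val_zero, Matrix.cons_val_one, Matrix.cons_val_fin_one, qEps, sphH_zero_zero,
    sphH_zero_one, sphH_one_zero, sphH_one_one, map_neg, map_mul, map_div₀, Complex.conj_I,
    conj_qpow, conj_rt, conj_sqrtq, conj_qC', qpow_add, qpow_sub, qpow_neg, qpow_half, sphN,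
    map_one, map_inv₀]
  generalize (dbracket q a : ℂ) = t
  generalize rt q = r at *
  rw [← hsq] at *
  generalize sqrtq q = s at *
  have hq5 := hq4 s hsq
  match_scalars <;> field_simp
  · linear_combination (qpow q c * t * (1 + s ^ 4)) * hI
  · ring

theorem qpow_three_half (q : Param) : qpow q (3 / 2) = qC q * sqrtq q := by
  rw [← qpow_half, ← qpow_one, ← qpow_add]; norm_num

theorem AElt_coe (q : Param) (a c : ℝ) : (AElt q a c : OSU q) =
    (qC q)⁻¹ • sphX q a + qC q ^ 2 • sphY q a - (qC q * dbracket q c) • sphN q a := by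
  have hI : Complex.I * Complex.I = -1 := Complex.I_mul_I
  have hs := sqrtq_ne_zero q
  have hsq := sqrtq_sq q
  have hr := rt_ne_zero q
  have hr2 := rt_sq q
  have hq1 := one_add_sq_ne_zero q
  have hq := qC_ne_zero q
  have hq4 : ∀ s : ℂ, s ^ 2 = qC q → 1 + s ^ 4 ≠ 0 := fun _ => one_add_pow_four_ne_zero
  have hdr : ∀ x, conj (dbracket q x : ℂ) = dbracket q x := fun x => Complex.conj_ofReal _
  change coeff q _ _ - _ • (1 : OSU q) = _
  rw [coeff_eq]
  push_cast
  rw [← qC]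
  simp only [Fin.sum_univ_two, spinOne, sqrt_one_add, Matrix.of_apply, Matrix.cons_val',
    Matrix.cons_val_zero, Matrix.cons_val_one, Matrix.cons_val_fin_one, qEps, sphH_zero_zero,
    sphH_zero_one, sphH_one_zero, sphH_one_one, map_neg, map_mul, map_div₀, Complex.conj_I,
    conj_rt, conj_sqrtq, conj_qC', qpow_neg, neg_div, qpow_three_half, sphN, hdr,
    map_one, map_inv₀]
  generalize (dbracket q a : ℂ) = t
  generalize (dbracket q c : ℂ) = b
  generalize rt q = r at *
  rw [← hsq] at *
  generalize sqrtq q = s at *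
  have hr3 : r ^ 2 * s ^ 2 = 1 + (s ^ 2) ^ 2 := by
    rw [hr2, add_mul, inv_mul_cancel₀ hq]; ring
  have hq5 := hq4 s hsq
  match_scalars <;> field_simp
  · linear_combination (-t * b * (1 + s ^ 4)) * hI - t * b * hr3
  · linear_combination b * hr3

/-! ### Quadratic relations between `T_c^±` and `A_c` -/

theorem sphX_mul_sphN (q : Param) (a : ℝ) :
    sphX q a * sphN q a = qC q ^ 2 • (sphN q a * sphX q a) := by
  rw [sphN, mul_smul_comm, smul_mul_assoc, sphX_mul_sphZ, smul_comm]

theorem sphY_mul_sphN (q : Param) (a : ℝ) :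
    sphY q a * sphN q a = (qC q ^ 2)⁻¹ • (sphN q a * sphY q a) := by
  rw [sphN, mul_smul_comm, smul_mul_assoc, sphZ_mul_sphY, smul_comm (qC q ^ 2)⁻¹,
    inv_smul_smul₀ (pow_ne_zero 2 (qC_ne_zero q))]

theorem sphX_mul_sphY' (q : Param) (a : ℝ) :
    sphX q a * sphY q a = (qC q)⁻¹ • (1 : OSU q) + (qC q * dbracket q a) • sphN q a
      - qC q ^ 3 • (sphN q a * sphN q a) := by
  have hI : Complex.I * Complex.I = -1 := Complex.I_mul_I
  have hq := qC_ne_zero q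
  rw [sphX_mul_sphY, sphN]
  simp only [mul_smul_comm, smul_mul_assoc]
  match_scalars <;> field_simp
  linear_combination hI

theorem sphY_mul_sphX' (q : Param) (a : ℝ) :
    sphY q a * sphX q a = (qC q)⁻¹ • (1 : OSU q) + ((qC q)⁻¹ * dbracket q a) • sphN q a
      - (qC q)⁻¹ • (sphN q a * sphN q a) := by
  have hI : Complex.I * Complex.I = -1 := Complex.I_mul_I
  have hq := qC_ne_zero q
  rw [sphY_mul_sphX, sphN]
  simp only [mul_smul_comm, smul_mul_assoc]
  match_scalars <;> field_simp
  linear_combination hI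

theorem qpow_two (q : Param) : qpow q 2 = qC q ^ 2 := by
  rw [show (2 : ℝ) = 1 + 1 by norm_num, qpow_add, qpow_one, sq]

theorem AElt_mul_TPlus (q : Param) (a c : ℝ) : (AElt q a (c + 2) : OSU q) * TPlus q a c =
    TPlus q a c * AElt q a c := by
  have hq := qC_ne_zero q
  have hc := qpow_ne_zero q c
  have ha := qpow_ne_zero q a
  simp only [AElt_coe, TPlus_coe, dbracket_eq, qpow_add, qpow_two]
  simp only [mul_add, add_mul, mul_sub, sub_mul, smul_mul_assoc, mul_smul_comm, smul_smul, mul_one, one_mul,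
    sphX_mul_sphN, sphY_mul_sphN, sphX_mul_sphY', sphY_mul_sphX', dbracket_eq]
  match_scalars <;> field_simp <;> ring

theorem AElt_mul_TMinus (q : Param) (a c : ℝ) : (AElt q a (c - 2) : OSU q) * TMinus q a c =
    TMinus q a c * AElt q a c := by
  have hq := qC_ne_zero q
  have hc := qpow_ne_zero q c
  have ha := qpow_ne_zero q a
  simp only [AElt_coe, TMinus_coe, dbracket_eq, qpow_sub, qpow_two]
  simp only [mul_add, add_mul, mul_sub, sub_mul, smul_mul_assoc, mul_smul_comm, smul_smul, mul_one, one_mul,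
    sphX_mul_sphN, sphY_mul_sphN, sphX_mul_sphY', sphY_mul_sphX', dbracket_eq]
  match_scalars <;> field_simp <;> ring

theorem TMinus_mul_TPlus (q : Param) (a c : ℝ) : (TMinus q a (c + 2) : OSU q) * TPlus q a c =
    -((AElt q a c + (qcosh q (c + a + 1) : ℂ) • 1) * (AElt q a c - (qcosh q (c - a + 1) : ℂ) • 1)) := by
  have hq := qC_ne_zero q
  have hc := qpow_ne_zero q c
  have ha := qpow_ne_zero q a
  simp only [AElt_coe, TMinus_coe, TPlus_coe, dbracket_eq, qcosh_eq, qpow_add, qpow_sub, qpow_two, qpow_one]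
  simp only [mul_add, add_mul, mul_sub, sub_mul, smul_mul_assoc, mul_smul_comm, smul_smul, mul_one, one_mul,
    sphX_mul_sphN, sphY_mul_sphN, sphX_mul_sphY', sphY_mul_sphX', dbracket_eq]
  match_scalars <;> field_simp <;> ring

theorem TPlus_mul_TMinus (q : Param) (a c : ℝ) : (TPlus q a (c - 2) : OSU q) * TMinus q a c =
    -((AElt q a c + (qcosh q (c + a - 1) : ℂ) • 1) * (AElt q a c - (qcosh q (c - a - 1) : ℂ) • 1)) := by
  have hq := qC_ne_zero q
  have hc := qpow_ne_zero q c
  have ha := qpow_ne_zero q a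
  simp only [AElt_coe, TMinus_coe, TPlus_coe, dbracket_eq, qcosh_eq, qpow_add, qpow_sub, qpow_two, qpow_one]
  simp only [mul_add, add_mul, mul_sub, sub_mul, smul_mul_assoc, mul_smul_comm, smul_smul, mul_one, one_mul,
    sphX_mul_sphN, sphY_mul_sphN, sphX_mul_sphY', sphY_mul_sphX', dbracket_eq]
  match_scalars <;> field_simp <;> ring

/-! ### The counit on the sphere -/

theorem counit_gen (q : Param) (g : Gen) : Coalgebra.counit (R := ℂ) (gen q g) = assign (1 : ℂ) 1 0 0 g :=
  lift_gen (counit_quad q) g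

theorem counit_sphX (q : Param) (a : ℝ) : Coalgebra.counit (R := ℂ) (sphX q a) = 1 := by
  simp [sphX, counit_gen, assign]
theorem counit_sphY (q : Param) (a : ℝ) : Coalgebra.counit (R := ℂ) (sphY q a) = (qC q)⁻¹ := by
  simp [sphY, counit_gen, assign]
theorem counit_sphN (q : Param) (a : ℝ) : Coalgebra.counit (R := ℂ) (sphN q a) = 0 := by
  simp [sphN, sphZ, counit_gen, assign]

theorem counit_TPlus (q : Param) (a c : ℝ) : Coalgebra.counit (R := ℂ) (TPlus q a c : OSU q) =
    dbracket q c - dbracket q a := by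
  have hq := qC_ne_zero q
  have hc := qpow_ne_zero q c
  have ha := qpow_ne_zero q a
  simp only [TPlus_coe, map_sub, map_add, map_smul, counit_sphX, counit_sphY, counit_sphN,
    Bialgebra.counit_one, dbracket_eq, smul_eq_mul]
  field_simp
  ring

/-! ### Cross relations between `B_t` and the sphere -/

theorem kInv_SInv_mat (q : Param) (i j : Fin 2) :
    (kInv q).ofConv (SInv q (mat q i j)) = !![qC q, 0; 0, (qC q)⁻¹] i j := by
  rw [SInv_mat]
  fin_cases i <;> fin_cases j <;> simp [kInv_mat]

theorem skewD_SInv_mat (q : Param) (i j : Fin 2) :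
    (skewD q).ofConv (SInv q (mat q i j)) = !![0, qC q; -(qC q)⁻¹, 0] i j := by
  rw [SInv_mat]
  fin_cases i <;> fin_cases j <;> simp [skewD_mat]

theorem I_smul_Bt_apply (q : Param) (a : ℝ) (x : OSU q) : Complex.I * (Bt q a).ofConv x =
    Complex.I * (skewD q).ofConv x + bracket q a * (kInv q).ofConv x := by
  have := congrArg (fun ω : U q => ω.ofConv x) (I_smul_Bt q a)
  simpa using this

theorem I_smul_Bt_apply_of_mem {q : Param} {a : ℝ} {x : OSU q} (hx : x ∈ sphere q a) :
    Complex.I * (Bt q a).ofConv x = bracket q a * Coalgebra.counit (R := ℂ) x := by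
  have h := congrArg (Coalgebra.counit (R := ℂ)) (mem_eig.mp (mem_sphere_iff.mp hx))
  rw [map_add, map_smul, map_smul, map_smul, counit_lact, counit_lact] at h
  rw [I_smul_Bt_apply]
  exact h

/-- The functional `z ↦ √-1 B_t(h z y)` for `h` in the sphere. -/
theorem twist_I_smul_Bt {q : Param} {a : ℝ} {h : OSU q} (hh : h ∈ sphere q a) (y : OSU q) :
    twist h y (Complex.I • Bt q a) = Coalgebra.counit (R := ℂ) h •
      ((kInv q).ofConv y • (Complex.I • Bt q a) + (Complex.I * (skewD q).ofConv y) • 1) := by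
  have h0 := I_smul_Bt_apply_of_mem hh
  rw [I_smul_Bt_apply] at h0
  apply WithConv.ofConv_injective
  ext z
  simp only [twist, I_smul_Bt, WithConv.ofConv_toConv, LinearMap.comp_apply, LinearMap.mulLeft_apply,
    LinearMap.mulRight_apply, WithConv.ofConv_add, WithConv.ofConv_smul, LinearMap.add_apply,
    LinearMap.smul_apply, skewD_mul, kInv_mul, smul_eq_mul, one_ofConv]
  linear_combination (kInv q).ofConv z * (kInv q).ofConv y * h0

theorem Double.cross' {q : Param} (ω : U q) {x : OSU q} {ι : Type*} [Fintype ι]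
    {x₁ x₂ x₃ : ι → OSU q} (h : comul₂ q x = ∑ i, x₁ i ⊗ₜ[ℂ] (x₂ i ⊗ₜ[ℂ] x₃ i)) :
    ofDual q ω * ofFun q x = ∑ i, ofFun q (x₂ i) * ofDual q (twist (x₃ i) (SInv q (x₁ i)) ω) := by
  let e := (Fintype.equivFin ι).symm
  rw [Double.cross ω (x₁ := x₁ ∘ e) (x₂ := x₂ ∘ e) (x₃ := x₃ ∘ e)
    (h.trans (Equiv.sum_comp e _).symm)]
  exact Equiv.sum_comp e fun i => ofFun q (x₂ i) * ofDual q (twist (x₃ i) (SInv q (x₁ i)) ω)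

/-- The coefficients of the vector `v₊⊗v₊ + √-1 t v₋⊗v₊ + q⁻¹ v₋⊗v₋`. -/
def etaCoeff (q : Param) (a : ℝ) (k l : Fin 2) : ℂ := !![1, 0; Complex.I * dbracket q a, (qC q)⁻¹] k l

theorem sphH_eq_sum (q : Param) (a : ℝ) (i j : Fin 2) :
    sphH q a i j = ∑ k, ∑ l, etaCoeff q a k l • (mat q i k * mat q j l) := by
  simp only [sphH, Fin.sum_univ_two, etaCoeff, Matrix.of_apply, Matrix.cons_val',
    Matrix.cons_val_zero, Matrix.cons_val_one, Matrix.cons_val_fin_one]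
  module

theorem comul_sphH (q : Param) (a : ℝ) (i j : Fin 2) : Coalgebra.comul (R := ℂ) (sphH q a i j) =
    ∑ m, ∑ n, (mat q i m * mat q j n) ⊗ₜ[ℂ] sphH q a m n := by
  simp only [sphH, map_add, map_smul, comul_mat_mul, TensorProduct.tmul_add,
    TensorProduct.tmul_smul, Fin.sum_univ_two]
  module

theorem counit_mat (q : Param) (i j : Fin 2) : Coalgebra.counit (R := ℂ) (mat q i j) =
    !![1, 0; 0, 1] i j := by
  fin_cases i <;> fin_cases j <;> simp [mat, counit_gen, assign]

theorem counit_sphH (q : Param) (a : ℝ) (i j : Fin 2) :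
    Coalgebra.counit (R := ℂ) (sphH q a i j) = etaCoeff q a i j := by
  simp only [sphH, map_add, map_smul, counit_mul, counit_mat, etaCoeff]
  fin_cases i <;> fin_cases j <;> simp

theorem comul₂_sphH (q : Param) (a : ℝ) (i j : Fin 2) : comul₂ q (sphH q a i j) =
    ∑ s : (Fin 2 × Fin 2) × (Fin 2 × Fin 2), (mat q i s.1.1 * mat q j s.1.2) ⊗ₜ[ℂ]
      ((mat q s.1.1 s.2.1 * mat q s.1.2 s.2.2) ⊗ₜ[ℂ] sphH q a s.2.1 s.2.2) := by
  rw [comul₂_apply, comul_sphH]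
  simp only [map_sum, LinearMap.lTensor_tmul, comul_sphH, TensorProduct.tmul_sum,
    Fintype.sum_prod_type]

theorem IBt_mul_sphH (q : Param) (a : ℝ) (i j : Fin 2) :
    Double.ofDual q (Complex.I • Bt q a) * Double.ofFun q (sphH q a i j) =
      ∑ m, ∑ n, Double.ofFun q (sphH q a m n) * Double.ofDual q
        ((kInv q).ofConv (SInv q (mat q i m * mat q j n)) • (Complex.I • Bt q a) +
          (Complex.I * (skewD q).ofConv (SInv q (mat q i m * mat q j n))) • 1) := by
  rw [Double.cross' _ (comul₂_sphH q a i j)]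
  simp only [Fintype.sum_prod_type]
  refine Finset.sum_congr rfl fun m _ => Finset.sum_congr rfl fun n _ => ?_
  simp only [twist_I_smul_Bt (sphH_mem q a _ _), counit_sphH, Double.ofDual_smul, mul_smul_comm]
  simp only [← smul_mul_assoc, ← Finset.sum_mul]
  congr 1
  rw [sphH_eq_sum]
  simp only [← Double.ofFun_smul]
  change ∑ k, ∑ l, Double.funHom q _ = Double.funHom q _
  simp only [map_sum]

theorem SInv_mat_mul_values (q : Param) (i j m n : Fin 2) :
    (kInv q).ofConv (SInv q (mat q i m * mat q j n)) =
      !![qC q, 0; 0, (qC q)⁻¹] j n * !![qC q, 0; 0, (qC q)⁻¹] i m ∧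
    (skewD q).ofConv (SInv q (mat q i m * mat q j n)) =
      !![0, qC q; -(qC q)⁻¹, 0] j n * !![qC q, 0; 0, (qC q)⁻¹] i m +
        !![1, 0; 0, 1] j n * !![0, qC q; -(qC q)⁻¹, 0] i m := by
  rw [SInv_mul, kInv_mul, skewD_mul, kInv_SInv_mat, kInv_SInv_mat, skewD_SInv_mat, skewD_SInv_mat,
    counit_SInv, counit_mat]
  exact ⟨rfl, rfl⟩

theorem IBt_mul_sphX (q : Param) (a : ℝ) :
    Double.ofDual q (Complex.I • Bt q a) * Double.ofFun q (sphX q a) =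
      Double.ofFun q (qC q ^ 2 • sphX q a) * Double.ofDual q (Complex.I • Bt q a) +
      Double.ofFun q ((qC q ^ 3 + qC q) • sphN q a - (qC q * dbracket q a) • 1) := by
  have hq := qC_ne_zero q
  have hI : Complex.I * Complex.I = -1 := Complex.I_mul_I
  rw [← sphH_zero_zero, IBt_mul_sphH]
  simp only [Fin.sum_univ_two, (SInv_mat_mul_values q _ _ _ _).1, (SInv_mat_mul_values q _ _ _ _).2,
    sphH_zero_zero, sphH_zero_one, sphH_one_zero, sphH_one_one, sphN, Matrix.of_apply, Matrix.cons_val',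
    Matrix.cons_val_zero, Matrix.cons_val_one, Matrix.cons_val_fin_one, Double.ofDual_add, 
    Double.ofDual_smul, Double.ofDual_one, mul_add, mul_smul_comm, mul_one, ← Double.funHom_apply,
    map_add, map_smul, map_sub, smul_mul_assoc, add_mul]
  generalize (dbracket q a : ℂ) = t
  match_scalars <;> field_simp <;> ring_nf <;> simp

theorem IBt_mul_sphY (q : Param) (a : ℝ) :
    Double.ofDual q (Complex.I • Bt q a) * Double.ofFun q (sphY q a) =
      Double.ofFun q ((qC q ^ 2)⁻¹ • sphY q a) * Double.ofDual q (Complex.I • Bt q a) +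
      Double.ofFun q (((qC q ^ 2)⁻¹ * dbracket q a) • 1 - (1 + (qC q ^ 2)⁻¹) • sphN q a) := by
  have hq := qC_ne_zero q
  have hI : Complex.I * Complex.I = -1 := Complex.I_mul_I
  rw [← sphH_one_one, IBt_mul_sphH]
  simp only [Fin.sum_univ_two, (SInv_mat_mul_values q _ _ _ _).1, (SInv_mat_mul_values q _ _ _ _).2,
    sphH_zero_zero, sphH_zero_one, sphH_one_zero, sphH_one_one, sphN, Matrix.of_apply, Matrix.cons_val',
    Matrix.cons_val_zero, Matrix.cons_val_one, Matrix.cons_val_fin_one, Double.ofDual_add, 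
    Double.ofDual_smul, Double.ofDual_one, mul_add, mul_smul_comm, mul_one, ← Double.funHom_apply,
    map_add, map_smul, map_sub, smul_mul_assoc, add_mul]
  generalize (dbracket q a : ℂ) = t
  match_scalars <;> field_simp <;> ring_nf <;> simp

theorem IBt_mul_sphN (q : Param) (a : ℝ) :
    Double.ofDual q (Complex.I • Bt q a) * Double.ofFun q (sphN q a) =
      Double.ofFun q (sphN q a) * Double.ofDual q (Complex.I • Bt q a) +
      Double.ofFun q ((qC q)⁻¹ • sphX q a - sphY q a) := by
  have hq := qC_ne_zero q
  have hI : Complex.I * Complex.I = -1 := Complex.I_mul_I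
  have h : sphN q a = (Complex.I * (qC q)⁻¹) • sphH q a 0 1 := by
    rw [sphH_zero_one, smul_smul, mul_assoc, inv_mul_cancel₀ hq, mul_one, sphN]
  nth_rw 1 [h]
  rw [Double.ofFun_smul, mul_smul_comm, IBt_mul_sphH]
  simp only [Fin.sum_univ_two, (SInv_mat_mul_values q _ _ _ _).1, (SInv_mat_mul_values q _ _ _ _).2,
    sphH_zero_zero, sphH_zero_one, sphH_one_zero, sphH_one_one, sphN, Matrix.of_apply, Matrix.cons_val',
    Matrix.cons_val_zero, Matrix.cons_val_one, Matrix.cons_val_fin_one, Double.ofDual_add, 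
    Double.ofDual_smul, Double.ofDual_one, mul_add, mul_smul_comm, mul_one, ← Double.funHom_apply,
    map_add, map_smul, map_sub, smul_mul_assoc, add_mul]
  match_scalars <;> field_simp <;> ring_nf <;> simp

/-! ### Modules over `U_q(sl(2,ℝ)_t)` -/

namespace UqSL
variable {q : Param} {a : ℝ}

theorem ofFun_add (x y : sphere q a) : ofFun (x + y) = ofFun x + ofFun y :=
  Subtype.ext (Double.ofFun_add _ _)

theorem ofFun_smul (z : ℂ) (x : sphere q a) : ofFun (z • x) = z • ofFun x :=
  Subtype.ext (Double.ofFun_smul _ _)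

theorem ofFun_mul {x y z : sphere q a} (h : (z : OSU q) = x * y) : ofFun z = ofFun x * ofFun y :=
  Subtype.ext ((congrArg (Double.ofFun q) h).trans (Double.ofFun_mul _ _))

theorem ofFun_one {x : sphere q a} (h : (x : OSU q) = 1) : ofFun x = 1 :=
  Subtype.ext ((congrArg (Double.ofFun q) h).trans Double.ofFun_one)

/-- The inclusion of the sphere into `U_q(sl(2,ℝ)_t)` as a linear map. -/
def funL (q : Param) (a : ℝ) : sphere q a →ₗ[ℂ] UqSL q a where
  toFun := ofFun
  map_add' := ofFun_add
  map_smul' := ofFun_smul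

theorem funL_apply (x : sphere q a) : funL q a x = ofFun x := rfl

/-- The generator `X` of the sphere in `U_q(sl(2,ℝ)_t)`. -/
def X (q : Param) (a : ℝ) : UqSL q a := ofFun ⟨sphX q a, sphX_mem q a⟩

/-- The generator `Y` of the sphere in `U_q(sl(2,ℝ)_t)`. -/
def Y (q : Param) (a : ℝ) : UqSL q a := ofFun ⟨sphY q a, sphY_mem q a⟩

/-- The generator `N` of the sphere in `U_q(sl(2,ℝ)_t)`. -/
def N (q : Param) (a : ℝ) : UqSL q a := ofFun ⟨sphN q a, sphN_mem q a⟩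

theorem induction {P : UqSL q a → Prop} (hX : P (X q a)) (hY : P (Y q a)) (hN : P (N q a))
    (hB : P (B q a)) (hc : ∀ z : ℂ, P (algebraMap ℂ _ z)) (hm : ∀ x y, P x → P y → P (x * y))
    (ha : ∀ x y, P x → P y → P (x + y)) (u : UqSL q a) : P u := by
  have h1 : ∀ x (hx : x ∈ sphere q a), P (ofFun ⟨x, hx⟩) := by
    intro x hx
    refine (sphere_induction (P := fun x => ∃ hx : x ∈ sphere q a, P (ofFun ⟨x, hx⟩))
      ⟨_, hX⟩ ⟨_, hY⟩ ⟨_, hN⟩ ?_ ?_ ?_ hx).2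
    · intro z
      have h : algebraMap ℂ (OSU q) z ∈ sphere q a := by
        rw [Algebra.algebraMap_eq_smul_one]
        exact (sphere q a).smul_mem _ (one_mem_sphere q a)
      refine ⟨h, ?_⟩
      convert hc z
      apply Subtype.ext
      exact (Double.funHom q).commutes z
    · rintro x hx y hy ⟨_, px⟩ ⟨_, py⟩
      refine ⟨mul_mem_sphere hx hy, ?_⟩
      rw [ofFun_mul (x := ⟨x, hx⟩) (y := ⟨y, hy⟩) rfl]
      exact hm _ _ px py
    · rintro x hx y hy ⟨_, px⟩ ⟨_, py⟩
      refine ⟨add_mem hx hy, ?_⟩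
      have := ofFun_add (⟨x, hx⟩ : sphere q a) ⟨y, hy⟩
      exact this ▸ ha _ _ px py
  have h2 : ∀ ω (hω : ω ∈ coideal q a), P (ofDual ⟨ω, hω⟩) := by
    intro ω hω
    induction hω using Algebra.adjoin_induction with
    | mem h hh => cases Set.mem_singleton_iff.mp hh; exact hB
    | algebraMap z =>
      convert hc z
      apply Subtype.ext
      exact (Double.dualHom q).commutes z
    | add h h' hh hh' ih ih' =>
      convert ha _ _ ih ih'
      apply Subtype.ext
      exact Double.ofDual_add _ _
    | mul h h' hh hh' ih ih' =>
      convert hm _ _ ih ih'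
      apply Subtype.ext
      exact Double.ofDual_mul _ _
  obtain ⟨u, hu⟩ := u
  induction hu using Algebra.adjoin_induction with
  | mem x hx =>
    rcases hx with ⟨y, hy, rfl⟩ | ⟨y, hy, rfl⟩
    · exact h1 y hy
    · exact h2 y hy
  | algebraMap z => exact hc z
  | add x y hx hy px py => exact ha _ _ px py
  | mul x y hx hy px py => exact hm _ _ px py

theorem TPlus_eq (c : ℝ) : ofFun (TPlus q a c) = qpow q c • X q a + (1 + qC q ^ 2) • N q a -
    (dbracket q a : ℂ) • 1 - (qC q * (qpow q c)⁻¹) • Y q a := by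
  apply Subtype.ext
  change Double.funHom q _ = _
  rw [TPlus_coe]
  simp only [map_sub, map_add, map_smul, map_one]
  rfl

theorem TMinus_eq (c : ℝ) : ofFun (TMinus q a c) = -(qpow q c)⁻¹ • X q a + (1 + qC q ^ 2) • N q a -
    (dbracket q a : ℂ) • 1 + (qC q * qpow q c) • Y q a := by
  apply Subtype.ext
  change Double.funHom q _ = _
  rw [TMinus_coe]
  simp only [map_sub, map_add, map_smul, map_one]
  rfl

theorem AElt_eq (c : ℝ) : ofFun (AElt q a c) = (qC q)⁻¹ • X q a + qC q ^ 2 • Y q a -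
    (qC q * dbracket q c) • N q a := by
  apply Subtype.ext
  change Double.funHom q _ = _
  rw [AElt_coe]
  simp only [map_sub, map_add, map_smul]
  rfl

theorem I_smul_B_coe : ((Complex.I • B q a : UqSL q a) : Double q) =
    Double.ofDual q (Complex.I • Bt q a) := (Double.ofDual_smul _ _).symm

theorem IB_mul_X : (Complex.I • B q a) * X q a = qC q ^ 2 • (X q a * (Complex.I • B q a)) +
    ((qC q ^ 3 + qC q) • N q a - (qC q * dbracket q a) • 1) := by
  apply Subtype.ext
  have := IBt_mul_sphX q a
  rw [← Double.funHom_apply (_ - _)] at this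
  rw [Double.ofFun_smul, smul_mul_assoc, map_sub, map_smul, map_smul, map_one, ← I_smul_B_coe] at this
  exact this

theorem IB_mul_Y : (Complex.I • B q a) * Y q a = (qC q ^ 2)⁻¹ • (Y q a * (Complex.I • B q a)) +
    (((qC q ^ 2)⁻¹ * dbracket q a) • 1 - (1 + (qC q ^ 2)⁻¹) • N q a) := by
  apply Subtype.ext
  have := IBt_mul_sphY q a
  rw [← Double.funHom_apply (_ - _)] at this
  rw [Double.ofFun_smul, smul_mul_assoc, map_sub, map_smul, map_smul, map_one, ← I_smul_B_coe] at this
  exact this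

theorem IB_mul_N : (Complex.I • B q a) * N q a = N q a * (Complex.I • B q a) +
    ((qC q)⁻¹ • X q a - Y q a) := by
  apply Subtype.ext
  have := IBt_mul_sphN q a
  rw [← Double.funHom_apply (_ - _)] at this
  rw [map_sub, map_smul, ← I_smul_B_coe] at this
  exact this

theorem A_mul_TPlus (c : ℝ) : ofFun (AElt q a (c + 2)) * ofFun (TPlus q a c) =
    ofFun (TPlus q a c) * ofFun (AElt q a c) := by
  apply Subtype.ext
  change Double.ofFun q _ * Double.ofFun q _ = Double.ofFun q _ * Double.ofFun q _
  rw [← Double.ofFun_mul, ← Double.ofFun_mul, AElt_mul_TPlus]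

theorem A_mul_TMinus (c : ℝ) : ofFun (AElt q a (c - 2)) * ofFun (TMinus q a c) =
    ofFun (TMinus q a c) * ofFun (AElt q a c) := by
  apply Subtype.ext
  change Double.ofFun q _ * Double.ofFun q _ = Double.ofFun q _ * Double.ofFun q _
  rw [← Double.ofFun_mul, ← Double.ofFun_mul, AElt_mul_TMinus]

theorem TMinus_mul_TPlus (c : ℝ) : ofFun (TMinus q a (c + 2)) * ofFun (TPlus q a c) =
    -((ofFun (AElt q a c) + (qcosh q (c + a + 1) : ℂ) • 1) *
      (ofFun (AElt q a c) - (qcosh q (c - a + 1) : ℂ) • 1)) := by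
  apply Subtype.ext
  change Double.funHom q _ * Double.funHom q _ =
    -((Double.funHom q _ + (qcosh q (c + a + 1) : ℂ) • 1) * (Double.funHom q _ - _ • 1))
  rw [← map_mul, QSL.TMinus_mul_TPlus]
  simp only [map_neg, map_mul, map_add, map_sub, map_smul, map_one]

theorem TPlus_mul_TMinus (c : ℝ) : ofFun (TPlus q a (c - 2)) * ofFun (TMinus q a c) =
    -((ofFun (AElt q a c) + (qcosh q (c + a - 1) : ℂ) • 1) *
      (ofFun (AElt q a c) - (qcosh q (c - a - 1) : ℂ) • 1)) := by
  apply Subtype.ext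
  change Double.funHom q _ * Double.funHom q _ =
    -((Double.funHom q _ + (qcosh q (c + a - 1) : ℂ) • 1) * (Double.funHom q _ - _ • 1))
  rw [← map_mul, QSL.TPlus_mul_TMinus]
  simp only [map_neg, map_mul, map_add, map_sub, map_smul, map_one]

end UqSL

section Modules
variable {q : Param} {a : ℝ} {V : Type*} [AddCommGroup V] [Module (UqSL q a) V] [Module ℂ V]
  [IsScalarTower ℂ (UqSL q a) V]

/-- `v` is a weight vector: `√-1 B_t v = [c] v`. -/
def IsWt (q : Param) (a : ℝ) {V : Type*} [AddCommGroup V] [Module (UqSL q a) V] [Module ℂ V]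
    (c : ℝ) (v : V) : Prop :=
  Complex.I • (UqSL.B q a • v) = (bracket q c : ℂ) • v

theorem isWt_iff {c : ℝ} {v : V} :
    IsWt q a c v ↔ (Complex.I • UqSL.B q a) • v = (bracket q c : ℂ) • v := by
  rw [smul_assoc]; rfl

section
variable {c : ℝ} {v : V}

theorem IsWt.IB_X (hv : IsWt q a c v) : (Complex.I • UqSL.B q a) • UqSL.X q a • v =
    (qC q ^ 2 * bracket q c) • UqSL.X q a • v + (qC q ^ 3 + qC q) • UqSL.N q a • v -
      (qC q * dbracket q a) • v := by
  rw [smul_smul, UqSL.IB_mul_X, add_smul, sub_smul, smul_assoc, mul_smul, isWt_iff.mp hv, smul_assoc,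
    smul_assoc, one_smul, smul_comm (UqSL.X q a), smul_smul, add_sub]

theorem IsWt.IB_Y (hv : IsWt q a c v) : (Complex.I • UqSL.B q a) • UqSL.Y q a • v =
    ((qC q ^ 2)⁻¹ * bracket q c) • UqSL.Y q a • v + ((qC q ^ 2)⁻¹ * dbracket q a) • v -
      (1 + (qC q ^ 2)⁻¹) • UqSL.N q a • v := by
  rw [smul_smul, UqSL.IB_mul_Y, add_smul, sub_smul, smul_assoc, mul_smul, isWt_iff.mp hv, smul_assoc,
    smul_assoc, one_smul, smul_comm (UqSL.Y q a), smul_smul, add_sub]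

theorem IsWt.IB_N (hv : IsWt q a c v) : (Complex.I • UqSL.B q a) • UqSL.N q a • v =
    (bracket q c : ℂ) • UqSL.N q a • v + (qC q)⁻¹ • UqSL.X q a • v - UqSL.Y q a • v := by
  rw [smul_smul, UqSL.IB_mul_N, add_smul, sub_smul, smul_assoc, mul_smul, isWt_iff.mp hv,
    smul_comm (UqSL.N q a), add_sub]

theorem IsWt.TPlus (hv : IsWt q a c v) : IsWt q a (c + 2) (UqSL.ofFun (TPlus q a c) • v) := by
  have hq := qC_ne_zero q
  have hc := qpow_ne_zero q c
  have ha := qpow_ne_zero q a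
  have h1 := qC_sub_inv_ne_zero q
  have h2 : qC q ^ 2 - 1 ≠ 0 := by
    intro h; apply h1; field_simp; linear_combination h
  rw [isWt_iff]
  simp only [UqSL.TPlus_eq, add_smul, sub_smul, smul_assoc, one_smul, smul_add, smul_sub,
    smul_comm (Complex.I • UqSL.B q a) (_ : ℂ), hv.IB_X, hv.IB_Y, hv.IB_N, isWt_iff.mp hv]
  simp only [bracket_eq, dbracket_eq, qpow_add, qpow_two]
  generalize UqSL.X q a • v = x
  generalize UqSL.Y q a • v = y
  generalize UqSL.N q a • v = z
  match_scalars <;> field_simp <;> ring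

theorem IsWt.TMinus (hv : IsWt q a c v) : IsWt q a (c - 2) (UqSL.ofFun (TMinus q a c) • v) := by
  have hq := qC_ne_zero q
  have hc := qpow_ne_zero q c
  have ha := qpow_ne_zero q a
  have h1 := qC_sub_inv_ne_zero q
  have h2 : qC q ^ 2 - 1 ≠ 0 := by
    intro h; apply h1; field_simp; linear_combination h
  rw [isWt_iff]
  simp only [UqSL.TMinus_eq, add_smul, sub_smul, smul_assoc, one_smul, smul_add, smul_sub,
    smul_comm (Complex.I • UqSL.B q a) (_ : ℂ), hv.IB_X, hv.IB_Y, hv.IB_N, isWt_iff.mp hv]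
  simp only [bracket_eq, dbracket_eq, qpow_sub, qpow_two]
  generalize UqSL.X q a • v = x
  generalize UqSL.Y q a • v = y
  generalize UqSL.N q a • v = z
  match_scalars <;> field_simp <;> ring

theorem IsWt.AElt (hv : IsWt q a c v) : IsWt q a c (UqSL.ofFun (AElt q a c) • v) := by
  have hq := qC_ne_zero q
  have hc := qpow_ne_zero q c
  have ha := qpow_ne_zero q a
  have h1 := qC_sub_inv_ne_zero q
  have h2 : qC q ^ 2 - 1 ≠ 0 := by
    intro h; apply h1; field_simp; linear_combination h
  rw [isWt_iff]
  simp only [UqSL.AElt_eq, add_smul, sub_smul, smul_assoc, smul_add, smul_sub,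
    smul_comm (Complex.I • UqSL.B q a) (_ : ℂ), hv.IB_X, hv.IB_Y, hv.IB_N]
  simp only [bracket_eq, dbracket_eq]
  generalize UqSL.X q a • v = x
  generalize UqSL.Y q a • v = y
  generalize UqSL.N q a • v = z
  match_scalars <;> field_simp <;> ring

end
end Modules

/-! ### Ladders of weight vectors -/

section Ladder
variable {q : Param} {a : ℝ} {V : Type} [AddCommGroup V] [Module (UqSL q a) V]

theorem AElt_up (b : ℝ) (v : V) (n : ℕ) : UqSL.ofFun (AElt q a (b + 2 * n)) • up q a b v n =
    up q a b (UqSL.ofFun (AElt q a b) • v) n := by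
  induction n with
  | zero => simp [up]
  | succ n ih =>
    rw [up, smul_smul, show b + 2 * ((n + 1 : ℕ) : ℝ) = b + 2 * n + 2 by push_cast; ring,
      UqSL.A_mul_TPlus, mul_smul, ih]
    rfl

theorem AElt_down (b : ℝ) (v : V) (n : ℕ) : UqSL.ofFun (AElt q a (b - 2 * n)) • down q a b v n =
    down q a b (UqSL.ofFun (AElt q a b) • v) n := by
  induction n with
  | zero => simp [down]
  | succ n ih =>
    rw [down, smul_smul, show b - 2 * ((n + 1 : ℕ) : ℝ) = b - 2 * n - 2 by push_cast; ring,
      UqSL.A_mul_TMinus, mul_smul, ih]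
    rfl

variable [Module ℂ V]

/-- The span of the ladders over the vectors in `S₀`. -/
def ladder (q : Param) (a : ℝ) {V : Type} [AddCommGroup V] [Module (UqSL q a) V] [Module ℂ V]
    (b : ℝ) (S₀ : Submodule ℂ V) : Submodule ℂ V :=
  Submodule.span ℂ {w | ∃ s ∈ S₀, ∃ n, w = up q a b s n ∨ w = down q a b s n}

theorem up_mem_ladder {b : ℝ} {S₀ : Submodule ℂ V} {s : V} (hs : s ∈ S₀) (n : ℕ) :
    up q a b s n ∈ ladder q a b S₀ := Submodule.subset_span ⟨s, hs, n, .inl rfl⟩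

theorem down_mem_ladder {b : ℝ} {S₀ : Submodule ℂ V} {s : V} (hs : s ∈ S₀) (n : ℕ) :
    down q a b s n ∈ ladder q a b S₀ := Submodule.subset_span ⟨s, hs, n, .inr rfl⟩

variable [IsScalarTower ℂ (UqSL q a) V]

theorem up_smul (b : ℝ) (z : ℂ) (v : V) (n : ℕ) : up q a b (z • v) n = z • up q a b v n := by
  induction n with
  | zero => rfl
  | succ n ih => rw [up, ih, smul_comm, up]

theorem down_smul (b : ℝ) (z : ℂ) (v : V) (n : ℕ) : down q a b (z • v) n = z • down q a b v n := by
  induction n with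
  | zero => rfl
  | succ n ih => rw [down, ih, smul_comm, down]

theorem IsWt.up {b : ℝ} {v : V} (hv : IsWt q a b v) (n : ℕ) :
    IsWt q a (b + 2 * n) (up q a b v n) := by
  induction n with
  | zero => simpa [QSL.up] using hv
  | succ n ih =>
    rw [QSL.up, show b + 2 * ((n + 1 : ℕ) : ℝ) = b + 2 * n + 2 by push_cast; ring]
    exact ih.TPlus

theorem IsWt.down {b : ℝ} {v : V} (hv : IsWt q a b v) (n : ℕ) :
    IsWt q a (b - 2 * n) (down q a b v n) := by
  induction n with
  | zero => simpa [QSL.down] using hv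
  | succ n ih =>
    rw [QSL.down, show b - 2 * ((n + 1 : ℕ) : ℝ) = b - 2 * n - 2 by push_cast; ring]
    exact ih.TMinus

theorem TMinus_TPlus_smul (c : ℝ) (v : V) :
    UqSL.ofFun (TMinus q a (c + 2)) • UqSL.ofFun (TPlus q a c) • v =
      ((qcosh q (c - a + 1) - qcosh q (c + a + 1) : ℂ)) • UqSL.ofFun (AElt q a c) • v -
        UqSL.ofFun (AElt q a c) • UqSL.ofFun (AElt q a c) • v +
        (qcosh q (c + a + 1) * qcosh q (c - a + 1) : ℂ) • v := by
  rw [smul_smul, UqSL.TMinus_mul_TPlus]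
  simp only [neg_smul, mul_smul, add_smul, sub_smul, smul_assoc, one_smul, smul_sub]
  rw [smul_comm (UqSL.ofFun (AElt q a c)) (_ : ℂ)]
  generalize UqSL.ofFun (AElt q a c) • UqSL.ofFun (AElt q a c) • v = x
  generalize UqSL.ofFun (AElt q a c) • v = y
  module

theorem TPlus_TMinus_smul (c : ℝ) (v : V) :
    UqSL.ofFun (TPlus q a (c - 2)) • UqSL.ofFun (TMinus q a c) • v =
      ((qcosh q (c - a - 1) - qcosh q (c + a - 1) : ℂ)) • UqSL.ofFun (AElt q a c) • v -
        UqSL.ofFun (AElt q a c) • UqSL.ofFun (AElt q a c) • v +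
        (qcosh q (c + a - 1) * qcosh q (c - a - 1) : ℂ) • v := by
  rw [smul_smul, UqSL.TPlus_mul_TMinus]
  simp only [neg_smul, mul_smul, add_smul, sub_smul, smul_assoc, one_smul, smul_sub]
  rw [smul_comm (UqSL.ofFun (AElt q a c)) (_ : ℂ)]
  generalize UqSL.ofFun (AElt q a c) • UqSL.ofFun (AElt q a c) • v = x
  generalize UqSL.ofFun (AElt q a c) • v = y
  module

/-- The generators in terms of `T_c^±` and `A_c`, for any `c`. -/
theorem X_smul_eq (c : ℝ) (w : V) : UqSL.X q a • w =
    (qpow q (c + 1) / (qcosh q c * qcosh q (c + 1))) • UqSL.ofFun (TPlus q a c) • w -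
    ((qpow q (c - 1))⁻¹ / (qcosh q c * qcosh q (c - 1))) • UqSL.ofFun (TMinus q a c) • w +
    (1 / (qcosh q (c + 1) * qcosh q (c - 1)) : ℂ) • ((qcosh q 1 : ℂ) • UqSL.ofFun (AElt q a c) • w +
      (dbracket q a * dbracket q c : ℂ) • w) := by
  have hq := qC_ne_zero q
  have hc := qpow_ne_zero q c
  have e0 := qpow_add_inv_ne_zero q c
  have e1 := qpow_add_inv_ne_zero q (c + 1)
  have e2 := qpow_add_inv_ne_zero q (c - 1)
  simp only [UqSL.TPlus_eq, UqSL.TMinus_eq, UqSL.AElt_eq, add_smul, sub_smul, smul_assoc, one_smul,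
    qcosh_eq, dbracket_eq q c, qpow_add, qpow_sub, qpow_one] at *
  generalize UqSL.X q a • w = x
  generalize UqSL.Y q a • w = y
  generalize UqSL.N q a • w = z
  generalize (dbracket q a : ℂ) = t
  generalize qpow q c = u at *
  generalize qC q = Q at *
  obtain ⟨d0, h0⟩ : ∃ d, d = u ^ 2 + 1 := ⟨_, rfl⟩
  obtain ⟨d1, h1⟩ : ∃ d, d = u ^ 2 * Q ^ 2 + 1 := ⟨_, rfl⟩
  obtain ⟨d2, h2⟩ : ∃ d, d = u ^ 2 + Q ^ 2 := ⟨_, rfl⟩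
  have g0 : u + u⁻¹ = d0 / u := by rw [h0]; field_simp
  have g1 : u * Q + (u * Q)⁻¹ = d1 / (u * Q) := by rw [h1]; field_simp
  have g2 : u * Q⁻¹ + (u * Q⁻¹)⁻¹ = d2 / (u * Q) := by rw [h2]; field_simp
  rw [g0] at e0
  rw [g1] at e1
  rw [g2] at e2
  rw [g0, g1, g2]
  have f0 : d0 ≠ 0 := by rintro rfl; simp at e0
  have f1 : d1 ≠ 0 := by rintro rfl; simp at e1
  have f2 : d2 ≠ 0 := by rintro rfl; simp at e2
  match_scalars <;> field_simp <;> simp only [h0, h1, h2] <;> ring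

theorem Y_smul_eq (c : ℝ) (w : V) : qC q • UqSL.Y q a • w =
    -((qpow q (c + 1))⁻¹ / (qcosh q c * qcosh q (c + 1))) • UqSL.ofFun (TPlus q a c) • w +
    (qpow q (c - 1) / (qcosh q c * qcosh q (c - 1))) • UqSL.ofFun (TMinus q a c) • w +
    (1 / (qcosh q (c + 1) * qcosh q (c - 1)) : ℂ) • ((qcosh q 1 : ℂ) • UqSL.ofFun (AElt q a c) • w +
      (dbracket q a * dbracket q c : ℂ) • w) := by
  have hq := qC_ne_zero q
  have hc := qpow_ne_zero q c
  have e0 := qpow_add_inv_ne_zero q c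
  have e1 := qpow_add_inv_ne_zero q (c + 1)
  have e2 := qpow_add_inv_ne_zero q (c - 1)
  simp only [UqSL.TPlus_eq, UqSL.TMinus_eq, UqSL.AElt_eq, add_smul, sub_smul, smul_assoc, one_smul,
    qcosh_eq, dbracket_eq q c, qpow_add, qpow_sub, qpow_one] at *
  generalize UqSL.X q a • w = x
  generalize UqSL.Y q a • w = y
  generalize UqSL.N q a • w = z
  generalize (dbracket q a : ℂ) = t
  generalize qpow q c = u at *
  generalize qC q = Q at *
  obtain ⟨d0, h0⟩ : ∃ d, d = u ^ 2 + 1 := ⟨_, rfl⟩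
  obtain ⟨d1, h1⟩ : ∃ d, d = u ^ 2 * Q ^ 2 + 1 := ⟨_, rfl⟩
  obtain ⟨d2, h2⟩ : ∃ d, d = u ^ 2 + Q ^ 2 := ⟨_, rfl⟩
  have g0 : u + u⁻¹ = d0 / u := by rw [h0]; field_simp
  have g1 : u * Q + (u * Q)⁻¹ = d1 / (u * Q) := by rw [h1]; field_simp
  have g2 : u * Q⁻¹ + (u * Q⁻¹)⁻¹ = d2 / (u * Q) := by rw [h2]; field_simp
  rw [g0] at e0
  rw [g1] at e1
  rw [g2] at e2
  rw [g0, g1, g2]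
  have f0 : d0 ≠ 0 := by rintro rfl; simp at e0
  have f1 : d1 ≠ 0 := by rintro rfl; simp at e1
  have f2 : d2 ≠ 0 := by rintro rfl; simp at e2
  match_scalars <;> field_simp <;> simp only [h0, h1, h2] <;> ring

theorem N_smul_eq (c : ℝ) (w : V) : UqSL.N q a • w =
    ((qC q)⁻¹ / (qcosh q c * qcosh q (c + 1))) • UqSL.ofFun (TPlus q a c) • w +
    ((qC q)⁻¹ / (qcosh q c * qcosh q (c - 1))) • UqSL.ofFun (TMinus q a c) • w +
    ((qC q)⁻¹ / qcosh q 1 : ℂ) • ((dbracket q a : ℂ) • w -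
      (dbracket q c / (qcosh q (c + 1) * qcosh q (c - 1)) : ℂ) • ((qcosh q 1 : ℂ) •
        UqSL.ofFun (AElt q a c) • w + (dbracket q a * dbracket q c : ℂ) • w)) := by
  have hq := qC_ne_zero q
  have hc := qpow_ne_zero q c
  have e0 := qpow_add_inv_ne_zero q c
  have e1 := qpow_add_inv_ne_zero q (c + 1)
  have e2 := qpow_add_inv_ne_zero q (c - 1)
  have e3 := qpow_add_inv_ne_zero q 1
  simp only [UqSL.TPlus_eq, UqSL.TMinus_eq, UqSL.AElt_eq, add_smul, sub_smul, smul_assoc, one_smul,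
    qcosh_eq, dbracket_eq q c, qpow_add, qpow_sub, qpow_one] at *
  generalize UqSL.X q a • w = x
  generalize UqSL.Y q a • w = y
  generalize UqSL.N q a • w = z
  generalize (dbracket q a : ℂ) = t
  generalize qpow q c = u at *
  generalize qC q = Q at *
  obtain ⟨d3, h3⟩ : ∃ d, d = Q ^ 2 + 1 := ⟨_, rfl⟩
  obtain ⟨d0, h0⟩ : ∃ d, d = u ^ 2 + 1 := ⟨_, rfl⟩
  obtain ⟨d1, h1⟩ : ∃ d, d = u ^ 2 * Q ^ 2 + 1 := ⟨_, rfl⟩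
  obtain ⟨d2, h2⟩ : ∃ d, d = u ^ 2 + Q ^ 2 := ⟨_, rfl⟩
  have g0 : u + u⁻¹ = d0 / u := by rw [h0]; field_simp
  have g1 : u * Q + (u * Q)⁻¹ = d1 / (u * Q) := by rw [h1]; field_simp
  have g2 : u * Q⁻¹ + (u * Q⁻¹)⁻¹ = d2 / (u * Q) := by rw [h2]; field_simp
  have g3 : Q + Q⁻¹ = d3 / Q := by rw [h3]; field_simp
  rw [g3] at e3
  rw [g0] at e0
  rw [g1] at e1
  rw [g2] at e2
  rw [g0, g1, g2, g3]
  have f0 : d0 ≠ 0 := by rintro rfl; simp at e0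
  have f1 : d1 ≠ 0 := by rintro rfl; simp at e1
  have f2 : d2 ≠ 0 := by rintro rfl; simp at e2
  have f3 : d3 ≠ 0 := by rintro rfl; simp at e3
  match_scalars <;> field_simp <;> simp only [h0, h1, h2, h3] <;> ring

/-- The elements `X`, `Y`, `N` are combinations of `T_c^±`, `A_c` and `1`, for every `c`. -/
theorem generators_smul_mem {W : Submodule ℂ V} {w : V} (c : ℝ) (h0 : w ∈ W)
    (h1 : UqSL.ofFun (TPlus q a c) • w ∈ W) (h2 : UqSL.ofFun (TMinus q a c) • w ∈ W)
    (h3 : UqSL.ofFun (AElt q a c) • w ∈ W) :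
    UqSL.X q a • w ∈ W ∧ UqSL.Y q a • w ∈ W ∧ UqSL.N q a • w ∈ W := by
  have h4 := add_mem (W.smul_mem (qcosh q 1 : ℂ) h3) (W.smul_mem (dbracket q a * dbracket q c : ℂ) h0)
  refine ⟨?_, ?_, ?_⟩
  · rw [X_smul_eq c]
    exact add_mem (sub_mem (W.smul_mem _ h1) (W.smul_mem _ h2)) (W.smul_mem _ h4)
  · rw [← inv_smul_smul₀ (qC_ne_zero q) (UqSL.Y q a • w), Y_smul_eq c]
    exact W.smul_mem _ (add_mem (add_mem (W.smul_mem _ h1) (W.smul_mem _ h2)) (W.smul_mem _ h4))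
  · rw [N_smul_eq c]
    exact add_mem (add_mem (W.smul_mem _ h1) (W.smul_mem _ h2))
      (W.smul_mem _ (sub_mem (W.smul_mem _ h0) (W.smul_mem _ h4)))

/-- A subspace stable under the generators is a submodule. -/
theorem smul_mem_of_generators {W : Submodule ℂ V}
    (h : ∀ w ∈ W, (UqSL.X q a • w ∈ W ∧ UqSL.Y q a • w ∈ W ∧ UqSL.N q a • w ∈ W) ∧
      UqSL.B q a • w ∈ W) (u : UqSL q a) : ∀ w ∈ W, u • w ∈ W := by
  induction u using UqSL.induction with
  | hX => exact fun w hw => (h w hw).1.1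
  | hY => exact fun w hw => (h w hw).1.2.1
  | hN => exact fun w hw => (h w hw).1.2.2
  | hB => exact fun w hw => (h w hw).2
  | hc z => intro w hw; rw [algebraMap_smul]; exact W.smul_mem z hw
  | hm x y hx hy => intro w hw; rw [mul_smul]; exact hx _ (hy _ hw)
  | ha x y hx hy => intro w hw; rw [add_smul]; exact add_mem (hx _ hw) (hy _ hw)

/-- The ladders over an `A_b`-stable space of vectors of weight `[b]` span a submodule. -/
theorem smul_mem_ladder {b : ℝ} {S₀ : Submodule ℂ V} (hw : ∀ s ∈ S₀, IsWt q a b s)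
    (hA : ∀ s ∈ S₀, UqSL.ofFun (AElt q a b) • s ∈ S₀) (u : UqSL q a) :
    ∀ w ∈ ladder q a b S₀, u • w ∈ ladder q a b S₀ := by
  set W := ladder q a b S₀ with hW
  have hB : ∀ {c : ℝ} {w : V}, w ∈ W → IsWt q a c w → UqSL.B q a • w ∈ W := by
    intro c w hw h
    have h2 : UqSL.B q a • w = (-Complex.I * bracket q c) • w := by
      rw [mul_smul, ← h, smul_smul, neg_mul, Complex.I_mul_I, neg_neg, one_smul]
    rw [h2]
    exact W.smul_mem _ hw
  refine smul_mem_of_generators (fun w hw' => ?_) u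
  induction hw' using Submodule.span_induction with
  | zero => simp
  | add x y _ _ hx hy =>
    simp only [smul_add]
    exact ⟨⟨add_mem hx.1.1 hy.1.1, add_mem hx.1.2.1 hy.1.2.1, add_mem hx.1.2.2 hy.1.2.2⟩,
      add_mem hx.2 hy.2⟩
  | smul z x _ hx =>
    simp only [smul_comm _ z]
    exact ⟨⟨W.smul_mem _ hx.1.1, W.smul_mem _ hx.1.2.1, W.smul_mem _ hx.1.2.2⟩, W.smul_mem _ hx.2⟩
  | mem w h =>
    obtain ⟨s, hs, n, rfl | rfl⟩ := h
    · have hAm := AElt_up (q := q) (a := a) b s n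
      refine ⟨generators_smul_mem (b + 2 * n) (up_mem_ladder hs n) (up_mem_ladder hs (n + 1)) ?_ ?_,
        hB (up_mem_ladder hs n) ((hw s hs).up n)⟩
      · cases n with
        | zero => simpa [up, down] using down_mem_ladder (q := q) (a := a) (b := b) hs 1
        | succ n =>
          rw [up, show b + 2 * ((n + 1 : ℕ) : ℝ) = b + 2 * n + 2 by push_cast; ring,
            TMinus_TPlus_smul, AElt_up, AElt_up]
          exact add_mem (sub_mem (W.smul_mem _ (up_mem_ladder (hA s hs) n))
            (up_mem_ladder (hA _ (hA s hs)) n)) (W.smul_mem _ (up_mem_ladder hs n))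
      · rw [hAm]
        exact up_mem_ladder (hA s hs) n
    · have hAm := AElt_down (q := q) (a := a) b s n
      refine ⟨generators_smul_mem (b - 2 * n) (down_mem_ladder hs n) ?_ (down_mem_ladder hs (n + 1)) ?_,
        hB (down_mem_ladder hs n) ((hw s hs).down n)⟩
      · cases n with
        | zero => simpa [up, down] using up_mem_ladder (q := q) (a := a) (b := b) hs 1
        | succ n =>
          rw [down, show b - 2 * ((n + 1 : ℕ) : ℝ) = b - 2 * n - 2 by push_cast; ring,
            TPlus_TMinus_smul, AElt_down, AElt_down]
          exact add_mem (sub_mem (W.smul_mem _ (down_mem_ladder (hA s hs) n))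
            (down_mem_ladder (hA _ (hA s hs)) n)) (W.smul_mem _ (down_mem_ladder hs n))
      · rw [hAm]
        exact down_mem_ladder (hA s hs) n

end Ladder

/-! ### Weight decompositions and representations of `O_q(S_t²) ⋈ I_c` -/

/-- Weight vectors of distinct weights are linearly independent. -/
theorem IsWt.eq_zero_of_sum {q : Param} {a : ℝ} {V : Type*} [AddCommGroup V] [Module (UqSL q a) V]
    [Module ℂ V] [IsScalarTower ℂ (UqSL q a) V] {ι : Type*} {c : ι → ℝ} (hc : Function.Injective c)
    {s : Finset ι} {w : ι → V} (hw : ∀ k ∈ s, IsWt q a (c k) (w k)) (h : ∑ k ∈ s, w k = 0) :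
    ∀ k ∈ s, w k = 0 := by
  classical
  induction s using Finset.induction_on generalizing w with
  | empty => simp
  | insert m s hm ih =>
    have hs : ∀ k ∈ s, w k = 0 := by
      intro k hk
      have h1 : ∑ k ∈ s, ((bracket q (c k) : ℂ) - bracket q (c m)) • w k = 0 := by
        have h2 := congrArg (fun v => (Complex.I • UqSL.B q a) • v - (bracket q (c m) : ℂ) • v) h
        simp only [Finset.smul_sum, ← Finset.sum_sub_distrib, smul_zero, sub_zero] at h2
        rw [Finset.sum_insert hm, isWt_iff.mp (hw m (Finset.mem_insert_self _ _)), sub_self,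
          zero_add] at h2
        rw [← h2]
        refine Finset.sum_congr rfl fun k hk => ?_
        rw [isWt_iff.mp (hw k (Finset.mem_insert_of_mem hk)), sub_smul]
      have h3 := ih (w := fun k => ((bracket q (c k) : ℂ) - bracket q (c m)) • w k) (fun k hk => by
        rw [isWt_iff, smul_comm, isWt_iff.mp (hw k (Finset.mem_insert_of_mem hk)), smul_comm]) h1 k hk
      refine (smul_eq_zero.mp h3).resolve_left fun h4 => ?_
      have h5 : (bracket q (c k) : ℂ) = bracket q (c m) := sub_eq_zero.mp h4
      exact hm (hc (bracket_inj.mp h5) ▸ hk)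
    intro k hk
    rcases Finset.mem_insert.mp hk with rfl | hk
    · rwa [Finset.sum_insert hm, Finset.sum_eq_zero hs, add_zero] at h
    · exact hs k hk

namespace DIc
variable {q : Param} {a : ℝ}

/-- The unit of the `m`-th block of `I_c`, as an element of `O_q(S_t²) ⋈ I_c`. -/
def block (q : Param) (a : ℝ) (m : ℤ) : DIc q a := ofDual ⟨blockUnit q a m, blockUnit_mem_Ic q a m⟩

theorem induction {P : DIc q a → Prop} (hf : ∀ x, P (ofFun x)) (hb : ∀ m, P (block q a m))
    (hm : ∀ x y, P x → P y → P (x * y)) (ha : ∀ x y, P x → P y → P (x + y))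
    (hs : ∀ (z : ℂ) x, P x → P (z • x)) (u : DIc q a) : P u := by
  have h1 : P 1 := by
    have h : ofFun (⟨1, one_mem_sphere q a⟩ : sphere q a) = 1 := Subtype.ext Double.ofFun_one
    exact h ▸ hf _
  have h2 : ∀ ω (hω : ω ∈ Ic q a), P (ofDual ⟨ω, hω⟩) := by
    intro ω hω
    refine (Ic_induction (P := fun ω => ∃ hω : ω ∈ Ic q a, P (ofDual ⟨ω, hω⟩)) ?_ ?_ ?_ ?_ hω).2
    · exact fun m => ⟨blockUnit_mem_Ic q a m, hb m⟩
    · refine ⟨zero_mem _, ?_⟩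
      convert hs 0 _ h1
      rw [zero_smul]
      exact Subtype.ext (map_zero (Double.dualHom q))
    · rintro x y ⟨hx, px⟩ ⟨hy, py⟩
      refine ⟨add_mem hx hy, ?_⟩
      convert ha _ _ px py
      exact Subtype.ext (Double.ofDual_add _ _)
    · rintro z x ⟨hx, px⟩
      refine ⟨Submodule.smul_mem _ z hx, ?_⟩
      convert hs z _ px
      exact Subtype.ext (Double.ofDual_smul _ _)
  obtain ⟨u, hu⟩ := u
  induction hu using Algebra.adjoin_induction with
  | mem x hx =>
    rcases hx with ⟨y, hy, rfl⟩ | ⟨y, hy, rfl⟩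
    · exact hf ⟨y, hy⟩
    · exact h2 y hy
  | algebraMap z =>
    convert hs z _ h1
    rw [← Algebra.algebraMap_eq_smul_one]
    rfl
  | add x y hx hy px py => exact ha _ _ px py
  | mul x y hx hy px py => exact hm _ _ px py

end DIc

/-- A representation `ρ` of `O_q(S_t²) ⋈ I_c` on a `U_q(sl(2,ℝ)_t)`-module which agrees with the
module structure on `O_q(S_t²)`, and for which the units of the blocks of `I_c` form a complete system
of projections onto weight spaces. -/
structure IsWeightRep {q : Param} {a : ℝ} (V : Type) [AddCommGroup V] [Module (UqSL q a) V]
    [Module ℂ V] [IsScalarTower ℂ (UqSL q a) V] (ρ : DIc q a →ₐ[ℂ] Module.End ℂ V) : Prop where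
  fun_apply : ∀ (x : sphere q a) (v : V), ρ (DIc.ofFun x) v = UqSL.ofFun x • v
  block_B : ∀ (m : ℤ) v, ρ (DIc.block q a m) ((Complex.I • UqSL.B q a) • v) =
    (bracket q (a + m) : ℂ) • ρ (DIc.block q a m) v
  isWt : ∀ (m : ℤ) v, IsWt q a (a + m) (ρ (DIc.block q a m) v)
  exists_sum : ∀ v, ∃ s : Finset ℤ, ∑ m ∈ s, ρ (DIc.block q a m) v = v

section Rep
variable {q : Param} {a : ℝ} {V W : Type} [AddCommGroup V] [Module (UqSL q a) V] [Module ℂ V]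
  [IsScalarTower ℂ (UqSL q a) V] [AddCommGroup W] [Module (UqSL q a) W] [Module ℂ W]
  [IsScalarTower ℂ (UqSL q a) W] {ρ : DIc q a →ₐ[ℂ] Module.End ℂ V}

theorem add_intCast_injective (a : ℝ) : Function.Injective fun m : ℤ => a + (m : ℝ) :=
  fun _ _ h => Int.cast_injective (add_left_cancel h)

theorem IsWeightRep.block_of_isWt (h : IsWeightRep V ρ) (m : ℤ) {n : ℤ} {v : V}
    (hv : IsWt q a (a + n) v) : ρ (DIc.block q a m) v = if n = m then v else 0 := by
  have key : ∀ k : ℤ, n ≠ k → ρ (DIc.block q a k) v = 0 := by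
    intro k hk
    have h1 := h.block_B k v
    rw [isWt_iff.mp hv, map_smul, ← sub_eq_zero, ← sub_smul] at h1
    refine (smul_eq_zero.mp h1).resolve_left fun h2 => hk ?_
    have h3 : (bracket q (a + n) : ℂ) = bracket q (a + k) := sub_eq_zero.mp h2
    exact add_intCast_injective a (bracket_inj.mp h3)
  split_ifs with hnm
  · subst hnm
    obtain ⟨s, hs⟩ := h.exists_sum v
    by_cases hn : n ∈ s
    · rwa [Finset.sum_eq_single_of_mem n hn fun k _ hk => key k hk.symm] at hs
    · rw [Finset.sum_eq_zero fun k hk => key k fun h' => hn (h' ▸ hk)] at hs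
      rw [← hs, map_zero]
  · exact key m hnm

theorem IsWeightRep.isAssociatedRep (h : IsWeightRep V ρ) : IsAssociatedRep q a V ρ where
  fun_apply := h.fun_apply
  proj_apply := by
    intro m Φ hΦ n v hv
    have : DIc.ofDual Φ = DIc.block q a m := by
      rw [DIc.block]
      congr 1
      exact Subtype.ext hΦ.eq_blockUnit
    rw [this]
    exact h.block_of_isWt m hv
  nondegenerate := by
    rw [eq_top_iff]
    intro v _
    obtain ⟨s, hs⟩ := h.exists_sum v
    rw [← hs]
    exact Submodule.sum_mem _ fun m _ => Submodule.subset_span ⟨_, v, rfl⟩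

theorem IsWeightRep.map_eq_zero (h : IsWeightRep V ρ) (f : V →ₗ[UqSL q a] W) (x : DIc q a) :
    ∀ v, f v = 0 → f (ρ x v) = 0 := by
  induction x using DIc.induction with
  | hf x => intro v hv; rw [h.fun_apply, map_smul, hv, smul_zero]
  | hb m =>
    intro v hv
    obtain ⟨s, hs⟩ := h.exists_sum v
    have hw : ∀ k : ℤ, IsWt q a (a + k) (f (ρ (DIc.block q a k) v)) := by
      intro k
      have := h.isWt k v
      rw [isWt_iff] at this ⊢
      rw [← map_smul, this, ← algebraMap_smul (UqSL q a), map_smul, algebraMap_smul]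
    by_cases hm : m ∈ s
    · refine IsWt.eq_zero_of_sum (add_intCast_injective a) (s := s) (fun k _ => hw k) ?_ m hm
      rw [← map_sum, hs, hv]
    · rw [← hs, map_sum, Finset.sum_eq_zero, map_zero]
      intro k hk
      rw [h.block_of_isWt m (h.isWt k v), if_neg]
      rintro rfl
      exact hm hk
  | hm x y hx hy => intro v hv; rw [map_mul]; exact hx _ (hy _ hv)
  | ha x y hx hy => intro v hv; rw [map_add, LinearMap.add_apply, map_add, hx v hv, hy v hv, add_zero]
  | hs z x hx =>
    intro v hv
    rw [map_smul, LinearMap.smul_apply, ← algebraMap_smul (UqSL q a), map_smul, hx v hv, smul_zero]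

theorem IsWeightRep.exists_of_surjective (h : IsWeightRep V ρ) (f : V →ₗ[UqSL q a] W)
    (hf : Function.Surjective f) : ∃ ρ' : DIc q a →ₐ[ℂ] Module.End ℂ W,
      IsWeightRep W ρ' ∧ ∀ x v, f (ρ x v) = ρ' x (f v) := by
  let g := Function.surjInv hf
  have hfs : ∀ (z : ℂ) (v : V), f (z • v) = z • f v := fun z v => by
    rw [← algebraMap_smul (UqSL q a), map_smul, algebraMap_smul]
  have hg : ∀ w, f (g w) = w := Function.surjInv_eq hf
  have key : ∀ x v v', f v = f v' → f (ρ x v) = f (ρ x v') := by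
    intro x v v' hv
    rw [← sub_eq_zero, ← map_sub, ← map_sub]
    exact h.map_eq_zero f x _ (by rw [map_sub, hv, sub_self])
  let R : DIc q a → Module.End ℂ W := fun x =>
    { toFun := fun w => f (ρ x (g w))
      map_add' := fun w w' => by
        rw [← map_add, ← map_add]; exact key _ _ _ (by rw [map_add, hg, hg, hg])
      map_smul' := fun z w => by
        rw [RingHom.id_apply, ← hfs, ← map_smul]; exact key _ _ _ (by rw [hfs, hg, hg]) }
  have hR : ∀ x v, R x (f v) = f (ρ x v) := fun x v => key _ _ _ (hg _)
  let ρ' : DIc q a →ₐ[ℂ] Module.End ℂ W := AlgHom.ofLinearMap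
    { toFun := R
      map_add' := fun x y => LinearMap.ext fun w => by
        obtain ⟨v, rfl⟩ := hf w
        rw [LinearMap.add_apply, hR, hR, hR, map_add, LinearMap.add_apply, map_add]
      map_smul' := fun z x => LinearMap.ext fun w => by
        obtain ⟨v, rfl⟩ := hf w
        rw [RingHom.id_apply, LinearMap.smul_apply, hR, hR, map_smul, LinearMap.smul_apply, hfs] }
    (LinearMap.ext fun w => by
        obtain ⟨v, rfl⟩ := hf w
        exact (hR _ _).trans (by rw [map_one]; rfl))
    (fun x y => LinearMap.ext fun w => by
        obtain ⟨v, rfl⟩ := hf w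
        exact (hR _ _).trans (by
          rw [map_mul]
          exact (hR x _).symm.trans (congrArg (R x) (hR y v).symm)))
  have hρ : ∀ x v, f (ρ x v) = ρ' x (f v) := fun x v => (hR x v).symm
  refine ⟨ρ', ⟨?_, ?_, ?_, ?_⟩, hρ⟩
  · intro x w
    obtain ⟨v, rfl⟩ := hf w
    rw [← hρ, h.fun_apply, map_smul]
  · intro m w
    obtain ⟨v, rfl⟩ := hf w
    rw [← map_smul, ← hρ, ← hρ, h.block_B, hfs]
  · intro m w
    obtain ⟨v, rfl⟩ := hf w
    rw [← hρ, isWt_iff, ← map_smul, isWt_iff.mp (h.isWt m v), hfs]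
  · intro w
    obtain ⟨v, rfl⟩ := hf w
    obtain ⟨s, hs⟩ := h.exists_sum v
    refine ⟨s, ?_⟩
    simp only [← hρ]
    rw [← map_sum, hs]

theorem IsWeightRep.exists_of_injective (h : IsWeightRep V ρ) (f : W →ₗ[UqSL q a] V)
    (hf : Function.Injective f) : ∃ ρ' : DIc q a →ₐ[ℂ] Module.End ℂ W,
      IsWeightRep W ρ' ∧ ∀ x w, f (ρ' x w) = ρ x (f w) := by
  have hfs : ∀ (z : ℂ) (v : W), f (z • v) = z • f v := fun z v => by
    rw [← algebraMap_smul (UqSL q a), map_smul, algebraMap_smul]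
  have key : ∀ x w, ∃ w', f w' = ρ x (f w) := by
    intro x w
    have := h.map_eq_zero (LinearMap.range f).mkQ x (f w) (by simp)
    rwa [Submodule.mkQ_apply, Submodule.Quotient.mk_eq_zero] at this
  choose g hg using key
  let ρ' : DIc q a →ₐ[ℂ] Module.End ℂ W := AlgHom.ofLinearMap
    { toFun := fun x =>
        { toFun := g x
          map_add' := fun w w' => hf (by simp only [map_add, hg])
          map_smul' := fun z w => hf (by simp only [hfs, hg, map_smul, RingHom.id_apply]) }
      map_add' := fun x y => LinearMap.ext fun w => hf (by
        change f (g _ w) = f (g x w + g y w)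
        simp only [map_add, hg, LinearMap.add_apply])
      map_smul' := fun z x => LinearMap.ext fun w => hf (by
        change f (g _ w) = f (z • g x w)
        simp only [hfs, hg, map_smul, LinearMap.smul_apply]) }
    (LinearMap.ext fun w => hf (by
        change f (g _ w) = f w
        rw [hg, map_one]; rfl))
    (fun x y => LinearMap.ext fun w => hf (by
        change f (g _ w) = f (g x (g y w))
        rw [hg, hg, hg, map_mul]; rfl))
  have hρ : ∀ x w, f (ρ' x w) = ρ x (f w) := hg
  refine ⟨ρ', ⟨?_, ?_, ?_, ?_⟩, hρ⟩
  · exact fun x w => hf (by rw [hρ, h.fun_apply, map_smul])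
  · exact fun m w => hf (by rw [hρ, map_smul, h.block_B, hfs, hρ])
  · exact fun m w => isWt_iff.mpr (hf (by
      rw [map_smul, hρ, isWt_iff.mp (h.isWt m _), hfs, hρ]))
  · intro w
    obtain ⟨s, hs⟩ := h.exists_sum (f w)
    refine ⟨s, hf ?_⟩
    simp only [map_sum, hρ, hs]

end Rep

/-! ### The induced module `O_q(SU(2))` -/

section Induced
variable {q : Param} {a : ℝ}

instance : Module (UqSL q a) (OSU q) :=
  Module.compHom (OSU q) ((indRep q).comp (UqSL q a).val).toRingHom

theorem UqSL.smul_def (u : UqSL q a) (x : OSU q) : u • x = indRep q u x := rfl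

instance : IsScalarTower ℂ (UqSL q a) (OSU q) where
  smul_assoc z u x := by
    rw [UqSL.smul_def, UqSL.smul_def]
    change indRep q (z • (u : Double q)) x = _
    rw [map_smul, LinearMap.smul_apply]

theorem UqSL.ofFun_smul_OSU (x : sphere q a) (y : OSU q) : UqSL.ofFun x • y = (x : OSU q) * y :=
  indRep_ofFun (x : OSU q) y

theorem UqSL.IB_smul_OSU (y : OSU q) :
    (Complex.I • UqSL.B q a) • y = adjAct (Complex.I • Bt q a) y := by
  rw [UqSL.smul_def, UqSL.I_smul_B_coe, indRep_ofDual]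

theorem adjForm_one_tmul (x : OSU q ⊗[ℂ] (OSU q ⊗[ℂ] OSU q)) : ∃ s : Finset ℤ, ∀ s', s ⊆ s' →
    ∑ m ∈ s', adjForm (blockUnit q a m) x = adjForm 1 x := by
  classical
  induction x using TensorProduct.induction_on with
  | zero => exact ⟨∅, by simp⟩
  | add x y hx hy =>
    obtain ⟨s, hs⟩ := hx
    obtain ⟨t, ht⟩ := hy
    refine ⟨s ∪ t, fun s' h => ?_⟩
    simp only [map_add, Finset.sum_add_distrib]
    rw [hs s' (Finset.union_subset_left h), ht s' (Finset.union_subset_right h)]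
  | tmul x y =>
    induction y using TensorProduct.induction_on with
    | zero => exact ⟨∅, by simp⟩
    | add y z hx hy =>
      obtain ⟨s, hs⟩ := hx
      obtain ⟨t, ht⟩ := hy
      refine ⟨s ∪ t, fun s' h => ?_⟩
      simp only [map_add, Finset.sum_add_distrib, TensorProduct.tmul_add]
      rw [hs s' (Finset.union_subset_left h), ht s' (Finset.union_subset_right h)]
    | tmul y z =>
      obtain ⟨s, hs⟩ := exists_sum_eigProj a (z * SInv q x)
      refine ⟨s, fun s' h => ?_⟩
      simp only [adjForm_tmul]
      rw [← Finset.sum_smul, one_ofConv]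
      congr 1
      change ∑ m ∈ s', Coalgebra.counit (R := ℂ) (eigProj q a m (z * SInv q x)) = _
      rw [← map_sum, hs s' h]

theorem isWeightRep_indRep (q : Param) (a : ℝ) :
    IsWeightRep (a := a) (OSU q) ((indRep q).comp (DIc q a).val) := by
  have hb : ∀ m, ((indRep q).comp (DIc q a).val) (DIc.block q a m) = adjAct (blockUnit q a m) :=
    fun m => indRep_ofDual _
  refine ⟨?_, ?_, ?_, ?_⟩
  · exact fun x v => rfl
  · intro m v
    rw [hb, UqSL.IB_smul_OSU, ← Module.End.mul_apply, ← adjAct_mul, blockUnit_mul_Bt, adjAct_smul,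
      LinearMap.smul_apply]
  · intro m v
    rw [hb, isWt_iff, UqSL.IB_smul_OSU, ← Module.End.mul_apply, ← adjAct_mul, Bt_mul_blockUnit,
      adjAct_smul, LinearMap.smul_apply]
  · intro v
    obtain ⟨s, hs⟩ := adjForm_one_tmul (a := a) (comul₂ q v)
    refine ⟨s, ?_⟩
    simp only [hb, adjAct_apply]
    rw [hs s subset_rfl, ← adjAct_apply, adjAct_one]
    rfl

end Induced

/-! ### Transcendence of `A_c` -/

section Shift
variable (q : Param)

/-- The operator of the shift representation on sequences by which `α` acts. -/
def shiftA : Module.End ℂ (ℕ → ℂ) where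
  toFun v n := (1 - qC q ^ (2 * (n + 1))) * v (n + 1)
  map_add' v w := by ext n; simp [mul_add]
  map_smul' z v := by ext n; simp; ring

/-- The operator of the shift representation on sequences by which `α*` acts. -/
def shiftAs : Module.End ℂ (ℕ → ℂ) where
  toFun v n := match n with
    | 0 => 0
    | n + 1 => v n
  map_add' v w := by ext n; cases n <;> simp
  map_smul' z v := by ext n; cases n <;> simp

/-- The operator of the shift representation on sequences by which `γ` and `γ*` act. -/
def shiftC : Module.End ℂ (ℕ → ℂ) where
  toFun v n := qC q ^ n * v n
  map_add' v w := by ext n; simp [mul_add]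
  map_smul' z v := by ext n; simp; ring

theorem shift_quad : Quad q (Module.End ℂ (ℕ → ℂ)) (shiftA q) shiftAs (shiftC q) (shiftC q) := by
  constructor <;> ext v n <;>
    first
    | rfl
    | (cases n <;> simp [shiftA, shiftAs, shiftC] <;> ring)

/-- The representation of `O_q(SU(2))` on sequences by weighted shifts. -/
def shiftRep : OSU q →ₐ[ℂ] Module.End ℂ (ℕ → ℂ) := lift (shift_quad q)

theorem shiftRep_gen (g : Gen) : shiftRep q (gen q g) =
    assign (shiftA q) shiftAs (shiftC q) (shiftC q) g := lift_gen _ _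

/-- `A_c` raises the top degree of a finite sequence by two. -/
theorem shiftRep_AElt (a c : ℝ) {d : ℕ} {v : ℕ → ℂ} (h : ∀ n, d < n → v n = 0) :
    shiftRep q (AElt q a c) v (d + 2) = qC q * v d ∧
      ∀ n, d + 2 < n → shiftRep q (AElt q a c) v n = 0 := by
  have hq := qC_ne_zero q
  have key : ∀ n, d < n + 1 → shiftRep q (AElt q a c) v (n + 2) = qC q * v n := by
    intro n hn
    rw [AElt_coe]
    simp only [sphX, sphY, sphN, sphZ, map_add, map_sub, map_smul, map_mul, shiftRep_gen, assign,
      LinearMap.add_apply, LinearMap.sub_apply, LinearMap.smul_apply, Module.End.mul_apply,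
      Pi.add_apply, Pi.sub_apply, Pi.smul_apply, smul_eq_mul, shiftA, shiftAs, shiftC,
      LinearMap.coe_mk, AddHom.coe_mk]
    rw [h (n + 1) hn, h (n + 2) (by omega), h (n + 2 + 1) (by omega), h (n + 2 + 1 + 1) (by omega)]
    field_simp
    ring
  refine ⟨key d (by omega), fun n hn => ?_⟩
  obtain ⟨m, rfl⟩ : ∃ m, n = m + 2 := ⟨n - 2, by omega⟩
  rw [key m (by omega), h m (by omega), mul_zero]

theorem shiftRep_AElt_pow (a c : ℝ) (k : ℕ) :
    shiftRep q ((AElt q a c : OSU q) ^ k) (Pi.single 0 1) (2 * k) = qC q ^ k ∧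
      ∀ n, 2 * k < n → shiftRep q ((AElt q a c : OSU q) ^ k) (Pi.single 0 1) n = 0 := by
  induction k with
  | zero =>
    simp only [pow_zero, map_one, Module.End.one_apply]
    exact ⟨Pi.single_eq_same _ _, fun n hn => Pi.single_eq_of_ne (by omega) _⟩
  | succ k ih =>
    rw [pow_succ', map_mul, Module.End.mul_apply]
    have := shiftRep_AElt q a c ih.2
    rw [ih.1] at this
    exact ⟨this.1.trans (pow_succ' _ _).symm, this.2⟩

end Shift

open Polynomial in
/-- `A_c` satisfies no polynomial equation. -/
theorem aeval_AElt_ne_zero (q : Param) (a c : ℝ) {p : ℂ[X]} (hp : p ≠ 0) :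
    aeval (AElt q a c : OSU q) p ≠ 0 := by
  intro h
  have h1 := congrArg (fun x => shiftRep q x (Pi.single 0 1) (2 * p.natDegree)) h
  simp only [map_zero, LinearMap.zero_apply, Pi.zero_apply] at h1
  rw [aeval_eq_sum_range, map_sum, Finset.sum_range_succ, LinearMap.add_apply, Pi.add_apply,
    LinearMap.sum_apply, Finset.sum_apply, Finset.sum_eq_zero, zero_add, map_smul,
    LinearMap.smul_apply, Pi.smul_apply, (shiftRep_AElt_pow q a c _).1, smul_eq_mul,
    coeff_natDegree] at h1
  · exact mul_ne_zero (leadingCoeff_ne_zero.mpr hp) (pow_ne_zero _ (qC_ne_zero q)) h1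
  · intro k hk
    rw [map_smul, LinearMap.smul_apply, Pi.smul_apply, (shiftRep_AElt_pow q a c k).2, smul_zero]
    have := Finset.mem_range.mp hk
    omega

open Polynomial in
/-- If `T' T` is a nonzero polynomial in `A_c`, then `T` is not in `T ℂ[A_c] (A_c - λ)`. -/
theorem ne_mul_aeval_mul {q : Param} {a c : ℝ} {T T' : OSU q} {x y : ℂ}
    (hT : T' * T = -(((AElt q a c : OSU q) + x • 1) * (AElt q a c - y • 1))) (p : ℂ[X]) (lam : ℂ) :
    T ≠ T * (aeval (AElt q a c : OSU q) p * (AElt q a c - lam • 1)) := by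
  intro h
  have h1 : T' * T * (1 - aeval (AElt q a c : OSU q) p * (AElt q a c - lam • 1)) = 0 := by
    rw [mul_sub, mul_one, mul_assoc, ← h, sub_self]
  have h2 : aeval (AElt q a c : OSU q) (-((X + C x) * (X - C y)) * (1 - p * (X - C lam))) = 0 := by
    rw [← h1, hT]
    simp [Algebra.algebraMap_eq_smul_one]
  refine aeval_AElt_ne_zero q a c ?_ h2
  refine mul_ne_zero (neg_ne_zero.mpr (mul_ne_zero (X_add_C_ne_zero x) (X_sub_C_ne_zero y))) ?_
  intro h3
  simpa using congrArg (eval lam) h3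

/-! ### The universal modules `M_{λ,b}` -/

section Universal
variable {q : Param} {a : ℝ}

theorem isWt_M_e (lam b : ℝ) : IsWt q a b (M.e q a lam b) := by
  rw [isWt_iff, ← sub_eq_zero, ← algebraMap_smul (UqSL q a) (bracket q b : ℂ), ← sub_smul, M.e, ← map_smul,
    smul_eq_mul, mul_one, Submodule.mkQ_apply, Submodule.Quotient.mk_eq_zero]
  exact Submodule.subset_span (Set.mem_insert _ _)

theorem AElt_smul_M_e (lam b : ℝ) :
    UqSL.ofFun (AElt q a b) • M.e q a lam b = (lam : ℂ) • M.e q a lam b := by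
  rw [← sub_eq_zero, ← algebraMap_smul (UqSL q a), ← sub_smul, M.e, ← map_smul,
    smul_eq_mul, mul_one, Submodule.mkQ_apply, Submodule.Quotient.mk_eq_zero]
  exact Submodule.subset_span (Set.mem_insert_of_mem _ rfl)

theorem exists_smul_M_e {lam b : ℝ} (v : M q a lam b) : ∃ u : UqSL q a, v = u • M.e q a lam b := by
  obtain ⟨u, rfl⟩ := Submodule.mkQ_surjective _ v
  exact ⟨u, by rw [M.e, ← map_smul, smul_eq_mul, mul_one]⟩

variable {V : Type} [AddCommGroup V] [Module (UqSL q a) V]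

theorem map_up {W : Type} [AddCommGroup W] [Module (UqSL q a) W] (f : V →ₗ[UqSL q a] W) (b : ℝ)
    (v : V) (n : ℕ) : f (up q a b v n) = up q a b (f v) n := by
  induction n with
  | zero => rfl
  | succ n ih => rw [up, map_smul, ih, up]

theorem map_down {W : Type} [AddCommGroup W] [Module (UqSL q a) W] (f : V →ₗ[UqSL q a] W) (b : ℝ)
    (v : V) (n : ℕ) : f (down q a b v n) = down q a b (f v) n := by
  induction n with
  | zero => rfl
  | succ n ih => rw [down, map_smul, ih, down]

variable [Module ℂ V] [IsScalarTower ℂ (UqSL q a) V]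

/-- The universal property of `M_{λ,b}`. -/
theorem exists_lift_M {lam b : ℝ} {v : V} (h1 : IsWt q a b v)
    (h2 : UqSL.ofFun (AElt q a b) • v = (lam : ℂ) • v) :
    ∃ f : M q a lam b →ₗ[UqSL q a] V, f (M.e q a lam b) = v := by
  refine ⟨(basicIdeal q a lam b).liftQ (LinearMap.toSpanSingleton (UqSL q a) V v) ?_, ?_⟩
  · rw [basicIdeal, Submodule.span_le]
    rintro u (rfl | rfl)
    · simp only [SetLike.mem_coe, LinearMap.mem_ker, LinearMap.toSpanSingleton_apply, sub_smul,
        algebraMap_smul]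
      rw [isWt_iff.mp h1, sub_self]
    · simp only [SetLike.mem_coe, LinearMap.mem_ker, LinearMap.toSpanSingleton_apply, sub_smul,
        algebraMap_smul]
      rw [h2, sub_self]
  · rw [M.e, Submodule.mkQ_apply, Submodule.liftQ_apply, LinearMap.toSpanSingleton_apply, one_smul]

/-- The module generated by an eigenvector of `A_b` of weight `[b]` is spanned by its ladder. -/
theorem smul_mem_span_ladder {lam : ℂ} {b : ℝ} {v : V} (h1 : IsWt q a b v)
    (h2 : UqSL.ofFun (AElt q a b) • v = lam • v) (u : UqSL q a) :
    u • v ∈ Submodule.span ℂ (Set.range (up q a b v) ∪ Set.range (down q a b v)) := by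
  have h3 := smul_mem_ladder (q := q) (a := a) (b := b) (S₀ := Submodule.span ℂ {v})
    (fun s hs => by
      obtain ⟨z, rfl⟩ := Submodule.mem_span_singleton.mp hs
      rw [isWt_iff, smul_comm, isWt_iff.mp h1, smul_comm])
    (fun s hs => by
      obtain ⟨z, rfl⟩ := Submodule.mem_span_singleton.mp hs
      rw [smul_comm, h2]
      exact Submodule.smul_mem _ _ (Submodule.smul_mem _ _ (Submodule.mem_span_singleton_self v)))
    u v (up_mem_ladder (Submodule.mem_span_singleton_self v) 0)
  refine Submodule.span_le.mpr ?_ h3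
  rintro w ⟨s, hs, n, hw⟩
  obtain ⟨z, rfl⟩ := Submodule.mem_span_singleton.mp hs
  rw [up_smul, down_smul] at hw
  rcases hw with rfl | rfl
  · exact Submodule.smul_mem _ _ (Submodule.subset_span (.inl ⟨n, rfl⟩))
  · exact Submodule.smul_mem _ _ (Submodule.subset_span (.inr ⟨n, rfl⟩))

theorem span_ladder_M (lam b : ℝ) : Submodule.span ℂ
    (Set.range (up q a b (M.e q a lam b)) ∪ Set.range (down q a b (M.e q a lam b))) = ⊤ := by
  rw [eq_top_iff]
  intro v _
  obtain ⟨u, rfl⟩ := exists_smul_M_e v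
  exact smul_mem_span_ladder (isWt_M_e lam b) (AElt_smul_M_e lam b) u

end Universal

/-! ### The sphere as a module -/

section SphereModule
variable {q : Param} {a : ℝ}

/-- Moving `√-1 B_t` past an element of the sphere. -/
theorem IB_mul_ofFun (x : sphere q a) : ∃ x' x'' : sphere q a,
    (Complex.I • UqSL.B q a) * UqSL.ofFun x =
      UqSL.ofFun x' * (Complex.I • UqSL.B q a) + UqSL.ofFun x'' := by
  obtain ⟨x, hx⟩ := x
  refine (sphere_induction (P := fun x => ∃ hx : x ∈ sphere q a, ∃ x' x'' : sphere q a,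
    (Complex.I • UqSL.B q a) * UqSL.ofFun ⟨x, hx⟩ =
      UqSL.ofFun x' * (Complex.I • UqSL.B q a) + UqSL.ofFun x'') ?_ ?_ ?_ ?_ ?_ ?_ hx).2
  · refine ⟨sphX_mem q a, qC q ^ 2 • ⟨_, sphX_mem q a⟩, (qC q ^ 3 + qC q) • ⟨_, sphN_mem q a⟩ -
      (qC q * dbracket q a) • ⟨1, one_mem_sphere q a⟩, ?_⟩
    refine UqSL.IB_mul_X.trans ?_
    simp only [← UqSL.funL_apply, map_sub, map_smul]
    rw [smul_mul_assoc, UqSL.funL_apply ⟨1, _⟩, UqSL.ofFun_one rfl]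
    rfl
  · refine ⟨sphY_mem q a, (qC q ^ 2)⁻¹ • ⟨_, sphY_mem q a⟩,
      ((qC q ^ 2)⁻¹ * dbracket q a) • ⟨1, one_mem_sphere q a⟩ -
      (1 + (qC q ^ 2)⁻¹) • ⟨_, sphN_mem q a⟩, ?_⟩
    refine UqSL.IB_mul_Y.trans ?_
    simp only [← UqSL.funL_apply, map_sub, map_smul]
    rw [smul_mul_assoc, UqSL.funL_apply ⟨1, _⟩, UqSL.ofFun_one rfl]
    rfl
  · refine ⟨sphN_mem q a, ⟨_, sphN_mem q a⟩, (qC q)⁻¹ • ⟨_, sphX_mem q a⟩ - ⟨_, sphY_mem q a⟩, ?_⟩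
    refine UqSL.IB_mul_N.trans ?_
    simp only [← UqSL.funL_apply, map_sub, map_smul]
    rfl
  · intro z
    have h : algebraMap ℂ (OSU q) z ∈ sphere q a := by
      rw [Algebra.algebraMap_eq_smul_one]
      exact (sphere q a).smul_mem _ (one_mem_sphere q a)
    have h2 : UqSL.ofFun (⟨_, h⟩ : sphere q a) = algebraMap ℂ _ z :=
      Subtype.ext ((Double.funHom q).commutes z)
    refine ⟨h, ⟨_, h⟩, 0, ?_⟩
    rw [h2, ← Algebra.commutes, ← UqSL.funL_apply 0, map_zero, add_zero]
  · rintro x _ y _ ⟨hx, x', x'', h1⟩ ⟨hy, y', y'', h2⟩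
    have hm : ∀ x y : sphere q a, (x : OSU q) * y ∈ sphere q a := fun x y => mul_mem_sphere x.2 y.2
    refine ⟨mul_mem_sphere hx hy, ⟨_, hm x' y'⟩, ⟨_, hm x' y''⟩ + ⟨_, hm x'' ⟨y, hy⟩⟩, ?_⟩
    rw [UqSL.ofFun_add, UqSL.ofFun_mul (x := ⟨x, hx⟩) (y := ⟨y, hy⟩) rfl,
      UqSL.ofFun_mul (z := ⟨_, hm x' y'⟩) rfl, UqSL.ofFun_mul (z := ⟨_, hm x' y''⟩) rfl,
      UqSL.ofFun_mul (z := ⟨_, hm x'' ⟨y, hy⟩⟩) rfl, ← mul_assoc, h1, add_mul, mul_assoc, h2, mul_add,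
      mul_assoc, add_assoc]
  · rintro x _ y _ ⟨hx, x', x'', h1⟩ ⟨hy, y', y'', h2⟩
    refine ⟨add_mem hx hy, x' + y', x'' + y'', ?_⟩
    have := UqSL.ofFun_add (⟨x, hx⟩ : sphere q a) ⟨y, hy⟩
    change _ * UqSL.ofFun (⟨x, hx⟩ + ⟨y, hy⟩) = _
    rw [this, mul_add, h1, h2, UqSL.ofFun_add, UqSL.ofFun_add, add_mul]
    abel

theorem isWt_one_OSU : IsWt q a a (1 : OSU q) := by
  rw [isWt_iff, UqSL.IB_smul_OSU, adjAct_apply_one]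
  congr 1
  have := I_smul_Bt_apply_of_mem (one_mem_sphere q a)
  rw [Bialgebra.counit_one, mul_one] at this
  exact this

theorem ofFun_smul_one (x : sphere q a) : UqSL.ofFun x • (1 : OSU q) = x := by
  rw [UqSL.ofFun_smul_OSU, mul_one]

/-- The action of `√-1 B_t` on the elements `x v`, where `v` has weight `[a]`. -/
theorem IB_smul_ofFun_smul (x : sphere q a) : ∃ y : sphere q a, ∀ {V : Type} [AddCommGroup V]
    [Module (UqSL q a) V] [Module ℂ V] [IsScalarTower ℂ (UqSL q a) V] {v : V}, IsWt q a a v →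
    (Complex.I • UqSL.B q a) • UqSL.ofFun x • v = UqSL.ofFun y • v := by
  obtain ⟨x', x'', h⟩ := IB_mul_ofFun x
  refine ⟨(bracket q a : ℂ) • x' + x'', fun hv => ?_⟩
  rw [smul_smul, h, add_smul, mul_smul, isWt_iff.mp hv, UqSL.ofFun_add, UqSL.ofFun_smul, add_smul,
    smul_assoc, smul_comm]

theorem B_eq : UqSL.B q a = -Complex.I • (Complex.I • UqSL.B q a) := by
  rw [smul_smul, neg_mul, Complex.I_mul_I, neg_neg, one_smul]

/-- The sphere as a submodule of `O_q(SU(2))`. -/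
def sphereMod (q : Param) (a : ℝ) : Submodule (UqSL q a) (OSU q) where
  carrier := sphere q a
  add_mem' := add_mem
  zero_mem' := zero_mem _
  smul_mem' := by
    intro u x hx
    refine smul_mem_of_generators (W := sphere q a) (fun w hw => ⟨⟨?_, ?_, ?_⟩, ?_⟩) u x hx
    · rw [UqSL.X, UqSL.ofFun_smul_OSU]; exact mul_mem_sphere (sphX_mem q a) hw
    · rw [UqSL.Y, UqSL.ofFun_smul_OSU]; exact mul_mem_sphere (sphY_mem q a) hw
    · rw [UqSL.N, UqSL.ofFun_smul_OSU]; exact mul_mem_sphere (sphN_mem q a) hw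
    · obtain ⟨y, hy⟩ := IB_smul_ofFun_smul ⟨w, hw⟩
      have := hy (isWt_one_OSU (q := q) (a := a))
      rw [ofFun_smul_one, ofFun_smul_one] at this
      rw [B_eq, smul_assoc, this]
      exact Submodule.smul_mem _ _ y.2

/-- A vector of weight `[a]` receives a module homomorphism from the sphere, with `1 ↦ v`. -/
theorem exists_sphereMod_hom {V : Type} [AddCommGroup V] [Module (UqSL q a) V] [Module ℂ V]
    [IsScalarTower ℂ (UqSL q a) V] {v : V} (hv : IsWt q a a v) :
    ∃ f : sphereMod q a →ₗ[UqSL q a] V, ∀ (x : OSU q) (hx : x ∈ sphere q a),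
      f ⟨x, hx⟩ = UqSL.ofFun ⟨x, hx⟩ • v := by
  let g : sphereMod q a → V := fun x => UqSL.ofFun (⟨x.1, x.2⟩ : sphere q a) • v
  have hadd : ∀ x y, g (x + y) = g x + g y := fun x y => by
    have := UqSL.ofFun_add (⟨x.1, x.2⟩ : sphere q a) ⟨y.1, y.2⟩
    exact (congrArg (· • v) this).trans (add_smul _ _ _)
  have hsm : ∀ (z : ℂ) x, g (z • x) = z • g x := fun z x => by
    have := UqSL.ofFun_smul z (⟨x.1, x.2⟩ : sphere q a)
    exact (congrArg (· • v) this).trans (smul_assoc _ _ _)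
  have hfun : ∀ (y : sphere q a) x, g (UqSL.ofFun y • x) = UqSL.ofFun y • g x := fun y x => by
    have := UqSL.ofFun_mul (x := y) (y := (⟨x.1, x.2⟩ : sphere q a))
      (z := ⟨_, (UqSL.ofFun y • x).2⟩) (UqSL.ofFun_smul_OSU y x.1)
    exact (congrArg (· • v) this).trans (mul_smul _ _ _)
  refine ⟨{ toFun := g, map_add' := hadd, map_smul' := fun u => ?_ }, fun x hx => rfl⟩
  simp only [RingHom.id_apply]
  induction u using UqSL.induction with
  | hX => exact hfun _
  | hY => exact hfun _
  | hN => exact hfun _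
  | hB =>
    intro x
    obtain ⟨y, hy⟩ := IB_smul_ofFun_smul (⟨x.1, x.2⟩ : sphere q a)
    have h1 := hy (isWt_one_OSU (q := q) (a := a))
    rw [ofFun_smul_one, ofFun_smul_one] at h1
    have h2 : (Complex.I • UqSL.B q a) • x = ⟨y.1, y.2⟩ := Subtype.ext h1
    rw [B_eq, smul_assoc, hsm, h2, smul_assoc, hy hv]
  | hc z => intro x; rw [algebraMap_smul, hsm, algebraMap_smul]
  | hm u w hu hw => intro x; rw [mul_smul, mul_smul, hu, hw]
  | ha u w hu hw => intro x; rw [add_smul, add_smul, hadd, hu, hw]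

/-- The module `M_{λ,a}` is a quotient of the sphere, on which `I_c` acts by the weight projections. -/
theorem exists_isWeightRep_M (lam : ℝ) : ∃ ρ : DIc q a →ₐ[ℂ] Module.End ℂ (M q a lam a),
    IsWeightRep (M q a lam a) ρ := by
  obtain ⟨ρ₁, h₁, -⟩ := (isWeightRep_indRep q a).exists_of_injective (sphereMod q a).subtype
    Subtype.val_injective
  obtain ⟨f, hf⟩ := exists_sphereMod_hom (isWt_M_e (q := q) (a := a) lam a)
  have hs : Function.Surjective f := by
    intro v
    obtain ⟨u, rfl⟩ := exists_smul_M_e v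
    refine ⟨u • ⟨1, one_mem_sphere q a⟩, ?_⟩
    rw [map_smul, hf, UqSL.ofFun_one rfl, one_smul]
  obtain ⟨ρ₂, h₂, -⟩ := h₁.exists_of_surjective f hs
  exact ⟨ρ₂, h₂⟩

end SphereModule

/-! ### The ladder of `M_{λ,a}` does not break at once -/

section NonVanishing
variable {q : Param} {a : ℝ}

open Polynomial in
/-- The vectors `e_{a±2}` of `M_{λ,a}` do not vanish: otherwise `T_a^±` would lie in the left ideal of
the sphere generated by `A_a - λ`, and hence, comparing weights, in `T_a^± ℂ[A_a] (A_a - λ)`. -/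
theorem ofFun_smul_M_e_ne_zero (lam : ℝ) :
    UqSL.ofFun (TPlus q a a) • M.e q a lam a ≠ 0 ∧ UqSL.ofFun (TMinus q a a) • M.e q a lam a ≠ 0 := by
  set A : OSU q := (AElt q a a : OSU q) with hA
  let L : ℂ[X] →ₗ[ℂ] OSU q := LinearMap.mulRight ℂ (A - (lam : ℂ) • 1) ∘ₗ (aeval A).toLinearMap
  let S₀ : Submodule ℂ (OSU q) := LinearMap.range L
  have hL : ∀ p, L (X * p) = UqSL.ofFun (AElt q a a) • L p := by
    intro p
    rw [UqSL.ofFun_smul_OSU]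
    simp [L, hA, mul_assoc]
  have hAS : ∀ s ∈ S₀, UqSL.ofFun (AElt q a a) • s ∈ S₀ := by
    rintro _ ⟨p, rfl⟩
    exact ⟨X * p, hL p⟩
  have hw : ∀ s ∈ S₀, IsWt q a a s := by
    have h1 : IsWt q a a (L 1) := by
      have := (isWt_one_OSU (q := q) (a := a)).AElt
      rw [UqSL.ofFun_smul_OSU, mul_one] at this
      have h2 := isWt_one_OSU (q := q) (a := a)
      rw [isWt_iff] at this h2 ⊢
      simp only [L, LinearMap.comp_apply, AlgHom.toLinearMap_apply, map_one, LinearMap.mulRight_apply,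
        one_mul]
      rw [smul_sub, this, smul_comm, h2, smul_sub, smul_comm (lam : ℂ)]
    rintro _ ⟨p, rfl⟩
    induction p using Polynomial.induction_on' with
    | add p r hp hr =>
      rw [isWt_iff] at *
      rw [map_add, smul_add, hp, hr, smul_add]
    | monomial n z =>
      have : ∀ n : ℕ, IsWt q a a (L (X ^ n)) := by
        intro n
        induction n with
        | zero => rwa [pow_zero]
        | succ n ih => rw [pow_succ', hL]; exact ih.AElt
      have h3 := this n
      rw [isWt_iff] at *
      rw [← C_mul_X_pow_eq_monomial, ← smul_eq_C_mul, map_smul, smul_comm, h3, smul_comm]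
  have hρ := isWeightRep_indRep q a
  set ρ := (indRep q).comp (DIc q a).val
  -- an element killing the generator lies in the left ideal, hence in the ladder over `S₀`
  have key : ∀ x : sphere q a, UqSL.ofFun x • M.e q a lam a = 0 → (x : OSU q) ∈ ladder q a a S₀ := by
    intro x hx
    rw [M.e, ← map_smul, smul_eq_mul, mul_one, Submodule.mkQ_apply, Submodule.Quotient.mk_eq_zero,
      basicIdeal, Submodule.mem_span_pair] at hx
    obtain ⟨u, v, huv⟩ := hx
    have h1 := congrArg (· • (1 : OSU q)) huv
    simp only [add_smul, smul_eq_mul, mul_smul, sub_smul, algebraMap_smul, ofFun_smul_one] at h1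
    rw [isWt_iff.mp isWt_one_OSU, sub_self, smul_zero, zero_add] at h1
    rw [← h1]
    have e : L 1 = A - (lam : ℂ) • 1 := by simp [L]
    have h2 : A - (lam : ℂ) • 1 ∈ S₀ := e ▸ ⟨1, rfl⟩
    exact smul_mem_ladder hw hAS v _ (up_mem_ladder h2 0)
  have hup : ∀ s ∈ S₀, ∀ (n : ℕ) (m : ℤ), ρ (DIc.block q a m) (up q a a s n) =
      if (n : ℤ) * 2 = m then up q a a s n else 0 := by
    intro s hs n m
    have := (hw s hs).up n
    rw [show a + 2 * (n : ℝ) = a + ((n * 2 : ℤ) : ℝ) by push_cast; ring] at this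
    exact hρ.block_of_isWt m this
  have hdown : ∀ s ∈ S₀, ∀ (n : ℕ) (m : ℤ), ρ (DIc.block q a m) (down q a a s n) =
      if (n : ℤ) * -2 = m then down q a a s n else 0 := by
    intro s hs n m
    have := (hw s hs).down n
    rw [show a - 2 * (n : ℝ) = a + ((n * -2 : ℤ) : ℝ) by push_cast; ring] at this
    exact hρ.block_of_isWt m this
  constructor
  · intro h
    have hT : ∀ w ∈ ladder q a a S₀, ∃ p, ρ (DIc.block q a 2) w = (TPlus q a a : OSU q) * L p := by
      intro w hw'
      induction hw' using Submodule.span_induction with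
      | zero => exact ⟨0, by simp⟩
      | add x y _ _ hx hy =>
        obtain ⟨p, hp⟩ := hx
        obtain ⟨r, hr⟩ := hy
        exact ⟨p + r, by rw [map_add, hp, hr, map_add, mul_add]⟩
      | smul z x _ hx =>
        obtain ⟨p, hp⟩ := hx
        exact ⟨z • p, by rw [map_smul, hp, map_smul, mul_smul_comm]⟩
      | mem w h =>
        obtain ⟨s, hs, n, rfl | rfl⟩ := h
        · rw [hup s hs]
          split_ifs with hn
          · obtain rfl : n = 1 := by omega
            obtain ⟨p, rfl⟩ := hs
            refine ⟨p, ?_⟩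
            simp [up, UqSL.ofFun_smul_OSU]
          · exact ⟨0, by simp⟩
        · rw [hdown s hs, if_neg (by omega)]
          exact ⟨0, by simp⟩
    obtain ⟨p, hp⟩ := hT _ (key _ h)
    have h3 : IsWt q a (a + (2 : ℤ)) (TPlus q a a : OSU q) := by
      have := (isWt_one_OSU (q := q) (a := a)).TPlus
      rw [ofFun_smul_one] at this
      exact_mod_cast this
    rw [hρ.block_of_isWt 2 h3, if_pos rfl] at hp
    exact ne_mul_aeval_mul (TMinus_mul_TPlus q a a) p lam hp
  · intro h
    have hT : ∀ w ∈ ladder q a a S₀, ∃ p, ρ (DIc.block q a (-2)) w = (TMinus q a a : OSU q) * L p := by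
      intro w hw'
      induction hw' using Submodule.span_induction with
      | zero => exact ⟨0, by simp⟩
      | add x y _ _ hx hy =>
        obtain ⟨p, hp⟩ := hx
        obtain ⟨r, hr⟩ := hy
        exact ⟨p + r, by rw [map_add, hp, hr, map_add, mul_add]⟩
      | smul z x _ hx =>
        obtain ⟨p, hp⟩ := hx
        exact ⟨z • p, by rw [map_smul, hp, map_smul, mul_smul_comm]⟩
      | mem w h =>
        obtain ⟨s, hs, n, rfl | rfl⟩ := h
        · rw [hup s hs, if_neg (by omega)]
          exact ⟨0, by simp⟩
        · rw [hdown s hs]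
          split_ifs with hn
          · obtain rfl : n = 1 := by omega
            obtain ⟨p, rfl⟩ := hs
            refine ⟨p, ?_⟩
            simp [down, UqSL.ofFun_smul_OSU]
          · exact ⟨0, by simp⟩
    obtain ⟨p, hp⟩ := hT _ (key _ h)
    have h3 : IsWt q a (a + (-2 : ℤ)) (TMinus q a a : OSU q) := by
      have := (isWt_one_OSU (q := q) (a := a)).TMinus
      rw [ofFun_smul_one] at this
      push_cast
      exact this
    rw [hρ.block_of_isWt (-2) h3, if_pos rfl] at hp
    exact ne_mul_aeval_mul (TPlus_mul_TMinus q a a) p lam hp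

end NonVanishing

/-! ### The involution of the dual on `I` -/

/-- The multiplicative conjugate linear map `x ↦ S(x)*`, which transposes the matrix `u`. -/
def starS (q : Param) (x : OSU q) : OSU q := star (S q x)

section
variable {q : Param}

theorem starS_add (x y : OSU q) : starS q (x + y) = starS q x + starS q y := by simp [starS, S]

theorem starS_mul (x y : OSU q) : starS q (x * y) = starS q x * starS q y := by simp [starS, S]

theorem starS_smul (z : ℂ) (x : OSU q) : starS q (z • x) = conj z • starS q x := by
  simp only [starS, S, map_smul, MulOpposite.unop_smul]
  exact star_smul z _

theorem starS_one : starS q (1 : OSU q) = 1 := by simp [starS, S]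

theorem starS_mat (i j : Fin 2) : starS q (mat q i j) = mat q j i := by
  have hq := qC_ne_zero q
  have h : ∀ g, S q (gen q g) = (assign (R := (OSU q)ᵐᵒᵖ) (.op (αs q)) (.op (α q))
      (.op (-qC q • γ q)) (.op (-(qC q)⁻¹ • γs q)) g).unop := fun g =>
    congrArg MulOpposite.unop (lift_gen (antipode_quad q (qC_ne_zero q)) g)
  obtain ⟨h1, h2, h3, h4⟩ := star_gen q
  have hst : ∀ (z : ℂ) (x : OSU q), star (z • x) = conj z • star x := star_smul
  have hg : ∀ g, starS q (gen q g) = assign (α q) (αs q) (-qC q • γs q) (-(qC q)⁻¹ • γ q) g := by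
    intro g
    rw [starS, h]
    cases g <;> simp [assign, h1, h2, h3, h4, hst, conj_qC]
  have hneg : ∀ x : OSU q, starS q (-x) = -starS q x := fun x => by simp [starS, S]
  fin_cases i <;> fin_cases j <;>
    simp [mat, hg, assign, starS_smul, hneg, conj_qC, hq]

/-- The coproduct of `S(x)*` is `∑ S(x₂)* ⊗ S(x₁)*`. -/
theorem comul_starS (x : OSU q) : ∃ (ι : Type) (_ : Fintype ι) (y z : ι → OSU q),
    Coalgebra.comul (R := ℂ) x = ∑ i, y i ⊗ₜ[ℂ] z i ∧
      Coalgebra.comul (R := ℂ) (starS q x) = ∑ i, starS q (z i) ⊗ₜ[ℂ] starS q (y i) := by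
  induction x using OSU.induction with
  | hc c =>
    rw [Algebra.algebraMap_eq_smul_one]
    refine ⟨Unit, inferInstance, fun _ => c • 1, fun _ => 1, ?_, ?_⟩
    · simp [Algebra.TensorProduct.one_def, TensorProduct.smul_tmul']
    · simp [starS_smul, starS_one, Algebra.TensorProduct.one_def]
  | hg g =>
    obtain ⟨c, i, j, h⟩ := gen_mem_mat q g
    refine ⟨Fin 2, inferInstance, fun k => c • mat q i k, fun k => mat q k j, ?_, ?_⟩
    · rw [h, map_smul, comul_mat, Finset.smul_sum]
      rfl
    · rw [h, starS_smul, starS_mat, map_smul, comul_mat, Finset.smul_sum]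
      simp only [starS_smul, starS_mat, TensorProduct.tmul_smul]
  | hm x y hx hy =>
    obtain ⟨ι, _, y, z, h1, h2⟩ := hx
    obtain ⟨κ, _, y', z', h3, h4⟩ := hy
    refine ⟨ι × κ, inferInstance, fun p => y p.1 * y' p.2, fun p => z p.1 * z' p.2, ?_, ?_⟩
    · rw [Bialgebra.comul_mul, h1, h3, Finset.sum_mul_sum, Fintype.sum_prod_type]
      simp
    · rw [starS_mul, Bialgebra.comul_mul, h2, h4, Finset.sum_mul_sum, Fintype.sum_prod_type]
      simp [starS_mul]
  | ha x y hx hy =>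
    obtain ⟨ι, _, y, z, h1, h2⟩ := hx
    obtain ⟨κ, _, y', z', h3, h4⟩ := hy
    refine ⟨ι ⊕ κ, inferInstance, Sum.elim y y', Sum.elim z z', ?_, ?_⟩
    · simp [h1, h3]
    · simp [starS_add, h2, h4]

theorem dualStar_apply (ω : U q) (x : OSU q) :
    (dualStar q ω).ofConv x = conj (ω.ofConv (starS q x)) := rfl

theorem dualStar_add (ω ν : U q) : dualStar q (ω + ν) = dualStar q ω + dualStar q ν := by
  apply WithConv.ofConv_injective
  ext x
  simp [dualStar_apply]

theorem dualStar_smul (z : ℂ) (ω : U q) : dualStar q (z • ω) = conj z • dualStar q ω := by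
  apply WithConv.ofConv_injective
  ext x
  simp [dualStar_apply]

theorem conv_apply {ω ν : U q} {x : OSU q} {ι : Type} [Fintype ι] {y z : ι → OSU q}
    (h : Coalgebra.comul (R := ℂ) x = ∑ i, y i ⊗ₜ[ℂ] z i) :
    (ω * ν).ofConv x = ∑ i, ω.ofConv (y i) * ν.ofConv (z i) := by
  rw [LinearMap.convMul_def]
  simp [h]

theorem dualStar_mul (ω ν : U q) : dualStar q (ω * ν) = dualStar q ν * dualStar q ω := by
  apply WithConv.ofConv_injective
  ext x
  obtain ⟨ι, _, y, z, h1, h2⟩ := comul_starS x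
  rw [dualStar_apply, conv_apply h1, conv_apply h2, map_sum]
  refine Finset.sum_congr rfl fun i _ => ?_
  rw [map_mul, dualStar_apply, dualStar_apply, mul_comm]

theorem counit_starS (x : OSU q) : Coalgebra.counit (R := ℂ) (starS q x) =
    conj (Coalgebra.counit (R := ℂ) x) := by
  induction x using OSU.induction with
  | hc c => simp [Algebra.algebraMap_eq_smul_one, starS_smul, starS_one]
  | hg g =>
    obtain ⟨c, i, j, h⟩ := gen_mem_mat q g
    rw [h, starS_smul, starS_mat, map_smul, map_smul, counit_mat, counit_mat]
    fin_cases i <;> fin_cases j <;> simp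
  | hm x y hx hy => rw [starS_mul, counit_mul, hx, hy, counit_mul, map_mul]
  | ha x y hx hy => rw [starS_add, map_add, hx, hy, map_add, map_add]

theorem dualStar_one : dualStar q 1 = 1 := by
  apply WithConv.ofConv_injective
  ext x
  rw [dualStar_apply, one_ofConv, counit_starS, Complex.conj_conj]

theorem kInv_starS (x : OSU q) : (kInv q).ofConv (starS q x) = conj ((kInv q).ofConv x) := by
  induction x using OSU.induction with
  | hc c => simp [Algebra.algebraMap_eq_smul_one, starS_smul, starS_one, kInv_one]
  | hg g =>
    obtain ⟨c, i, j, h⟩ := gen_mem_mat q g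
    rw [h, starS_smul, starS_mat, map_smul, map_smul, kInv_mat, kInv_mat]
    fin_cases i <;> fin_cases j <;> simp [conj_qC]
  | hm x y hx hy => rw [starS_mul, kInv_mul, hx, hy, kInv_mul, map_mul]
  | ha x y hx hy => rw [starS_add, map_add, hx, hy, map_add, map_add]

theorem skewD_starS (x : OSU q) : (skewD q).ofConv (starS q x) = -conj ((skewD q).ofConv x) := by
  induction x using OSU.induction with
  | hc c => simp [Algebra.algebraMap_eq_smul_one, starS_smul, starS_one, skewD_one]
  | hg g =>
    obtain ⟨c, i, j, h⟩ := gen_mem_mat q g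
    rw [h, starS_smul, starS_mat, map_smul, map_smul, skewD_mat, skewD_mat]
    fin_cases i <;> fin_cases j <;> simp
  | hm x y hx hy =>
    rw [starS_mul, skewD_mul, hx, hy, skewD_mul, map_add, map_mul, map_mul, counit_starS, kInv_starS]
    ring
  | ha x y hx hy => rw [starS_add, map_add, hx, hy, map_add, map_add]; ring

theorem dualStar_Bt (a : ℝ) : dualStar q (Bt q a) = -Bt q a := by
  have h : dualStar q (Complex.I • Bt q a) = Complex.I • Bt q a := by
    rw [I_smul_Bt]
    apply WithConv.ofConv_injective
    ext x
    simp [dualStar_apply, skewD_starS, kInv_starS]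
  rw [dualStar_smul, Complex.conj_I] at h
  have h2 := congrArg (Complex.I • ·) h
  simpa [smul_smul] using h2

/-! ### Invariant forms -/

section Forms
variable {a : ℝ} {V : Type} [AddCommGroup V] [Module (UqSL q a) V] [Module ℂ V]

theorem IsInvariantForm.X {F : V →ₗ⋆[ℂ] V →ₗ[ℂ] ℂ} (hF : IsInvariantForm q a F) (v w : V) :
    F v (UqSL.X q a • w) = F ((qC q • UqSL.Y q a) • v) w := by
  rw [UqSL.Y, ← UqSL.ofFun_smul]
  exact hF.invariant_fun _ _ (star_sphX q a).symm v w

theorem IsInvariantForm.Y {F : V →ₗ⋆[ℂ] V →ₗ[ℂ] ℂ} (hF : IsInvariantForm q a F) (v w : V) :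
    F v (UqSL.Y q a • w) = F (((qC q)⁻¹ • UqSL.X q a) • v) w := by
  rw [UqSL.X, ← UqSL.ofFun_smul]
  exact hF.invariant_fun _ _ (star_sphY q a).symm v w

theorem IsInvariantForm.N {F : V →ₗ⋆[ℂ] V →ₗ[ℂ] ℂ} (hF : IsInvariantForm q a F) (v w : V) :
    F v (UqSL.N q a • w) = F (UqSL.N q a • v) w :=
  hF.invariant_fun _ _ (star_sphN q a).symm v w

theorem IsInvariantForm.B {F : V →ₗ⋆[ℂ] V →ₗ[ℂ] ℂ} (hF : IsInvariantForm q a F) (v w : V) :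
    F v (UqSL.B q a • w) = F ((-UqSL.B q a) • v) w := by
  have h0 : Bt q a ∈ coideal q a := Algebra.subset_adjoin (Set.mem_singleton _)
  have e : -UqSL.B q a = UqSL.ofDual ⟨-Bt q a, neg_mem h0⟩ := by
    apply Subtype.ext
    change -Double.dualHom q _ = Double.dualHom q _
    rw [map_neg]
  rw [e]
  exact hF.invariant_dual _ _ (dualStar_Bt a).symm v w

/-- Vectors of different weights are orthogonal. -/
theorem IsInvariantForm.eq_zero_of_isWt {F : V →ₗ⋆[ℂ] V →ₗ[ℂ] ℂ} (hF : IsInvariantForm q a F)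
    {b c : ℝ} (hbc : b ≠ c) {v w : V} (hv : IsWt q a b v) (hw : IsWt q a c w) : F v w = 0 := by
  have h1 := hF.B v w
  have h2 : ∀ {b : ℝ} {v : V}, IsWt q a b v → UqSL.B q a • v = (-Complex.I * bracket q b) • v := by
    intro b v h
    rw [mul_smul, ← h, smul_smul, neg_mul, Complex.I_mul_I, neg_neg, one_smul]
  rw [neg_smul, h2 hv, h2 hw, map_smul, map_neg, map_smulₛₗ F, LinearMap.neg_apply,
    LinearMap.smul_apply] at h1
  simp only [map_mul, map_neg, Complex.conj_I, Complex.conj_ofReal, smul_eq_mul] at h1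
  have h3 : ((bracket q b : ℂ) - bracket q c) * F v w = 0 := by
    have h4 : Complex.I * (((bracket q b : ℂ) - bracket q c) * F v w) = 0 := by
      linear_combination h1
    exact (mul_eq_zero.mp h4).resolve_left Complex.I_ne_zero
  refine (mul_eq_zero.mp h3).resolve_left fun h => hbc ?_
  exact bracket_inj.mp (sub_eq_zero.mp h)

variable [IsScalarTower ℂ (UqSL q a) V]

/-- Invariance of a form need only be checked on the generators. -/
theorem isInvariantForm_of_generators {F : V →ₗ⋆[ℂ] V →ₗ[ℂ] ℂ}
    (hX : ∀ v w, F v (UqSL.X q a • w) = F (qC q • UqSL.Y q a • v) w)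
    (hY : ∀ v w, F v (qC q • UqSL.Y q a • w) = F (UqSL.X q a • v) w)
    (hN : ∀ v w, F v (UqSL.N q a • w) = F (UqSL.N q a • v) w)
    (hB : ∀ v w, F v ((Complex.I • UqSL.B q a) • w) = F ((Complex.I • UqSL.B q a) • v) w) :
    IsInvariantForm q a F where
  invariant_fun := by
    have key : ∀ x ∈ sphere q a, ∃ (hx : x ∈ sphere q a) (hy : star x ∈ sphere q a),
        ∀ v w : V, F v (UqSL.ofFun ⟨x, hx⟩ • w) = F (UqSL.ofFun ⟨star x, hy⟩ • v) w := by
      intro x hx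
      have hq := qC_ne_zero q
      refine sphere_induction (P := fun x => ∃ (hx : x ∈ sphere q a) (hy : star x ∈ sphere q a),
        ∀ v w : V, F v (UqSL.ofFun ⟨x, hx⟩ • w) = F (UqSL.ofFun ⟨star x, hy⟩ • v) w) ?_ ?_ ?_ ?_ ?_ ?_ hx
      · refine ⟨sphX_mem q a, star_mem_sphere (sphX_mem q a), fun v w => ?_⟩
        have : UqSL.ofFun ⟨star (sphX q a), star_mem_sphere (sphX_mem q a)⟩ = qC q • UqSL.Y q a := by
          rw [UqSL.Y, ← UqSL.ofFun_smul]
          congr 1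
          exact Subtype.ext (star_sphX q a)
        rw [this, smul_assoc]
        exact hX v w
      · refine ⟨sphY_mem q a, star_mem_sphere (sphY_mem q a), fun v w => ?_⟩
        have : UqSL.ofFun ⟨star (sphY q a), star_mem_sphere (sphY_mem q a)⟩ =
            (qC q)⁻¹ • UqSL.X q a := by
          rw [UqSL.X, ← UqSL.ofFun_smul]
          congr 1
          exact Subtype.ext (star_sphY q a)
        have h := (F v).map_smul (qC q) (UqSL.Y q a • w)
        rw [this, smul_assoc, map_smulₛₗ F, LinearMap.smul_apply, ← hY, h, map_inv₀, conj_qC,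
          inv_smul_smul₀ hq]
        rfl
      · refine ⟨sphN_mem q a, star_mem_sphere (sphN_mem q a), fun v w => ?_⟩
        have : UqSL.ofFun ⟨star (sphN q a), star_mem_sphere (sphN_mem q a)⟩ = UqSL.N q a := by
          rw [UqSL.N]
          congr 1
          exact Subtype.ext (star_sphN q a)
        rw [this]
        exact hN v w
      · intro z
        have h : ∀ z, algebraMap ℂ (OSU q) z ∈ sphere q a := fun z => by
          rw [Algebra.algebraMap_eq_smul_one]
          exact (sphere q a).smul_mem _ (one_mem_sphere q a)
        have h2 : ∀ z, UqSL.ofFun (⟨_, h z⟩ : sphere q a) = algebraMap ℂ _ z :=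
          fun z => Subtype.ext ((Double.funHom q).commutes z)
        refine ⟨h z, star_mem_sphere (h z), fun v w => ?_⟩
        have h3 : UqSL.ofFun ⟨star (algebraMap ℂ (OSU q) z), star_mem_sphere (h z)⟩ =
            algebraMap ℂ _ (conj z) := by
          rw [← h2]
          congr 1
          apply Subtype.ext
          simp only [Algebra.algebraMap_eq_smul_one, star_smul, star_one]
          rfl
        rw [h2, h3, algebraMap_smul, algebraMap_smul, map_smul, map_smulₛₗ F, LinearMap.smul_apply,
          Complex.conj_conj]
      · rintro x _ y _ ⟨hx, hx', h1⟩ ⟨hy, hy', h2⟩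
        have hm := mul_mem_sphere hx hy
        refine ⟨hm, star_mem_sphere hm, fun v w => ?_⟩
        rw [UqSL.ofFun_mul (z := ⟨x * y, hm⟩) (x := ⟨x, hx⟩) (y := ⟨y, hy⟩) rfl,
          UqSL.ofFun_mul (z := ⟨star (x * y), star_mem_sphere hm⟩) (x := ⟨_, hy'⟩) (y := ⟨_, hx'⟩)
          (star_mul x y), mul_smul, mul_smul, h1, h2]
      · rintro x _ y _ ⟨hx, hx', h1⟩ ⟨hy, hy', h2⟩
        have hm := add_mem hx hy
        refine ⟨hm, star_mem_sphere hm, fun v w => ?_⟩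
        have e1 : UqSL.ofFun ⟨x + y, hm⟩ = UqSL.ofFun ⟨x, hx⟩ + UqSL.ofFun ⟨y, hy⟩ :=
          UqSL.ofFun_add ⟨x, hx⟩ ⟨y, hy⟩
        have e2 : UqSL.ofFun ⟨star (x + y), star_mem_sphere hm⟩ =
            UqSL.ofFun ⟨_, hx'⟩ + UqSL.ofFun ⟨_, hy'⟩ := by
          rw [← UqSL.ofFun_add]
          congr 1
          exact Subtype.ext (star_add x y)
        rw [e1, e2, add_smul, add_smul, map_add, map_add, LinearMap.add_apply, h1, h2]
    rintro ⟨x, hx⟩ ⟨y, hy⟩ h v w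
    obtain ⟨_, _, h1⟩ := key x hx
    obtain rfl : y = star x := h
    exact h1 v w
  invariant_dual := by
    have key : ∀ ω ∈ coideal q a, ∃ (hω : ω ∈ coideal q a) (hν : dualStar q ω ∈ coideal q a),
        ∀ v w : V, F v (UqSL.ofDual ⟨ω, hω⟩ • w) = F (UqSL.ofDual ⟨dualStar q ω, hν⟩ • v) w := by
      intro ω hω
      induction hω using Algebra.adjoin_induction with
      | mem ω h =>
        obtain rfl := Set.mem_singleton_iff.mp h
        have h0 : Bt q a ∈ coideal q a := Algebra.subset_adjoin (Set.mem_singleton _)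
        have h1 : dualStar q (Bt q a) ∈ coideal q a := by rw [dualStar_Bt]; exact neg_mem h0
        refine ⟨h0, h1, fun v w => ?_⟩
        have h2 : UqSL.ofDual ⟨_, h1⟩ = -UqSL.B q a := by
          apply Subtype.ext
          exact (congrArg (Double.dualHom q) (dualStar_Bt a)).trans (map_neg (Double.dualHom q) _)
        have h3 := hB v w
        rw [h2, neg_smul, map_neg, LinearMap.neg_apply]
        rw [smul_assoc, smul_assoc, map_smul, map_smulₛₗ F, LinearMap.smul_apply, Complex.conj_I,
          neg_smul, ← smul_neg] at h3
        exact smul_right_injective ℂ Complex.I_ne_zero h3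
      | algebraMap z =>
        have h : ∀ z, algebraMap ℂ (U q) z ∈ coideal q a := fun z => Subalgebra.algebraMap_mem _ z
        have h2 : ∀ z, UqSL.ofDual (⟨_, h z⟩ : coideal q a) = algebraMap ℂ _ z :=
          fun z => Subtype.ext ((Double.dualHom q).commutes z)
        have h3 : dualStar q (algebraMap ℂ (U q) z) = algebraMap ℂ (U q) (conj z) := by
          rw [Algebra.algebraMap_eq_smul_one, dualStar_smul, dualStar_one,
            Algebra.algebraMap_eq_smul_one]
        refine ⟨h z, h3 ▸ h _, fun v w => ?_⟩
        have h4 : UqSL.ofDual ⟨dualStar q (algebraMap ℂ (U q) z), h3 ▸ h _⟩ =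
            algebraMap ℂ (UqSL q a) (conj z) := by
          rw [← h2]
          congr 1
          exact Subtype.ext h3
        rw [h2, h4, algebraMap_smul, algebraMap_smul, map_smul, map_smulₛₗ F, LinearMap.smul_apply,
          Complex.conj_conj]
      | add ω ν _ _ ih ih' =>
        obtain ⟨hω, hω', h1⟩ := ih
        obtain ⟨hν, hν', h2⟩ := ih'
        have h3 : dualStar q (ω + ν) ∈ coideal q a := by rw [dualStar_add]; exact add_mem hω' hν'
        refine ⟨add_mem hω hν, h3, fun v w => ?_⟩
        have e1 : UqSL.ofDual ⟨ω + ν, add_mem hω hν⟩ = UqSL.ofDual ⟨ω, hω⟩ + UqSL.ofDual ⟨ν, hν⟩ :=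
          Subtype.ext (Double.ofDual_add _ _)
        have e2 : UqSL.ofDual ⟨_, h3⟩ = UqSL.ofDual ⟨_, hω'⟩ + UqSL.ofDual ⟨_, hν'⟩ := by
          apply Subtype.ext
          exact (congrArg (Double.ofDual q) (dualStar_add ω ν)).trans (Double.ofDual_add _ _)
        rw [e1, e2, add_smul, add_smul, map_add, map_add, LinearMap.add_apply, h1, h2]
      | mul ω ν _ _ ih ih' =>
        obtain ⟨hω, hω', h1⟩ := ih
        obtain ⟨hν, hν', h2⟩ := ih'
        have h3 : dualStar q (ω * ν) ∈ coideal q a := by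
          rw [dualStar_mul]; exact (coideal q a).mul_mem hν' hω'
        refine ⟨(coideal q a).mul_mem hω hν, h3, fun v w => ?_⟩
        have e1 : UqSL.ofDual ⟨ω * ν, (coideal q a).mul_mem hω hν⟩ =
            UqSL.ofDual ⟨ω, hω⟩ * UqSL.ofDual ⟨ν, hν⟩ := Subtype.ext (Double.ofDual_mul _ _)
        have e2 : UqSL.ofDual ⟨_, h3⟩ = UqSL.ofDual ⟨_, hν'⟩ * UqSL.ofDual ⟨_, hω'⟩ := by
          apply Subtype.ext
          exact (congrArg (Double.ofDual q) (dualStar_mul ω ν)).trans (Double.ofDual_mul _ _)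
        rw [e1, e2, mul_smul, mul_smul, h1, h2]
    rintro ⟨x, hx⟩ ⟨y, hy⟩ h v w
    obtain ⟨_, _, h1⟩ := key x hx
    obtain rfl : y = dualStar q x := h
    exact h1 v w

/-- If a submodule is orthogonal to a cyclic vector, it is orthogonal to everything. -/
theorem IsInvariantForm.eq_zero_of_cyclic {F : V →ₗ⋆[ℂ] V →ₗ[ℂ] ℂ} (hF : IsInvariantForm q a F)
    {K : Submodule (UqSL q a) V} {e : V} (he : ∀ v ∈ K, F v e = 0) (u : UqSL q a) :
    ∀ v ∈ K, F v (u • e) = 0 := by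
  have key : ∀ u : UqSL q a, ∀ w, (∀ v ∈ K, F v w = 0) → ∀ v ∈ K, F v (u • w) = 0 := by
    intro u
    induction u using UqSL.induction with
    | hX => intro w hw v hv; rw [hF.X]; exact hw _ (K.smul_mem _ hv)
    | hY => intro w hw v hv; rw [hF.Y]; exact hw _ (K.smul_mem _ hv)
    | hN => intro w hw v hv; rw [hF.N]; exact hw _ (K.smul_mem _ hv)
    | hB => intro w hw v hv; rw [hF.B]; exact hw _ (K.smul_mem _ hv)
    | hc z => intro w hw v hv; rw [algebraMap_smul, map_smul, hw v hv, smul_zero]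
    | hm x y hx hy => intro w hw; rw [mul_smul]; exact hx _ (hy _ hw)
    | ha x y hx hy => intro w hw v hv; rw [add_smul, map_add, hx w hw v hv, hy w hw v hv, add_zero]
  exact key u e he

end Forms

end

/-! ### Ladders indexed by the integers -/

/-- The ladder over `e_b = v`, indexed by the integers: `lad n = e_{b+2n}`. -/
def lad (q : Param) (a : ℝ) {V : Type} [AddCommGroup V] [Module (UqSL q a) V] (b : ℝ) (v : V) :
    ℤ → V
  | .ofNat n => up q a b v n
  | .negSucc n => down q a b v (n + 1)

/-- The coefficient in `T⁻_{c+2} T⁺_c e_c = s e_c` for `c = b + 2n`, where `e_c` is an eigenvector of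
`A_c` with eigenvalue `λ`. -/
def step (q : Param) (a lam b : ℝ) (n : ℤ) : ℝ :=
  -((lam + qcosh q (b + 2 * n + a + 1)) * (lam - qcosh q (b + 2 * n - a + 1)))

/-- The product of the coefficients `step` met between `e_b` and `e_{b+2n}`. -/
def stepProd (q : Param) (a lam b : ℝ) : ℤ → ℝ
  | .ofNat n => ∏ k ∈ Finset.range n, step q a lam b k
  | .negSucc n => ∏ k ∈ Finset.range (n + 1), step q a lam b (-(k : ℤ) - 1)

section
variable {q : Param} {a : ℝ}

theorem lad_natCast {V : Type} [AddCommGroup V] [Module (UqSL q a) V] (b : ℝ) (v : V) (n : ℕ) :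
    lad q a b v n = up q a b v n := rfl

theorem lad_neg_natCast {V : Type} [AddCommGroup V] [Module (UqSL q a) V] (b : ℝ) (v : V) (n : ℕ) :
    lad q a b v (-(n : ℤ)) = down q a b v n := by
  cases n with
  | zero => rfl
  | succ n => rfl

theorem map_lad {V W : Type} [AddCommGroup V] [Module (UqSL q a) V] [AddCommGroup W]
    [Module (UqSL q a) W] (f : V →ₗ[UqSL q a] W) (b : ℝ) (v : V) (n : ℤ) :
    f (lad q a b v n) = lad q a b (f v) n := by
  cases n with
  | ofNat n => exact map_up f b v n
  | negSucc n => exact map_down f b v (n + 1)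

theorem stepProd_natCast_succ (lam b : ℝ) (n : ℕ) : stepProd q a lam b (n + 1 : ℕ) =
    stepProd q a lam b n * step q a lam b n := Finset.prod_range_succ _ _

theorem stepProd_neg_natCast (lam b : ℝ) (n : ℕ) : stepProd q a lam b (-(n : ℤ)) =
    ∏ k ∈ Finset.range n, step q a lam b (-(k : ℤ) - 1) := by
  cases n with
  | zero => rfl
  | succ n => rfl

theorem stepProd_add_one (lam b : ℝ) (n : ℤ) :
    stepProd q a lam b (n + 1) * (if 0 ≤ n then 1 else step q a lam b n) =
      stepProd q a lam b n * (if n + 1 ≤ 0 then 1 else step q a lam b n) := by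
  obtain ⟨k, rfl | rfl⟩ : ∃ k : ℕ, n = k ∨ n = -((k + 1 : ℕ) : ℤ) := by
    rcases le_or_gt 0 n with h | h
    · exact ⟨n.toNat, .inl (by omega)⟩
    · exact ⟨(-n - 1).toNat, .inr (by omega)⟩
  · rw [if_pos (by omega), if_neg (by omega), mul_one]
    exact_mod_cast stepProd_natCast_succ lam b k
  · rw [if_neg (by omega), if_pos (by omega), show -((k + 1 : ℕ) : ℤ) + 1 = -(k : ℤ) by omega,
      stepProd_neg_natCast, stepProd_neg_natCast, Finset.prod_range_succ, mul_one]
    congr 2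
    omega

variable {V : Type} [AddCommGroup V] [Module (UqSL q a) V] [Module ℂ V]
  [IsScalarTower ℂ (UqSL q a) V]

theorem IsWt.lad {b : ℝ} {v : V} (hv : IsWt q a b v) (n : ℤ) :
    IsWt q a (b + 2 * n) (lad q a b v n) := by
  cases n with
  | ofNat n => exact_mod_cast hv.up n
  | negSucc n =>
    have e : b + 2 * ((Int.negSucc n : ℤ) : ℝ) = b - 2 * ((n + 1 : ℕ) : ℝ) := by push_cast; ring
    rw [e]
    exact hv.down (n + 1)

section
variable {lam b : ℝ} {v : V}

theorem AElt_smul_lad (hA : UqSL.ofFun (AElt q a b) • v = (lam : ℂ) • v) (n : ℤ) :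
    UqSL.ofFun (AElt q a (b + 2 * n)) • lad q a b v n = (lam : ℂ) • lad q a b v n := by
  cases n with
  | ofNat n =>
    have := AElt_up (q := q) (a := a) b v n
    rw [hA, up_smul] at this
    exact_mod_cast this
  | negSucc n =>
    have := AElt_down (q := q) (a := a) b v (n + 1)
    rw [hA, down_smul] at this
    have e : b + 2 * ((Int.negSucc n : ℤ) : ℝ) = b - 2 * ((n + 1 : ℕ) : ℝ) := by push_cast; ring
    rw [e]
    exact this

theorem TPlus_smul_lad (hA : UqSL.ofFun (AElt q a b) • v = (lam : ℂ) • v) (n : ℤ) :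
    UqSL.ofFun (TPlus q a (b + 2 * n)) • lad q a b v n =
    ((if 0 ≤ n then 1 else step q a lam b n : ℝ) : ℂ) • lad q a b v (n + 1) := by
  obtain ⟨k, rfl | rfl⟩ : ∃ k : ℕ, n = k ∨ n = -((k + 1 : ℕ) : ℤ) := by
    rcases le_or_gt 0 n with h | h
    · exact ⟨n.toNat, .inl (by omega)⟩
    · exact ⟨(-n - 1).toNat, .inr (by omega)⟩
  · rw [if_pos (by omega), Complex.ofReal_one, one_smul]
    rfl
  · have h1 := TPlus_TMinus_smul (q := q) (a := a) (b - 2 * k) (down q a b v k)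
    have h2 := AElt_smul_lad hA (-(k : ℤ))
    rw [lad_neg_natCast] at h2
    push_cast at h2
    rw [show b + 2 * -(k : ℝ) = b - 2 * k by ring] at h2
    rw [h2, smul_comm (UqSL.ofFun (AElt q a (b - 2 * k))) (lam : ℂ), h2] at h1
    have e : b + 2 * ((-((k + 1 : ℕ) : ℤ) : ℤ) : ℝ) = b - 2 * k - 2 := by push_cast; ring
    rw [lad_neg_natCast, down, e, h1, if_neg (by omega),
      show -((k + 1 : ℕ) : ℤ) + 1 = -(k : ℤ) by omega, lad_neg_natCast, step, e,
      show b - 2 * k - 2 + a + 1 = b - 2 * (k : ℝ) + a - 1 by ring,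
      show b - 2 * k - 2 - a + 1 = b - 2 * (k : ℝ) - a - 1 by ring]
    push_cast
    module

theorem TMinus_smul_lad (hA : UqSL.ofFun (AElt q a b) • v = (lam : ℂ) • v) (n : ℤ) :
    UqSL.ofFun (TMinus q a (b + 2 * n)) • lad q a b v n =
    ((if n ≤ 0 then 1 else step q a lam b (n - 1) : ℝ) : ℂ) • lad q a b v (n - 1) := by
  obtain ⟨k, rfl | rfl⟩ : ∃ k : ℕ, n = -(k : ℤ) ∨ n = (k + 1 : ℕ) := by
    rcases le_or_gt n 0 with h | h
    · exact ⟨(-n).toNat, .inl (by omega)⟩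
    · exact ⟨(n - 1).toNat, .inr (by omega)⟩
  · rw [if_pos (by omega), Complex.ofReal_one, one_smul, lad_neg_natCast,
      show -(k : ℤ) - 1 = -((k + 1 : ℕ) : ℤ) by omega, lad_neg_natCast, down]
    congr 3
    push_cast
    ring
  · have h1 := TMinus_TPlus_smul (q := q) (a := a) (b + 2 * k) (up q a b v k)
    have h2 := AElt_smul_lad hA (k : ℤ)
    rw [lad_natCast, Int.cast_natCast] at h2
    rw [h2, smul_comm (UqSL.ofFun (AElt q a (b + 2 * k))) (lam : ℂ), h2] at h1
    have e : b + 2 * (((k + 1 : ℕ) : ℤ) : ℝ) = b + 2 * k + 2 := by push_cast; ring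
    rw [lad_natCast, up, e, h1, if_neg (by omega), show ((k + 1 : ℕ) : ℤ) - 1 = k by omega,
      lad_natCast, step, Int.cast_natCast]
    push_cast
    module

/-- The vectors of the ladder which are reached without a vanishing coefficient do not vanish. -/
theorem lad_ne_zero (hA : UqSL.ofFun (AElt q a b) • v = (lam : ℂ) • v)
    (hv : v ≠ 0) (n : ℤ) (hn : stepProd q a lam b n ≠ 0) : lad q a b v n ≠ 0 := by
  have hup : ∀ k : ℕ, stepProd q a lam b k ≠ 0 → lad q a b v k ≠ 0 := by
    intro k
    induction k with
    | zero => exact fun _ => hv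
    | succ k ih =>
      intro hk h0
      rw [stepProd_natCast_succ] at hk
      have h1 := TMinus_smul_lad hA ((k + 1 : ℕ) : ℤ)
      rw [h0, smul_zero, if_neg (by omega), show ((k + 1 : ℕ) : ℤ) - 1 = k by omega] at h1
      refine (smul_eq_zero.mp h1.symm).elim ?_ (ih (left_ne_zero_of_mul hk))
      exact Complex.ofReal_ne_zero.mpr (right_ne_zero_of_mul hk)
  have hdown : ∀ k : ℕ, stepProd q a lam b (-(k : ℤ)) ≠ 0 → lad q a b v (-(k : ℤ)) ≠ 0 := by
    intro k
    induction k with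
    | zero => exact fun _ => hv
    | succ k ih =>
      intro hk h0
      rw [stepProd_neg_natCast, Finset.prod_range_succ, ← stepProd_neg_natCast] at hk
      have h1 := TPlus_smul_lad hA (-((k + 1 : ℕ) : ℤ))
      rw [h0, smul_zero, if_neg (by omega), show -((k + 1 : ℕ) : ℤ) + 1 = -(k : ℤ) by omega,
        show -((k + 1 : ℕ) : ℤ) = -(k : ℤ) - 1 by omega] at h1
      refine (smul_eq_zero.mp h1.symm).elim ?_ (ih (left_ne_zero_of_mul hk))
      exact Complex.ofReal_ne_zero.mpr (right_ne_zero_of_mul hk)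
  rcases Int.eq_nat_or_neg n with ⟨k, rfl | rfl⟩
  · exact hup k hn
  · exact hdown k hn

end

/-- The weights along a ladder are distinct. -/
theorem add_two_mul_injective (b : ℝ) : Function.Injective fun n : ℤ => b + 2 * (n : ℝ) :=
  fun _ _ h => Int.cast_injective (mul_left_cancel₀ two_ne_zero (add_left_cancel h))

/-- Coordinates with respect to the nonzero vectors among weight vectors of distinct weights. -/
theorem exists_coord {c : ℤ → ℝ} (hc : Function.Injective c) {e : ℤ → V}
    (he : ∀ n, IsWt q a (c n) (e n)) (hs : Submodule.span ℂ (Set.range e) = ⊤) :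
    ∃ κ : V →ₗ[ℂ] ℤ →₀ ℂ, (∀ n, e n ≠ 0 → κ (e n) = Finsupp.single n 1) ∧
      ∀ v, Finsupp.linearCombination ℂ e (κ v) = v := by
  let I := {n // e n ≠ 0}
  have hli : LinearIndependent ℂ (fun i : I => e i) := by
    rw [linearIndependent_iff']
    intro s g hg i hi
    have := IsWt.eq_zero_of_sum (q := q) (a := a) (hc.comp Subtype.val_injective) (s := s)
      (w := fun i : I => g i • e i) (fun k _ => by
        rw [isWt_iff, smul_comm, isWt_iff.mp (he k), smul_comm]; rfl) hg i hi
    exact (smul_eq_zero.mp this).resolve_right i.2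
  have hsp : ⊤ ≤ Submodule.span ℂ (Set.range (fun i : I => e i)) := by
    rw [← hs, Submodule.span_le]
    rintro _ ⟨n, rfl⟩
    by_cases hn : e n = 0
    · rw [hn]; exact zero_mem _
    · exact Submodule.subset_span ⟨⟨n, hn⟩, rfl⟩
  let B := Module.Basis.mk hli hsp
  refine ⟨Finsupp.lmapDomain ℂ ℂ Subtype.val ∘ₗ B.repr.toLinearMap, fun n hn => ?_, fun v => ?_⟩
  · have : e n = B ⟨n, hn⟩ := (Module.Basis.mk_apply hli hsp ⟨n, hn⟩).symm
    rw [this]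
    simp
  · simp only [LinearMap.comp_apply, LinearEquiv.coe_coe, Finsupp.lmapDomain_apply,
      Finsupp.linearCombination_mapDomain]
    have : e ∘ Subtype.val = B := funext fun i => (Module.Basis.mk_apply hli hsp i).symm
    rw [this]
    exact B.linearCombination_repr v

end

/-! ### The invariant form of a ladder -/

section Diagonal
variable {V : Type} [AddCommGroup V] [Module ℂ V]

/-- The sesquilinear form which in the coordinates `κ` is diagonal with entries `f n`. -/
def diagForm (κ : V →ₗ[ℂ] ℤ →₀ ℂ) (f : ℤ → ℝ) : V →ₗ⋆[ℂ] V →ₗ[ℂ] ℂ :=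
  LinearMap.mk₂'ₛₗ (starRingEnd ℂ) (RingHom.id ℂ)
    (fun v w => (κ w).sum fun n z => conj (κ v n) * f n * z)
    (fun v v' w => by
      rw [← Finsupp.sum_add]
      refine Finsupp.sum_congr fun n _ => ?_
      simp only [map_add, Finsupp.add_apply]
      ring)
    (fun z v w => by
      rw [smul_eq_mul, Finsupp.mul_sum]
      refine Finsupp.sum_congr fun n _ => ?_
      simp only [map_smul, Finsupp.smul_apply, smul_eq_mul, map_mul]
      ring)
    (fun v w w' => by
      rw [map_add, Finsupp.sum_add_index'] <;> intros <;> ring)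
    (fun z v w => by
      rw [map_smul, Finsupp.sum_smul_index (by intros; ring), RingHom.id_apply, smul_eq_mul,
        Finsupp.mul_sum]
      refine Finsupp.sum_congr fun n _ => ?_
      ring)

theorem diagForm_apply (κ : V →ₗ[ℂ] ℤ →₀ ℂ) (f : ℤ → ℝ) (v w : V) :
    diagForm κ f v w = (κ w).sum fun n z => conj (κ v n) * f n * z := rfl

theorem diagForm_apply_of_single {κ : V →ₗ[ℂ] ℤ →₀ ℂ} {f : ℤ → ℝ} {w : V} {n : ℤ}
    (hw : κ w = Finsupp.single n 1) (v : V) : diagForm κ f v w = conj (κ v n) * f n := by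
  rw [diagForm_apply, hw, Finsupp.sum_single_index] <;> ring

theorem diagForm_apply_basis {κ : V →ₗ[ℂ] ℤ →₀ ℂ} {f : ℤ → ℝ} {e : ℤ → V}
    (hκ : ∀ n, e n ≠ 0 → κ (e n) = Finsupp.single n 1) (hf : ∀ n, f n ≠ 0 → e n ≠ 0) (m n : ℤ) :
    diagForm κ f (e m) (e n) = if m = n then (f n : ℂ) else 0 := by
  by_cases hn : e n = 0
  · rw [hn, map_zero, by_contra fun h => hf n h hn]
    simp
  · rw [diagForm_apply_of_single (hκ n hn)]
    by_cases hm : e m = 0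
    · rw [hm, map_zero, if_neg]
      · simp
      · rintro rfl; exact hn hm
    · rw [hκ m hm]
      by_cases h : m = n
      · subst h; simp
      · simp [h]

end Diagonal

section
variable {q : Param} {a : ℝ} {V : Type} [AddCommGroup V] [Module (UqSL q a) V] [Module ℂ V]
  [IsScalarTower ℂ (UqSL q a) V]

/-- Invariance under a pair of elements is checked on a spanning family. -/
theorem form_eq_of_span {F : V →ₗ⋆[ℂ] V →ₗ[ℂ] ℂ} {e : ℤ → V}
    (hs : Submodule.span ℂ (Set.range e) = ⊤) {x y : UqSL q a}
    (h : ∀ m n, F (e m) (x • e n) = F (y • e m) (e n)) (v w : V) : F v (x • w) = F (y • v) w := by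
  have hv : v ∈ Submodule.span ℂ (Set.range e) := hs ▸ Submodule.mem_top
  have hw : w ∈ Submodule.span ℂ (Set.range e) := hs ▸ Submodule.mem_top
  induction hv using Submodule.span_induction with
  | zero => simp
  | add v v' _ _ h1 h2 => rw [smul_add, map_add, map_add, LinearMap.add_apply, LinearMap.add_apply, h1, h2]
  | smul z v _ h1 =>
    rw [smul_comm y z, map_smulₛₗ F, map_smulₛₗ F, LinearMap.smul_apply, LinearMap.smul_apply, h1]
  | mem v hv =>
    obtain ⟨m, rfl⟩ := hv
    induction hw using Submodule.span_induction with
    | zero => simp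
    | add w w' _ _ h1 h2 => rw [smul_add, map_add, map_add, h1, h2]
    | smul z w _ h1 => rw [smul_comm x z, (F (e m)).map_smul, (F (y • e m)).map_smul, h1]
    | mem w hw =>
      obtain ⟨n, rfl⟩ := hw
      exact h m n

/-- On a module spanned by weight vectors `e n` of weights `b + 2n` on which `T⁺`, `T⁻` act by
raising and lowering, with coefficients `τ n` and `σ n`, a diagonal form is invariant as soon as its
entries satisfy the recursion which makes `T⁺` and `T⁻` adjoint up to the factors `q^c + q^{-c}`. -/
theorem isInvariantForm_diagonal {F : V →ₗ⋆[ℂ] V →ₗ[ℂ] ℂ} {e : ℤ → V} {lam b : ℝ} {f τ σ : ℤ → ℝ}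
    (hs : Submodule.span ℂ (Set.range e) = ⊤)
    (he : ∀ n : ℤ, IsWt q a (b + 2 * n) (e n))
    (hA : ∀ n : ℤ, UqSL.ofFun (AElt q a (b + 2 * n)) • e n = (lam : ℂ) • e n)
    (hT : ∀ n : ℤ, UqSL.ofFun (TPlus q a (b + 2 * n)) • e n = (τ n : ℂ) • e (n + 1))
    (hT' : ∀ n : ℤ, UqSL.ofFun (TMinus q a (b + 2 * n)) • e n = (σ n : ℂ) • e (n - 1))
    (hF : ∀ m n, F (e m) (e n) = if m = n then (f n : ℂ) else 0)
    (hf : ∀ n : ℤ, f (n + 1) * qcosh q (b + 2 * (n + 1)) * τ n = f n * qcosh q (b + 2 * n) * σ (n + 1)) :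
    IsInvariantForm q a F := by
  have hne : ∀ x, (qcosh q x : ℂ) ≠ 0 := fun x => Complex.ofReal_ne_zero.mpr (qcosh_pos q x).ne'
  have hpow : ∀ x, conj (qpow q x) = qpow q x := fun _ => Complex.conj_ofReal _
  have hf' : ∀ n : ℤ, (f (n + 1) * qcosh q (b + 2 * (n + 1)) * τ n : ℂ) =
      f n * qcosh q (b + 2 * n) * σ (n + 1) := fun n => by exact_mod_cast hf n
  -- the vectors of degree `n` which the generators produce, in terms of their neighbours
  have hX : ∀ n : ℤ, UqSL.X q a • e n =
      ((qpow q (b + 2 * n + 1) / (qcosh q (b + 2 * n) * qcosh q (b + 2 * n + 1))) * τ n) • e (n + 1) +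
      (-((qpow q (b + 2 * n - 1))⁻¹ / (qcosh q (b + 2 * n) * qcosh q (b + 2 * n - 1))) * σ n) • e (n - 1) +
      ((1 / (qcosh q (b + 2 * n + 1) * qcosh q (b + 2 * n - 1)) : ℂ) *
        (qcosh q 1 * lam + dbracket q a * dbracket q (b + 2 * n))) • e n := by
    intro n
    rw [X_smul_eq (b + 2 * n), hA, hT, hT']
    module
  have hY : ∀ n : ℤ, qC q • UqSL.Y q a • e n =
      (-((qpow q (b + 2 * n + 1))⁻¹ / (qcosh q (b + 2 * n) * qcosh q (b + 2 * n + 1))) * τ n) • e (n + 1) +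
      ((qpow q (b + 2 * n - 1) / (qcosh q (b + 2 * n) * qcosh q (b + 2 * n - 1))) * σ n) • e (n - 1) +
      ((1 / (qcosh q (b + 2 * n + 1) * qcosh q (b + 2 * n - 1)) : ℂ) *
        (qcosh q 1 * lam + dbracket q a * dbracket q (b + 2 * n))) • e n := by
    intro n
    rw [Y_smul_eq (b + 2 * n), hA, hT, hT']
    module
  have hN : ∀ n : ℤ, UqSL.N q a • e n =
      (((qC q)⁻¹ / (qcosh q (b + 2 * n) * qcosh q (b + 2 * n + 1))) * τ n) • e (n + 1) +
      (((qC q)⁻¹ / (qcosh q (b + 2 * n) * qcosh q (b + 2 * n - 1))) * σ n) • e (n - 1) +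
      (((qC q)⁻¹ / qcosh q 1 : ℂ) * (dbracket q a -
        (dbracket q (b + 2 * n) / (qcosh q (b + 2 * n + 1) * qcosh q (b + 2 * n - 1)) : ℂ) *
        (qcosh q 1 * lam + dbracket q a * dbracket q (b + 2 * n)))) • e n := by
    intro n
    rw [N_smul_eq (b + 2 * n), hA, hT, hT']
    module
  -- a three-term recursion for `x`, with its transpose for `y`, is an adjunction
  have key : ∀ (x y : UqSL q a) (r r' s s' d : ℤ → ℂ),
      (∀ n, x • e n = r n • e (n + 1) + s n • e (n - 1) + d n • e n) →
      (∀ n, y • e n = r' n • e (n + 1) + s' n • e (n - 1) + d n • e n) →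
      (∀ n, conj (r' n) = r' n) → (∀ n, conj (s' n) = s' n) → (∀ n, conj (d n) = d n) →
      (∀ n, r n * f (n + 1) = s' (n + 1) * f n) → (∀ n, s (n + 1) * f n = r' n * f (n + 1)) →
      ∀ v w, F v (x • w) = F (y • v) w := by
    intro x y r r' s s' d hx hy hr hs' hd h1 h2
    refine form_eq_of_span hs fun m n => ?_
    rw [hx, hy]
    simp only [map_add, LinearMap.add_apply, map_smulₛₗ F, LinearMap.smul_apply, hr, hs', hd, map_smul,
      hF, smul_eq_mul]
    congr 1
    · rw [add_comm (r' m * _)]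
      congr 1
      · by_cases h : m = n + 1
        · subst h
          rw [if_pos rfl, if_pos (by ring), h1]
        · rw [if_neg h, if_neg (by omega), mul_zero, mul_zero]
      · by_cases h : m + 1 = n
        · subst h
          rw [if_pos (by ring), if_pos rfl, add_sub_cancel_right, h2]
        · rw [if_neg (by omega), if_neg h, mul_zero, mul_zero]
    · by_cases h : m = n
      · rw [h]
      · rw [if_neg h, mul_zero, mul_zero]
  have e2 : ∀ n : ℤ, b + 2 * ((n + 1 : ℤ) : ℝ) = b + 2 * (n + 1) := fun n => by push_cast; ring
  have e3 : ∀ n : ℤ, b + 2 * ((n : ℝ) + 1) - 1 = b + 2 * n + 1 := fun n => by ring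
  refine isInvariantForm_of_generators ?_ ?_ ?_ ?_
  · intro v w
    rw [← smul_assoc]
    refine key (UqSL.X q a) (qC q • UqSL.Y q a) _ _ _ _ _ hX
      (fun n => (smul_assoc _ _ _).trans (hY n)) ?_ ?_ ?_ ?_ ?_ v w
    · intro n; simp only [map_mul, map_neg, map_div₀, map_inv₀, hpow, Complex.conj_ofReal]
    · intro n; simp only [map_mul, map_div₀, hpow, Complex.conj_ofReal]
    · intro n; simp only [map_mul, map_add, map_div₀, map_one, Complex.conj_ofReal]
    · intro n
      have := hf' n
      have h1 := hne (b + 2 * n)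
      have h2 := hne (b + 2 * (n + 1))
      have h3 := hne (b + 2 * n + 1)
      have h4 := qpow_ne_zero q (b + 2 * n + 1)
      simp only [e2, e3]
      field_simp
      linear_combination this
    · intro n
      have := hf' n
      have h1 := hne (b + 2 * n)
      have h2 := hne (b + 2 * (n + 1))
      have h3 := hne (b + 2 * n + 1)
      have h4 := qpow_ne_zero q (b + 2 * n + 1)
      simp only [e2, e3]
      field_simp
      linear_combination this
  · intro v w
    rw [← smul_assoc]
    refine key (qC q • UqSL.Y q a) (UqSL.X q a) _ _ _ _ _
      (fun n => (smul_assoc _ _ _).trans (hY n)) hX ?_ ?_ ?_ ?_ ?_ v w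
    · intro n; simp only [map_mul, map_div₀, hpow, Complex.conj_ofReal]
    · intro n; simp only [map_mul, map_neg, map_div₀, map_inv₀, hpow, Complex.conj_ofReal]
    · intro n; simp only [map_mul, map_add, map_div₀, map_one, Complex.conj_ofReal]
    · intro n
      have := hf' n
      have h1 := hne (b + 2 * n)
      have h2 := hne (b + 2 * (n + 1))
      have h3 := hne (b + 2 * n + 1)
      have h4 := qpow_ne_zero q (b + 2 * n + 1)
      simp only [e2, e3]
      field_simp
      linear_combination -this
    · intro n
      have := hf' n
      have h1 := hne (b + 2 * n)
      have h2 := hne (b + 2 * (n + 1))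
      have h3 := hne (b + 2 * n + 1)
      have h4 := qpow_ne_zero q (b + 2 * n + 1)
      simp only [e2, e3]
      field_simp
      linear_combination -this
  · refine key (UqSL.N q a) (UqSL.N q a) _ _ _ _ _ hN hN ?_ ?_ ?_ ?_ ?_
    · intro n; simp only [map_mul, map_div₀, map_inv₀, conj_qC, Complex.conj_ofReal]
    · intro n; simp only [map_mul, map_div₀, map_inv₀, conj_qC, Complex.conj_ofReal]
    · intro n; simp only [map_mul, map_sub, map_add, map_div₀, map_inv₀, conj_qC, Complex.conj_ofReal]
    · intro n
      have := hf' n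
      have h1 := hne (b + 2 * n)
      have h2 := hne (b + 2 * (n + 1))
      have h3 := hne (b + 2 * n + 1)
      have h4 := qC_ne_zero q
      simp only [e2, e3]
      field_simp
      linear_combination this
    · intro n
      have := hf' n
      have h1 := hne (b + 2 * n)
      have h2 := hne (b + 2 * (n + 1))
      have h3 := hne (b + 2 * n + 1)
      have h4 := qC_ne_zero q
      simp only [e2, e3]
      field_simp
      linear_combination -this
  · refine form_eq_of_span hs fun m n => ?_
    rw [isWt_iff.mp (he m), isWt_iff.mp (he n), map_smul, map_smulₛₗ F, LinearMap.smul_apply, hF,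
      Complex.conj_ofReal]
    by_cases h : m = n
    · rw [h]
    · rw [if_neg h, smul_zero, smul_zero]

/-- The kernel of an invariant form is a submodule. -/
theorem IsInvariantForm.smul_ker {F : V →ₗ⋆[ℂ] V →ₗ[ℂ] ℂ} (hF : IsInvariantForm q a F)
    (u : UqSL q a) : ∀ v, (∀ w, F v w = 0) → ∀ w, F (u • v) w = 0 := by
  have hq := qC_ne_zero q
  induction u using UqSL.induction with
  | hX =>
    intro v hv w
    have h := hF.Y v w
    rw [hv, smul_assoc, map_smulₛₗ F, LinearMap.smul_apply, eq_comm] at h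
    exact (smul_eq_zero.mp h).resolve_left (by simp [hq])
  | hY =>
    intro v hv w
    have h := hF.X v w
    rw [hv, smul_assoc, map_smulₛₗ F, LinearMap.smul_apply, eq_comm] at h
    exact (smul_eq_zero.mp h).resolve_left (by simp [hq])
  | hN => intro v hv w; rw [← hF.N, hv]
  | hB =>
    intro v hv w
    have h := hF.B v w
    rwa [hv, neg_smul, map_neg, LinearMap.neg_apply, eq_comm, neg_eq_zero] at h
  | hc z =>
    intro v hv w
    rw [algebraMap_smul, map_smulₛₗ F, LinearMap.smul_apply, hv, smul_zero]
  | hm x y hx hy => intro v hv; rw [mul_smul]; exact hx _ (hy _ hv)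
  | ha x y hx hy => intro v hv w; rw [add_smul, map_add, LinearMap.add_apply, hx v hv, hy v hv, add_zero]

end

/-! ### The kernel of the invariant form of `M_{λ,b}` -/

-- Shortcuts for instance search, which is slow through the quotient defining `M_{λ,b}`.
local instance M.shortcutAddCommGroup (q : Param) (a lam b : ℝ) :
    AddCommGroup (M q a lam b) := inferInstance

local instance M.shortcutModule (q : Param) (a lam b : ℝ) :
    Module (UqSL q a) (M q a lam b) := inferInstance

local instance M.shortcutComplexModule (q : Param) (a lam b : ℝ) :
    Module ℂ (M q a lam b) := inferInstance

local instance M.shortcutIsScalarTower (q : Param) (a lam b : ℝ) :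
    IsScalarTower ℂ (UqSL q a) (M q a lam b) := inferInstance

section
variable {q : Param} {a : ℝ}

theorem span_lad_M (lam b : ℝ) :
    Submodule.span ℂ (Set.range (lad q a b (M.e q a lam b))) = ⊤ := by
  rw [eq_top_iff, ← span_ladder_M lam b, Submodule.span_le]
  rintro _ (⟨n, rfl⟩ | ⟨n, rfl⟩)
  · exact Submodule.subset_span ⟨n, rfl⟩
  · exact Submodule.subset_span ⟨-n, lad_neg_natCast _ _ _⟩

/-- The kernel `N_{λ,b}` is spanned by the vectors of the ladder which lie beyond a vanishing
coefficient. -/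
theorem mem_N_iff {lam b : ℝ} (h : M.e q a lam b ≠ 0) (v : M q a lam b) : v ∈ N q a lam b ↔
    v ∈ Submodule.span ℂ (lad q a b (M.e q a lam b) '' {n | stepProd q a lam b n = 0}) := by
  set e := lad q a b (M.e q a lam b) with he
  have hw := isWt_M_e (q := q) (a := a) lam b
  have hA := AElt_smul_M_e (q := q) (a := a) lam b
  have hs : Submodule.span ℂ (Set.range e) = ⊤ := span_lad_M lam b
  have hcosh : ∀ x, qcosh q x ≠ 0 := fun x => (qcosh_pos q x).ne'
  obtain ⟨κ, hκ, hκ'⟩ := exists_coord (add_two_mul_injective b) hw.lad hs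
  let f : ℤ → ℝ := fun n => stepProd q a lam b n / qcosh q (b + 2 * n)
  have hf : ∀ n, f n ≠ 0 → e n ≠ 0 := fun n hn => lad_ne_zero hA h n (left_ne_zero_of_mul hn)
  set F := diagForm κ f
  have hb := diagForm_apply_basis hκ hf
  have hF : IsInvariantForm q a F := by
    refine isInvariantForm_diagonal hs hw.lad (AElt_smul_lad hA) (TPlus_smul_lad hA)
      (TMinus_smul_lad hA) hb fun n => ?_
    have h1 := hcosh (b + 2 * n)
    have h2 := hcosh (b + 2 * (n + 1))
    have h3 := stepProd_add_one (q := q) (a := a) lam b n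
    simp only [f, Int.cast_add, Int.cast_one, div_mul_cancel₀ _ h1, div_mul_cancel₀ _ h2,
      add_sub_cancel_right]
    exact h3
  constructor
  · intro hv
    rw [← hκ' v, Finsupp.linearCombination_apply]
    refine Submodule.sum_mem _ fun n hn => Submodule.smul_mem _ _ (Submodule.subset_span ⟨n, ?_, rfl⟩)
    by_contra h0
    have hfn : f n ≠ 0 := div_ne_zero h0 (hcosh _)
    have h1 := hv F hF 1 (e n)
    rw [one_smul, diagForm_apply_of_single (hκ n (hf n hfn))] at h1
    refine (mul_eq_zero.mp h1).elim (fun h2 => ?_) (Complex.ofReal_ne_zero.mpr hfn)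
    exact Finsupp.mem_support_iff.mp hn ((map_eq_zero _).mp h2)
  · intro hv
    let K : Submodule (UqSL q a) (M q a lam b) :=
      { carrier := {v | ∀ w, F v w = 0}
        zero_mem' := by simp
        add_mem' := fun h1 h2 w => by rw [map_add, LinearMap.add_apply, h1, h2, add_zero]
        smul_mem' := fun u v h1 => hF.smul_ker u v h1 }
    -- an element of the kernel of `F` has no component along `e_b`, so that every form kills it
    have hK : ∀ v ∈ K, ∀ G : M q a lam b →ₗ⋆[ℂ] M q a lam b →ₗ[ℂ] ℂ, IsInvariantForm q a G →
        G v (M.e q a lam b) = 0 := by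
      intro v hv G hG
      have h0 : κ v 0 = 0 := by
        have h1 : F v (e 0) = 0 := hv _
        rw [diagForm_apply_of_single (hκ 0 h)] at h1
        refine (map_eq_zero (starRingEnd ℂ)).mp ((mul_eq_zero.mp h1).resolve_right ?_)
        exact Complex.ofReal_ne_zero.mpr (div_ne_zero (by simp [stepProd]) (hcosh _))
      rw [← hκ' v, Finsupp.linearCombination_apply, Finsupp.sum, map_sum, LinearMap.sum_apply]
      refine Finset.sum_eq_zero fun n hn => ?_
      have hn0 : n ≠ 0 := by rintro rfl; exact Finsupp.mem_support_iff.mp hn h0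
      rw [map_smulₛₗ G, LinearMap.smul_apply, hG.eq_zero_of_isWt (b := b + 2 * n) (c := b) ?_
        (hw.lad n) hw, smul_zero]
      simpa using hn0
    have hKN : ∀ v ∈ K, v ∈ N q a lam b := by
      intro v hv G hG x w
      obtain ⟨u, rfl⟩ := exists_smul_M_e w
      exact hG.eq_zero_of_cyclic (K := K) (fun v hv => hK v hv G hG) u _ (K.smul_mem x hv)
    induction hv using Submodule.span_induction with
    | zero => exact zero_mem _
    | add x y _ _ h1 h2 => exact add_mem h1 h2
    | smul z x _ h1 =>
      rw [← algebraMap_smul (UqSL q a)]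
      exact Submodule.smul_mem _ _ h1
    | mem x hx =>
      obtain ⟨n, hn, rfl⟩ := hx
      refine hKN _ fun w => ?_
      have hw' : w ∈ Submodule.span ℂ (Set.range e) := hs ▸ Submodule.mem_top
      induction hw' using Submodule.span_induction with
      | zero => simp
      | add x y _ _ h1 h2 => rw [map_add, h1, h2, add_zero]
      | smul z x _ h1 => rw [map_smul, h1, smul_zero]
      | mem x hx =>
        obtain ⟨m, rfl⟩ := hx
        rw [hb]
        split_ifs with hnm
        · subst hnm
          simp [f, Set.mem_ofPred_eq.mp hn]
        · rfl

/-- The kernel of a homomorphism is spanned by the vectors of the ladder which it kills. -/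
theorem map_eq_zero_iff_mem_span {lam b : ℝ} {W : Type} [AddCommGroup W] [Module (UqSL q a) W]
    [Module ℂ W] [IsScalarTower ℂ (UqSL q a) W] (f : M q a lam b →ₗ[UqSL q a] W) {S : Set ℤ}
    (hS : ∀ n, f (lad q a b (M.e q a lam b) n) = 0 ↔ n ∈ S) (v : M q a lam b) :
    f v = 0 ↔ v ∈ Submodule.span ℂ (lad q a b (M.e q a lam b) '' S) := by
  have hfs : ∀ (z : ℂ) v, f (z • v) = z • f v := (f.restrictScalars ℂ).map_smul
  have hw := isWt_M_e (q := q) (a := a) lam b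
  obtain ⟨κ, hκ, hκ'⟩ := exists_coord (add_two_mul_injective b) hw.lad (span_lad_M lam b)
  constructor
  · intro hv
    rw [← hκ' v, Finsupp.linearCombination_apply, Finsupp.sum, map_sum] at hv
    have h1 := IsWt.eq_zero_of_sum (q := q) (a := a) (add_two_mul_injective b) (fun n _ => by
      rw [isWt_iff, ← map_smul, smul_comm, isWt_iff.mp (hw.lad n), smul_comm, hfs]) hv
    rw [← hκ' v, Finsupp.linearCombination_apply]
    refine Submodule.sum_mem _ fun n hn => Submodule.smul_mem _ _ (Submodule.subset_span ⟨n, ?_, rfl⟩)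
    have h2 := h1 n hn
    rw [hfs] at h2
    exact (hS n).mp ((smul_eq_zero.mp h2).resolve_left (Finsupp.mem_support_iff.mp hn))
  · intro hv
    induction hv using Submodule.span_induction with
    | zero => exact map_zero _
    | add x y _ _ h1 h2 => rw [map_add, h1, h2, add_zero]
    | smul z x _ h1 => rw [hfs, h1, smul_zero]
    | mem x hx =>
      obtain ⟨n, hn, rfl⟩ := hx
      exact (hS n).mpr hn

/-- An eigenvector of `A_b` of weight `[b]` whose ladder vanishes exactly beyond the vanishing
coefficients generates a copy of `L_{λ,b}`. -/
theorem exists_injective_of_lad {lam b : ℝ} {V : Type} [AddCommGroup V] [Module (UqSL q a) V]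
    [Module ℂ V] [IsScalarTower ℂ (UqSL q a) V] {w : V} (hw : IsWt q a b w)
    (hA : UqSL.ofFun (AElt q a b) • w = (lam : ℂ) • w) (hw0 : w ≠ 0)
    (hlad : ∀ n, lad q a b w n = 0 ↔ stepProd q a lam b n = 0) :
    ∃ f : L q a lam b →ₗ[UqSL q a] V, Function.Injective f ∧ f (L.e q a lam b) = w ∧
      ∀ v, f v ∈ Submodule.span ℂ (Set.range (lad q a b w)) := by
  obtain ⟨j, hj⟩ := exists_lift_M hw hA
  have hne : M.e q a lam b ≠ 0 := fun h => hw0 (hj.symm.trans ((congrArg j h).trans (map_zero j)))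
  have hker : ∀ v, v ∈ N q a lam b ↔ j v = 0 := fun v => by
    rw [mem_N_iff hne, map_eq_zero_iff_mem_span j (S := {n | stepProd q a lam b n = 0})]
    intro n
    rw [map_lad, hj]
    exact hlad n
  have hle : N q a lam b ≤ LinearMap.ker j := fun v hv => LinearMap.mem_ker.mpr ((hker v).mp hv)
  refine ⟨(N q a lam b).liftQ j hle, ?_, ?_, ?_⟩
  · rw [← LinearMap.ker_eq_bot]
    exact Submodule.ker_liftQ_eq_bot _ _ _ fun v hv => (hker v).mpr hv
  · exact hj
  · intro v
    obtain ⟨x, rfl⟩ := Submodule.mkQ_surjective _ v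
    change j x ∈ _
    have hx : x ∈ Submodule.span ℂ (Set.range (lad q a b (M.e q a lam b))) :=
      span_lad_M (q := q) (a := a) lam b ▸ Submodule.mem_top
    induction hx using Submodule.span_induction with
    | zero => rw [map_zero]; exact zero_mem _
    | add x y _ _ h1 h2 => rw [map_add]; exact add_mem h1 h2
    | smul z x _ h1 =>
      rw [← algebraMap_smul (UqSL q a), map_smul, algebraMap_smul]
      exact Submodule.smul_mem _ _ h1
    | mem x hx =>
      obtain ⟨n, rfl⟩ := hx
      rw [map_lad, hj]
      exact Submodule.subset_span ⟨n, rfl⟩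

/-! ### The critical value `λ = q + q⁻¹` -/

theorem qcosh_one (q : Param) : qcosh q 1 = (q : ℝ) + (q : ℝ)⁻¹ := by
  rw [qcosh, Real.rpow_one, Real.rpow_neg_one]

theorem qcosh_eq_iff {x y : ℝ} : qcosh q x = qcosh q y ↔ x = y ∨ x = -y := by
  have hq := q_pos q
  have h1 : (q : ℝ) ≠ 1 := q.2.2.ne
  constructor
  · intro h
    have hx := Real.rpow_pos_of_pos hq x
    have hy := Real.rpow_pos_of_pos hq y
    rw [qcosh, qcosh, Real.rpow_neg hq.le, Real.rpow_neg hq.le] at h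
    have h2 : ((q : ℝ) ^ x - (q : ℝ) ^ y) * ((q : ℝ) ^ x - ((q : ℝ) ^ y)⁻¹) = 0 := by
      field_simp at h ⊢
      linear_combination h
    rcases mul_eq_zero.mp h2 with h3 | h3
    · exact .inl ((Real.rpow_right_inj hq h1).mp (sub_eq_zero.mp h3))
    · rw [← Real.rpow_neg hq.le] at h3
      exact .inr ((Real.rpow_right_inj hq h1).mp (sub_eq_zero.mp h3))
  · rintro (rfl | rfl)
    · rfl
    · rw [qcosh, qcosh, neg_neg, add_comm]

theorem stepProd_eq_zero_iff {lam b : ℝ} {n : ℤ} : stepProd q a lam b n = 0 ↔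
    ∃ k, (0 ≤ k ∧ k < n ∨ n ≤ k ∧ k < 0) ∧ step q a lam b k = 0 := by
  rcases Int.eq_nat_or_neg n with ⟨m, rfl | rfl⟩
  · change ∏ k ∈ Finset.range m, step q a lam b k = 0 ↔ _
    rw [Finset.prod_eq_zero_iff]
    constructor
    · rintro ⟨k, hk, h⟩
      have := Finset.mem_range.mp hk
      exact ⟨k, by omega, h⟩
    · rintro ⟨k, hk, h⟩
      obtain ⟨k, rfl⟩ : ∃ j : ℕ, k = j := ⟨k.toNat, by omega⟩
      exact ⟨k, Finset.mem_range.mpr (by omega), h⟩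
  · rw [stepProd_neg_natCast, Finset.prod_eq_zero_iff]
    constructor
    · rintro ⟨k, hk, h⟩
      have := Finset.mem_range.mp hk
      exact ⟨-(k : ℤ) - 1, by omega, h⟩
    · rintro ⟨k, hk, h⟩
      obtain ⟨j, rfl⟩ : ∃ j : ℕ, k = -(j : ℤ) - 1 := ⟨(-k - 1).toNat, by omega⟩
      exact ⟨j, Finset.mem_range.mpr (by omega), h⟩

theorem step_eq_zero_iff {b : ℝ} {m n : ℤ} (hb : b = a + 2 * m) :
    step q a ((q : ℝ) + (q : ℝ)⁻¹) b n = 0 ↔ n + m = 0 ∨ n + m = -1 := by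
  rw [← qcosh_one, step, neg_eq_zero, mul_eq_zero, sub_eq_zero,
    or_iff_right (add_pos (qcosh_pos q _) (qcosh_pos q _)).ne', qcosh_eq_iff, hb,
    show a + 2 * (m : ℝ) + 2 * n - a + 1 = 2 * ((n + m : ℤ) : ℝ) + 1 by push_cast; ring]
  constructor
  · rintro (h | h)
    · left
      have : ((n + m : ℤ) : ℝ) = (0 : ℤ) := by push_cast at h ⊢; linarith
      exact Int.cast_injective this
    · right
      have : ((n + m : ℤ) : ℝ) = (-1 : ℤ) := by push_cast at h ⊢; linarith
      exact Int.cast_injective this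
  · rintro (h | h) <;> rw [h] <;> norm_num

theorem stepProd_center {n : ℤ} : stepProd q a ((q : ℝ) + (q : ℝ)⁻¹) a n = 0 ↔ n ≠ 0 := by
  simp only [stepProd_eq_zero_iff, step_eq_zero_iff (show a = a + 2 * ((0 : ℤ) : ℝ) by simp)]
  constructor
  · rintro ⟨k, h⟩; omega
  · intro h
    rcases lt_or_gt_of_ne h with h | h
    · exact ⟨-1, by omega⟩
    · exact ⟨0, by omega⟩

theorem stepProd_right {n : ℤ} : stepProd q a ((q : ℝ) + (q : ℝ)⁻¹) (a + 2) n = 0 ↔ n < 0 := by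
  simp only [stepProd_eq_zero_iff, step_eq_zero_iff (show a + 2 = a + 2 * ((1 : ℤ) : ℝ) by simp)]
  constructor
  · rintro ⟨k, h⟩; omega
  · exact fun h => ⟨-1, by omega⟩

theorem stepProd_left {n : ℤ} : stepProd q a ((q : ℝ) + (q : ℝ)⁻¹) (a - 2) n = 0 ↔ 0 < n := by
  simp only [stepProd_eq_zero_iff, step_eq_zero_iff (show a - 2 = a + 2 * ((-1 : ℤ) : ℝ) by
    push_cast; ring)]
  constructor
  · rintro ⟨k, h⟩; omega
  · exact fun h => ⟨0, by omega⟩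

theorem up_TPlus {V : Type} [AddCommGroup V] [Module (UqSL q a) V] (b : ℝ) (v : V) (n : ℕ) :
    up q a (b + 2) (UqSL.ofFun (TPlus q a b) • v) n = up q a b v (n + 1) := by
  induction n with
  | zero => simp [up]
  | succ n ih =>
    rw [up, ih, up, up, up, show b + 2 + 2 * (n : ℝ) = b + 2 * ((n + 1 : ℕ) : ℝ) by push_cast; ring]

theorem down_TMinus {V : Type} [AddCommGroup V] [Module (UqSL q a) V] (b : ℝ) (v : V) (n : ℕ) :
    down q a (b - 2) (UqSL.ofFun (TMinus q a b) • v) n = down q a b v (n + 1) := by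
  induction n with
  | zero => simp [down]
  | succ n ih =>
    rw [down, ih, down, down, down,
      show b - 2 - 2 * (n : ℝ) = b - 2 * ((n + 1 : ℕ) : ℝ) by push_cast; ring]

theorem down_eq_zero {V : Type} [AddCommGroup V] [Module (UqSL q a) V] {b : ℝ} {v : V}
    (h : UqSL.ofFun (TMinus q a b) • v = 0) (n : ℕ) : down q a b v (n + 1) = 0 := by
  induction n with
  | zero => simpa [down] using h
  | succ n ih => rw [down, ih, smul_zero]

theorem up_eq_zero {V : Type} [AddCommGroup V] [Module (UqSL q a) V] {b : ℝ} {v : V}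
    (h : UqSL.ofFun (TPlus q a b) • v = 0) (n : ℕ) : up q a b v (n + 1) = 0 := by
  induction n with
  | zero => simpa [up] using h
  | succ n ih => rw [up, ih, smul_zero]

end

section Critical
variable (q : Param) (a : ℝ)

/-- The cyclic vector of `M_{q+q⁻¹,a}`. -/
abbrev eCrit : MCrit q a := M.e q a ((q : ℝ) + (q : ℝ)⁻¹) a

theorem AElt_smul_TPlus_eCrit : UqSL.ofFun (AElt q a (a + 2)) • UqSL.ofFun (TPlus q a a) • eCrit q a =
    (((q : ℝ) + (q : ℝ)⁻¹ : ℝ) : ℂ) • UqSL.ofFun (TPlus q a a) • eCrit q a := by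
  rw [smul_smul, UqSL.A_mul_TPlus, mul_smul, AElt_smul_M_e, smul_comm]

theorem AElt_smul_TMinus_eCrit : UqSL.ofFun (AElt q a (a - 2)) • UqSL.ofFun (TMinus q a a) • eCrit q a =
    (((q : ℝ) + (q : ℝ)⁻¹ : ℝ) : ℂ) • UqSL.ofFun (TMinus q a a) • eCrit q a := by
  rw [smul_smul, UqSL.A_mul_TMinus, mul_smul, AElt_smul_M_e, smul_comm]

theorem TMinus_smul_TPlus_eCrit :
    UqSL.ofFun (TMinus q a (a + 2)) • UqSL.ofFun (TPlus q a a) • eCrit q a = 0 := by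
  have h := TMinus_smul_lad (AElt_smul_M_e (q := q) (a := a) ((q : ℝ) + (q : ℝ)⁻¹) a) 1
  have h0 : step q a ((q : ℝ) + (q : ℝ)⁻¹) a (1 - 1) = 0 :=
    (step_eq_zero_iff (m := 0) (by simp)).mpr (by omega)
  rw [if_neg (by omega), h0, Complex.ofReal_zero, zero_smul] at h
  simpa [lad, up] using h

theorem TPlus_smul_TMinus_eCrit :
    UqSL.ofFun (TPlus q a (a - 2)) • UqSL.ofFun (TMinus q a a) • eCrit q a = 0 := by
  have h := TPlus_smul_lad (AElt_smul_M_e (q := q) (a := a) ((q : ℝ) + (q : ℝ)⁻¹) a) (-1)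
  have h0 : step q a ((q : ℝ) + (q : ℝ)⁻¹) a (-1) = 0 :=
    (step_eq_zero_iff (m := 0) (by simp)).mpr (by omega)
  rw [if_neg (by omega), h0, Complex.ofReal_zero, zero_smul] at h
  have e : lad q a a (eCrit q a) (-1) = down q a a (eCrit q a) 1 := rfl
  rw [e] at h
  simpa [down, sub_eq_add_neg] using h

theorem up_eCrit_ne_zero (n : ℕ) : up q a a (eCrit q a) (n + 1) ≠ 0 := by
  rw [← up_TPlus]
  exact lad_ne_zero (AElt_smul_TPlus_eCrit q a)
    (ofFun_smul_M_e_ne_zero (q := q) (a := a) ((q : ℝ) + (q : ℝ)⁻¹)).1 n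
    (fun h => absurd (stepProd_right.mp h) (by omega))

theorem down_eCrit_ne_zero (n : ℕ) : down q a a (eCrit q a) (n + 1) ≠ 0 := by
  rw [← down_TMinus, ← lad_neg_natCast]
  exact lad_ne_zero (AElt_smul_TMinus_eCrit q a)
    (ofFun_smul_M_e_ne_zero (q := q) (a := a) ((q : ℝ) + (q : ℝ)⁻¹)).2 _
    (fun h => absurd (stepProd_left.mp h) (by omega))

theorem eCrit_ne_zero : eCrit q a ≠ 0 := fun h =>
  (ofFun_smul_M_e_ne_zero (q := q) (a := a) ((q : ℝ) + (q : ℝ)⁻¹)).1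
    ((congrArg (UqSL.ofFun (TPlus q a a) • ·) h).trans (smul_zero _))

theorem lad_eCrit_ne_zero (n : ℤ) : lad q a a (eCrit q a) n ≠ 0 := by
  rcases n with (_ | n) | n
  · exact eCrit_ne_zero q a
  · exact up_eCrit_ne_zero q a n
  · exact down_eCrit_ne_zero q a n

theorem lad_TPlus_eCrit (n : ℤ) : lad q a (a + 2) (UqSL.ofFun (TPlus q a a) • eCrit q a) n =
    if n < 0 then 0 else lad q a a (eCrit q a) (n + 1) := by
  cases n with
  | ofNat n =>
    rw [if_neg (by simp)]
    exact up_TPlus a _ n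
  | negSucc n =>
    rw [if_pos (Int.negSucc_lt_zero n)]
    exact down_eq_zero (TMinus_smul_TPlus_eCrit q a) n

theorem lad_TMinus_eCrit (n : ℤ) : lad q a (a - 2) (UqSL.ofFun (TMinus q a a) • eCrit q a) n =
    if 0 < n then 0 else lad q a a (eCrit q a) (n - 1) := by
  obtain ⟨k, rfl | rfl⟩ : ∃ k : ℕ, n = -(k : ℤ) ∨ n = (k + 1 : ℕ) := by
    rcases le_or_gt n 0 with h | h
    · exact ⟨(-n).toNat, .inl (by omega)⟩
    · exact ⟨(n - 1).toNat, .inr (by omega)⟩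
  · rw [if_neg (by omega), lad_neg_natCast, show -(k : ℤ) - 1 = -((k + 1 : ℕ) : ℤ) by omega,
      lad_neg_natCast]
    exact down_TMinus a _ k
  · rw [if_pos (by omega)]
    exact up_eq_zero (TPlus_smul_TMinus_eCrit q a) k

/-- `D₂⁺` is the submodule of `M_{q+q⁻¹,a}` spanned by the `e_{a+2n}` with `n > 0`. -/
theorem exists_DPlus_hom : ∃ f : DPlus q a →ₗ[UqSL q a] MCrit q a, Function.Injective f ∧
    (∀ n : ℕ, f (up q a (a + 2) (L.e q a ((q : ℝ) + (q : ℝ)⁻¹) (a + 2)) n) =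
      up q a a (eCrit q a) (n + 1)) ∧
    ∀ v, f v ∈ Submodule.span ℂ (lad q a a (eCrit q a) '' {n | 0 < n}) := by
  have hw : IsWt q a (a + 2) (UqSL.ofFun (TPlus q a a) • eCrit q a) :=
    (isWt_M_e (q := q) (a := a) ((q : ℝ) + (q : ℝ)⁻¹) a).TPlus
  obtain ⟨f, h1, h2, h3⟩ := exists_injective_of_lad hw (AElt_smul_TPlus_eCrit q a)
    (ofFun_smul_M_e_ne_zero (q := q) (a := a) ((q : ℝ) + (q : ℝ)⁻¹)).1 fun n => by
      rw [lad_TPlus_eCrit, stepProd_right]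
      simp [lad_eCrit_ne_zero]
  refine ⟨f, h1, fun n => ?_, fun v => ?_⟩
  · rw [map_up, h2, up_TPlus]
  · refine Submodule.span_le.mpr ?_ (h3 v)
    rintro _ ⟨n, rfl⟩
    rw [lad_TPlus_eCrit]
    split_ifs with h
    · exact zero_mem _
    · exact Submodule.subset_span ⟨n + 1, by rw [Set.mem_ofPred_eq]; omega, rfl⟩

/-- `D₂⁻` is the submodule of `M_{q+q⁻¹,a}` spanned by the `e_{a+2n}` with `n < 0`. -/
theorem exists_DMinus_hom : ∃ f : DMinus q a →ₗ[UqSL q a] MCrit q a, Function.Injective f ∧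
    (∀ n : ℕ, f (down q a (a - 2) (L.e q a ((q : ℝ) + (q : ℝ)⁻¹) (a - 2)) n) =
      down q a a (eCrit q a) (n + 1)) ∧
    ∀ v, f v ∈ Submodule.span ℂ (lad q a a (eCrit q a) '' {n | n < 0}) := by
  have hw : IsWt q a (a - 2) (UqSL.ofFun (TMinus q a a) • eCrit q a) :=
    (isWt_M_e (q := q) (a := a) ((q : ℝ) + (q : ℝ)⁻¹) a).TMinus
  obtain ⟨f, h1, h2, h3⟩ := exists_injective_of_lad hw (AElt_smul_TMinus_eCrit q a)
    (ofFun_smul_M_e_ne_zero (q := q) (a := a) ((q : ℝ) + (q : ℝ)⁻¹)).2 fun n => by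
      rw [lad_TMinus_eCrit, stepProd_left]
      simp [lad_eCrit_ne_zero]
  refine ⟨f, h1, fun n => ?_, fun v => ?_⟩
  · rw [map_down, h2, down_TMinus]
  · refine Submodule.span_le.mpr ?_ (h3 v)
    rintro _ ⟨n, rfl⟩
    rw [lad_TMinus_eCrit]
    split_ifs with h
    · exact zero_mem _
    · exact Submodule.subset_span ⟨n - 1, by rw [Set.mem_ofPred_eq]; omega, rfl⟩

end Critical

/-! ### The trivial representation -/

theorem blockUnit_apply_one (q : Param) (a : ℝ) (m : ℤ) :
    (blockUnit q a m).ofConv 1 = if 0 = m then 1 else 0 := by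
  change Coalgebra.counit (R := ℂ) (eigProj q a m 1) = _
  have h : (1 : OSU q) ∈ eig q a (a + (0 : ℤ)) := by simpa using one_mem_eig q a
  rw [eigProj_of_mem h]
  split_ifs <;> simp

/-- `I_c` acts on vectors of weight `[a]` by `ω ↦ ω(1)`. -/
theorem IsWeightRep.ofDual_apply {q : Param} {a : ℝ} {V : Type} [AddCommGroup V]
    [Module (UqSL q a) V] [Module ℂ V] [IsScalarTower ℂ (UqSL q a) V]
    {ρ : DIc q a →ₐ[ℂ] Module.End ℂ V} (h : IsWeightRep V ρ) {v : V} (hv : IsWt q a a v)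
    (ω : Ic q a) : ρ (DIc.ofDual ω) v = (ω : U q).ofConv 1 • v := by
  obtain ⟨ω, hω⟩ := ω
  have hv' : IsWt q a (a + (0 : ℤ)) v := by simpa using hv
  refine (Ic_induction (P := fun ω => ∃ hω : ω ∈ Ic q a,
    ρ (DIc.ofDual ⟨ω, hω⟩) v = ω.ofConv 1 • v) ?_ ?_ ?_ ?_ hω).2
  · intro m
    refine ⟨blockUnit_mem_Ic q a m, (h.block_of_isWt m hv').trans ?_⟩
    rw [blockUnit_apply_one, ite_smul, one_smul, zero_smul]
  · refine ⟨zero_mem _, ?_⟩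
    have : DIc.ofDual (⟨0, zero_mem _⟩ : Ic q a) = 0 := Subtype.ext (map_zero (Double.dualHom q))
    rw [this, map_zero]
    simp
  · rintro x y ⟨hx, h1⟩ ⟨hy, h2⟩
    refine ⟨add_mem hx hy, ?_⟩
    have : DIc.ofDual (⟨x + y, add_mem hx hy⟩ : Ic q a) = DIc.ofDual ⟨x, hx⟩ + DIc.ofDual ⟨y, hy⟩ :=
      Subtype.ext (Double.ofDual_add _ _)
    rw [this, map_add, LinearMap.add_apply, h1, h2, ← add_smul]
    rfl
  · rintro z x ⟨hx, h1⟩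
    refine ⟨Submodule.smul_mem _ z hx, ?_⟩
    have : DIc.ofDual (⟨z • x, Submodule.smul_mem _ z hx⟩ : Ic q a) = z • DIc.ofDual ⟨x, hx⟩ :=
      Subtype.ext (map_smul (Double.dualHom q) z x)
    rw [this, map_smul, LinearMap.smul_apply, h1, smul_smul]
    rfl

/-- A vector of weight `[a]` killed by `T_a^±` on which `A_a` acts by `q + q⁻¹` spans a copy of the
trivial representation. -/
theorem ofFun_smul_eq_counit {q : Param} {a : ℝ} {V : Type} [AddCommGroup V] [Module (UqSL q a) V]
    [Module ℂ V] [IsScalarTower ℂ (UqSL q a) V] {t : V} (h1 : UqSL.ofFun (TPlus q a a) • t = 0)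
    (h2 : UqSL.ofFun (TMinus q a a) • t = 0)
    (h3 : UqSL.ofFun (AElt q a a) • t = (((q : ℝ) + (q : ℝ)⁻¹ : ℝ) : ℂ) • t) (x : sphere q a) :
    UqSL.ofFun x • t = Coalgebra.counit (R := ℂ) (x : OSU q) • t := by
  have hq := qC_ne_zero q
  have hc := qpow_ne_zero q a
  have hd : (1 / (qcosh q (a + 1) * qcosh q (a - 1)) : ℂ) *
      (qcosh q 1 * qcosh q 1 + dbracket q a * dbracket q a) = 1 := by
    have e1 : (qcosh q (a + 1) : ℂ) ≠ 0 := Complex.ofReal_ne_zero.mpr (qcosh_pos q _).ne'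
    have e2 : (qcosh q (a - 1) : ℂ) ≠ 0 := Complex.ofReal_ne_zero.mpr (qcosh_pos q _).ne'
    rw [one_div, inv_mul_eq_one₀ (mul_ne_zero e1 e2)]
    simp only [qcosh_eq, dbracket_eq, qpow_add, qpow_sub, qpow_one]
    field_simp
    ring
  rw [← qcosh_one] at h3
  have hX : UqSL.X q a • t = t := by
    rw [X_smul_eq a, h1, h2, h3, smul_zero, smul_zero, sub_zero, zero_add, smul_smul, ← add_smul,
      smul_smul, hd, one_smul]
  have hY : qC q • UqSL.Y q a • t = t := by
    rw [Y_smul_eq a, h1, h2, h3, smul_zero, smul_zero, add_zero, zero_add, smul_smul, ← add_smul,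
      smul_smul, hd, one_smul]
  have hN : UqSL.N q a • t = 0 := by
    have e : (dbracket q a / (qcosh q (a + 1) * qcosh q (a - 1)) : ℂ) *
        (qcosh q 1 * qcosh q 1 + dbracket q a * dbracket q a) = dbracket q a := by
      rw [div_eq_mul_one_div, mul_assoc, hd, mul_one]
    rw [N_smul_eq a, h1, h2, h3, smul_zero, smul_zero, add_zero, zero_add, smul_smul _ _ t, ← add_smul,
      smul_smul _ _ t, e, sub_self, smul_zero]
  obtain ⟨x, hx⟩ := x
  refine (sphere_induction (P := fun x => ∃ hx : x ∈ sphere q a,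
    UqSL.ofFun ⟨x, hx⟩ • t = Coalgebra.counit (R := ℂ) x • t) ?_ ?_ ?_ ?_ ?_ ?_ hx).2
  · exact ⟨sphX_mem q a, by rw [counit_sphX, one_smul]; exact hX⟩
  · refine ⟨sphY_mem q a, ?_⟩
    rw [counit_sphY, ← inv_smul_smul₀ hq (UqSL.ofFun _ • t)]
    exact congrArg _ hY
  · exact ⟨sphN_mem q a, by rw [counit_sphN, zero_smul]; exact hN⟩
  · intro z
    have h : algebraMap ℂ (OSU q) z ∈ sphere q a := by
      rw [Algebra.algebraMap_eq_smul_one]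
      exact (sphere q a).smul_mem _ (one_mem_sphere q a)
    have h2 : UqSL.ofFun (⟨_, h⟩ : sphere q a) = algebraMap ℂ _ z :=
      Subtype.ext ((Double.funHom q).commutes z)
    refine ⟨h, ?_⟩
    rw [h2, algebraMap_smul, Bialgebra.counit_algebraMap]
  · rintro x _ y _ ⟨hx, h1⟩ ⟨hy, h2⟩
    refine ⟨mul_mem_sphere hx hy, ?_⟩
    rw [UqSL.ofFun_mul (z := ⟨x * y, mul_mem_sphere hx hy⟩) (x := ⟨x, hx⟩) (y := ⟨y, hy⟩) rfl,
      mul_smul, h2, smul_comm, h1, smul_smul, counit_mul, mul_comm]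
  · rintro x _ y _ ⟨hx, h1⟩ ⟨hy, h2⟩
    refine ⟨add_mem hx hy, ?_⟩
    have e : UqSL.ofFun ⟨x + y, add_mem hx hy⟩ = UqSL.ofFun ⟨x, hx⟩ + UqSL.ofFun ⟨y, hy⟩ :=
      UqSL.ofFun_add ⟨x, hx⟩ ⟨y, hy⟩
    rw [e, add_smul, h1, h2, map_add, add_smul]

theorem linearIndependent_lad {q : Param} {a b : ℝ} {V : Type} [AddCommGroup V] [Module (UqSL q a) V]
    [Module ℂ V] [IsScalarTower ℂ (UqSL q a) V] {v : V} (hv : IsWt q a b v)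
    (h : ∀ n, lad q a b v n ≠ 0) : LinearIndependent ℂ (lad q a b v) := by
  rw [linearIndependent_iff']
  intro s g hg i hi
  have := IsWt.eq_zero_of_sum (q := q) (a := a) (add_two_mul_injective b) (s := s)
    (w := fun i => g i • lad q a b v i) (fun k _ => by
      rw [isWt_iff, smul_comm, isWt_iff.mp (hv.lad k), smul_comm]) hg i hi
  exact (smul_eq_zero.mp this).resolve_right (h i)

theorem bijective_toSpanSingleton {V : Type} [AddCommGroup V] [Module ℂ V] {t : V} (ht : t ≠ 0)
    (h : ∀ v, ∃ z : ℂ, v = z • t) : Function.Bijective (LinearMap.toSpanSingleton ℂ V t) := by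
  refine ⟨smul_left_injective ℂ ht, fun v => ?_⟩
  obtain ⟨z, rfl⟩ := h v
  exact ⟨z, rfl⟩

section Critical
variable (q : Param) (a : ℝ)

theorem mem_N_center_iff (v : MCrit q a) : v ∈ N q a ((q : ℝ) + (q : ℝ)⁻¹) a ↔
    v ∈ Submodule.span ℂ (lad q a a (eCrit q a) '' {n | n ≠ 0}) := by
  rw [mem_N_iff (eCrit_ne_zero q a)]
  simp only [stepProd_center]

/-- The cyclic vector of `𝟙`. -/
abbrev eTriv : Triv q a := L.e q a ((q : ℝ) + (q : ℝ)⁻¹) a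

theorem eTriv_ne_zero : eTriv q a ≠ 0 := by
  intro h
  have h1 : eCrit q a ∈ N q a ((q : ℝ) + (q : ℝ)⁻¹) a := (Submodule.Quotient.mk_eq_zero _).mp h
  rw [mem_N_center_iff] at h1
  have h2 := (linearIndependent_lad (isWt_M_e (q := q) (a := a) _ a)
    (lad_eCrit_ne_zero q a)).notMem_span_image (s := {n : ℤ | n ≠ 0}) (x := 0) (by simp)
  exact h2 h1

theorem lad_mem_N {n : ℤ} (hn : n ≠ 0) :
    lad q a a (eCrit q a) n ∈ N q a ((q : ℝ) + (q : ℝ)⁻¹) a :=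
  (mem_N_center_iff q a _).mpr (Submodule.subset_span ⟨n, hn, rfl⟩)

theorem exists_smul_eTriv (v : Triv q a) : ∃ z : ℂ, v = z • eTriv q a := by
  obtain ⟨w, rfl⟩ : ∃ w : MCrit q a, L.proj q a ((q : ℝ) + (q : ℝ)⁻¹) a w = v :=
    Submodule.mkQ_surjective (N q a ((q : ℝ) + (q : ℝ)⁻¹) a) v
  have hw : w ∈ Submodule.span ℂ (Set.range (lad q a a (eCrit q a))) :=
    span_lad_M (q := q) (a := a) ((q : ℝ) + (q : ℝ)⁻¹) a ▸ Submodule.mem_top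
  induction hw using Submodule.span_induction with
  | zero => exact ⟨0, by rw [map_zero, zero_smul]⟩
  | add x y _ _ h1 h2 =>
    obtain ⟨z, h1⟩ := h1
    obtain ⟨z', h2⟩ := h2
    exact ⟨z + z', by rw [map_add, h1, h2, add_smul]⟩
  | smul z x _ h1 =>
    obtain ⟨z', h1⟩ := h1
    exact ⟨z * z', by rw [map_smul, h1, smul_smul]⟩
  | mem x hx =>
    obtain ⟨n, rfl⟩ := hx
    by_cases hn : n = 0
    · subst hn
      exact ⟨1, (one_smul ℂ _).symm⟩
    · refine ⟨0, ?_⟩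
      rw [zero_smul]
      exact (Submodule.Quotient.mk_eq_zero _).mpr (lad_mem_N q a hn)

theorem isWt_eTriv : IsWt q a a (eTriv q a) := by
  have h := isWt_iff.mp (isWt_M_e (q := q) (a := a) ((q : ℝ) + (q : ℝ)⁻¹) a)
  rw [isWt_iff]
  have h2 := congrArg (N q a ((q : ℝ) + (q : ℝ)⁻¹) a).mkQ h
  rwa [map_smul, ← algebraMap_smul (UqSL q a) (bracket q a : ℂ), map_smul, algebraMap_smul] at h2

theorem ofFun_smul_eTriv (x : sphere q a) :
    UqSL.ofFun x • eTriv q a = Coalgebra.counit (R := ℂ) (x : OSU q) • eTriv q a := by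
  have h1 : up q a a (eCrit q a) 1 ∈ N q a ((q : ℝ) + (q : ℝ)⁻¹) a := lad_mem_N q a one_ne_zero
  have h2 : down q a a (eCrit q a) 1 ∈ N q a ((q : ℝ) + (q : ℝ)⁻¹) a :=
    lad_neg_natCast (q := q) (a := a) a (eCrit q a) 1 ▸ lad_mem_N q a (by omega)
  have h3 := congrArg (N q a ((q : ℝ) + (q : ℝ)⁻¹) a).mkQ
    (AElt_smul_M_e (q := q) (a := a) ((q : ℝ) + (q : ℝ)⁻¹) a)
  rw [← algebraMap_smul (UqSL q a) (_ : ℂ), map_smul, map_smul, algebraMap_smul] at h3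
  have e1 : up q a a (eCrit q a) 1 = UqSL.ofFun (TPlus q a a) • eCrit q a := by simp [up]
  have e2 : down q a a (eCrit q a) 1 = UqSL.ofFun (TMinus q a a) • eCrit q a := by simp [down]
  rw [e1] at h1
  rw [e2] at h2
  exact ofFun_smul_eq_counit ((Submodule.Quotient.mk_eq_zero _).mpr h1)
    ((Submodule.Quotient.mk_eq_zero _).mpr h2) h3 x

end Critical

/-! ### The sequence -/

theorem eq_zero_of_smul_eq_zero {V : Type} [AddCommGroup V] [Module ℂ V] {z : ℂ} {v : V}
    (h : z • v = 0) (hv : v ≠ 0) : z = 0 := (smul_eq_zero.mp h).resolve_right hv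

theorem injective_coprod {V W M : Type} [AddCommGroup V] [Module ℂ V] [AddCommGroup W] [Module ℂ W]
    [AddCommGroup M] [Module ℂ M] {f : V →ₗ[ℂ] M} {g : W →ₗ[ℂ] M} (hf : Function.Injective f)
    (hg : Function.Injective g) {S T : Submodule ℂ M} (h : Disjoint S T) (hS : ∀ v, f v ∈ S)
    (hT : ∀ w, g w ∈ T) : Function.Injective (f.coprod g) := by
  rw [← LinearMap.ker_eq_bot, LinearMap.ker_eq_bot']
  rintro ⟨v, w⟩ h1
  rw [LinearMap.coprod_apply] at h1
  have hv : f v = 0 := by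
    refine Submodule.disjoint_def.mp h _ (hS v) ?_
    rw [eq_neg_of_add_eq_zero_left h1]
    exact neg_mem (hT w)
  have hw : g w = 0 := by rwa [hv, zero_add] at h1
  rw [hf (hv.trans (map_zero f).symm), hg (hw.trans (map_zero g).symm)]
  rfl

section Critical
variable (q : Param) (a : ℝ)

/-- An endomorphism which on the cyclic vector acts by a scalar acts on all of `𝟙` by this scalar. -/
theorem apply_eq_smul_of_eTriv {f : Module.End ℂ (Triv q a)} {z : ℂ} (h : f (eTriv q a) = z • eTriv q a)
    (v : Triv q a) : f v = z • v := by
  obtain ⟨y, rfl⟩ := exists_smul_eTriv q a v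
  rw [map_smul, h, smul_comm]

theorem finrank_Triv : Module.finrank ℂ (Triv q a) = 1 :=
  ((LinearEquiv.ofBijective _ (bijective_toSpanSingleton (eTriv_ne_zero q a)
    (exists_smul_eTriv q a))).finrank_eq.symm).trans (Module.finrank_self ℂ)

/-- The linear map which sends the cyclic vector of `𝟙` to that of `M_{q+q⁻¹,a}`. -/
theorem exists_section : ∃ s : Triv q a →ₗ[ℂ] MCrit q a, s (eTriv q a) = eCrit q a := by
  let E := LinearEquiv.ofBijective _ (bijective_toSpanSingleton (eTriv_ne_zero q a)
    (exists_smul_eTriv q a))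
  refine ⟨LinearMap.toSpanSingleton ℂ _ (eCrit q a) ∘ₗ E.symm.toLinearMap, ?_⟩
  have h : E 1 = eTriv q a := by
    change (1 : ℂ) • eTriv q a = _
    rw [one_smul]
  rw [← h, LinearMap.comp_apply, LinearEquiv.coe_coe, E.symm_apply_apply]
  exact one_smul ℂ _

variable {q a} {ρM : DIc q a →ₐ[ℂ] Module.End ℂ (MCrit q a)}
  {ρT : DIc q a →ₐ[ℂ] Module.End ℂ (Triv q a)}

/-- The vectors of weight `[a]` in `M_{q+q⁻¹,a}` are the multiples of the cyclic vector. -/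
theorem exists_smul_eCrit (hM : IsWeightRep (MCrit q a) ρM) (v : MCrit q a) :
    ∃ z : ℂ, ρM (DIc.block q a 0) v = z • eCrit q a := by
  have hw : v ∈ Submodule.span ℂ (Set.range (lad q a a (eCrit q a))) :=
    span_lad_M (q := q) (a := a) ((q : ℝ) + (q : ℝ)⁻¹) a ▸ Submodule.mem_top
  induction hw using Submodule.span_induction with
  | zero => exact ⟨0, by rw [map_zero, zero_smul]⟩
  | add x y _ _ h1 h2 =>
    obtain ⟨z, h1⟩ := h1
    obtain ⟨z', h2⟩ := h2
    exact ⟨z + z', by rw [map_add, h1, h2, add_smul]⟩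
  | smul z x _ h1 =>
    obtain ⟨z', h1⟩ := h1
    exact ⟨z * z', by rw [map_smul, h1, smul_smul]⟩
  | mem x hx =>
    obtain ⟨n, rfl⟩ := hx
    have h1 := (isWt_M_e (q := q) (a := a) ((q : ℝ) + (q : ℝ)⁻¹) a).lad n
    rw [show a + 2 * (n : ℝ) = a + ((2 * n : ℤ) : ℝ) by push_cast; ring] at h1
    rw [hM.block_of_isWt 0 h1]
    by_cases hn : n = 0
    · subst hn
      exact ⟨1, by rw [if_pos (by omega), one_smul]; rfl⟩
    · exact ⟨0, by rw [if_neg (by omega), zero_smul]⟩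

/-- A section would map `𝟙` to the multiples of the cyclic vector, but `T_a⁺` kills `𝟙` and not the
cyclic vector. -/
theorem not_exists_section (hM : IsWeightRep (MCrit q a) ρM) (hT : IsWeightRep (Triv q a) ρT) :
    ¬ ∃ s : Triv q a →ₗ[ℂ] MCrit q a,
      L.proj q a ((q : ℝ) + (q : ℝ)⁻¹) a ∘ₗ s = LinearMap.id ∧
      ∀ (x : DIc q a) (v : Triv q a), s (ρT x v) = ρM x (s v) := by
  rintro ⟨s, h1, h2⟩
  have h3 : ρT (DIc.block q a 0) (eTriv q a) = eTriv q a := by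
    have : IsWt q a (a + (0 : ℤ)) (eTriv q a) := by simpa using isWt_eTriv q a
    rw [hT.block_of_isWt 0 this, if_pos rfl]
  obtain ⟨z, hz⟩ := exists_smul_eCrit hM (s (eTriv q a))
  rw [← h2, h3] at hz
  have h4 := h2 (DIc.ofFun (TPlus q a a)) (eTriv q a)
  rw [hT.fun_apply, hM.fun_apply, ofFun_smul_eTriv, counit_TPlus, sub_self, zero_smul, map_zero, hz,
    smul_comm, eq_comm] at h4
  have hz0 : z = 0 := eq_zero_of_smul_eq_zero h4
    (ofFun_smul_M_e_ne_zero (q := q) (a := a) ((q : ℝ) + (q : ℝ)⁻¹)).1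
  have h5 := LinearMap.congr_fun h1 (eTriv q a)
  rw [LinearMap.comp_apply, hz, hz0, zero_smul, map_zero] at h5
  exact eTriv_ne_zero q a h5.symm

/-- The kernel of the projection onto `𝟙` is the sum of `D₂⁺` and `D₂⁻`: both are spanned by the
`e_{a+2n}` with `n ≠ 0`. -/
theorem range_coprod_eq_ker {f : DPlus q a →ₗ[ℂ] MCrit q a} {g : DMinus q a →ₗ[ℂ] MCrit q a}
    (hf : ∀ n : ℕ, f (up q a (a + 2) (L.e q a ((q : ℝ) + (q : ℝ)⁻¹) (a + 2)) n) =
      up q a a (eCrit q a) (n + 1))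
    (hf' : ∀ v, f v ∈ Submodule.span ℂ (lad q a a (eCrit q a) '' {n | 0 < n}))
    (hg : ∀ n : ℕ, g (down q a (a - 2) (L.e q a ((q : ℝ) + (q : ℝ)⁻¹) (a - 2)) n) =
      down q a a (eCrit q a) (n + 1))
    (hg' : ∀ v, g v ∈ Submodule.span ℂ (lad q a a (eCrit q a) '' {n | n < 0})) :
    LinearMap.range (f.coprod g) = LinearMap.ker (L.proj q a ((q : ℝ) + (q : ℝ)⁻¹) a) := by
  ext v
  have hker : v ∈ LinearMap.ker (L.proj q a ((q : ℝ) + (q : ℝ)⁻¹) a) ↔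
      v ∈ N q a ((q : ℝ) + (q : ℝ)⁻¹) a := Submodule.Quotient.mk_eq_zero _
  rw [hker, mem_N_center_iff]
  constructor
  · rintro ⟨⟨v, w⟩, rfl⟩
    rw [LinearMap.coprod_apply]
    exact add_mem (Submodule.span_mono (Set.image_mono fun n (hn : 0 < n) => hn.ne') (hf' v))
      (Submodule.span_mono (Set.image_mono fun n (hn : n < 0) => hn.ne) (hg' w))
  · refine fun hv => Submodule.span_le.mpr ?_ hv
    rintro _ ⟨n, hn, rfl⟩
    rcases n with (_ | n) | n
    · exact absurd rfl hn
    · exact ⟨(up q a (a + 2) (L.e q a ((q : ℝ) + (q : ℝ)⁻¹) (a + 2)) n, 0), by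
        rw [LinearMap.coprod_apply, map_zero, add_zero]; exact hf n⟩
    · exact ⟨(0, down q a (a - 2) (L.e q a ((q : ℝ) + (q : ℝ)⁻¹) (a - 2)) n), by
        rw [LinearMap.coprod_apply, map_zero, zero_add]; exact hg n⟩

/-- Mapping the cyclic vector of `𝟙` to that of `M_{q+q⁻¹,a}` splits the sequence over `I_c`. -/
theorem isSection {s : Triv q a →ₗ[ℂ] MCrit q a} (hs : s (eTriv q a) = eCrit q a)
    (hM : IsWeightRep (MCrit q a) ρM) (hT : IsWeightRep (Triv q a) ρT) :
    L.proj q a ((q : ℝ) + (q : ℝ)⁻¹) a ∘ₗ s = LinearMap.id ∧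
      ∀ (ω : Ic q a) (v : Triv q a), s (ρT (DIc.ofDual ω) v) = ρM (DIc.ofDual ω) (s v) := by
  have hproj : L.proj q a ((q : ℝ) + (q : ℝ)⁻¹) a (eCrit q a) = eTriv q a := rfl
  refine ⟨LinearMap.ext fun v => ?_, fun ω v => ?_⟩
  · obtain ⟨z, rfl⟩ := exists_smul_eTriv q a v
    rw [LinearMap.comp_apply, map_smul, hs, map_smul, hproj]
    rfl
  · obtain ⟨z, rfl⟩ := exists_smul_eTriv q a v
    rw [map_smul, map_smul, map_smul, map_smul, hs, hT.ofDual_apply (isWt_eTriv q a) ω,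
      hM.ofDual_apply (isWt_M_e (q := q) (a := a) ((q : ℝ) + (q : ℝ)⁻¹) a) ω, map_smul, hs]

theorem proj_surjective : Function.Surjective (L.proj q a ((q : ℝ) + (q : ℝ)⁻¹) a) :=
  fun v => Submodule.mkQ_surjective (N q a ((q : ℝ) + (q : ℝ)⁻¹) a) v

/-- The sum `φ` of the embeddings of `D₂⁺` and `D₂⁻`. -/
theorem exists_inclusion (hM : IsWeightRep (MCrit q a) ρM) :
    ∃ (ρP : DIc q a →ₐ[ℂ] Module.End ℂ (DPlus q a))
      (ρN : DIc q a →ₐ[ℂ] Module.End ℂ (DMinus q a))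
      (φ : DPlus q a × DMinus q a →ₗ[ℂ] MCrit q a),
      IsWeightRep (DPlus q a) ρP ∧ IsWeightRep (DMinus q a) ρN ∧
      (∀ n : ℕ, φ (up q a (a + 2) (L.e q a ((q : ℝ) + (q : ℝ)⁻¹) (a + 2)) n, 0) =
        up q a a (eCrit q a) (n + 1)) ∧
      (∀ n : ℕ, φ (0, down q a (a - 2) (L.e q a ((q : ℝ) + (q : ℝ)⁻¹) (a - 2)) n) =
        down q a a (eCrit q a) (n + 1)) ∧
      (∀ (x : DIc q a) (v : DPlus q a) (w : DMinus q a), φ (ρP x v, ρN x w) = ρM x (φ (v, w))) ∧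
      Function.Injective φ ∧
      LinearMap.range φ = LinearMap.ker (L.proj q a ((q : ℝ) + (q : ℝ)⁻¹) a) := by
  obtain ⟨f, hf, hfup, hfspan⟩ := exists_DPlus_hom q a
  obtain ⟨g, hg, hgdown, hgspan⟩ := exists_DMinus_hom q a
  obtain ⟨ρP, hP, hPM⟩ := hM.exists_of_injective f hf
  obtain ⟨ρN, hN, hNM⟩ := hM.exists_of_injective g hg
  have hli := linearIndependent_lad (isWt_M_e (q := q) (a := a) ((q : ℝ) + (q : ℝ)⁻¹) a)
    (lad_eCrit_ne_zero q a)
  have hdisj : Disjoint {n : ℤ | 0 < n} {n : ℤ | n < 0} :=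
    Set.disjoint_left.mpr fun n (h1 : 0 < n) (h2 : n < 0) => lt_asymm h1 h2
  let f' : DPlus q a →ₗ[ℂ] MCrit q a := f.restrictScalars ℂ
  let g' : DMinus q a →ₗ[ℂ] MCrit q a := g.restrictScalars ℂ
  have hφ : ∀ v w, f'.coprod g' (v, w) = f v + g w := fun _ _ => rfl
  refine ⟨ρP, ρN, f'.coprod g', hP, hN, fun n => ?_, fun n => ?_, fun x v w => ?_,
    injective_coprod hf hg (hli.disjoint_span_image hdisj) hfspan hgspan,
    range_coprod_eq_ker hfup hfspan hgdown hgspan⟩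
  · rw [hφ, map_zero, add_zero]
    exact hfup n
  · rw [hφ, map_zero, zero_add]
    exact hgdown n
  · rw [hφ, hφ, hPM, hNM, map_add]

theorem exists_quotient (hM : IsWeightRep (MCrit q a) ρM) :
    ∃ ρT : DIc q a →ₐ[ℂ] Module.End ℂ (Triv q a), IsWeightRep (Triv q a) ρT ∧
      ∀ (x : DIc q a) (v : MCrit q a), L.proj q a ((q : ℝ) + (q : ℝ)⁻¹) a (ρM x v) =
        ρT x (L.proj q a ((q : ℝ) + (q : ℝ)⁻¹) a v) := by
  obtain ⟨ρT, hT, hMT⟩ := hM.exists_of_surjective (N q a ((q : ℝ) + (q : ℝ)⁻¹) a).mkQ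
    proj_surjective
  exact ⟨ρT, hT, fun x v => (hMT x v)⟩

end Critical

end QSL

end

set_option maxHeartbeats 1000000 in
theorem mainTheorem5 (q : Set.Ioo (0 : ℝ) 1) (a : ℝ) :
    ∃ (ρP : QSL.DIc q a →ₐ[ℂ] Module.End ℂ (QSL.DPlus q a))
      (ρN : QSL.DIc q a →ₐ[ℂ] Module.End ℂ (QSL.DMinus q a))
      (ρM : QSL.DIc q a →ₐ[ℂ] Module.End ℂ (QSL.MCrit q a))
      (ρT : QSL.DIc q a →ₐ[ℂ] Module.End ℂ (QSL.Triv q a)),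
      -- the four modules as representations of `O_q(S_t²) ⋈ I_c`
      QSL.IsAssociatedRep q a (QSL.DPlus q a) ρP ∧
      QSL.IsAssociatedRep q a (QSL.DMinus q a) ρN ∧
      QSL.IsAssociatedRep q a (QSL.MCrit q a) ρM ∧
      QSL.IsAssociatedRep q a (QSL.Triv q a) ρT ∧
      -- `𝟙` is the trivial representation
      Module.finrank ℂ (QSL.Triv q a) = 1 ∧
      (∀ (x : QSL.sphere q a) (v : QSL.Triv q a),
        ρT (QSL.DIc.ofFun x) v = Coalgebra.counit (R := ℂ) (x : QSL.OSU q) • v) ∧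
      (∀ (ω : QSL.Ic q a) (v : QSL.Triv q a),
        ρT (QSL.DIc.ofDual ω) v = (ω : QSL.U q).ofConv 1 • v) ∧
      ∃ (φ : QSL.DPlus q a × QSL.DMinus q a →ₗ[ℂ] QSL.MCrit q a)
        (p : QSL.MCrit q a →ₗ[ℂ] QSL.Triv q a),
        p = QSL.L.proj q a ((q : ℝ) + (q : ℝ)⁻¹) a ∧
        -- `φ` maps `e_{a+2n}` to `e_{a+2n}`, `n ≠ 0`
        (∀ n : ℕ, φ (QSL.up q a (a + 2) (QSL.L.e q a ((q : ℝ) + (q : ℝ)⁻¹) (a + 2)) n, 0) =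
          QSL.up q a a (QSL.M.e q a ((q : ℝ) + (q : ℝ)⁻¹) a) (n + 1)) ∧
        (∀ n : ℕ, φ (0, QSL.down q a (a - 2) (QSL.L.e q a ((q : ℝ) + (q : ℝ)⁻¹) (a - 2)) n) =
          QSL.down q a a (QSL.M.e q a ((q : ℝ) + (q : ℝ)⁻¹) a) (n + 1)) ∧
        -- `φ` and `p` are morphisms of representations
        (∀ (x : QSL.DIc q a) (v : QSL.DPlus q a) (w : QSL.DMinus q a),
          φ (ρP x v, ρN x w) = ρM x (φ (v, w))) ∧
        (∀ (x : QSL.DIc q a) (v : QSL.MCrit q a), p (ρM x v) = ρT x (p v)) ∧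
        -- exactness
        Function.Injective φ ∧
        LinearMap.range φ = LinearMap.ker p ∧
        Function.Surjective p ∧
        -- the sequence splits over `I_c`
        (∃ s : QSL.Triv q a →ₗ[ℂ] QSL.MCrit q a, p ∘ₗ s = LinearMap.id ∧
          ∀ (ω : QSL.Ic q a) (v : QSL.Triv q a),
            s (ρT (QSL.DIc.ofDual ω) v) = ρM (QSL.DIc.ofDual ω) (s v)) ∧
        -- but not over `O_q(S_t²) ⋈ I_c`
        ¬ ∃ s : QSL.Triv q a →ₗ[ℂ] QSL.MCrit q a, p ∘ₗ s = LinearMap.id ∧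
          ∀ (x : QSL.DIc q a) (v : QSL.Triv q a), s (ρT x v) = ρM x (s v) := by
  obtain ⟨ρM, hM⟩ := QSL.exists_isWeightRep_M (q := q) (a := a) ((q : ℝ) + (q : ℝ)⁻¹)
  obtain ⟨ρT, hT, hMT⟩ := QSL.exists_quotient hM
  obtain ⟨ρP, ρN, φ, hP, hN, hup, hdown, hφ, hinj, hrange⟩ := QSL.exists_inclusion hM
  obtain ⟨s, hs⟩ := QSL.exists_section q a
  exact ⟨ρP, ρN, ρM, ρT, hP.isAssociatedRep, hN.isAssociatedRep, hM.isAssociatedRep,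
    hT.isAssociatedRep, QSL.finrank_Triv q a,
    fun x => QSL.apply_eq_smul_of_eTriv q a ((hT.fun_apply x _).trans (QSL.ofFun_smul_eTriv q a x)),
    fun ω => QSL.apply_eq_smul_of_eTriv q a (hT.ofDual_apply (QSL.isWt_eTriv q a) ω),
    φ, _, rfl, hup, hdown, hφ, hMT, hinj, hrange, QSL.proj_surjective,
    ⟨s, QSL.isSection hs hM hT⟩, QSL.not_exists_section hM hT⟩
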